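/- **Setting.** Let $n\ge m\ge 1$, $d\ge 0$ be integers, $\mathbb K$ an algebraically closed field of characteristic $0$, $v$ an indeterminate. For a finite field $\mathbb F_q$ put $V=\mathbb F_q^d$, $G=GL(V)$, and let $\mathscr X_{n,d}$ be the set of flags $0=V_0\subseteq V_1\subseteq\dots\subseteq V_n=V$. A decorated matrix is a pair $(A,\Delta)$ with $A=(a_{ij})\in \mathrm{Mat}_{n\times m}(\mathbb N)$ and $\Delta=\{(i_1,j_1),\dots,(i_k,j_k)\}$, $1\le i_1<\dots<i_k\le n$, $m\ge j_1>\dots>j_k\ge1$, $a_{ij}>0$ for $(i,j)\in\Delta$; $\Xi_{n|m,d}$ is the set of those with $\sum a_{ij}=d$. It parametrizes the $G$-orbits on $\mathscr X_{n,d}\times\mathscr X_{m,d}\times V$: the triple $(f,f',w)$ is in $\mathcal O_{A,\Delta}$ iff $V$ has a basis $\{e_{i,j,k}\}_{1\le k\le a_{ij}}$ with $V_s=\langle e_{i,j,k}:i\le s\rangle$, $V'_s=\langle e_{i,j,k}:j\le s\rangle$, $w=\sum_{(i,j)\in\Delta}e_{i,j,1}$. Let $e_{A,\Delta}$ be the characteristic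 function of $\mathcal O_{A,\Delta}$. Convolution of $G$-invariant functions is $(\varphi*\psi)(f,f',w)=\sum_{(f'',u)}\varphi(f,f'',u)\psi(f'',f',w-u)$, the sum being over $f''\in\mathscr X_{m,d}$, $u\in V$. The space $\mathcal{MV}_{n|m}$ is the $\mathbb K(v)$-space with basis $e_{A,\Delta}$, $(A,\Delta)\in\Xi_{n|m,d}$, and $\mathcal{MS}_{m,d}$ is the one with basis indexed by $\Xi_{m|m,d}$; the coefficients of the products $e_X*e_Y$ are obtained from the integral polynomials in $q$ which give the coefficients for invariant functions over all $\mathbb F_q$, by substituting $q=v^2$. Put $$[A]_\Delta=v^{-\sum_{i\ge k,\ j<l}a_{ij}a_{kl}-\sum_{\{(i,j)\}\le\Delta}a_{ij}}\,e_{A,\Delta},$$ where $\{(i,j)\}\le\Delta$ means $i\le k$, $j\le l$ for some $(k,l)\in\Delta$; put $[A]_\Delta=0$ if $(A,\Delta)$ is not a decorated matrix. In $\mathcal{MS}_{m,d}$ let, for $1\le h\le m-1$ and $1\le r\le m$, $$E_h=\sum[B]_\emptyset,\quad F_h=\sum[C]_\emptyset,\quad H_r^{\pm}=\sum v^{\mp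 d_{rr}}[D]_\emptyset,\quad L=\sum v^{-2d_{11}}[D]_\emptyset+\sum v^{-d'_{11}}[D']_{\{(1,1)\}},$$ the sums being over all $(B,\emptyset),(C,\emptyset),(D,\emptyset),(D',\{(1,1)\})\in\Xi_{m|m,d}$ with $B-E_{h,h+1}$, $C-E_{h+1,h}$, $D$, $D'$ diagonal. Here $E_{p,c}$ with two indices is a matrix unit. Let $\overline{[N]}=\dfrac{v^{-2N}-1}{v^{-2}-1}$. **Proposition.** Let $(A,\Delta)\in\Xi_{n|m,d}$ with $\Delta=\{(i_1,j_1),\dots,(i_k,j_k)\}$ as above, $1\le h\le m-1$. Put $i_0=0$, and for $p\in[1,n]$ $$\xi(p)=\sum_{j\le p}a_{j,h+1}-\sum_{j<p}a_{j,h},\qquad \xi'(p)=\sum_{j\ge p}a_{j,h}-\sum_{j>p}a_{j,h+1},$$ $A^+_p=A+E_{p,h+1}-E_{p,h}$, $A^-_p=A+E_{p,h}-E_{p,h+1}$. All $p,s,t$ run over $[1,n]$; a sum with terms $[A^+_p]$ is moreover restricted to $a_{p,h}\ge1$, one with terms $[A^-_p]$ to $a_{p,h+1}\ge1$. Then the following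 hold in $\mathcal{MV}_{n|m}$, and also, for every finite field $\mathbb F_q$ and every $v\in\mathbb K$ with $v^2=q$, for the convolution of $\mathbb K$-valued invariant functions. (a) For $r\in[1,m]$: $[A]_\Delta*H_r^\pm=v^{\mp\sum_i a_{i,r}}[A]_\Delta$. (b) If $\Delta\ne\emptyset$ and $j_k>1$: $$[A]_\Delta*L=v^{-2\sum_{i>i_k}a_{i,1}}\Big([A]_\Delta+\sum_{t>i_k,\,a_{t,1}>0}v^{\sum_{i_k<i\le t}a_{i,1}}[A]_{\Delta\cup\{(t,1)\}}\Big).$$ (c) If $\Delta\ne\emptyset$ and $j_k=1$, with $\Delta^-=\Delta\setminus\{(i_k,1)\}$: $$[A]_\Delta*L=v^{-2\sum_{i>i_k}a_{i,1}}(1-v^{-2a_{i_k,1}})\Big(\sum_{t>i_{k-1},\,a_{t,1}>0}v^{-\sum_{i\le i_k}a_{i,1}+\sum_{i\le t}a_{i,1}}[A]_{\Delta^-\cup\{(t,1)\}}+v^{-\sum_{i_{k-1}<i\le i_k}a_{i,1}}[A]_{\Delta^-}\Big).$$ (d) If $\Delta=\emptyset$: $$[A]_\emptyset*L=\sum_{t:\,a_{t,1}>0}v^{-\sum_ia_{i,1}-\sum_{i>t}a_{i,1}}[A]_{\{(t,1)\}}+v^{-2\sum_ia_{i,1}}[A]_\emptyset.$$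 (e) If $j_t\ne h,h+1$ for all $t$: $$[A]_\Delta*E_h=\sum_pv^{\xi(p)}\overline{[a_{p,h+1}+1]}[A^+_p]_\Delta,\qquad [A]_\Delta*F_h=\sum_pv^{\xi'(p)}\overline{[a_{p,h}+1]}[A^-_p]_\Delta.$$ (f) If $j_l=h$ for some $l$ and no $j_t$ equals $h+1$, let $\Delta_\ast=(\Delta\setminus\{(i_l,h)\})\cup\{(i_l,h+1)\}$ and $\Delta_s=\Delta\cup\{(s,h+1)\}$. Then $$\begin{aligned}[A]_\Delta*E_h={}&\sum_{i_{l-1}<p\le i_l}v^{\xi(p)-1}\overline{[a_{p,h+1}+1]}[A^+_p]_\Delta+\sum_{p\notin[i_{l-1}+1,i_l]}v^{\xi(p)}\overline{[a_{p,h+1}+1]}[A^+_p]_\Delta\\&+v^{\sum_{i\le i_{l-1}}a_{i,h+1}-\sum_{i<i_l}a_{i,h}}[A^+_{i_l}]_{\Delta_\ast}+\sum_{i_{l-1}<s<i_l}v^{\sum_{i\le i_{l-1}}a_{i,h+1}-\sum_{i<s}a_{i,h}}[A^+_s]_{\Delta_s},\end{aligned}$$ $$[A]_\Delta*F_h=\sum_{i_{l-1}<p<i_l}v^{\xi'(p)-1}\overline{[a_{p,h}+1]}[A^-_p]_\Delta+\sum_{p=i_l}v^{\xi'(p)-1}\overline{[a_{p,h}]}[A^-_p]_\Delta+\sum_{p\notin[i_{l-1}+1,i_l]}v^{\xi'(p)}\overline{[a_{p,h}+1]}[A^-_p]_\Delta.$$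 (g) If $j_l=h+1$ for some $l$ and no $j_t$ equals $h$, let $\Delta_\ast=(\Delta\setminus\{(i_l,h+1)\})\cup\{(i_l,h)\}$ and $\Delta_s=\Delta_\ast\cup\{(s,h+1)\}$. Then $$[A]_\Delta*E_h=\sum_{p\ne i_l}v^{\xi(p)}\overline{[a_{p,h+1}+1]}[A^+_p]_\Delta+\sum_{p=i_l}v^{\xi(p)}\overline{[a_{p,h+1}]}[A^+_p]_\Delta,$$ $$\begin{aligned}[A]_\Delta*F_h={}&\sum_pv^{\xi'(p)}\overline{[a_{p,h}+1]}[A^-_p]_\Delta+v^{\xi'(i_l)-\sum_{i_{l-1}<i\le i_l}a_{i,h+1}+1}[A^-_{i_l}]_{\Delta_\ast}\\&+\sum_{i_{l-1}<s<i_l}v^{\xi'(i_l)-\sum_{s<i\le i_l}a_{i,h+1}+1}[A^-_{i_l}]_{\Delta_s}.\end{aligned}$$ (h) If $j_l=h$ and $j_{l-1}=h+1$ for some $l\ge2$, let $u=i_{l-1}$, $\Delta_\ast=(\Delta\setminus\{(u,h+1),(i_l,h)\})\cup\{(i_l,h+1)\}$, $\Delta_0=\Delta\setminus\{(u,h+1)\}$,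 $\Delta_s=\Delta_0\cup\{(s,h+1)\}$. Then $$\begin{aligned}[A]_\Delta*E_h={}&\sum_{p\notin[u,i_l]}v^{\xi(p)}\overline{[a_{p,h+1}+1]}[A^+_p]_\Delta+\sum_{u<p\le i_l}v^{\xi(p)-1}\overline{[a_{p,h+1}+1]}[A^+_p]_\Delta+\sum_{p=u}v^{\xi(p)}\overline{[a_{p,h+1}]}[A^+_p]_\Delta\\&+v^{\xi(u)-\sum_{u\le j<i_l}a_{j,h}}(1-v^{-2})\overline{[a_{u,h+1}]}[A^+_{i_l}]_{\Delta_\ast}+\sum_{u<s<i_l}v^{\xi(u)-\sum_{u\le j<s}a_{j,h}}(1-v^{-2})\overline{[a_{u,h+1}]}[A^+_s]_{\Delta_s},\end{aligned}$$ $$\begin{aligned}[A]_\Delta*F_h={}&\sum_{p\notin[u+1,i_l]}v^{\xi'(p)}\overline{[a_{p,h}+1]}[A^-_p]_\Delta+\sum_{u<p<i_l}v^{\xi'(p)-1}\overline{[a_{p,h}+1]}[A^-_p]_\Delta+\sum_{p=i_l}v^{\xi'(p)-1}\overline{[a_{p,h}]}[A^-_p]_\Delta\\&+v^{\xi'(u)-\sum_{i_{l-2}<i\le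 u}a_{i,h+1}+1}(1-v^{-2})\overline{[a_{u,h}+1]}[A^-_u]_{\Delta_0}\\&+\sum_{i_{l-2}<s<u}v^{\xi'(u)-\sum_{s<i\le u}a_{i,h+1}+1}(1-v^{-2})\overline{[a_{u,h}+1]}[A^-_u]_{\Delta_s}.\end{aligned}$$ -/

import Mathlib

open scoped Classical in
/-- A decorated matrix of total weight `d`: `Δ` consists of cells with positive entry, and ordered
by increasing row its cells have strictly decreasing columns. Rows and columns are numbered from `0`,
so the row called `i` in the usual numbering is `i - 1` here. -/
structure IsDecorated {n m : ℕ} (d : ℕ) (A : Matrix (Fin n) (Fin m) ℕ)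
    (Δ : Finset (Fin n × Fin m)) : Prop where
  pos : ∀ x ∈ Δ, 0 < A x.1 x.2
  anti : ∀ x ∈ Δ, ∀ y ∈ Δ, x ≠ y → (x.1 < y.1 ∧ y.2 < x.2) ∨ (y.1 < x.1 ∧ x.2 < y.2)
  total : ∑ i, ∑ j, A i j = d

/-- The finite set `Ξ_{n|m,d}` of decorated matrices. -/
@[ext]
structure DecMat (n m d : ℕ) where
  mat : Matrix (Fin n) (Fin m) ℕ
  dec : Finset (Fin n × Fin m)
  isDec : IsDecorated d mat dec

theorem DecMat.entry_le {n m d : ℕ} (X : DecMat n m d) (i : Fin n) (j : Fin m) :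
    X.mat i j ≤ d := by
  calc X.mat i j ≤ ∑ j', X.mat i j' :=
        Finset.single_le_sum (f := fun j' => X.mat i j') (fun _ _ => Nat.zero_le _)
          (Finset.mem_univ j)
    _ ≤ ∑ i', ∑ j', X.mat i' j' :=
        Finset.single_le_sum (f := fun i' => ∑ j', X.mat i' j') (fun _ _ => Nat.zero_le _)
          (Finset.mem_univ i)
    _ = d := X.isDec.total

instance DecMat.instFinite (n m d : ℕ) : Finite (DecMat n m d) := by
  refine Finite.of_injective
    (fun X : DecMat n m d =>
      ((fun i j => ⟨X.mat i j, Nat.lt_succ_of_le (X.entry_le i j)⟩, X.dec) :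
        (Fin n → Fin m → Fin (d + 1)) × Finset (Fin n × Fin m))) ?_
  intro X Y h
  simp only [Prod.mk.injEq] at h
  refine DecMat.ext ?_ h.2
  ext i j
  have := congrFun (congrFun h.1 i) j
  simpa using this

noncomputable instance DecMat.instFintype (n m d : ℕ) : Fintype (DecMat n m d) :=
  Fintype.ofFinite _

/-- The `n`-step partial flags `0 = V_0 ⊆ V_1 ⊆ ⋯ ⊆ V_n = V` in `V = F^d`. -/
def PFlag (F : Type*) [Field F] (d n : ℕ) : Type _ :=
  {f : Fin (n + 1) → Submodule F (Fin d → F) // Monotone f ∧ f 0 = ⊥ ∧ f (Fin.last n) = ⊤}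

instance PFlag.instFinite (F : Type*) [Field F] [Fintype F] (d n : ℕ) : Finite (PFlag F d n) := by
  have : Finite (Submodule F (Fin d → F)) :=
    Finite.of_injective (fun S : Submodule F (Fin d → F) => (S : Set (Fin d → F)))
      SetLike.coe_injective
  unfold PFlag
  infer_instance

noncomputable instance PFlag.instFintype (F : Type*) [Field F] [Fintype F] (d n : ℕ) :
    Fintype (PFlag F d n) :=
  Fintype.ofFinite _

/-- The action of `g ∈ GL(V)` on flags. -/
def PFlag.map {F : Type*} [Field F] {d n : ℕ} (g : (Fin d → F) ≃ₗ[F] (Fin d → F))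
    (f : PFlag F d n) : PFlag F d n :=
  ⟨fun s => (f.1 s).map (g : (Fin d → F) →ₗ[F] (Fin d → F)),
    fun _ _ h => Submodule.map_mono (f.2.1 h),
    by simp [f.2.2.1], by simp [f.2.2.2]⟩

theorem PFlag.map_symm_map {F : Type*} [Field F] {d n : ℕ}
    (g : (Fin d → F) ≃ₗ[F] (Fin d → F)) (f : PFlag F d n) : (f.map g).map g.symm = f := by
  apply Subtype.ext
  funext s
  simp [PFlag.map, ← Submodule.map_comp]

theorem PFlag.map_map_symm {F : Type*} [Field F] {d n : ℕ}
    (g : (Fin d → F) ≃ₗ[F] (Fin d → F)) (f : PFlag F d n) : (f.map g.symm).map g = f :=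
  PFlag.map_symm_map g.symm f

/-- The `GL(V)`-orbit `𝒪_{A,Δ}`: the triple `(f, f', w)` lies in it if there is a basis
`e_{i,j,k}` (`1 ≤ k ≤ a_{ij}`) of `V` with `V_s = ⟨e_{i,j,k} : i ≤ s⟩`, `V'_s = ⟨e_{i,j,k} : j ≤ s⟩`
and `w = ∑_{(i,j) ∈ Δ} e_{i,j,1}`. -/
def InOrbit {F : Type*} [Field F] {n m d : ℕ} (X : DecMat n m d)
    (f : PFlag F d n) (f' : PFlag F d m) (w : Fin d → F) : Prop :=
  ∃ e : Module.Basis (Σ c : Fin n × Fin m, Fin (X.mat c.1 c.2)) F (Fin d → F),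
    (∀ s, f.1 s = Submodule.span F (e '' {c | (c.1.1 : ℕ) < s})) ∧
    (∀ s, f'.1 s = Submodule.span F (e '' {c | (c.1.2 : ℕ) < s})) ∧
    w = ∑ x : {x // x ∈ X.dec}, e ⟨x.1, ⟨0, X.isDec.pos x.1 x.2⟩⟩

theorem InOrbit.map {F : Type*} [Field F] {n m d : ℕ} {X : DecMat n m d}
    {f : PFlag F d n} {f' : PFlag F d m} {w : Fin d → F} (h : InOrbit X f f' w)
    (g : (Fin d → F) ≃ₗ[F] (Fin d → F)) : InOrbit X (f.map g) (f'.map g) (g w) := by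
  obtain ⟨e, h1, h2, h3⟩ := h
  refine ⟨e.map g, fun s => ?_, fun s => ?_, ?_⟩
  · simp only [PFlag.map, h1, Submodule.map_span, Set.image_image]
    rfl
  · simp only [PFlag.map, h2, Submodule.map_span, Set.image_image]
    rfl
  · simp [h3, map_sum]

theorem inOrbit_map_iff {F : Type*} [Field F] {n m d : ℕ} (X : DecMat n m d)
    (f : PFlag F d n) (f' : PFlag F d m) (w : Fin d → F)
    (g : (Fin d → F) ≃ₗ[F] (Fin d → F)) :
    InOrbit X (f.map g) (f'.map g) (g w) ↔ InOrbit X f f' w := by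
  refine ⟨fun h => ?_, fun h => h.map g⟩
  have := h.map g.symm
  simpa [PFlag.map_symm_map] using this

/-- The space of `GL(V)`-invariant `R`-valued functions on
`{n-step flags} × {m-step flags} × V`. -/
def InvFun (R : Type*) [Field R] (F : Type*) [Field F] (n m d : ℕ) :
    Submodule R (PFlag F d n → PFlag F d m → (Fin d → F) → R) where
  carrier := {φ | ∀ (g : (Fin d → F) ≃ₗ[F] (Fin d → F)) f f' w,
    φ (f.map g) (f'.map g) (g w) = φ f f' w}
  add_mem' := fun ha hb g f f' w => by simp [ha g f f' w, hb g f f' w]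
  zero_mem' := fun _ _ _ _ => rfl
  smul_mem' := fun c _ ha g f f' w => by simp [ha g f f' w]

open scoped Classical in
/-- The characteristic function `e_{A,Δ}` of the orbit `𝒪_{A,Δ}`. -/
noncomputable def orbitChar (R : Type*) [Field R] (F : Type*) [Field F] {n m d : ℕ}
    (X : DecMat n m d) : InvFun R F n m d :=
  ⟨fun f f' w => if InOrbit X f f' w then 1 else 0, fun g f f' w => by
    simp only [inOrbit_map_iff]⟩

/-- The convolution product
`(φ * ψ)(f, f', w) = ∑_{(f'', u)} φ(f, f'', u) ψ(f'', f', w - u)`. -/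
noncomputable def conv {R : Type*} [Field R] {F : Type*} [Field F] [Fintype F] {n m l d : ℕ}
    (φ : InvFun R F n m d) (ψ : InvFun R F m l d) : InvFun R F n l d :=
  ⟨fun f f' w => ∑ f'' : PFlag F d m, ∑ u : Fin d → F, φ.1 f f'' u * ψ.1 f'' f' (w - u), by
    intro g f f' w
    refine (Fintype.sum_equiv ⟨PFlag.map g, PFlag.map g.symm, PFlag.map_symm_map g,
      PFlag.map_map_symm g⟩ _ _ fun f'' => ?_).symm
    refine Fintype.sum_equiv g.toEquiv _ _ fun u => ?_
    simp only [Equiv.coe_fn_mk, LinearEquiv.coe_toEquiv, ← map_sub]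
    rw [φ.2 g f f'' u, ψ.2 g f'' f' (w - u)]⟩

/-- The number of `(f'', u)` with `(f, f'', u) ∈ 𝒪_X` and `(f'', f', w - u) ∈ 𝒪_Y`. -/
noncomputable def convCount {F : Type*} [Field F] {n m l d : ℕ}
    (X : DecMat n m d) (Y : DecMat m l d)
    (f : PFlag F d n) (f' : PFlag F d l) (w : Fin d → F) : ℕ :=
  {p : PFlag F d m × (Fin d → F) | InOrbit X f p.1 p.2 ∧ InOrbit Y p.1 f' (w - p.2)}.ncard

/-- `P` is the polynomial in `q` giving the coefficient of `e_Z` in `e_X * e_Y` over every finite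
field `𝔽_q`. Such a polynomial is unique, as `𝒪_Z` is never empty. -/
def IsStructPoly {n m l d : ℕ} (X : DecMat n m d) (Y : DecMat m l d) (Z : DecMat n l d)
    (P : Polynomial ℤ) : Prop :=
  ∀ (F : Type) [Field F] [Fintype F] (f : PFlag F d n) (f' : PFlag F d l) (w : Fin d → F),
    InOrbit Z f f' w → (convCount X Y f f' w : ℤ) = P.eval (Fintype.card F : ℤ)

open scoped Classical in
/-- The generic structure constant: the structure polynomial at `q = v ^ 2` (and `0` if there is
no such polynomial). -/
noncomputable def structConst {R : Type*} [Field R] (v : R) {n m l d : ℕ}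
    (X : DecMat n m d) (Y : DecMat m l d) (Z : DecMat n l d) : R :=
  if h : ∃ P : Polynomial ℤ, IsStructPoly X Y Z P then Polynomial.aeval (v ^ 2) h.choose else 0

/-- The generic convolution product, on the spaces with bases `e_X` indexed by decorated
matrices. -/
noncomputable def genConv {R : Type*} [Field R] (v : R) {n m l d : ℕ}
    (x : DecMat n m d → R) (y : DecMat m l d → R) : DecMat n l d → R :=
  fun Z => ∑ X, ∑ Y, x X * y Y * structConst v X Y Z

open scoped Classical in
/-- The vector `e_X` of the generic space. -/
noncomputable def genChar (R : Type*) [Field R] {n m d : ℕ} (X : DecMat n m d) :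
    DecMat n m d → R :=
  Pi.single X 1

open scoped Classical in
/-- The exponent `-d(A,Δ) + r(A,Δ) = -∑_{i ≥ k, j < l} a_{ij} a_{kl} - ∑_{{(i,j)} ≤ Δ} a_{ij}`. -/
noncomputable def normExp {n m : ℕ} (A : Matrix (Fin n) (Fin m) ℕ)
    (Δ : Finset (Fin n × Fin m)) : ℤ :=
  -(∑ x : Fin n × Fin m, ∑ y : Fin n × Fin m with y.1 ≤ x.1 ∧ x.2 < y.2,
      (A x.1 x.2 : ℤ) * (A y.1 y.2 : ℤ))
  - ∑ x : Fin n × Fin m with (∃ y ∈ Δ, x.1 ≤ y.1 ∧ x.2 ≤ y.2), (A x.1 x.2 : ℤ)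

open scoped Classical in
/-- `[A]_Δ = v^{-d(A,Δ)+r(A,Δ)} e_{A,Δ}`, for a given family `e` of vectors `e_{A,Δ}`; it is `0` if
`(A,Δ)` is not a decorated matrix. -/
noncomputable def stdVec {R M : Type*} [Field R] [AddCommGroup M] [Module R M] {n m d : ℕ}
    (v : R) (e : DecMat n m d → M) (A : Matrix (Fin n) (Fin m) ℕ)
    (Δ : Finset (Fin n × Fin m)) : M :=
  if h : IsDecorated d A Δ then v ^ normExp A Δ • e ⟨A, Δ, h⟩ else 0

section Generators

variable {R M : Type*} [Field R] [AddCommGroup M] [Module R M] {m d : ℕ}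

open scoped Classical in
/-- `E_h = ∑ [B]_∅` over the `B` with `B - E_{h,h+1}` diagonal (used with `h' = h + 1`). Swapping
`h` and `h'` gives `F_h`. -/
noncomputable def genOff (v : R) (e : DecMat m m d → M) (h h' : Fin m) : M :=
  ∑ X : DecMat m m d with
      X.dec = ∅ ∧ ∃ a : Fin m → ℕ, X.mat = Matrix.diagonal a + Matrix.single h h' 1,
    stdVec v e X.mat X.dec

open scoped Classical in
/-- `∑ v^{-s d_{r,r}} [D]_∅` over the diagonal `D`; it is `H_r^+` for `s = 1` and `H_r^-` for
`s = -1`. -/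
noncomputable def genH (v : R) (e : DecMat m m d → M) (r : Fin m) (s : ℤ) : M :=
  ∑ X : DecMat m m d with X.dec = ∅ ∧ ∃ a : Fin m → ℕ, X.mat = Matrix.diagonal a,
    v ^ (-s * (X.mat r r : ℤ)) • stdVec v e X.mat X.dec

open scoped Classical in
/-- `L = ∑ v^{-2 d_{1,1}} [D]_∅ + ∑ v^{-d'_{1,1}} [D']_{{(1,1)}}` over the diagonal `D`, `D'`; here
`c` is the first index. -/
noncomputable def genL (v : R) (e : DecMat m m d → M) (c : Fin m) : M :=
  (∑ X : DecMat m m d with X.dec = ∅ ∧ ∃ a : Fin m → ℕ, X.mat = Matrix.diagonal a,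
    v ^ (-2 * (X.mat c c : ℤ)) • stdVec v e X.mat X.dec)
  + ∑ X : DecMat m m d with X.dec = {(c, c)} ∧ ∃ a : Fin m → ℕ, X.mat = Matrix.diagonal a,
    v ^ (-(X.mat c c : ℤ)) • stdVec v e X.mat X.dec

end Generators

/-- The overlined binomial `∏_{i=1}^t (v^{-2(N-i+1)} - 1) / (v^{-2i} - 1)`. -/
noncomputable def qbar {R : Type*} [Field R] (v : R) (N t : ℕ) : R :=
  ∏ i ∈ Finset.Icc 1 t, (v ^ (-2 * ((N : ℤ) - i + 1)) - 1) / (v ^ (-2 * (i : ℤ)) - 1)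

section Formulas

variable {n m : ℕ}

open scoped Classical in
/-- `∑ a_{i,c}` over the rows `i` satisfying `P`. -/
noncomputable def colSum (A : Matrix (Fin n) (Fin m) ℕ) (c : Fin m) (P : Fin n → Prop) : ℤ :=
  ∑ i : Fin n with P i, (A i c : ℤ)

/-- `ξ_A(p) = ∑_{j ≤ p} a_{j,h+1} - ∑_{j < p} a_{j,h}` (with `h' = h + 1`). -/
noncomputable def xi (A : Matrix (Fin n) (Fin m) ℕ) (h h' : Fin m) (p : Fin n) : ℤ :=
  colSum A h' (fun j => j ≤ p) - colSum A h (fun j => j < p)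

/-- `ξ'_A(p) = ∑_{j ≥ p} a_{j,h} - ∑_{j > p} a_{j,h+1}` (with `h' = h + 1`). -/
noncomputable def xi' (A : Matrix (Fin n) (Fin m) ℕ) (h h' : Fin m) (p : Fin n) : ℤ :=
  colSum A h (fun j => p ≤ j) - colSum A h' (fun j => p < j)

/-- For a row `i = i_l` of `Δ`: the condition `i_{l-1} < p` (void if `l = 1`, that is `i_0 = 0`). -/
def AfterPrev (Δ : Finset (Fin n × Fin m)) (i p : Fin n) : Prop :=
  ∀ x ∈ Δ, x.1 < i → x.1 < p

/-- `A + E_{p,c'} - E_{p,c}` (used only if `a_{p,c} ≥ 1`). -/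
def moveCell (A : Matrix (Fin n) (Fin m) ℕ) (p : Fin n) (c c' : Fin m) :
    Matrix (Fin n) (Fin m) ℕ :=
  A + Matrix.single p c' 1 - Matrix.single p c 1

variable {R M : Type*} [Field R] [AddCommGroup M] [Module R M]

open scoped Classical in
/-- The explicit formulas. Here `B A Δ` is `[A]_Δ`, `opH r s` is right multiplication by `H_r^±`
(`s = ±1`), `opL` by `L`, and `opE h h'`, `opF h h'` by `E_h`, `F_h`, where `h' = h + 1`; `c` is the
first column. -/
structure ExplicitRightFormulas (d : ℕ) (v : R) (c : Fin m)
    (B : Matrix (Fin n) (Fin m) ℕ → Finset (Fin n × Fin m) → M)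
    (opH : Fin m → ℤ → M → M) (opL : M → M) (opE opF : Fin m → Fin m → M → M) : Prop where
  caseA : ∀ A Δ, IsDecorated d A Δ → ∀ r : Fin m, ∀ s : ℤ, (s = 1 ∨ s = -1) →
    opH r s (B A Δ) = v ^ (-s * ∑ i, (A i r : ℤ)) • B A Δ
  caseB : ∀ A Δ, IsDecorated d A Δ → ∀ ik jk, (ik, jk) ∈ Δ → (∀ x ∈ Δ, x.1 ≤ ik) → c < jk →
    opL (B A Δ) = v ^ (-2 * colSum A c (fun i => ik < i)) •
      (B A Δ + ∑ t : Fin n with ik < t ∧ 0 < A t c,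
        v ^ colSum A c (fun i => ik < i ∧ i ≤ t) • B A (insert (t, c) Δ))
  caseC : ∀ A Δ, IsDecorated d A Δ → ∀ ik, (ik, c) ∈ Δ →
    opL (B A Δ) =
      v ^ (-2 * colSum A c (fun i => ik < i)) •
        (∑ t : Fin n with AfterPrev Δ ik t ∧ 0 < A t c,
          (v ^ (-colSum A c (fun i => i ≤ ik) + colSum A c (fun i => i ≤ t))
            * (1 - v ^ (-2 * (A ik c : ℤ)))) • B A (insert (t, c) (Δ.erase (ik, c))))
      + v ^ (-2 * colSum A c (fun i => ik < i)) •
        ((v ^ (-colSum A c (fun i => AfterPrev Δ ik i ∧ i ≤ ik))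
            * (1 - v ^ (-2 * (A ik c : ℤ)))) • B A (Δ.erase (ik, c)))
  caseD : ∀ A, IsDecorated d A ∅ →
    opL (B A ∅) =
      (∑ t : Fin n with 0 < A t c,
        v ^ (-(∑ i, (A i c : ℤ)) - colSum A c (fun i => t < i)) • B A {(t, c)})
      + v ^ (-2 * ∑ i, (A i c : ℤ)) • B A ∅
  caseE : ∀ A Δ, IsDecorated d A Δ → ∀ h h' : Fin m, (h' : ℕ) = h + 1 →
    (∀ x ∈ Δ, x.2 ≠ h ∧ x.2 ≠ h') →
    opE h h' (B A Δ) =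
      (∑ p : Fin n with 1 ≤ A p h,
        (v ^ xi A h h' p * qbar v (A p h' + 1) 1) • B (moveCell A p h h') Δ) ∧
    opF h h' (B A Δ) =
      (∑ p : Fin n with 1 ≤ A p h',
        (v ^ xi' A h h' p * qbar v (A p h + 1) 1) • B (moveCell A p h' h) Δ)
  caseF : ∀ A Δ, IsDecorated d A Δ → ∀ h h' : Fin m, (h' : ℕ) = h + 1 →
    ∀ il, (il, h) ∈ Δ → (∀ x ∈ Δ, x.2 ≠ h') →
    opE h h' (B A Δ) =
      (∑ p : Fin n with (AfterPrev Δ il p ∧ p ≤ il) ∧ 1 ≤ A p h,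
        (v ^ (xi A h h' p - 1) * qbar v (A p h' + 1) 1) • B (moveCell A p h h') Δ)
      + (∑ p : Fin n with ¬ (AfterPrev Δ il p ∧ p ≤ il) ∧ 1 ≤ A p h,
        (v ^ xi A h h' p * qbar v (A p h' + 1) 1) • B (moveCell A p h h') Δ)
      + (∑ p : Fin n with p = il ∧ 1 ≤ A p h,
        v ^ (colSum A h' (fun i => ¬ AfterPrev Δ il i) - colSum A h (fun i => i < il)) •
          B (moveCell A p h h') (insert (il, h') (Δ.erase (il, h))))
      + (∑ s : Fin n with (AfterPrev Δ il s ∧ s < il) ∧ 1 ≤ A s h,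
        v ^ (colSum A h' (fun i => ¬ AfterPrev Δ il i) - colSum A h (fun i => i < s)) •
          B (moveCell A s h h') (insert (s, h') Δ)) ∧
    opF h h' (B A Δ) =
      (∑ p : Fin n with (AfterPrev Δ il p ∧ p < il) ∧ 1 ≤ A p h',
        (v ^ (xi' A h h' p - 1) * qbar v (A p h + 1) 1) • B (moveCell A p h' h) Δ)
      + (∑ p : Fin n with p = il ∧ 1 ≤ A p h',
        (v ^ (xi' A h h' p - 1) * qbar v (A p h) 1) • B (moveCell A p h' h) Δ)
      + (∑ p : Fin n with ¬ (AfterPrev Δ il p ∧ p ≤ il) ∧ 1 ≤ A p h',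
        (v ^ xi' A h h' p * qbar v (A p h + 1) 1) • B (moveCell A p h' h) Δ)
  caseG : ∀ A Δ, IsDecorated d A Δ → ∀ h h' : Fin m, (h' : ℕ) = h + 1 →
    ∀ il, (il, h') ∈ Δ → (∀ x ∈ Δ, x.2 ≠ h) →
    opE h h' (B A Δ) =
      (∑ p : Fin n with p ≠ il ∧ 1 ≤ A p h,
        (v ^ xi A h h' p * qbar v (A p h' + 1) 1) • B (moveCell A p h h') Δ)
      + (∑ p : Fin n with p = il ∧ 1 ≤ A p h,
        (v ^ xi A h h' p * qbar v (A p h') 1) • B (moveCell A p h h') Δ) ∧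
    opF h h' (B A Δ) =
      (∑ p : Fin n with 1 ≤ A p h',
        (v ^ xi' A h h' p * qbar v (A p h + 1) 1) • B (moveCell A p h' h) Δ)
      + (∑ p : Fin n with p = il ∧ 1 ≤ A p h',
        v ^ (xi' A h h' p - colSum A h' (fun i => AfterPrev Δ il i ∧ i ≤ p) + 1) •
          B (moveCell A p h' h) (insert (il, h) (Δ.erase (il, h'))))
      + (∑ p : Fin n with p = il ∧ 1 ≤ A p h', ∑ s : Fin n with AfterPrev Δ il s ∧ s < il,
        v ^ (xi' A h h' p - colSum A h' (fun i => s < i ∧ i ≤ p) + 1) •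
          B (moveCell A p h' h) (insert (s, h') (insert (il, h) (Δ.erase (il, h')))))
  /-- Here `il = i_l` and `iu = i_{l-1}`. -/
  caseH : ∀ A Δ, IsDecorated d A Δ → ∀ h h' : Fin m, (h' : ℕ) = h + 1 →
    ∀ il iu, (il, h) ∈ Δ → (iu, h') ∈ Δ →
    opE h h' (B A Δ) =
      (∑ p : Fin n with ¬ (iu ≤ p ∧ p ≤ il) ∧ 1 ≤ A p h,
        (v ^ xi A h h' p * qbar v (A p h' + 1) 1) • B (moveCell A p h h') Δ)
      + (∑ p : Fin n with (iu < p ∧ p ≤ il) ∧ 1 ≤ A p h,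
        (v ^ (xi A h h' p - 1) * qbar v (A p h' + 1) 1) • B (moveCell A p h h') Δ)
      + (∑ p : Fin n with p = iu ∧ 1 ≤ A p h,
        (v ^ xi A h h' p * qbar v (A p h') 1) • B (moveCell A p h h') Δ)
      + (∑ p : Fin n with p = il ∧ 1 ≤ A p h,
        (v ^ (xi A h h' iu - colSum A h (fun j => iu ≤ j ∧ j < p))
            * (1 - v ^ (-2 : ℤ)) * qbar v (A iu h') 1) •
          B (moveCell A p h h') (insert (il, h') ((Δ.erase (iu, h')).erase (il, h))))
      + (∑ s : Fin n with (iu < s ∧ s < il) ∧ 1 ≤ A s h,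
        (v ^ (xi A h h' iu - colSum A h (fun j => iu ≤ j ∧ j < s))
            * (1 - v ^ (-2 : ℤ)) * qbar v (A iu h') 1) •
          B (moveCell A s h h') (insert (s, h') (Δ.erase (iu, h')))) ∧
    opF h h' (B A Δ) =
      (∑ p : Fin n with ¬ (iu < p ∧ p ≤ il) ∧ 1 ≤ A p h',
        (v ^ xi' A h h' p * qbar v (A p h + 1) 1) • B (moveCell A p h' h) Δ)
      + (∑ p : Fin n with (iu < p ∧ p < il) ∧ 1 ≤ A p h',
        (v ^ (xi' A h h' p - 1) * qbar v (A p h + 1) 1) • B (moveCell A p h' h) Δ)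
      + (∑ p : Fin n with p = il ∧ 1 ≤ A p h',
        (v ^ (xi' A h h' p - 1) * qbar v (A p h) 1) • B (moveCell A p h' h) Δ)
      + (∑ p : Fin n with p = iu ∧ 1 ≤ A p h',
        (v ^ (xi' A h h' p - colSum A h' (fun i => AfterPrev Δ iu i ∧ i ≤ p) + 1)
            * (1 - v ^ (-2 : ℤ)) * qbar v (A p h + 1) 1) •
          B (moveCell A p h' h) (Δ.erase (iu, h')))
      + (∑ p : Fin n with p = iu ∧ 1 ≤ A p h', ∑ s : Fin n with AfterPrev Δ iu s ∧ s < iu,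
        (v ^ (xi' A h h' p - colSum A h' (fun i => s < i ∧ i ≤ p) + 1)
            * (1 - v ^ (-2 : ℤ)) * qbar v (A p h + 1) 1) •
          B (moveCell A p h' h) (insert (s, h') (Δ.erase (iu, h'))))

end Formulas

/-!
A triple consisting of two flags `f`, `g` and a vector `w` belongs to exactly one orbit
(`exists_inOrbit`, `InOrbit.unique`). The matrix of the orbit is determined by the dimensions of
`V_s ∩ V'_t`. Its decoration is determined by the smallest lower set `I` of cells, for the product
order, such that `w` lies in the sum `lowerSpan f g I` of the subspaces `V_i ∩ V'_j` with
`(i, j) ∈ I`, the decoration being the set of maximal cells of `I` (`inOrbit_iff`).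

The orbits that occur in the generators are elementary: two flags that differ by a line in a single
step (`inOrbit_raise_iff`, `inOrbit_lower_iff`), or equal flags and a nonzero vector of the first
step (`inOrbit_diagonal_corner_iff`). A product with a generator therefore counts lines between two
steps of a flag, hyperplanes between two steps, or vectors of the first step. In a basis adapted to
the triple (`IsAdapted`) a line in `V'_{h+1} / V'_h` is given by its coordinates in one column, and
the orbit to which it leads depends on the last row with a nonzero coordinate and on the rows where
the coordinates agree with those of `w` (`IsAdapted.inOrbit_raise`). The same holds for hyperplanes,
with linear forms and the first nonzero row (`IsAdapted.inOrbit_lower`), and for vectors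
(`IsAdapted.inOrbit_shift`). All the conditions are conditions on single rows, so the numbers of
solutions are products of powers of `q` and of numbers `q ^ a - 1` (`ncard_raise`, `ncard_lower`,
`IsAdapted.ncard_shift`).

These numbers are values at `q` of integral polynomials that do not depend on the field. They are
the structure constants of the convolution over each finite field, and, since a polynomial is
determined by its values at the primes, also those of the generic product (`structConst_eq`,
`conv_orbitChar`). Both products thus satisfy the same rules for the generators, `IsRightMul`, from
which the formulas follow for any field and any `v ≠ 0` with `v ^ 2 ≠ 1`.

What remains is the comparison of exponents of `v`. The normalizing exponent is a quadratic form in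
the matrix and a sum over the lower set of the decoration; its change under the transfer of one unit
between neighbouring columns of a row is linear in the entries of these columns
(`crossSum_moveCell`), and the change of the decoration affects only a single column
(`normExp_sub_of_column`). This yields one formula for each generator, valid for all
decorations (`IsRightMul.mul_stdVec_raise_eq`, `IsRightMul.mul_stdVec_lower_eq`,
`IsRightMul.mul_stdVec_genL_eq`). The distinction of cases only
serves to make explicit in which rows the lower set reaches a given column and which decorations
generate the new lower set.
-/

/-! ### Coordinate subspaces -/

theorem mem_span_basis_image {ι F V : Type*} [Field F] [AddCommGroup V] [Module F V]
    (e : Module.Basis ι F V) (s : Set ι) (x : V) :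
    x ∈ Submodule.span F (e '' s) ↔ ∀ k, k ∉ s → e.repr x k = 0 := by
  rw [Module.Basis.mem_span_image]
  constructor
  · intro h k hk
    by_contra hne
    exact hk (h (by simpa using hne))
  · intro h k hk
    by_contra hne
    exact (by simpa using hk : e.repr x k ≠ 0) (h k hne)

theorem span_basis_image_inf {ι F V : Type*} [Field F] [AddCommGroup V] [Module F V]
    (e : Module.Basis ι F V) (s t : Set ι) :
    Submodule.span F (e '' s) ⊓ Submodule.span F (e '' t) = Submodule.span F (e '' (s ∩ t)) := by
  ext x
  simp only [Submodule.mem_inf, mem_span_basis_image, Set.mem_inter_iff, not_and_or]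
  exact ⟨fun h k hk => hk.elim (h.1 k) (h.2 k), fun h => ⟨fun k hk => h k (.inl hk),
    fun k hk => h k (.inr hk)⟩⟩

theorem finrank_span_basis_image {ι F V : Type*} [Field F] [AddCommGroup V] [Module F V]
    [Fintype ι] (e : Module.Basis ι F V) (s : Set ι) [DecidablePred (· ∈ s)] :
    Module.finrank F (Submodule.span F (e '' s)) = (Finset.univ.filter (· ∈ s)).card := by
  have h := finrank_span_eq_card (R := F) (b := fun k : s => e k)
    (e.linearIndependent.comp _ Subtype.val_injective)
  rw [← Fintype.card_subtype, ← h]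
  rw [Set.image_eq_range]

open scoped Classical in
/-- The sum of the entries of `A` in the rows `< s` and the columns `< t`. -/
noncomputable def rectSum {n m : ℕ} (A : Matrix (Fin n) (Fin m) ℕ) (s t : ℕ) : ℕ :=
  ∑ c : Fin n × Fin m with (c.1 : ℕ) < s ∧ (c.2 : ℕ) < t, A c.1 c.2

theorem rectSum_add {n m : ℕ} (A B : Matrix (Fin n) (Fin m) ℕ) (s t : ℕ) :
    rectSum (A + B) s t = rectSum A s t + rectSum B s t := by
  simp [rectSum, Finset.sum_add_distrib]

open scoped Classical in
theorem rectSum_single {n m : ℕ} (p : Fin n) (h : Fin m) (s t : ℕ) :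
    rectSum (Matrix.single p h 1) s t = if (p : ℕ) < s ∧ (h : ℕ) < t then 1 else 0 := by
  unfold rectSum
  rw [Finset.sum_filter, Finset.sum_eq_single (p, h)]
  · simp
  · rintro ⟨i, j⟩ - hne
    rw [Matrix.single_apply_of_ne]
    · simp
    · rintro ⟨rfl, rfl⟩
      exact hne rfl
  · simp

theorem rectSum_succ {n m : ℕ} (A : Matrix (Fin n) (Fin m) ℕ) (i : Fin n) (j : Fin m) :
    rectSum A (i + 1) (j + 1) + rectSum A i j
      = rectSum A i (j + 1) + rectSum A (i + 1) j + A i j := by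
  classical
  have key : A i j = ∑ c : Fin n × Fin m, if c = (i, j) then A c.1 c.2 else 0 := by simp
  unfold rectSum
  rw [key]
  simp only [Finset.sum_filter, ← Finset.sum_add_distrib]
  refine Finset.sum_congr rfl fun c _ => ?_
  obtain ⟨a, b⟩ := c
  simp only [Prod.mk.injEq, Fin.ext_iff]
  split_ifs <;> omega

/-- A matrix is determined by its rectangular sums: its entries are their mixed second differences.
-/
theorem eq_of_rectSum_eq {n m : ℕ} {A B : Matrix (Fin n) (Fin m) ℕ}
    (h : ∀ s ≤ n, ∀ t ≤ m, rectSum A s t = rectSum B s t) : A = B := by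
  ext i j
  have h1 := rectSum_succ A i j
  have h2 := rectSum_succ B i j
  have e1 := h (i + 1) i.2 (j + 1) j.2
  have e2 := h i i.2.le j j.2.le
  have e3 := h i i.2.le (j + 1) j.2
  have e4 := h (i + 1) i.2 j j.2.le
  omega

/-! ### Invariants of a triple of two flags and a vector -/

/-- The subspace `∑_{(i,j) ∈ I} V_i ∩ V'_j` attached to two flags and a lower set `I` of cells. -/
def lowerSpan {F : Type*} [Field F] {n m d : ℕ} (f : PFlag F d n) (g : PFlag F d m)
    (I : LowerSet (Fin n × Fin m)) : Submodule F (Fin d → F) :=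
  ⨆ c ∈ I, f.1 c.1.succ ⊓ g.1 c.2.succ

/-- A basis of `V` adapted to the triple `(f, g, w)` and the decorated matrix `X`, as in the
definition of the orbit. -/
structure IsAdapted {F : Type*} [Field F] {n m d : ℕ} (X : DecMat n m d)
    (f : PFlag F d n) (g : PFlag F d m) (w : Fin d → F)
    (e : Module.Basis (Σ c : Fin n × Fin m, Fin (X.mat c.1 c.2)) F (Fin d → F)) : Prop where
  left : ∀ s, f.1 s = Submodule.span F (e '' {c | (c.1.1 : ℕ) < s})
  right : ∀ s, g.1 s = Submodule.span F (e '' {c | (c.1.2 : ℕ) < s})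
  vec : w = ∑ x : {x // x ∈ X.dec}, e ⟨x.1, ⟨0, X.isDec.pos x.1 x.2⟩⟩

theorem inOrbit_iff_exists_isAdapted {F : Type*} [Field F] {n m d : ℕ} {X : DecMat n m d}
    {f : PFlag F d n} {g : PFlag F d m} {w : Fin d → F} :
    InOrbit X f g w ↔ ∃ e, IsAdapted X f g w e :=
  ⟨fun ⟨e, h1, h2, h3⟩ => ⟨e, h1, h2, h3⟩, fun ⟨e, h⟩ => ⟨e, h.left, h.right, h.vec⟩⟩

namespace IsAdapted

variable {F : Type*} [Field F] {n m d : ℕ} {X : DecMat n m d}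
  {f : PFlag F d n} {g : PFlag F d m} {w : Fin d → F}
  {e : Module.Basis (Σ c : Fin n × Fin m, Fin (X.mat c.1 c.2)) F (Fin d → F)}

theorem mem_left (H : IsAdapted X f g w e) (s : Fin (n + 1)) (x : Fin d → F) :
    x ∈ f.1 s ↔ ∀ k, (s : ℕ) ≤ k.1.1 → e.repr x k = 0 := by
  rw [H.left, mem_span_basis_image]
  simp

theorem mem_right (H : IsAdapted X f g w e) (s : Fin (m + 1)) (x : Fin d → F) :
    x ∈ g.1 s ↔ ∀ k, (s : ℕ) ≤ k.1.2 → e.repr x k = 0 := by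
  rw [H.right, mem_span_basis_image]
  simp

open scoped Classical in
theorem repr_vec (H : IsAdapted X f g w e) (k : Σ c : Fin n × Fin m, Fin (X.mat c.1 c.2)) :
    e.repr w k = if k.1 ∈ X.dec ∧ (k.2 : ℕ) = 0 then 1 else 0 := by
  rw [H.vec, map_sum, Finsupp.finsetSum_apply]
  obtain ⟨c, a⟩ := k
  by_cases h : c ∈ X.dec
  · rw [Finset.sum_eq_single ⟨c, h⟩]
    · by_cases ha : (a : ℕ) = 0
      · have : a = ⟨0, X.isDec.pos c h⟩ := Fin.ext ha
        subst this
        simp [h]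
      · have : a ≠ ⟨0, X.isDec.pos c h⟩ := fun h' => ha (by rw [h'])
        simp [ha, this.symm]
    · rintro ⟨b, hb⟩ - hne
      simp only [Module.Basis.repr_self]
      rw [Finsupp.single_apply_eq_zero]
      rintro h'
      exact absurd (Subtype.ext (congrArg Sigma.fst h').symm) hne
    · simp
  · rw [Finset.sum_eq_zero]
    · simp [h]
    · rintro ⟨b, hb⟩ -
      simp only [Module.Basis.repr_self]
      rw [Finsupp.single_apply_eq_zero]
      rintro h'
      have h' : c = b := congrArg Sigma.fst h'
      exact absurd (h' ▸ hb) h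

theorem finrank_inf (H : IsAdapted X f g w e) (s : Fin (n + 1)) (t : Fin (m + 1)) :
    Module.finrank F ↥(f.1 s ⊓ g.1 t) = rectSum X.mat s t := by
  classical
  rw [H.left, H.right, span_basis_image_inf, finrank_span_basis_image]
  simp only [rectSum, Set.mem_inter_iff, Set.mem_ofPred_eq, Finset.card_filter]
  rw [Fintype.sum_sigma, Finset.sum_filter]
  refine Finset.sum_congr rfl fun c _ => ?_
  split_ifs <;> simp

theorem lowerSpan_eq (H : IsAdapted X f g w e) (I : LowerSet (Fin n × Fin m)) :
    lowerSpan f g I = Submodule.span F (e '' {k | k.1 ∈ I}) := by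
  apply le_antisymm
  · refine iSup₂_le fun c hc x hx => ?_
    rw [mem_span_basis_image]
    rw [Submodule.mem_inf, H.mem_left, H.mem_right] at hx
    intro k hk
    by_contra hne
    refine hk (I.lower (a := c) ⟨?_, ?_⟩ hc)
    · by_contra hlt
      exact hne (hx.1 k (by simpa using (not_le.mp hlt : c.1 < k.1.1)))
    · by_contra hlt
      exact hne (hx.2 k (by simpa using (not_le.mp hlt : c.2 < k.1.2)))
  · rw [Submodule.span_le]
    rintro _ ⟨k, hk, rfl⟩
    refine Submodule.mem_iSup_of_mem k.1 (Submodule.mem_iSup_of_mem hk ?_)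
    rw [Submodule.mem_inf, H.mem_left, H.mem_right]
    constructor
    all_goals
      intro l hl
      rw [Module.Basis.repr_self, Finsupp.single_apply_eq_zero]
      rintro rfl
      simp at hl

theorem mem_lowerSpan (H : IsAdapted X f g w e) (I : LowerSet (Fin n × Fin m)) (x : Fin d → F) :
    x ∈ lowerSpan f g I ↔ ∀ k, k.1 ∉ I → e.repr x k = 0 := by
  rw [H.lowerSpan_eq, mem_span_basis_image]
  rfl

/-- The decoration is recovered from the triple: the lower set it generates is the smallest `I` with
`w ∈ lowerSpan f g I`. -/
theorem vec_mem_lowerSpan (H : IsAdapted X f g w e) (I : LowerSet (Fin n × Fin m)) :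
    w ∈ lowerSpan f g I ↔ lowerClosure (X.dec : Set (Fin n × Fin m)) ≤ I := by
  classical
  rw [H.mem_lowerSpan, lowerClosure_le]
  simp only [H.repr_vec]
  constructor
  · intro h c hc
    by_contra hcI
    have := h ⟨c, ⟨0, X.isDec.pos c hc⟩⟩ hcI
    simp at this
    exact this hc
  · intro h k hk
    rw [if_neg]
    exact fun h' => hk (h h'.1)

end IsAdapted

/-- For the product order on cells a decoration is an antichain, hence determined by the lower set
it generates. -/
theorem DecMat.isAntichain {n m d : ℕ} (X : DecMat n m d) :
    IsAntichain (· ≤ ·) (X.dec : Set (Fin n × Fin m)) := by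
  intro x hx y hy hne hle
  rcases X.isDec.anti x hx y hy hne with h | h
  · exact absurd hle.2 (not_le.mpr h.2)
  · exact absurd hle.1 (not_le.mpr h.1)

theorem DecMat.dec_eq_of_lowerClosure_eq {n m d : ℕ} {X Y : DecMat n m d}
    (h : lowerClosure (X.dec : Set (Fin n × Fin m)) = lowerClosure (Y.dec : Set (Fin n × Fin m))) :
    X.dec = Y.dec := by
  have key : ∀ X Y : DecMat n m d, lowerClosure (X.dec : Set (Fin n × Fin m))
      = lowerClosure (Y.dec : Set (Fin n × Fin m)) → X.dec ⊆ Y.dec := by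
    intro X Y h x hx
    obtain ⟨y, hy, hxy⟩ := mem_lowerClosure.mp
      (h ▸ subset_lowerClosure hx : x ∈ lowerClosure (Y.dec : Set (Fin n × Fin m)))
    obtain ⟨z, hz, hyz⟩ := mem_lowerClosure.mp
      (h ▸ subset_lowerClosure hy : y ∈ lowerClosure (X.dec : Set (Fin n × Fin m)))
    have : x = z := X.isAntichain.eq hx hz (hxy.trans hyz)
    subst this
    rwa [le_antisymm hxy hyz]
  exact Finset.Subset.antisymm (key X Y h) (key Y X h.symm)

/-- The orbits are pairwise disjoint. -/
theorem InOrbit.unique {F : Type*} [Field F] {n m d : ℕ} {X Y : DecMat n m d}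
    {f : PFlag F d n} {g : PFlag F d m} {w : Fin d → F} (hX : InOrbit X f g w)
    (hY : InOrbit Y f g w) : X = Y := by
  obtain ⟨e, hX⟩ := inOrbit_iff_exists_isAdapted.mp hX
  obtain ⟨e', hY⟩ := inOrbit_iff_exists_isAdapted.mp hY
  refine DecMat.ext ?_ ?_
  · refine eq_of_rectSum_eq fun s hs t ht => ?_
    have h1 := hX.finrank_inf ⟨s, Nat.lt_succ_of_le hs⟩ ⟨t, Nat.lt_succ_of_le ht⟩
    rw [hY.finrank_inf] at h1
    exact h1.symm
  · apply DecMat.dec_eq_of_lowerClosure_eq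
    apply le_antisymm
    · rw [← hX.vec_mem_lowerSpan, hY.vec_mem_lowerSpan]
    · rw [← hY.vec_mem_lowerSpan, hX.vec_mem_lowerSpan]

/-! ### Every triple lies in an orbit -/

theorem exists_span_complement {F V : Type*} [Field F] [AddCommGroup V] [Module F V]
    [FiniteDimensional F V] {L U : Submodule F V} (hLU : L ≤ U) {a : ℕ}
    (ha : Module.finrank F U = Module.finrank F L + a) :
    ∃ b : Fin a → V, U = L ⊔ Submodule.span F (Set.range b) := by
  obtain ⟨C, hC⟩ := L.exists_isCompl
  have h1 : L ⊔ C ⊓ U = U := by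
    rw [← sup_inf_assoc_of_le C hLU, hC.sup_eq_top, top_inf_eq]
  have h2 : L ⊓ (C ⊓ U) = ⊥ := by
    rw [← inf_assoc, hC.inf_eq_bot, bot_inf_eq]
  have h3 := Submodule.finrank_sup_add_finrank_inf_eq L (C ⊓ U)
  rw [h1, h2, finrank_bot, ha] at h3
  have h4 : Module.finrank F ↥(C ⊓ U) = a := by omega
  let b := Module.finBasisOfFinrankEq F ↥(C ⊓ U) h4
  refine ⟨fun i => b i, ?_⟩
  have h5 : Submodule.span F (Set.range fun i => (b i : V)) = C ⊓ U := by
    have := congrArg (Submodule.map (C ⊓ U).subtype) b.span_eq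
    rw [Submodule.map_span, Submodule.map_top, Submodule.range_subtype, ← Set.range_comp] at this
    exact this
  rw [h5, h1]

theorem exists_span_complement_of_mem {F V : Type*} [Field F] [AddCommGroup V] [Module F V]
    [FiniteDimensional F V] {L U : Submodule F V} (hLU : L ≤ U) {a : ℕ}
    (ha : Module.finrank F U = Module.finrank F L + a) {u : V} (hu : u ∈ U) (hu' : u ∉ L) :
    ∃ (h0 : 0 < a) (b : Fin a → V), b ⟨0, h0⟩ = u ∧ U = L ⊔ Submodule.span F (Set.range b) := by
  have h1 := Submodule.finrank_sup_span_singleton (K := F) hu'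
  have h2 : L ⊔ F ∙ u ≤ U := sup_le hLU (by simpa using hu)
  have h3 := Submodule.finrank_mono h2
  obtain ⟨a, rfl⟩ : ∃ k, a = k + 1 := ⟨a - 1, by omega⟩
  obtain ⟨b, hb⟩ := exists_span_complement h2 (a := a) (by omega)
  refine ⟨Nat.succ_pos _, Fin.cons u b, rfl, ?_⟩
  rw [hb, Fin.range_cons, Submodule.span_insert, sup_assoc]

section Completeness

variable {F : Type*} [Field F] {n m d : ℕ} (f : PFlag F d n) (g : PFlag F d m)

/-- The subspace `V_i ∩ V'_j` at the cell `(i, j)`. -/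
def cellUpper (c : Fin n × Fin m) : Submodule F (Fin d → F) :=
  f.1 c.1.succ ⊓ g.1 c.2.succ

/-- The part `V_{i-1} ∩ V'_j + V_i ∩ V'_{j-1}` of `V_i ∩ V'_j` coming from smaller cells. -/
def cellLower (c : Fin n × Fin m) : Submodule F (Fin d → F) :=
  f.1 c.1.castSucc ⊓ g.1 c.2.succ ⊔ f.1 c.1.succ ⊓ g.1 c.2.castSucc

theorem cellLower_le (c : Fin n × Fin m) : cellLower f g c ≤ cellUpper f g c :=
  sup_le (inf_le_inf_right _ (f.2.1 Fin.castSucc_lt_succ.le))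
    (inf_le_inf_left _ (g.2.1 Fin.castSucc_lt_succ.le))

/-- The relative position of two flags. -/
noncomputable def relPos : Matrix (Fin n) (Fin m) ℕ :=
  fun i j => Module.finrank F (cellUpper f g (i, j)) - Module.finrank F (cellLower f g (i, j))

theorem finrank_cellUpper (c : Fin n × Fin m) :
    Module.finrank F (cellUpper f g c)
      = Module.finrank F (cellLower f g c) + relPos f g c.1 c.2 := by
  have := Submodule.finrank_mono (cellLower_le f g c)
  have h : relPos f g c.1 c.2
      = Module.finrank F (cellUpper f g c) - Module.finrank F (cellLower f g c) := rfl
  omega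

/-- The formula for the dimension of a sum of two subspaces, the intersection of the two summands of
`cellLower` being `V_{i-1} ∩ V'_{j-1}`. -/
theorem finrank_cellLower (c : Fin n × Fin m) :
    Module.finrank F (cellLower f g c)
        + Module.finrank F ↥(f.1 c.1.castSucc ⊓ g.1 c.2.castSucc)
      = Module.finrank F ↥(f.1 c.1.castSucc ⊓ g.1 c.2.succ)
        + Module.finrank F ↥(f.1 c.1.succ ⊓ g.1 c.2.castSucc) := by
  have h : f.1 c.1.castSucc ⊓ g.1 c.2.castSucc
      = f.1 c.1.castSucc ⊓ g.1 c.2.succ ⊓ (f.1 c.1.succ ⊓ g.1 c.2.castSucc) := by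
    apply le_antisymm
    · exact le_inf (inf_le_inf_left _ (g.2.1 Fin.castSucc_lt_succ.le))
        (inf_le_inf_right _ (f.2.1 Fin.castSucc_lt_succ.le))
    · exact le_inf (inf_le_left.trans inf_le_left) (inf_le_right.trans inf_le_right)
  rw [cellLower, h]
  exact Submodule.finrank_sup_add_finrank_inf_eq _ _

theorem rectSum_relPos (s : Fin (n + 1)) (t : Fin (m + 1)) :
    rectSum (relPos f g) s t = Module.finrank F ↥(f.1 s ⊓ g.1 t) := by
  induction s using Fin.induction generalizing t with
  | zero =>
    rw [f.2.2.1, bot_inf_eq, finrank_bot]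
    simp [rectSum]
  | succ i ih =>
    induction t using Fin.induction with
    | zero =>
      rw [g.2.2.1, inf_bot_eq, finrank_bot]
      simp [rectSum]
    | succ j jh =>
      have h1 := rectSum_succ (relPos f g) i j
      have h2 : Module.finrank F ↥(f.1 i.succ ⊓ g.1 j.succ) = _ := finrank_cellUpper f g (i, j)
      have h3 := finrank_cellLower f g (i, j)
      have h4 := ih j.castSucc
      have h5 := ih j.succ
      simp only [Fin.val_succ, Fin.val_castSucc] at h1 h2 h3 h4 h5 jh ⊢
      omega

theorem sum_relPos : ∑ i, ∑ j, relPos f g i j = d := by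
  have h := rectSum_relPos f g (Fin.last n) (Fin.last m)
  rw [f.2.2.2, g.2.2.2, inf_top_eq, finrank_top, Module.finrank_fin_fun] at h
  rw [rectSum, Finset.filter_true_of_mem, Fintype.sum_prod_type] at h
  · exact h
  · rintro ⟨i, j⟩ -
    simp

variable {f g}

theorem inf_eq_span_of_cells
    {b : (Σ c : Fin n × Fin m, Fin (relPos f g c.1 c.2)) → Fin d → F}
    (hb : ∀ c, cellUpper f g c
      = cellLower f g c ⊔ Submodule.span F (Set.range fun k => b ⟨c, k⟩))
    (s : Fin (n + 1)) (t : Fin (m + 1)) :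
    f.1 s ⊓ g.1 t
      = Submodule.span F (b '' {k | (k.1.1 : ℕ) < s ∧ (k.1.2 : ℕ) < t}) := by
  apply le_antisymm
  · induction s using Fin.induction generalizing t with
    | zero => rw [f.2.2.1, bot_inf_eq]; exact bot_le
    | succ i ih =>
      induction t using Fin.induction with
      | zero => rw [g.2.2.1, inf_bot_eq]; exact bot_le
      | succ j jh =>
        have h := hb (i, j)
        rw [cellUpper, cellLower] at h
        simp only at h
        rw [h]
        refine sup_le (sup_le ((ih j.succ).trans (Submodule.span_mono (Set.image_mono ?_)))
          (jh.trans (Submodule.span_mono (Set.image_mono ?_)))) (Submodule.span_mono ?_)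
        · rintro k ⟨h1, h2⟩
          exact ⟨h1.trans (by simp), h2⟩
        · rintro k ⟨h1, h2⟩
          exact ⟨h1, h2.trans (by simp)⟩
        · rintro _ ⟨k, rfl⟩
          exact ⟨⟨(i, j), k⟩, by simp, rfl⟩
  · rw [Submodule.span_le]
    rintro _ ⟨⟨c, k⟩, ⟨h1, h2⟩, rfl⟩
    have h3 : b ⟨c, k⟩ ∈ cellUpper f g c := by
      rw [hb]
      exact Submodule.mem_sup_right (Submodule.subset_span ⟨k, rfl⟩)
    exact ⟨f.2.1 (show c.1.succ ≤ s from by rw [Fin.le_def]; simpa using h1) h3.1,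
      g.2.1 (show c.2.succ ≤ t from by rw [Fin.le_def]; simpa using h2) h3.2⟩

/-- Bases of the quotients `(V_i ∩ V'_j) / (V_{i-1} ∩ V'_j + V_i ∩ V'_{j-1})` lift to a basis of
`V` adapted to both flags. -/
theorem exists_basis_of_cells
    {b : (Σ c : Fin n × Fin m, Fin (relPos f g c.1 c.2)) → Fin d → F}
    (hb : ∀ c, cellUpper f g c
      = cellLower f g c ⊔ Submodule.span F (Set.range fun k => b ⟨c, k⟩)) :
    ∃ e : Module.Basis (Σ c : Fin n × Fin m, Fin (relPos f g c.1 c.2)) F (Fin d → F),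
      (∀ k, e k = b k) ∧
      (∀ s, f.1 s = Submodule.span F (e '' {c | (c.1.1 : ℕ) < s})) ∧
      (∀ s, g.1 s = Submodule.span F (e '' {c | (c.1.2 : ℕ) < s})) := by
  have h1 : ⊤ ≤ Submodule.span F (Set.range b) := by
    have := inf_eq_span_of_cells hb (Fin.last n) (Fin.last m)
    rw [f.2.2.2, g.2.2.2, inf_top_eq] at this
    rw [this]
    exact Submodule.span_mono (Set.image_subset_range _ _)
  have h2 : Fintype.card (Σ c : Fin n × Fin m, Fin (relPos f g c.1 c.2))
      = Module.finrank F (Fin d → F) := by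
    rw [Fintype.card_sigma, Module.finrank_fin_fun]
    simp only [Fintype.card_fin]
    rw [Fintype.sum_prod_type, sum_relPos]
  refine ⟨basisOfTopLeSpanOfCardEqFinrank b h1 h2, fun k => by simp, fun s => ?_, fun s => ?_⟩
  · have := inf_eq_span_of_cells hb s (Fin.last m)
    rw [g.2.2.2, inf_top_eq] at this
    simpa using this
  · have := inf_eq_span_of_cells hb (Fin.last n) s
    rw [f.2.2.2, top_inf_eq] at this
    simpa using this

theorem cellLower_le_lowerSpan {I : LowerSet (Fin n × Fin m)} {c : Fin n × Fin m}
    (h : ∀ x < c, x ∈ I) : cellLower f g c ≤ lowerSpan f g I := by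
  obtain ⟨i, j⟩ := c
  refine sup_le ?_ ?_
  · rcases Fin.eq_zero_or_eq_succ i.castSucc with h0 | ⟨k, hk⟩
    · simp [h0, f.2.2.1]
    · have hlt : k < i := by
        have := congrArg Fin.val hk
        rw [Fin.lt_def]
        simp at this
        omega
      refine le_trans ?_ (le_iSup₂_of_le (k, j) (h (k, j) ?_) le_rfl)
      · simp [hk]
      · exact Prod.mk_lt_mk.mpr (.inl ⟨hlt, le_rfl⟩)
  · rcases Fin.eq_zero_or_eq_succ j.castSucc with h0 | ⟨k, hk⟩
    · simp [h0, g.2.2.1]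
    · have hlt : k < j := by
        have := congrArg Fin.val hk
        rw [Fin.lt_def]
        simp at this
        omega
      refine le_trans ?_ (le_iSup₂_of_le (i, k) (h (i, k) ?_) le_rfl)
      · simp [hk]
      · exact Prod.mk_lt_mk.mpr (.inr ⟨le_rfl, hlt⟩)

variable (f g) in
open scoped Classical in
/-- A vector `w` is a sum of vectors `u c ∈ V_i ∩ V'_j`, over the cells `c = (i, j)` of an
antichain, that are nonzero modulo the smaller cells: take for the antichain the maximal cells of a
smallest lower set `I` with `w ∈ ∑_{(i,j) ∈ I} V_i ∩ V'_j`. -/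
theorem exists_antichain_decomposition (w : Fin d → F) :
    ∃ (Δ : Finset (Fin n × Fin m)) (u : Fin n × Fin m → Fin d → F),
      IsAntichain (· ≤ ·) (Δ : Set (Fin n × Fin m)) ∧
      (∀ c ∈ Δ, u c ∈ cellUpper f g c ∧ u c ∉ cellLower f g c) ∧ w = ∑ c ∈ Δ, u c := by
  have htop : lowerSpan f g ⊤ = ⊤ := by
    rw [eq_top_iff]
    rcases Nat.eq_zero_or_pos n with rfl | hn
    · have : (⊤ : Submodule F (Fin d → F)) = ⊥ := f.2.2.2.symm.trans f.2.2.1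
      rw [this]
      exact bot_le
    rcases Nat.eq_zero_or_pos m with rfl | hm
    · have : (⊤ : Submodule F (Fin d → F)) = ⊥ := g.2.2.2.symm.trans g.2.2.1
      rw [this]
      exact bot_le
    obtain ⟨n, rfl⟩ : ∃ k, n = k + 1 := ⟨n - 1, by omega⟩
    obtain ⟨m, rfl⟩ : ∃ k, m = k + 1 := ⟨m - 1, by omega⟩
    refine le_trans ?_ (le_iSup₂_of_le (Fin.last n, Fin.last m) trivial le_rfl)
    simp [f.2.2.2, g.2.2.2]
  -- a lower set of least cardinality with `w ∈ lowerSpan f g I`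
  obtain ⟨I, hI, hmin⟩ := (measure fun I : LowerSet (Fin n × Fin m) =>
    (I : Set (Fin n × Fin m)).ncard).wf.has_min {I | w ∈ lowerSpan f g I} ⟨⊤, by
      simp [htop]⟩
  -- the subspaces at the maximal cells of `I` already span `lowerSpan f g I`
  have hI' : w ∈ ⨆ c ∈ Finset.univ.filter (fun c => Maximal (· ∈ I) c), cellUpper f g c := by
    refine (iSup₂_le fun c hc => ?_ : lowerSpan f g I ≤ _) hI
    obtain ⟨b, hcb, hb⟩ := (Set.toFinite (I : Set (Fin n × Fin m))).exists_le_maximal hc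
    refine le_trans ?_ (le_iSup₂_of_le b (by simpa using hb) le_rfl)
    exact inf_le_inf (f.2.1 (Fin.succ_le_succ_iff.mpr hcb.1))
      (g.2.1 (Fin.succ_le_succ_iff.mpr hcb.2))
  rw [Submodule.mem_iSup_finset_iff_exists_sum] at hI'
  obtain ⟨u, hu⟩ := hI'
  refine ⟨_, fun c => u c, ?_, fun c hc => ⟨(u c).2, fun hL => ?_⟩, hu.symm⟩
  · intro x hx y hy hne hle
    simp only [Finset.coe_filter, Finset.mem_univ, true_and, Set.mem_ofPred_eq] at hx hy
    exact hne (le_antisymm hle (hx.2 hy.1 hle))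
  · have hc' : Maximal (· ∈ I) c := by simpa using hc
    -- if `u c` came from smaller cells, the maximal cell `c` could be removed from `I`
    let J : LowerSet (Fin n × Fin m) := ⟨{x | x ∈ I ∧ x ≠ c}, fun a b hba ha =>
      ⟨I.lower hba ha.1, fun hb => ha.2 (le_antisymm (hc'.2 ha.1 (hb ▸ hba)) (hb ▸ hba))⟩⟩
    refine hmin J ?_ ?_
    · show w ∈ lowerSpan f g J
      rw [← hu]
      refine Submodule.sum_mem _ fun x hx => ?_
      have hx' : Maximal (· ∈ I) x := by simpa using hx
      by_cases hxc : x = c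
      · subst hxc
        refine cellLower_le_lowerSpan (fun y hy => ?_) hL
        exact ⟨I.lower hy.le hx'.1, hy.ne⟩
      · exact (le_iSup₂_of_le (f := fun c (_ : c ∈ J) => f.1 c.1.succ ⊓ g.1 c.2.succ) x
          (show x ∈ J from ⟨hx'.1, hxc⟩) le_rfl) (u x).2
    · show Set.ncard _ < Set.ncard _
      refine Set.ncard_lt_ncard ⟨fun x hx => hx.1, fun h => ?_⟩ (Set.toFinite _)
      exact (h hc'.1).2 rfl

variable (f g) in
/-- Every triple of two flags and a vector lies in one of the orbits. -/
theorem exists_inOrbit (w : Fin d → F) : ∃ X : DecMat n m d, InOrbit X f g w := by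
  classical
  obtain ⟨Δ, u, hanti, hu, hw⟩ := exists_antichain_decomposition f g w
  have hex : ∀ c : Fin n × Fin m, ∃ b : Fin (relPos f g c.1 c.2) → Fin d → F,
      (c ∈ Δ → ∃ h0 : 0 < relPos f g c.1 c.2, b ⟨0, h0⟩ = u c) ∧
      cellUpper f g c = cellLower f g c ⊔ Submodule.span F (Set.range b) := by
    intro c
    by_cases hc : c ∈ Δ
    · obtain ⟨h0, b, hb, hs⟩ := exists_span_complement_of_mem (cellLower_le f g c)
        (finrank_cellUpper f g c) (hu c hc).1 (hu c hc).2
      exact ⟨b, fun _ => ⟨h0, hb⟩, hs⟩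
    · obtain ⟨b, hb⟩ := exists_span_complement (cellLower_le f g c) (finrank_cellUpper f g c)
      exact ⟨b, fun h => absurd h hc, hb⟩
  choose b hb0 hb using hex
  obtain ⟨e, he, h1, h2⟩ := exists_basis_of_cells (b := fun k => b k.1 k.2) hb
  have hdec : IsDecorated d (relPos f g) Δ := by
    refine ⟨fun x hx => (hb0 x hx).1, fun x hx y hy hne => ?_, sum_relPos f g⟩
    have hxy := hanti hx hy hne
    have hyx := hanti hy hx hne.symm
    replace hxy : ¬ x ≤ y := hxy
    replace hyx : ¬ y ≤ x := hyx
    simp only [Prod.le_def, not_and_or, not_le] at hxy hyx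
    rcases hxy with h | h <;> rcases hyx with h' | h'
    · exact absurd h' (not_lt.mpr h.le)
    · exact .inr ⟨h, h'⟩
    · exact .inl ⟨h', h⟩
    · exact absurd h' (not_lt.mpr h.le)
  refine ⟨⟨relPos f g, Δ, hdec⟩, e, h1, h2, ?_⟩
  rw [hw, ← Finset.sum_attach]
  refine Finset.sum_congr rfl fun x _ => ?_
  obtain ⟨h0, hx⟩ := hb0 x.1 x.2
  rw [he]
  exact hx.symm

end Completeness

/-- The orbit of a decorated matrix is described by the dimensions of `V_s ∩ V'_t` and by the lower
sets `I` with `w ∈ ∑_{(i,j) ∈ I} V_i ∩ V'_j`. -/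
theorem inOrbit_iff {F : Type*} [Field F] {n m d : ℕ} {X : DecMat n m d}
    {f : PFlag F d n} {g : PFlag F d m} {w : Fin d → F} :
    InOrbit X f g w ↔
      (∀ (s : Fin (n + 1)) (t : Fin (m + 1)),
        Module.finrank F ↥(f.1 s ⊓ g.1 t) = rectSum X.mat s t) ∧
      ∀ I, w ∈ lowerSpan f g I ↔ lowerClosure (X.dec : Set (Fin n × Fin m)) ≤ I := by
  constructor
  · intro h
    obtain ⟨e, h⟩ := inOrbit_iff_exists_isAdapted.mp h
    exact ⟨h.finrank_inf, h.vec_mem_lowerSpan⟩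
  · rintro ⟨h1, h2⟩
    obtain ⟨Y, hY⟩ := exists_inOrbit f g w
    obtain ⟨e, h⟩ := inOrbit_iff_exists_isAdapted.mp hY
    have : Y = X := by
      refine DecMat.ext ?_ ?_
      · refine eq_of_rectSum_eq fun s hs t ht => ?_
        rw [← h.finrank_inf ⟨s, Nat.lt_succ_of_le hs⟩ ⟨t, Nat.lt_succ_of_le ht⟩, h1]
      · apply DecMat.dec_eq_of_lowerClosure_eq
        apply le_antisymm
        · rw [← h.vec_mem_lowerSpan, h2]
        · rw [← h2, h.vec_mem_lowerSpan]
    exact this ▸ hY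

/-- The orbits are not empty. -/
theorem exists_inOrbit_of_decMat (F : Type*) [Field F] {n m d : ℕ} (X : DecMat n m d) :
    ∃ (f : PFlag F d n) (g : PFlag F d m) (w : Fin d → F), InOrbit X f g w := by
  have hcard : Fintype.card (Σ c : Fin n × Fin m, Fin (X.mat c.1 c.2)) = Fintype.card (Fin d) := by
    rw [Fintype.card_sigma, Fintype.card_fin]
    simp only [Fintype.card_fin]
    rw [Fintype.sum_prod_type, X.isDec.total]
  let e := (Pi.basisFun F (Fin d)).reindex (Fintype.equivOfCardEq hcard).symm
  refine ⟨⟨fun s => Submodule.span F (e '' {c | (c.1.1 : ℕ) < s}), fun s t hst =>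
    Submodule.span_mono (Set.image_mono fun _ hc => lt_of_lt_of_le (show _ < (s : ℕ) from hc) hst),
    by simp, ?_⟩,
    ⟨fun s => Submodule.span F (e '' {c | (c.1.2 : ℕ) < s}), fun s t hst =>
    Submodule.span_mono (Set.image_mono fun _ hc => lt_of_lt_of_le (show _ < (s : ℕ) from hc) hst),
    by simp, ?_⟩,
    _, e, fun _ => rfl, fun _ => rfl, rfl⟩
  · simp only [Fin.val_last, Fin.is_lt, Set.ofPred_true, Set.image_univ]
    exact e.span_eq
  · simp only [Fin.val_last, Fin.is_lt, Set.ofPred_true, Set.image_univ]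
    exact e.span_eq

/-! ### The orbits occurring in the generators -/

open scoped Classical in
/-- The partial sum `∑_{j < t} a_j`. -/
noncomputable def partialSum {m : ℕ} (a : Fin m → ℕ) (t : ℕ) : ℕ :=
  ∑ j : Fin m with j.val < t, a j

theorem rectSum_diagonal {m : ℕ} (a : Fin m → ℕ) (s t : ℕ) :
    rectSum (Matrix.diagonal a) s t = partialSum a (min s t) := by
  classical
  unfold rectSum partialSum
  rw [Finset.sum_filter, Finset.sum_filter, Fintype.sum_prod_type]
  refine Finset.sum_congr rfl fun i _ => ?_
  rw [Finset.sum_eq_single i]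
  · simp
  · intro j _ hj
    simp [Matrix.diagonal_apply_ne _ hj.symm]
  · simp

theorem lowerSpan_bot {F : Type*} [Field F] {n m d : ℕ} (f : PFlag F d n) (g : PFlag F d m) :
    lowerSpan f g ⊥ = ⊥ := by
  unfold lowerSpan
  simp

theorem inOrbit_iff_of_dec_eq_empty {F : Type*} [Field F] {n m d : ℕ} {X : DecMat n m d}
    (hX : X.dec = ∅) {f : PFlag F d n} {g : PFlag F d m} {w : Fin d → F} :
    InOrbit X f g w ↔ w = 0 ∧ ∀ (s : Fin (n + 1)) (t : Fin (m + 1)),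
        Module.finrank F ↥(f.1 s ⊓ g.1 t) = rectSum X.mat s t := by
  rw [inOrbit_iff, and_comm, hX]
  refine and_congr_left fun _ => ?_
  simp only [Finset.coe_empty, lowerClosure_empty, bot_le, iff_true]
  constructor
  · intro h
    simpa [lowerSpan_bot] using h ⊥
  · rintro rfl I
    exact zero_mem _

/-- For flags `f`, `g` the dimensions `dim (V_s ∩ V'_t)` are given by the diagonal matrix `diag(a)`
if and only if `f = g`. -/
theorem finrank_inf_eq_partialSum_iff {F : Type*} [Field F] {m d : ℕ} (f g : PFlag F d m)
    (a : Fin m → ℕ) :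
    (∀ s t : Fin (m + 1), Module.finrank F ↥(f.1 s ⊓ g.1 t) = partialSum a (min s t)) ↔
      f = g ∧ ∀ t : Fin (m + 1), Module.finrank F ↥(g.1 t) = partialSum a t := by
  constructor
  · intro h
    have hf : ∀ s, Module.finrank F ↥(f.1 s) = partialSum a s := fun s => by
      have := h s (Fin.last m)
      rwa [g.2.2.2, inf_top_eq, Fin.val_last, min_eq_left (Nat.lt_succ_iff.mp s.2)] at this
    have hg : ∀ s, Module.finrank F ↥(g.1 s) = partialSum a s := fun s => by
      have := h (Fin.last m) s
      rwa [f.2.2.2, top_inf_eq, Fin.val_last, min_eq_right (Nat.lt_succ_iff.mp s.2)] at this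
    refine ⟨Subtype.ext (funext fun s => ?_), hg⟩
    have hs := h s s
    rw [min_self] at hs
    rw [← Submodule.eq_of_le_of_finrank_eq inf_le_left (hs.trans (hf s).symm)]
    exact Submodule.eq_of_le_of_finrank_eq inf_le_right (hs.trans (hg s).symm)
  · rintro ⟨rfl, h⟩ s t
    rcases le_total s t with hst | hst
    · rw [inf_eq_left.mpr (f.2.1 hst), h, min_eq_left (by exact_mod_cast hst)]
    · rw [inf_eq_right.mpr (f.2.1 hst), h, min_eq_right (by exact_mod_cast hst)]

open scoped Classical in
/-- For flags `f`, `g` the dimensions `dim (V_s ∩ V'_t)` are given by the matrix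
`diag(a) + E_{h,h+1}` if and only if `f` arises from `g` by enlarging the step `h` by one
dimension. -/
theorem finrank_inf_eq_partialSum_add_iff {F : Type*} [Field F] {m d : ℕ} (f g : PFlag F d m)
    (a : Fin m → ℕ) {h h' : Fin m} (hh : (h' : ℕ) = h + 1) :
    (∀ s t : Fin (m + 1), Module.finrank F ↥(f.1 s ⊓ g.1 t)
        = partialSum a (min s t) + if (h : ℕ) < s ∧ (h' : ℕ) < t then 1 else 0) ↔
      (∀ s, s ≠ h.succ → f.1 s = g.1 s) ∧ g.1 h.succ ≤ f.1 h.succ ∧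
      Module.finrank F ↥(f.1 h.succ) = Module.finrank F ↥(g.1 h.succ) + 1 ∧
      ∀ t : Fin (m + 1), Module.finrank F ↥(g.1 t)
        = partialSum a t + if (h' : ℕ) < t then 1 else 0 := by
  constructor
  · intro H
    have hf : ∀ s : Fin (m + 1), Module.finrank F ↥(f.1 s)
        = partialSum a s + if (h : ℕ) < s then 1 else 0 := fun s => by
      have := H s (Fin.last m)
      rw [g.2.2.2, inf_top_eq, Fin.val_last, min_eq_left (Nat.lt_succ_iff.mp s.2)] at this
      simpa using this
    have hg : ∀ s : Fin (m + 1), Module.finrank F ↥(g.1 s)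
        = partialSum a s + if (h' : ℕ) < s then 1 else 0 := fun s => by
      have := H (Fin.last m) s
      rw [f.2.2.2, top_inf_eq, Fin.val_last, min_eq_right (Nat.lt_succ_iff.mp s.2)] at this
      simpa using this
    have hle : ∀ s, g.1 s ≤ f.1 s := fun s => by
      have hs := H s s
      rw [min_self] at hs
      refine inf_eq_right.mp (Submodule.eq_of_le_of_finrank_eq inf_le_right ?_)
      rw [hs, hg]
      congr 1
      split_ifs <;> omega
    refine ⟨fun s hs => (Submodule.eq_of_le_of_finrank_eq (hle s) ?_).symm, hle _, ?_, hg⟩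
    · rw [hf, hg]
      have : (s : ℕ) ≠ h + 1 := fun h0 => hs (Fin.ext (by simpa using h0))
      congr 1
      split_ifs <;> omega
    · rw [hf, hg]
      simp only [Fin.val_succ]
      split_ifs <;> omega
  · rintro ⟨h1, h2, h3, h4⟩ s t
    have hle : ∀ s, g.1 s ≤ f.1 s := fun s => by
      by_cases hs : s = h.succ
      · rw [hs]
        exact h2
      · exact (h1 s hs).ge
    rcases le_or_gt t s with hts | hst
    · have hts' : (t : ℕ) ≤ s := hts
      rw [inf_eq_right.mpr ((g.2.1 hts).trans (hle s)), h4, min_eq_right hts']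
      congr 1
      split_ifs <;> omega
    · have hst' : (s : ℕ) < t := hst
      by_cases hs : s = h.succ
      · subst hs
        rw [inf_eq_left.mpr ((f.2.1 hst.le).trans (h1 t hst.ne').le), h3, h4, min_eq_left hst'.le]
        rw [Fin.val_succ] at hst' ⊢
        split_ifs <;> omega
      · have : (s : ℕ) ≠ h + 1 := fun h0 => hs (Fin.ext (by simpa using h0))
        rw [h1 s hs, inf_eq_left.mpr (g.2.1 hst.le), h4, min_eq_left hst'.le]
        congr 1
        split_ifs <;> omega

/-- The triples in the orbit of `(diag(a), ∅)` are the `(f, f, 0)`; the last condition fixes the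
dimensions of the steps. -/
theorem inOrbit_diagonal_iff {F : Type*} [Field F] {m d : ℕ} {Y : DecMat m m d}
    (hY : Y.dec = ∅) {a : Fin m → ℕ} (ha : Y.mat = Matrix.diagonal a)
    {f g : PFlag F d m} {u : Fin d → F} :
    InOrbit Y f g u ↔ u = 0 ∧ f = g ∧
      ∀ t : Fin (m + 1), Module.finrank F ↥(g.1 t) = rectSum Y.mat m t := by
  have h : ∀ t : Fin (m + 1), min m (t : ℕ) = t := fun t =>
    min_eq_right (Nat.lt_succ_iff.mp t.2)
  rw [inOrbit_iff_of_dec_eq_empty hY, ha]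
  simp only [rectSum_diagonal, h, finrank_inf_eq_partialSum_iff]

/-- The triples in the orbit of `(diag(a) + E_{h,h+1}, ∅)` are the `(f, g, 0)` where the step `h` of
`f` contains that of `g` with codimension one, the other steps being equal. -/
theorem inOrbit_raise_iff {F : Type*} [Field F] {m d : ℕ} {Y : DecMat m m d}
    (hY : Y.dec = ∅) {a : Fin m → ℕ} {h h' : Fin m} (hh : (h' : ℕ) = h + 1)
    (ha : Y.mat = Matrix.diagonal a + Matrix.single h h' 1) {f g : PFlag F d m} {u : Fin d → F} :
    InOrbit Y f g u ↔ u = 0 ∧ (∀ s, s ≠ h.succ → f.1 s = g.1 s) ∧ g.1 h.succ ≤ f.1 h.succ ∧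
      Module.finrank F ↥(f.1 h.succ) = Module.finrank F ↥(g.1 h.succ) + 1 ∧
      ∀ t : Fin (m + 1), Module.finrank F ↥(g.1 t) = rectSum Y.mat m t := by
  classical
  have h0 : ∀ t : Fin (m + 1), min m (t : ℕ) = t := fun t =>
    min_eq_right (Nat.lt_succ_iff.mp t.2)
  rw [inOrbit_iff_of_dec_eq_empty hY, ha]
  simp only [rectSum_add, rectSum_single, rectSum_diagonal, h0, h.2, true_and,
    finrank_inf_eq_partialSum_add_iff f g a hh]

/-- The triples in the orbit of `(diag(a) + E_{h+1,h}, ∅)` are the `(f, g, 0)` where the step `h` of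
`g` contains that of `f` with codimension one, the other steps being equal. -/
theorem inOrbit_lower_iff {F : Type*} [Field F] {m d : ℕ} {Y : DecMat m m d}
    (hY : Y.dec = ∅) {a : Fin m → ℕ} {h h' : Fin m} (hh : (h' : ℕ) = h + 1)
    (ha : Y.mat = Matrix.diagonal a + Matrix.single h' h 1) {f g : PFlag F d m} {u : Fin d → F} :
    InOrbit Y f g u ↔ u = 0 ∧ (∀ s, s ≠ h.succ → f.1 s = g.1 s) ∧ f.1 h.succ ≤ g.1 h.succ ∧
      Module.finrank F ↥(g.1 h.succ) = Module.finrank F ↥(f.1 h.succ) + 1 ∧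
      ∀ t : Fin (m + 1), Module.finrank F ↥(g.1 t) = rectSum Y.mat m t := by
  classical
  have h0 : ∀ t : Fin (m + 1), min m (t : ℕ) = t := fun t =>
    min_eq_right (Nat.lt_succ_iff.mp t.2)
  have key := finrank_inf_eq_partialSum_add_iff g f a hh
  rw [inOrbit_iff_of_dec_eq_empty hY, ha]
  simp only [rectSum_add, rectSum_single, rectSum_diagonal, h0, h'.2, true_and]
  refine and_congr_right fun _ => ?_
  rw [forall_comm]
  have e1 : ∀ s t : Fin (m + 1), Module.finrank F ↥(f.1 t ⊓ g.1 s)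
      = partialSum a (min t s) + (if (h' : ℕ) < t ∧ (h : ℕ) < s then 1 else 0) ↔
      Module.finrank F ↥(g.1 s ⊓ f.1 t)
      = partialSum a (min s t) + (if (h : ℕ) < s ∧ (h' : ℕ) < t then 1 else 0) := fun s t => by
    rw [inf_comm]
    simp only [min_comm (t : ℕ), and_comm (a := (h' : ℕ) < t)]
  simp only [e1]
  rw [key]
  constructor
  · rintro ⟨k1, k2, k3, k4⟩
    refine ⟨fun s hs => (k1 s hs).symm, k2, k3, fun t => ?_⟩
    by_cases ht : t = h.succ
    · rw [ht, k3, k4]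
      simp only [Fin.val_succ]
      split_ifs <;> omega
    · have : (t : ℕ) ≠ h + 1 := fun h0 => ht (Fin.ext (by simpa using h0))
      rw [k1 t ht, k4]
      congr 1
      split_ifs <;> omega
  · rintro ⟨k1, k2, k3, k4⟩
    refine ⟨fun s hs => (k1 s hs).symm, k2, k3, fun t => ?_⟩
    by_cases ht : t = h.succ
    · have := k4 t
      rw [ht, k3] at this
      rw [ht]
      simp only [Fin.val_succ] at this ⊢
      split_ifs at * <;> omega
    · have : (t : ℕ) ≠ h + 1 := fun h0 => ht (Fin.ext (by simpa using h0))
      rw [k1 t ht, k4]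
      congr 1
      split_ifs <;> omega

/-- The triples in the orbit of `(diag(a), {(1,1)})` are the `(f, f, u)` with `0 ≠ u ∈ V_1`. -/
theorem inOrbit_diagonal_corner_iff {F : Type*} [Field F] {m d : ℕ} {Y : DecMat m m d} {c : Fin m}
    (hc : (c : ℕ) = 0) (hY : Y.dec = {(c, c)}) {a : Fin m → ℕ} (ha : Y.mat = Matrix.diagonal a)
    {f g : PFlag F d m} {u : Fin d → F} :
    InOrbit Y f g u ↔ u ≠ 0 ∧ u ∈ g.1 c.succ ∧ f = g ∧
      ∀ t : Fin (m + 1), Module.finrank F ↥(g.1 t) = rectSum Y.mat m t := by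
  have h : ∀ t : Fin (m + 1), min m (t : ℕ) = t := fun t =>
    min_eq_right (Nat.lt_succ_iff.mp t.2)
  rw [inOrbit_iff, hY, ha]
  simp only [rectSum_diagonal, h, finrank_inf_eq_partialSum_iff]
  rw [and_comm, ← and_assoc (a := u ≠ 0)]
  refine and_congr_left ?_
  rintro ⟨rfl, h1⟩
  simp only [Finset.coe_singleton, lowerClosure_singleton, LowerSet.Iic_le]
  have hfst : ∀ x : Fin m × Fin m, x ≤ (c, c) → x = (c, c) := fun x hx =>
    Prod.ext (Fin.ext (by have := Fin.le_def.mp hx.1; simp only [hc] at this ⊢; omega))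
      (Fin.ext (by have := Fin.le_def.mp hx.2; simp only [hc] at this ⊢; omega))
  constructor
  · intro h2
    constructor
    · rintro rfl
      exact (h2 ⊥).mp (zero_mem _)
    · have h3 := (h2 (LowerSet.Iic (c, c))).mpr (by simp)
      refine (iSup₂_le fun x hx => ?_ : lowerSpan f f _ ≤ f.1 c.succ) h3
      rw [hfst x (by simpa using hx)]
      simp
  · rintro ⟨h2, h3⟩ I
    constructor
    · intro h4
      by_contra hcI
      have : lowerSpan f f I = ⊥ := by
        rw [eq_bot_iff]
        refine iSup₂_le fun x hx => ?_
        exact absurd (I.lower (a := x) ⟨Fin.le_def.mpr (by simp [hc]),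
          Fin.le_def.mpr (by simp [hc])⟩ hx) hcI
      rw [this] at h4
      exact h2 (by simpa using h4)
    · intro hcI
      refine (le_iSup₂_of_le (f := fun x (_ : x ∈ I) => f.1 x.1.succ ⊓ f.1 x.2.succ) (c, c) hcI
        le_rfl) ?_
      simpa using h3

/-! ### Enlarging one step of a flag -/

/-- The vector with coordinates `x` on the basis vectors of the column `c`. -/
noncomputable def colVec {F V : Type*} [Field F] [AddCommGroup V] [Module F V] {n m : ℕ}
    {A : Matrix (Fin n) (Fin m) ℕ}
    (e : Module.Basis (Σ c : Fin n × Fin m, Fin (A c.1 c.2)) F V) (c : Fin m)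
    (x : ∀ i : Fin n, Fin (A i c) → F) : V :=
  ∑ i, ∑ k, x i k • e ⟨(i, c), k⟩

section ColVec

variable {F V : Type*} [Field F] [AddCommGroup V] [Module F V] {n m : ℕ}
    {A : Matrix (Fin n) (Fin m) ℕ}
    (e : Module.Basis (Σ c : Fin n × Fin m, Fin (A c.1 c.2)) F V) (c : Fin m)

theorem repr_colVec (x : ∀ i : Fin n, Fin (A i c) → F) (i : Fin n) (k : Fin (A i c)) :
    e.repr (colVec e c x) ⟨(i, c), k⟩ = x i k := by
  classical
  unfold colVec
  simp only [map_sum, map_smul, Module.Basis.repr_self, Finsupp.finsetSum_apply,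
    Finsupp.smul_apply, smul_eq_mul]
  rw [Finset.sum_eq_single i]
  · rw [Finset.sum_eq_single k]
    · simp
    · intro k' _ hk'
      rw [Finsupp.single_apply_eq_zero.mpr, mul_zero]
      intro h'
      simp only [Sigma.mk.injEq, heq_eq_eq, true_and] at h'
      exact absurd h'.symm hk'
    · simp
  · intro i' _ hi'
    refine Finset.sum_eq_zero fun k' _ => ?_
    rw [Finsupp.single_apply_eq_zero.mpr, mul_zero]
    intro h'
    exact absurd (congrArg (fun z => z.1.1) h').symm hi'
  · simp

theorem repr_colVec_of_ne (x : ∀ i : Fin n, Fin (A i c) → F)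
    (k : Σ c : Fin n × Fin m, Fin (A c.1 c.2)) (hk : k.1.2 ≠ c) :
    e.repr (colVec e c x) k = 0 := by
  classical
  unfold colVec
  simp only [map_sum, map_smul, Module.Basis.repr_self, Finsupp.finsetSum_apply,
    Finsupp.smul_apply, smul_eq_mul]
  refine Finset.sum_eq_zero fun i' _ => Finset.sum_eq_zero fun k' _ => ?_
  rw [Finsupp.single_apply_eq_zero.mpr, mul_zero]
  intro h'
  exact absurd (congrArg (fun z => z.1.2) h') hk

theorem colVec_smul (a : F) (x : ∀ i : Fin n, Fin (A i c) → F) :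
    colVec e c (a • x) = a • colVec e c x := by
  simp [colVec, Finset.smul_sum, smul_smul]

end ColVec

namespace IsAdapted

variable {F : Type*} [Field F] {n m d : ℕ} {X Z : DecMat n m d}
  {f : PFlag F d n} {g g' : PFlag F d m} {w : Fin d → F}
  {e : Module.Basis (Σ c : Fin n × Fin m, Fin (Z.mat c.1 c.2)) F (Fin d → F)}
  {h h' : Fin m} {p : Fin n} {x : ∀ i : Fin n, Fin (Z.mat i h') → F}

theorem colVec_mem_left_iff (H : IsAdapted Z f g w e) (hp : x p ≠ 0) (hx : ∀ i, p < i → x i = 0)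
    (s : Fin (n + 1)) : colVec e h' x ∈ f.1 s ↔ (p : ℕ) < s := by
  rw [H.mem_left]
  constructor
  · intro hs
    by_contra hps
    refine hp (funext fun k => ?_)
    rw [← repr_colVec e h' x p k, hs _ (by simpa using hps)]
    rfl
  · rintro hs ⟨⟨i, j⟩, k⟩ hk
    by_cases hj : j = h'
    · subst hj
      rw [repr_colVec, hx i (Fin.lt_def.mpr (lt_of_lt_of_le hs hk))]
      rfl
    · exact repr_colVec_of_ne _ _ _ _ hj

theorem smul_eq_zero_of_mem_right (H : IsAdapted Z f g w e) (hh : (h : ℕ) < h') (hp : x p ≠ 0)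
    {a : F} (ha : a • colVec e h' x ∈ g.1 h.succ) : a = 0 := by
  obtain ⟨k, hk⟩ := Function.ne_iff.mp hp
  rw [H.mem_right] at ha
  have := ha ⟨(p, h'), k⟩ (by simpa using hh)
  rw [map_smul, Finsupp.smul_apply, repr_colVec] at this
  exact (mul_eq_zero.mp this).resolve_right hk

theorem colVec_notMem_right (H : IsAdapted Z f g w e) (hh : (h : ℕ) < h') (hp : x p ≠ 0) :
    colVec e h' x ∉ g.1 h.succ := fun hx =>
  one_ne_zero (H.smul_eq_zero_of_mem_right hh hp (a := (1 : F)) (by simpa using hx))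

open scoped Classical in
theorem inf_raise (H : IsAdapted Z f g w e) (hh : (h : ℕ) < h') (hp : x p ≠ 0)
    (hx : ∀ i, p < i → x i = 0) (s : Fin (n + 1)) :
    f.1 s ⊓ (g.1 h.succ ⊔ Submodule.span F {colVec e h' x})
      = f.1 s ⊓ g.1 h.succ ⊔ if (p : ℕ) < s then Submodule.span F {colVec e h' x} else ⊥ := by
  split_ifs with hps
  · have h1 := (H.colVec_mem_left_iff hp hx s).mpr hps
    rw [inf_comm, sup_comm, sup_inf_assoc_of_le _ (by simpa using h1), inf_comm, sup_comm]
  · rw [sup_bot_eq]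
    apply le_antisymm
    · rintro y ⟨hy1, hy2⟩
      refine ⟨hy1, ?_⟩
      obtain ⟨z, hz, y', hy', rfl⟩ := Submodule.mem_sup.mp hy2
      obtain ⟨a, rfl⟩ := Submodule.mem_span_singleton.mp hy'
      obtain ⟨k, hk⟩ := Function.ne_iff.mp hp
      have h1 := (H.mem_left s _).mp hy1 ⟨(p, h'), k⟩ (by simpa using hps)
      have h2 := (H.mem_right _ _).mp hz ⟨(p, h'), k⟩ (by simpa using hh)
      rw [map_add, Finsupp.add_apply, h2, zero_add, map_smul, Finsupp.smul_apply, repr_colVec] at h1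
      rw [(mul_eq_zero.mp h1).resolve_right hk]
      simpa using hz
    · exact inf_le_inf_left _ le_sup_left

open scoped Classical in
theorem finrank_inf_raise (H : IsAdapted Z f g w e) (hh : (h : ℕ) < h') (hp : x p ≠ 0)
    (hx : ∀ i, p < i → x i = 0) (hg : ∀ t, t ≠ h.succ → g'.1 t = g.1 t)
    (hg' : g'.1 h.succ = g.1 h.succ ⊔ Submodule.span F {colVec e h' x})
    (s : Fin (n + 1)) (t : Fin (m + 1)) :
    Module.finrank F ↥(f.1 s ⊓ g'.1 t)
      = rectSum Z.mat s t + if (p : ℕ) < s ∧ t = h.succ then 1 else 0 := by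
  rw [← H.finrank_inf]
  by_cases ht : t = h.succ
  · subst ht
    rw [hg', H.inf_raise hh hp hx]
    by_cases hps : (p : ℕ) < s
    · rw [if_pos hps, if_pos ⟨hps, rfl⟩]
      exact Submodule.finrank_sup_span_singleton fun h3 => H.colVec_notMem_right hh hp h3.2
    · rw [if_neg hps, if_neg fun h0 => hps h0.1, sup_bot_eq, add_zero]
  · rw [hg t ht, if_neg fun h0 => ht h0.2, add_zero]

open scoped Classical in
/-- Adding a line spanned by a vector `u` of the column `h'` to the step `h` adds it to exactly
those subspaces `lowerSpan f g I` for which `I` contains the cell `(p, h)`, `p` being the last row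
where `u` has a nonzero coordinate. -/
theorem lowerSpan_raise (H : IsAdapted Z f g w e) (hh : (h' : ℕ) = h + 1) (hp : x p ≠ 0)
    (hx : ∀ i, p < i → x i = 0) (hg : ∀ t, t ≠ h.succ → g'.1 t = g.1 t)
    (hg' : g'.1 h.succ = g.1 h.succ ⊔ Submodule.span F {colVec e h' x})
    (I : LowerSet (Fin n × Fin m)) :
    lowerSpan f g' I = lowerSpan f g I ⊔
      if (p, h) ∈ I then Submodule.span F {colVec e h' x} else ⊥ := by
  have hlt : (h : ℕ) < h' := by omega
  have hle : ∀ t, g.1 t ≤ g'.1 t := fun t => by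
    by_cases ht : t = h.succ
    · rw [ht, hg']
      exact le_sup_left
    · rw [hg t ht]
  apply le_antisymm
  · refine iSup₂_le fun c hc => ?_
    by_cases hch : c.2 = h
    · rw [hch, hg', H.inf_raise hlt hp hx]
      refine sup_le (le_trans ?_ le_sup_left) ?_
      · exact le_iSup₂_of_le (f := fun c (_ : c ∈ I) => f.1 c.1.succ ⊓ g.1 c.2.succ) c hc
          (by rw [hch])
      · split_ifs with h1 h2
        · exact le_sup_right
        · exact absurd (I.lower (a := c) ⟨by rw [Fin.val_succ] at h1; exact Nat.lt_succ_iff.mp h1,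
            hch.ge⟩ hc) h2
        · exact bot_le
        · exact bot_le
    · rw [hg _ (fun h0 => hch (Fin.succ_injective _ h0))]
      exact (le_iSup₂_of_le (f := fun c (_ : c ∈ I) => f.1 c.1.succ ⊓ g.1 c.2.succ) c hc
        le_rfl).trans le_sup_left
  · refine sup_le (iSup₂_mono fun c _ => inf_le_inf_left _ (hle _)) ?_
    split_ifs with h1
    · refine le_iSup₂_of_le (f := fun c (_ : c ∈ I) => f.1 c.1.succ ⊓ g'.1 c.2.succ) (p, h) h1 ?_
      rw [Submodule.span_singleton_le_iff_mem]
      refine ⟨(H.colVec_mem_left_iff hp hx _).mpr (by simp), ?_⟩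
      simp only [hg']
      exact Submodule.mem_sup_right (Submodule.mem_span_singleton_self _)
    · exact bot_le

/-- Membership in the enlarged subspace in coordinates: away from `I`, the vector is a multiple of
the added one. -/
theorem mem_lowerSpan_raise (H : IsAdapted Z f g w e) (hh : (h' : ℕ) = h + 1) (hp : x p ≠ 0)
    (hx : ∀ i, p < i → x i = 0) (hg : ∀ t, t ≠ h.succ → g'.1 t = g.1 t)
    (hg' : g'.1 h.succ = g.1 h.succ ⊔ Submodule.span F {colVec e h' x})
    (I : LowerSet (Fin n × Fin m)) (y : Fin d → F) :
    y ∈ lowerSpan f g' I ↔ ∃ a : F, (a = 0 ∨ (p, h) ∈ I) ∧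
      ∀ k, k.1 ∉ I → e.repr y k = a * e.repr (colVec e h' x) k := by
  classical
  rw [H.lowerSpan_raise hh hp hx hg hg']
  have key : ∀ a : F, (∀ k, k.1 ∉ I → e.repr y k = a * e.repr (colVec e h' x) k) ↔
      y - a • colVec e h' x ∈ lowerSpan f g I := fun a => by
    rw [H.mem_lowerSpan]
    simp [sub_eq_zero]
  simp only [key]
  split_ifs with h1
  · simp only [h1, or_true, true_and]
    rw [Submodule.mem_sup]
    constructor
    · rintro ⟨z, hz, y', hy', rfl⟩
      obtain ⟨a, rfl⟩ := Submodule.mem_span_singleton.mp hy'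
      exact ⟨a, by simpa using hz⟩
    · rintro ⟨a, ha⟩
      exact ⟨_, ha, _, Submodule.mem_span_singleton.mpr ⟨a, rfl⟩, by simp⟩
  · simp [h1]

end IsAdapted

/-- Two cells of a decoration in the same column coincide. -/
theorem DecMat.eq_of_snd_eq {n m d : ℕ} (X : DecMat n m d) {x y : Fin n × Fin m}
    (hx : x ∈ X.dec) (hy : y ∈ X.dec) (h : x.2 = y.2) : x = y := by
  by_contra hne
  rcases X.isDec.anti x hx y hy hne with h1 | h1
  · exact absurd h h1.2.ne'
  · exact absurd h h1.2.ne

open scoped Classical in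
/-- The cells generating the lower set of the vector `w` after the step `h` of the second flag has
been enlarged by `∑ x_{i,k} e_{i,h',k}`, where `p` is the last row with `x_p ≠ 0`. -/
noncomputable def raiseDec {F : Type*} [Field F] {n m d : ℕ} (Z : DecMat n m d) (h h' : Fin m)
    (p : Fin n) (x : ∀ i : Fin n, Fin (Z.mat i h') → F) : Set (Fin n × Fin m) :=
  if (p, h') ∈ Z.dec ∧ ∀ k : Fin (Z.mat p h'), (k : ℕ) ≠ 0 → x p k = 0 then
    {c | c ∈ Z.dec ∧ c ≠ (p, h') ∨ c = (p, h) ∨ c.2 = h' ∧ c.1 < p ∧ x c.1 ≠ 0}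
  else Z.dec

namespace IsAdapted

variable {F : Type*} [Field F] {n m d : ℕ} {X Z : DecMat n m d}
  {f : PFlag F d n} {g g' : PFlag F d m} {w : Fin d → F}
  {e : Module.Basis (Σ c : Fin n × Fin m, Fin (Z.mat c.1 c.2)) F (Fin d → F)}
  {h h' : Fin m} {p : Fin n} {x : ∀ i : Fin n, Fin (Z.mat i h') → F}

/-- The lower set of `w` changes only if `w` becomes smaller modulo the added line. Since `w` has at
most one nonzero coordinate in the column `h'`, this requires the last nonzero block of the added
vector to be proportional to the block of `w` in the same row. Subtracting the multiple in question
from `w` moves the cell `(p, h')` to `(p, h)` and leaves the coordinates of the added vector in the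
rows above `p`. -/
theorem vec_mem_lowerSpan_raise (H : IsAdapted Z f g w e) (hh : (h' : ℕ) = h + 1) (hp : x p ≠ 0)
    (hx : ∀ i, p < i → x i = 0) (hg : ∀ t, t ≠ h.succ → g'.1 t = g.1 t)
    (hg' : g'.1 h.succ = g.1 h.succ ⊔ Submodule.span F {colVec e h' x})
    (I : LowerSet (Fin n × Fin m)) :
    w ∈ lowerSpan f g' I ↔ lowerClosure (raiseDec Z h h' p x) ≤ I := by
  classical
  rw [H.mem_lowerSpan_raise hh hp hx hg hg', lowerClosure_le]
  have hhle : (p, h) ≤ (p, h') := ⟨le_rfl, Fin.le_def.mpr (by simp [hh])⟩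
  -- if the cell `(p, h')` lies in `I`, the enlargement does not change the subspace
  have hI : (p, h') ∈ I → ∀ a : F, (∀ k, k.1 ∉ I → e.repr w k = a * e.repr (colVec e h' x) k) →
      (Z.dec : Set (Fin n × Fin m)) ⊆ I := by
    intro hpI a ha c hc
    by_contra hcI
    have h1 := ha ⟨c, ⟨0, Z.isDec.pos c hc⟩⟩ hcI
    have h2 : e.repr (colVec e h' x) ⟨c, ⟨0, Z.isDec.pos c hc⟩⟩ = 0 := by
      obtain ⟨i, j⟩ := c
      by_cases hj : j = h'
      · subst hj
        rw [repr_colVec, hx i]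
        · rfl
        · by_contra hle
          exact hcI (I.lower (a := (p, j)) ⟨not_lt.mp hle, le_rfl⟩ hpI)
      · exact repr_colVec_of_ne _ _ _ _ hj
    rw [h2, H.repr_vec, if_pos ⟨hc, rfl⟩, mul_zero] at h1
    exact one_ne_zero h1
  unfold raiseDec
  split_ifs with hs
  · obtain ⟨hpd, hs⟩ := hs
    constructor
    · rintro ⟨a, ha, hw⟩
      by_cases hpI : (p, h') ∈ I
      · have hsub := hI hpI a hw
        rintro c (⟨hc, -⟩ | rfl | ⟨h1, h2, -⟩)
        · exact hsub hc
        · exact I.lower hhle hpI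
        · exact I.lower (a := (p, h')) ⟨h2.le, h1.le⟩ hpI
      -- the coordinate of `w` at `(p, h')` is not zero, so `w` is congruent to a nonzero multiple
      · have ha0 : a ≠ 0 := by
          rintro rfl
          have := hw ⟨(p, h'), ⟨0, Z.isDec.pos _ hpd⟩⟩ hpI
          rw [H.repr_vec, if_pos ⟨hpd, rfl⟩, zero_mul] at this
          exact one_ne_zero this
        rintro c (⟨hc, hne⟩ | rfl | ⟨h1, h2, h3⟩)
        · by_contra hcI
          have := hw ⟨c, ⟨0, Z.isDec.pos c hc⟩⟩ hcI
          rw [repr_colVec_of_ne, H.repr_vec, if_pos ⟨hc, rfl⟩, mul_zero] at this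
          · exact one_ne_zero this
          · exact fun h0 => hne (Z.eq_of_snd_eq hc hpd h0)
        · exact ha.resolve_left ha0
        · by_contra hcI
          obtain ⟨i, j⟩ := c
          simp only at h1 h2 h3
          subst h1
          obtain ⟨k, hk⟩ := Function.ne_iff.mp h3
          have := hw ⟨(i, j), k⟩ hcI
          rw [repr_colVec, H.repr_vec, if_neg] at this
          · exact (mul_ne_zero ha0 hk) this.symm
          · rintro ⟨h4, -⟩
            exact h2.ne (congrArg Prod.fst (Z.eq_of_snd_eq h4 hpd rfl))
    · intro hsub
      have hph : (p, h) ∈ I := hsub (.inr (.inl rfl))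
      by_cases hpI : (p, h') ∈ I
      · refine ⟨0, .inl rfl, fun k hk => ?_⟩
        rw [H.repr_vec, if_neg, zero_mul]
        rintro ⟨h1, -⟩
        by_cases h2 : k.1 = (p, h')
        · exact hk (h2 ▸ hpI)
        · exact hk (hsub (.inl ⟨h1, h2⟩))
      · obtain ⟨k0, hk0⟩ := Function.ne_iff.mp hp
        have hk00 : (k0 : ℕ) = 0 := by
          by_contra h0
          exact hk0 (hs k0 h0)
        -- this multiple of the added vector has the same block at `(p, h')` as `w`
        refine ⟨(x p k0)⁻¹, .inr hph, ?_⟩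
        rintro ⟨⟨i, j⟩, k⟩ hk
        by_cases hj : j = h'
        · subst hj
          rw [repr_colVec, H.repr_vec]
          rcases lt_trichotomy i p with hip | rfl | hip
          · rw [if_neg]
            · have : x i = 0 := by
                by_contra h0
                exact hk (hsub (.inr (.inr ⟨rfl, hip, h0⟩)))
              simp [this]
            · rintro ⟨h4, -⟩
              exact hip.ne (congrArg Prod.fst (Z.eq_of_snd_eq h4 hpd rfl))
          · by_cases hk1 : (k : ℕ) = 0
            · have : k = k0 := Fin.ext (hk1.trans hk00.symm)
              rw [if_pos ⟨hpd, hk1⟩, this, inv_mul_cancel₀ hk0]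
            · rw [if_neg (fun h0 => hk1 h0.2), hs k hk1, mul_zero]
          · rw [if_neg]
            · simp [hx i hip]
            · rintro ⟨h4, -⟩
              exact hip.ne' (congrArg Prod.fst (Z.eq_of_snd_eq h4 hpd rfl))
        · rw [repr_colVec_of_ne _ _ _ _ hj, H.repr_vec, if_neg, mul_zero]
          rintro ⟨h4, -⟩
          exact hk (hsub (.inl ⟨h4, fun h0 => hj (congrArg Prod.snd h0)⟩))
  · constructor
    · rintro ⟨a, ha, hw⟩
      by_cases hpI : (p, h') ∈ I
      · exact hI hpI a hw
      · rcases eq_or_ne a 0 with rfl | ha0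
        · intro c hc
          by_contra hcI
          have := hw ⟨c, ⟨0, Z.isDec.pos c hc⟩⟩ hcI
          rw [H.repr_vec, if_pos ⟨hc, rfl⟩, zero_mul] at this
          exact one_ne_zero this
        · exfalso
          obtain ⟨k0, hk0⟩ := Function.ne_iff.mp hp
          -- otherwise the block of the added vector at `(p, h')` would be proportional
          -- to that of `w`
          have hpd : (p, h') ∈ Z.dec := by
            by_contra h0
            have := hw ⟨(p, h'), k0⟩ hpI
            rw [repr_colVec, H.repr_vec, if_neg (fun h1 => h0 h1.1)] at this
            exact (mul_ne_zero ha0 hk0) this.symm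
          refine hs ⟨hpd, fun k hk => ?_⟩
          have := hw ⟨(p, h'), k⟩ hpI
          rw [repr_colVec, H.repr_vec, if_neg (fun h1 => hk h1.2)] at this
          exact (mul_eq_zero.mp this.symm).resolve_left ha0
    · intro hsub
      refine ⟨0, .inl rfl, fun k hk => ?_⟩
      rw [H.repr_vec, if_neg (fun h1 => hk (hsub h1.1)), zero_mul]

/-- The orbit of the triple after the step `h` of the second flag has been enlarged by a line: one
unit moves from the column `h'` to the column `h` in the row `p`. -/
theorem inOrbit_raise (H : IsAdapted Z f g w e) (hh : (h' : ℕ) = h + 1) (hp : x p ≠ 0)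
    (hx : ∀ i, p < i → x i = 0) (hg : ∀ t, t ≠ h.succ → g'.1 t = g.1 t)
    (hg' : g'.1 h.succ = g.1 h.succ ⊔ Submodule.span F {colVec e h' x}) :
    InOrbit X f g' w ↔
      X.mat + Matrix.single p h' 1 = Z.mat + Matrix.single p h 1 ∧
      lowerClosure (X.dec : Set (Fin n × Fin m)) = lowerClosure (raiseDec Z h h' p x) := by
  classical
  have hfin := H.finrank_inf_raise (by omega) hp hx hg hg'
  rw [inOrbit_iff]
  refine and_congr ?_ ?_
  · have key : ∀ s t : ℕ, rectSum (Z.mat + Matrix.single p h 1) s t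
        = rectSum Z.mat s t + (if (p : ℕ) < s ∧ t = h + 1 then 1 else 0)
          + rectSum (Matrix.single p h' 1 : Matrix (Fin n) (Fin m) ℕ) s t := by
      intro s t
      rw [rectSum_add, rectSum_single, rectSum_single, add_assoc]
      congr 1
      split_ifs <;> omega
    have hval : ∀ t : Fin (m + 1), t = h.succ ↔ (t : ℕ) = h + 1 := fun t => by
      rw [Fin.ext_iff, Fin.val_succ]
    constructor
    · intro h1
      refine eq_of_rectSum_eq fun s hs t ht => ?_
      have h2 := h1 ⟨s, Nat.lt_succ_of_le hs⟩ ⟨t, Nat.lt_succ_of_le ht⟩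
      rw [hfin] at h2
      simp only [hval] at h2
      rw [key, rectSum_add, ← h2]
    · intro h1 s t
      rw [hfin]
      simp only [hval]
      have h2 := key s t
      rw [← h1, rectSum_add] at h2
      omega
  · simp only [H.vec_mem_lowerSpan_raise hh hp hx hg hg']
    constructor
    · intro h1
      exact le_antisymm ((h1 _).mp le_rfl) ((h1 _).mpr le_rfl)
    · intro h1 I
      rw [h1]

end IsAdapted

/-! ### Shrinking one step of a flag -/

/-- The linear form with coefficients `x` on the coordinates of the column `c`. -/
noncomputable def colForm {F V : Type*} [Field F] [AddCommGroup V] [Module F V] {n m : ℕ}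
    {A : Matrix (Fin n) (Fin m) ℕ}
    (e : Module.Basis (Σ c : Fin n × Fin m, Fin (A c.1 c.2)) F V) (c : Fin m)
    (x : ∀ i : Fin n, Fin (A i c) → F) : V →ₗ[F] F :=
  ∑ i, ∑ k, x i k • e.coord ⟨(i, c), k⟩

theorem colForm_apply {F V : Type*} [Field F] [AddCommGroup V] [Module F V] {n m : ℕ}
    {A : Matrix (Fin n) (Fin m) ℕ}
    (e : Module.Basis (Σ c : Fin n × Fin m, Fin (A c.1 c.2)) F V) (c : Fin m)
    (x : ∀ i : Fin n, Fin (A i c) → F) (y : V) :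
    colForm e c x y = ∑ i, ∑ k, x i k * e.repr y ⟨(i, c), k⟩ := by
  simp [colForm, LinearMap.sum_apply]

theorem colForm_basis {F V : Type*} [Field F] [AddCommGroup V] [Module F V] {n m : ℕ}
    {A : Matrix (Fin n) (Fin m) ℕ}
    (e : Module.Basis (Σ c : Fin n × Fin m, Fin (A c.1 c.2)) F V) (c : Fin m)
    (x : ∀ i : Fin n, Fin (A i c) → F) (i : Fin n) (k : Fin (A i c)) :
    colForm e c x (e ⟨(i, c), k⟩) = x i k := by
  classical
  rw [colForm_apply, Finset.sum_eq_single i]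
  · rw [Finset.sum_eq_single k]
    · simp
    · intro k' _ hk'
      rw [Module.Basis.repr_self, Finsupp.single_apply_eq_zero.mpr, mul_zero]
      intro h'
      simp only [Sigma.mk.injEq, heq_eq_eq, true_and] at h'
      exact absurd h' hk'
    · simp
  · intro i' _ hi'
    refine Finset.sum_eq_zero fun k' _ => ?_
    rw [Module.Basis.repr_self, Finsupp.single_apply_eq_zero.mpr, mul_zero]
    intro h'
    exact absurd (congrArg (fun z => z.1.1) h') hi'
  · simp

theorem finrank_inf_ker_add_one {F V : Type*} [Field F] [AddCommGroup V] [Module F V]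
    [FiniteDimensional F V] {U : Submodule F V} {l : V →ₗ[F] F} {u : V} (hu : u ∈ U)
    (hl : l u ≠ 0) : Module.finrank F ↥(U ⊓ LinearMap.ker l) + 1 = Module.finrank F U := by
  have h1 : u ∉ U ⊓ LinearMap.ker l := fun h => hl h.2
  rw [← Submodule.finrank_sup_span_singleton h1]
  suffices h : U ⊓ LinearMap.ker l ⊔ Submodule.span F {u} = U by rw [h]
  apply le_antisymm
  · exact sup_le inf_le_left (by simpa using hu)
  · intro y hy
    refine Submodule.mem_sup.mpr ⟨y - (l y / l u) • u, ⟨U.sub_mem hy (U.smul_mem _ hu), ?_⟩, _,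
      Submodule.mem_span_singleton.mpr ⟨l y / l u, rfl⟩, by simp⟩
    simp [hl]

open scoped Classical in
/-- The cells generating the lower set of the vector `w` after the step `h` of the second flag has
been cut down to the kernel of the linear form with coefficients `x` on the column `h`, where `p` is
the first row with `x_p ≠ 0`. -/
noncomputable def lowerDec {F : Type*} [Field F] {n m d : ℕ} (Z : DecMat n m d) (h h' : Fin m)
    (p : Fin n) (x : ∀ i : Fin n, Fin (Z.mat i h) → F) : Set (Fin n × Fin m) :=
  if ∃ t, ∃ ht : (t, h) ∈ Z.dec, x t ⟨0, Z.isDec.pos _ ht⟩ ≠ 0 then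
    insert (p, h') (Z.dec : Set (Fin n × Fin m))
  else Z.dec

namespace IsAdapted

variable {F : Type*} [Field F] {n m d : ℕ} {X Z : DecMat n m d}
  {f : PFlag F d n} {g g' : PFlag F d m} {w : Fin d → F}
  {e : Module.Basis (Σ c : Fin n × Fin m, Fin (Z.mat c.1 c.2)) F (Fin d → F)}
  {h h' : Fin m} {p : Fin n} {x : ∀ i : Fin n, Fin (Z.mat i h) → F}

theorem colForm_vec_ne_zero_iff (H : IsAdapted Z f g w e) :
    colForm e h x w ≠ 0 ↔ ∃ t, ∃ ht : (t, h) ∈ Z.dec, x t ⟨0, Z.isDec.pos _ ht⟩ ≠ 0 := by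
  classical
  rw [colForm_apply]
  simp only [H.repr_vec]
  constructor
  · intro h1
    obtain ⟨t, -, h2⟩ := Finset.exists_ne_zero_of_sum_ne_zero h1
    obtain ⟨k, -, h3⟩ := Finset.exists_ne_zero_of_sum_ne_zero h2
    by_cases h4 : (t, h) ∈ Z.dec ∧ (k : ℕ) = 0
    · refine ⟨t, h4.1, ?_⟩
      have : k = ⟨0, Z.isDec.pos _ h4.1⟩ := Fin.ext h4.2
      rw [← this]
      exact left_ne_zero_of_mul h3
    · rw [if_neg h4, mul_zero] at h3
      exact absurd rfl h3
  · rintro ⟨t, ht, h1⟩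
    rw [Finset.sum_eq_single t]
    · rw [Finset.sum_eq_single ⟨0, Z.isDec.pos _ ht⟩]
      · simpa [ht] using h1
      · intro k _ hk
        rw [if_neg, mul_zero]
        rintro ⟨-, h2⟩
        exact hk (Fin.ext h2)
      · simp
    · intro i _ hi
      refine Finset.sum_eq_zero fun k _ => ?_
      rw [if_neg, mul_zero]
      rintro ⟨h2, -⟩
      exact hi (congrArg Prod.fst (Z.eq_of_snd_eq h2 ht rfl))
    · simp

theorem colForm_eq_zero_of_mem_left (H : IsAdapted Z f g w e) (hx : ∀ i, i < p → x i = 0)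
    {s : Fin (n + 1)} (hs : (s : ℕ) ≤ p) {y : Fin d → F} (hy : y ∈ f.1 s) :
    colForm e h x y = 0 := by
  rw [colForm_apply]
  refine Finset.sum_eq_zero fun i _ => Finset.sum_eq_zero fun k _ => ?_
  by_cases hi : i < p
  · simp [hx i hi]
  · rw [(H.mem_left s y).mp hy, mul_zero]
    exact hs.trans (Fin.le_def.mp (not_lt.mp hi))

theorem colForm_eq_zero_of_mem_right (H : IsAdapted Z f g w e) {t : Fin (m + 1)}
    (ht : (t : ℕ) ≤ h) {y : Fin d → F} (hy : y ∈ g.1 t) : colForm e h x y = 0 := by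
  rw [colForm_apply]
  refine Finset.sum_eq_zero fun i _ => Finset.sum_eq_zero fun k _ => ?_
  rw [(H.mem_right t y).mp hy _ ht, mul_zero]

/-- Some basis vector in the cell `(p, h)` is not in the kernel of the linear form. -/
theorem exists_mem_colForm_ne_zero (H : IsAdapted Z f g w e) (hp : x p ≠ 0) :
    ∃ u, colForm e h x u ≠ 0 ∧ (∀ s : Fin (n + 1), (p : ℕ) < s → u ∈ f.1 s) ∧
      ∀ t : Fin (m + 1), (h : ℕ) < t → u ∈ g.1 t := by
  obtain ⟨k, hk⟩ := Function.ne_iff.mp hp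
  refine ⟨e ⟨(p, h), k⟩, by rwa [colForm_basis], fun s hs => ?_, fun t ht => ?_⟩
  · rw [H.mem_left]
    intro l hl
    rw [Module.Basis.repr_self, Finsupp.single_apply_eq_zero]
    rintro rfl
    exact absurd hl (not_le.mpr hs)
  · rw [H.mem_right]
    intro l hl
    rw [Module.Basis.repr_self, Finsupp.single_apply_eq_zero]
    rintro rfl
    exact absurd hl (not_le.mpr ht)

open scoped Classical in
theorem finrank_inf_lower (H : IsAdapted Z f g w e) (hp : x p ≠ 0)
    (hx : ∀ i, i < p → x i = 0) (hg : ∀ t, t ≠ h.succ → g'.1 t = g.1 t)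
    (hg' : g'.1 h.succ = g.1 h.succ ⊓ LinearMap.ker (colForm e h x))
    (s : Fin (n + 1)) (t : Fin (m + 1)) :
    Module.finrank F ↥(f.1 s ⊓ g'.1 t) + (if (p : ℕ) < s ∧ t = h.succ then 1 else 0)
      = rectSum Z.mat s t := by
  rw [← H.finrank_inf]
  by_cases ht : t = h.succ
  · subst ht
    rw [hg', ← inf_assoc]
    by_cases hps : (p : ℕ) < s
    · rw [if_pos ⟨hps, rfl⟩]
      obtain ⟨u, h1, h2, h3⟩ := H.exists_mem_colForm_ne_zero hp
      exact finrank_inf_ker_add_one (U := f.1 s ⊓ g.1 h.succ) ⟨h2 s hps, h3 _ (by simp)⟩ h1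
    · rw [if_neg fun h0 => hps h0.1, add_zero, inf_eq_left.mpr]
      intro y hy
      exact H.colForm_eq_zero_of_mem_left hx (not_lt.mp hps) hy.1
  · rw [hg t ht, if_neg fun h0 => ht h0.2, add_zero]

/-- Cutting the step `h` down to the kernel of a linear form cuts `lowerSpan f g I` down to the
kernel if `I` contains `(p, h)` but not `(p, h')`, and changes nothing otherwise; here `p` is the
first row where the form has a nonzero coefficient. -/
theorem mem_lowerSpan_lower (H : IsAdapted Z f g w e) (hh : (h' : ℕ) = h + 1) (hp : x p ≠ 0)
    (hx : ∀ i, i < p → x i = 0) (hg : ∀ t, t ≠ h.succ → g'.1 t = g.1 t)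
    (hg' : g'.1 h.succ = g.1 h.succ ⊓ LinearMap.ker (colForm e h x))
    (I : LowerSet (Fin n × Fin m)) (y : Fin d → F) :
    y ∈ lowerSpan f g' I ↔ y ∈ lowerSpan f g I ∧
      (colForm e h x y = 0 ∨ (p, h) ∉ I ∨ (p, h') ∈ I) := by
  have hle : ∀ t, g'.1 t ≤ g.1 t := fun t => by
    by_cases ht : t = h.succ
    · rw [ht, hg']
      exact inf_le_left
    · rw [hg t ht]
  have hmono : lowerSpan f g' I ≤ lowerSpan f g I :=
    iSup₂_mono fun c _ => inf_le_inf_left _ (hle _)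
  have hcell : ∀ c ∈ I, f.1 c.1.succ ⊓ g'.1 c.2.succ ≤ lowerSpan f g' I := fun c hc =>
    le_iSup₂_of_le (f := fun c (_ : c ∈ I) => f.1 c.1.succ ⊓ g'.1 c.2.succ) c hc le_rfl
  -- a vector of `V_i ∩ V'_h` on which the form vanishes is in the new subspace
  have hker : ∀ c ∈ I, ∀ z ∈ f.1 c.1.succ ⊓ g.1 c.2.succ,
      (c.2 = h → colForm e h x z = 0) → z ∈ lowerSpan f g' I := by
    rintro c hc z ⟨hz1, hz2⟩ hz0
    refine hcell c hc ⟨hz1, ?_⟩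
    by_cases hch : c.2 = h
    · rw [hch, hg']
      rw [hch] at hz2
      exact ⟨hz2, hz0 hch⟩
    · rw [hg _ fun h0 => hch (Fin.succ_injective _ h0)]
      exact hz2
  -- above the row `p` the form vanishes
  have hsmall : ∀ c : Fin n × Fin m, c.1 < p → ∀ z ∈ f.1 c.1.succ ⊓ g.1 c.2.succ,
      colForm e h x z = 0 := by
    rintro c hc z ⟨hz1, -⟩
    exact H.colForm_eq_zero_of_mem_left hx (s := c.1.succ) (by simpa using hc) hz1
  have hkerle : (p, h') ∉ I → lowerSpan f g' I ≤ LinearMap.ker (colForm e h x) := by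
    intro h3
    refine iSup₂_le fun c hc => ?_
    rintro z ⟨hz1, hz2⟩
    rcases lt_trichotomy c.2 h with hch | hch | hch
    · exact H.colForm_eq_zero_of_mem_right (t := c.2.succ) (by simpa using hch) (hle _ hz2)
    · rw [hch, hg'] at hz2
      exact hz2.2
    · refine hsmall c ?_ z ⟨hz1, hle _ hz2⟩
      by_contra hcp
      refine h3 (I.lower (a := c) ⟨not_lt.mp hcp, Fin.le_def.mpr ?_⟩ hc)
      have := Fin.lt_def.mp hch
      simp only
      omega
  obtain ⟨u, hu, huf, hug⟩ := H.exists_mem_colForm_ne_zero hp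
  -- subtracting a multiple of `u` moves any vector into the kernel of the form
  have hsub : ∀ c ∈ I, ∀ z ∈ f.1 c.1.succ ⊓ g.1 c.2.succ,
      z ∈ lowerSpan f g' I ⊔ Submodule.span F {u} := by
    intro c hc z hz
    by_cases hcp : c.2 = h ∧ p ≤ c.1
    · refine Submodule.mem_sup.mpr
        ⟨z - (colForm e h x z / colForm e h x u) • u, hker c hc _ ?_ fun _ => by simp [hu], _,
          Submodule.mem_span_singleton.mpr ⟨colForm e h x z / colForm e h x u, rfl⟩, by simp⟩
      refine Submodule.sub_mem _ hz (Submodule.smul_mem _ _ ⟨huf _ ?_, hug _ ?_⟩)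
      · simpa [Nat.lt_succ_iff] using hcp.2
      · simp [hcp.1]
    · refine Submodule.mem_sup_left (hker c hc z hz fun hch => hsmall c ?_ z hz)
      by_contra hcp'
      exact hcp ⟨hch, not_lt.mp hcp'⟩
  have hsub' : lowerSpan f g I ≤ lowerSpan f g' I ⊔ Submodule.span F {u} :=
    iSup₂_le fun c hc z hz => hsub c hc z hz
  constructor
  · intro hy
    refine ⟨hmono hy, ?_⟩
    by_contra! hcon
    obtain ⟨h1, -, h3⟩ := hcon
    exact h1 (hkerle h3 hy)
  · rintro ⟨hy, hcase⟩
    by_cases hpI : (p, h) ∈ I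
    · by_cases hpI' : (p, h') ∈ I
      · have hu' : u ∈ lowerSpan f g' I := by
          refine hker (p, h') hpI' u ⟨huf _ (by simp), hug _ (by simp [hh])⟩ ?_
          intro h0
          simp only at h0
          rw [h0] at hh
          omega
        have := hsub' hy
        rwa [sup_eq_left.mpr (by simpa using hu')] at this
      · have h0 : colForm e h x y = 0 := by
          rcases hcase with h1 | h1 | h1
          · exact h1
          · exact absurd hpI h1
          · exact absurd h1 hpI'
        obtain ⟨z, hz, z', hz', rfl⟩ := Submodule.mem_sup.mp (hsub' hy)
        obtain ⟨a, rfl⟩ := Submodule.mem_span_singleton.mp hz'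
        have hz0 : colForm e h x z = 0 := hkerle hpI' hz
        rw [map_add, hz0, zero_add, map_smul, smul_eq_mul] at h0
        rw [(mul_eq_zero.mp h0).resolve_right hu]
        simpa using hz
    · refine (iSup₂_le fun c hc z hz => hker c hc z hz fun hch => hsmall c ?_ z hz :
        lowerSpan f g I ≤ _) hy
      by_contra hcp
      exact hpI (I.lower (a := c) ⟨not_lt.mp hcp, hch.ge⟩ hc)

/-- The vector `w` is affected only if the form does not vanish on it; then it generates the cell
`(p, h')` besides its former ones. -/
theorem vec_mem_lowerSpan_lower (H : IsAdapted Z f g w e) (hh : (h' : ℕ) = h + 1) (hp : x p ≠ 0)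
    (hx : ∀ i, i < p → x i = 0) (hg : ∀ t, t ≠ h.succ → g'.1 t = g.1 t)
    (hg' : g'.1 h.succ = g.1 h.succ ⊓ LinearMap.ker (colForm e h x))
    (I : LowerSet (Fin n × Fin m)) :
    w ∈ lowerSpan f g' I ↔ lowerClosure (lowerDec Z h h' p x) ≤ I := by
  classical
  rw [H.mem_lowerSpan_lower hh hp hx hg hg', H.vec_mem_lowerSpan]
  unfold lowerDec
  split_ifs with h1
  · have h2 : colForm e h x w ≠ 0 := H.colForm_vec_ne_zero_iff.mpr h1
    obtain ⟨t, ht, h3⟩ := h1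
    rw [lowerClosure_le, lowerClosure_le, Set.insert_subset_iff]
    constructor
    · rintro ⟨h4, h5 | h5 | h5⟩
      · exact absurd h5 h2
      · have hpt : p ≤ t := by
          by_contra h6
          exact h3 (by rw [hx t (not_le.mp h6)]; rfl)
        have hle : (p, h) ≤ (t, h) := ⟨hpt, le_rfl⟩
        exact absurd (I.lower hle (h4 ht)) h5
      · exact ⟨h5, h4⟩
    · rintro ⟨h4, h5⟩
      exact ⟨h5, .inr (.inr h4)⟩
  · have h2 : colForm e h x w = 0 := by
      by_contra h0
      exact h1 (H.colForm_vec_ne_zero_iff.mp h0)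
    simp [h2]

/-- The orbit of the triple after the step `h` of the second flag has been cut down to a hyperplane:
one unit moves from the column `h` to the column `h'` in the row `p`. -/
theorem inOrbit_lower (H : IsAdapted Z f g w e) (hh : (h' : ℕ) = h + 1) (hp : x p ≠ 0)
    (hx : ∀ i, i < p → x i = 0) (hg : ∀ t, t ≠ h.succ → g'.1 t = g.1 t)
    (hg' : g'.1 h.succ = g.1 h.succ ⊓ LinearMap.ker (colForm e h x)) :
    InOrbit X f g' w ↔
      X.mat + Matrix.single p h 1 = Z.mat + Matrix.single p h' 1 ∧
      lowerClosure (X.dec : Set (Fin n × Fin m)) = lowerClosure (lowerDec Z h h' p x) := by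
  classical
  have hfin := H.finrank_inf_lower hp hx hg hg'
  rw [inOrbit_iff]
  refine and_congr ?_ ?_
  · have key : ∀ s t : ℕ, rectSum (Matrix.single p h 1 : Matrix (Fin n) (Fin m) ℕ) s t
        = (if (p : ℕ) < s ∧ t = h + 1 then 1 else 0)
          + rectSum (Matrix.single p h' 1 : Matrix (Fin n) (Fin m) ℕ) s t := by
      intro s t
      rw [rectSum_single, rectSum_single]
      split_ifs <;> omega
    have hval : ∀ t : Fin (m + 1), t = h.succ ↔ (t : ℕ) = h + 1 := fun t => by
      rw [Fin.ext_iff, Fin.val_succ]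
    simp only [hval] at hfin
    constructor
    · intro h1
      refine eq_of_rectSum_eq fun s hs t ht => ?_
      have h2 := h1 ⟨s, Nat.lt_succ_of_le hs⟩ ⟨t, Nat.lt_succ_of_le ht⟩
      have h3 := hfin ⟨s, Nat.lt_succ_of_le hs⟩ ⟨t, Nat.lt_succ_of_le ht⟩
      rw [h2] at h3
      rw [rectSum_add, rectSum_add, key, ← add_assoc]
      simp only at h3
      rw [h3]
    · intro h1 s t
      have h2 := hfin s t
      have h3 := key s t
      have h4 : rectSum (X.mat + Matrix.single p h 1) s t
        = rectSum (Z.mat + Matrix.single p h' 1) s t := by rw [h1]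
      rw [rectSum_add, rectSum_add] at h4
      omega
  · simp only [H.vec_mem_lowerSpan_lower hh hp hx hg hg']
    constructor
    · intro h1
      exact le_antisymm ((h1 _).mp le_rfl) ((h1 _).mpr le_rfl)
    · intro h1 I
      rw [h1]

end IsAdapted

/-! ### Moving the vector by the first step of a flag -/

namespace IsAdapted

variable {F : Type*} [Field F] {n m d : ℕ} {X Z : DecMat n m d}
  {f : PFlag F d n} {g : PFlag F d m} {w u : Fin d → F}
  {e : Module.Basis (Σ c : Fin n × Fin m, Fin (Z.mat c.1 c.2)) F (Fin d → F)} {c : Fin m}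

/-- The orbit of `(f, g, u)` for a vector `u` that agrees with `w` outside the coordinates of the
column `c`. -/
theorem inOrbit_shift (H : IsAdapted Z f g w e)
    (hu : ∀ k, k.1.2 ≠ c → e.repr u k = e.repr w k) :
    InOrbit X f g u ↔ X.mat = Z.mat ∧
      lowerClosure (X.dec : Set (Fin n × Fin m)) = lowerClosure
        {q | q ∈ Z.dec ∧ q.2 ≠ c ∨ q.2 = c ∧ (fun k => e.repr u ⟨(q.1, c), k⟩) ≠ 0} := by
  classical
  rw [inOrbit_iff]
  refine and_congr ?_ ?_
  · simp only [H.finrank_inf]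
    constructor
    · intro h
      exact (eq_of_rectSum_eq fun s hs t ht =>
        h ⟨s, Nat.lt_succ_of_le hs⟩ ⟨t, Nat.lt_succ_of_le ht⟩).symm
    · intro h s t
      rw [h]
  · have key : ∀ I, u ∈ lowerSpan f g I ↔ lowerClosure
        {q | q ∈ Z.dec ∧ q.2 ≠ c ∨ q.2 = c ∧ (fun k => e.repr u ⟨(q.1, c), k⟩) ≠ 0} ≤ I := by
      intro I
      rw [H.mem_lowerSpan, lowerClosure_le]
      constructor
      · rintro h ⟨i, j⟩ (⟨h1, h2⟩ | ⟨h1, h2⟩)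
        · by_contra hI
          have := h ⟨(i, j), ⟨0, Z.isDec.pos _ h1⟩⟩ hI
          rw [hu _ h2, H.repr_vec, if_pos ⟨h1, rfl⟩] at this
          exact one_ne_zero this
        · simp only at h1
          subst h1
          obtain ⟨k, hk⟩ := Function.ne_iff.mp h2
          by_contra hI
          exact hk (h ⟨(i, j), k⟩ hI)
      · rintro h ⟨⟨i, j⟩, k⟩ hI
        by_cases hj : j = c
        · subst hj
          by_contra h1
          exact hI (h (.inr ⟨rfl, fun h2 => h1 (congrFun h2 k)⟩))
        · rw [hu _ hj, H.repr_vec, if_neg]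
          rintro ⟨h1, -⟩
          exact hI (h (.inl ⟨h1, hj⟩))
    simp only [key]
    constructor
    · intro h1
      exact le_antisymm ((h1 _).mp le_rfl) ((h1 _).mpr le_rfl)
    · intro h1 I
      rw [h1]

end IsAdapted

/-! ### Decorations generating a given lower set -/

theorem DecMat.lowerClosure_dec_eq_iff {n m d : ℕ} {X Y : DecMat n m d} :
    lowerClosure (X.dec : Set (Fin n × Fin m)) = lowerClosure (Y.dec : Set (Fin n × Fin m)) ↔
      X.dec = Y.dec :=
  ⟨DecMat.dec_eq_of_lowerClosure_eq, fun h => by rw [h]⟩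

/-- A decoration consists of the maximal elements of the lower set it generates, which belong to
every set of generators. -/
theorem DecMat.dec_subset_of_lowerClosure_eq {n m d : ℕ} (X : DecMat n m d)
    {S : Set (Fin n × Fin m)}
    (h : lowerClosure (X.dec : Set (Fin n × Fin m)) = lowerClosure S) :
    (X.dec : Set (Fin n × Fin m)) ⊆ S := by
  intro x hx
  obtain ⟨y, hy, hxy⟩ := mem_lowerClosure.mp (h ▸ subset_lowerClosure hx : x ∈ lowerClosure S)
  obtain ⟨z, hz, hyz⟩ := mem_lowerClosure.mp
    (h ▸ subset_lowerClosure hy : y ∈ lowerClosure (X.dec : Set (Fin n × Fin m)))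
  have : x = z := X.isAntichain.eq hx hz (hxy.trans hyz)
  subst this
  rwa [le_antisymm hxy hyz]

/-- If the decoration of `Z` without the column `c`, together with the cells of the rows `P` in the
first column `c`, generates the same lower set as the decoration of `X`, the two decorations agree
outside the column `c`; the remaining freedom is described row by row. -/
theorem lowerClosure_corner_iff {n m d : ℕ} (X Z : DecMat n m d) {c : Fin m} (hc : (c : ℕ) = 0)
    (P : Fin n → Prop) :
    lowerClosure (X.dec : Set (Fin n × Fin m))
        = lowerClosure {q | q ∈ Z.dec ∧ q.2 ≠ c ∨ q.2 = c ∧ P q.1} ↔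
      X.dec.filter (·.2 ≠ c) = Z.dec.filter (·.2 ≠ c) ∧
      ∀ i, ((i, c) ∈ X.dec → P i) ∧
        ((i, c) ∉ lowerClosure (X.dec : Set (Fin n × Fin m)) → ¬ P i) := by
  constructor
  · intro h
    have hsub := X.dec_subset_of_lowerClosure_eq h
    refine ⟨?_, fun i => ⟨fun hi => ?_, fun hi hP => hi ?_⟩⟩
    · ext q
      simp only [Finset.mem_filter]
      refine and_congr_left fun hq => ⟨fun hqX => ?_, fun hqZ => ?_⟩
      · exact (hsub hqX).elim (fun h1 => h1.1) (fun h1 => absurd h1.1 hq)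
      · obtain ⟨r, hr, hqr⟩ := mem_lowerClosure.mp (h ▸ subset_lowerClosure (.inl ⟨hqZ, hq⟩) :
          q ∈ lowerClosure (X.dec : Set (Fin n × Fin m)))
        rcases hsub hr with h1 | h1
        · rwa [Z.isAntichain.eq hqZ h1.1 hqr]
        · refine absurd (Fin.ext ?_) hq
          have h2 := Fin.le_def.mp hqr.2
          rw [h1.1] at h2
          omega
    · exact (hsub hi).elim (fun h1 => absurd rfl h1.2) (fun h1 => h1.2)
    · rw [h]
      exact subset_lowerClosure (.inr ⟨rfl, hP⟩)
  · rintro ⟨h1, h2⟩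
    have h1' : ∀ q : Fin n × Fin m, q.2 ≠ c → (q ∈ X.dec ↔ q ∈ Z.dec) := fun q hq => by
      have := Finset.ext_iff.mp h1 q
      simpa [hq] using this
    apply le_antisymm <;> rw [lowerClosure_le]
    · rintro ⟨i, j⟩ hq
      apply subset_lowerClosure
      by_cases hj : j = c
      · subst hj
        exact .inr ⟨rfl, (h2 i).1 hq⟩
      · exact .inl ⟨(h1' _ hj).mp hq, hj⟩
    · rintro ⟨i, j⟩ (⟨hq, hj⟩ | ⟨hj, hP⟩)
      · exact subset_lowerClosure ((h1' _ hj).mpr hq)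
      · simp only at hj
        subst hj
        by_contra h3
        exact (h2 i).2 h3 hP

open scoped Classical in
/-- The relation between the decoration `Δ` of a factor and the decoration `Δ'` of a term of its
product with `E_h`, when the two are different; here `p` is the row of the moved entry. -/
def RaiseRel {n m : ℕ} (h h' : Fin m) (p : Fin n) (Δ Δ' : Finset (Fin n × Fin m)) : Prop :=
  (p, h) ∈ lowerClosure (Δ : Set (Fin n × Fin m)) ∧
  (p, h') ∉ lowerClosure (Δ : Set (Fin n × Fin m)) ∧
  Δ' = insert (p, h') ((Δ.filter (·.2 ≠ h')).erase (p, h))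

/-- If the decoration of `Z`, with `(p, h')` replaced by `(p, h)` and the cells of the rows `P`
above `p` in the column `h'`, generates the same lower set as the decoration of `X`, the two
decorations determine each other outside the column `h'`; the remaining freedom is described row by
row. -/
theorem lowerClosure_raise_iff {n m d : ℕ} (X Z : DecMat n m d) {h h' : Fin m}
    (hh : (h' : ℕ) = h + 1) {p : Fin n} (hp : (p, h') ∈ Z.dec) (P : Fin n → Prop) :
    lowerClosure (X.dec : Set (Fin n × Fin m)) = lowerClosure
        {q | q ∈ Z.dec ∧ q ≠ (p, h') ∨ q = (p, h) ∨ q.2 = h' ∧ q.1 < p ∧ P q.1} ↔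
      RaiseRel h h' p X.dec Z.dec ∧ ∀ i < p, ((i, h') ∈ X.dec → P i) ∧
        ((i, h') ∉ lowerClosure (X.dec : Set (Fin n × Fin m)) → ¬ P i) := by
  classical
  have hlt : h < h' := Fin.lt_def.mpr (by omega)
  have hle : (p, h) ≤ (p, h') := ⟨le_rfl, hlt.le⟩
  constructor
  · intro H
    have hsub := X.dec_subset_of_lowerClosure_eq H
    have hsup : ∀ q, (q ∈ Z.dec ∧ q ≠ (p, h') ∨ q = (p, h) ∨ q.2 = h' ∧ q.1 < p ∧ P q.1) →
        q ∈ lowerClosure (X.dec : Set (Fin n × Fin m)) := fun q hq => by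
      rw [H]
      exact subset_lowerClosure hq
    -- none of the generators lies above `(p, h')`
    have hmax : ∀ q, (p, h') ≤ q →
        ¬ (q ∈ Z.dec ∧ q ≠ (p, h') ∨ q = (p, h) ∨ q.2 = h' ∧ q.1 < p ∧ P q.1) := by
      rintro q hq (⟨h1, h2⟩ | rfl | ⟨-, h2, -⟩)
      · exact h2 (Z.isAntichain.eq hp h1 hq).symm
      · exact absurd hq.2 (not_le.mpr hlt)
      · exact absurd hq.1 (not_le.mpr h2)
    refine ⟨⟨hsup _ (.inr (.inl rfl)), ?_, ?_⟩, fun i hi => ⟨fun h1 => ?_, fun h1 h2 => ?_⟩⟩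
    · rw [H]
      intro h1
      obtain ⟨q, hq, hpq⟩ := mem_lowerClosure.mp h1
      exact hmax q hpq hq
    · ext q
      simp only [Finset.mem_insert, Finset.mem_erase, Finset.mem_filter]
      constructor
      · intro hq
        by_cases hqp : q = (p, h')
        · exact .inl hqp
        · have hnle : ∀ r, r ≤ (p, h') → ¬ q ≤ r := fun r hr hqr =>
            hqp (Z.isAntichain.eq hq hp (hqr.trans hr))
          obtain ⟨r, hr, hqr⟩ := mem_lowerClosure.mp (hsup q (.inl ⟨hq, hqp⟩))
          refine .inr ⟨fun h1 => hnle _ hle h1.le, ?_, ?_⟩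
          · rcases hsub hr with ⟨h1, -⟩ | h1 | ⟨h1, h2, -⟩
            · rwa [Z.isAntichain.eq hq h1 hqr]
            · exact absurd hqr (hnle r (h1.le.trans hle))
            · exact absurd hqr (hnle r ⟨h2.le, h1.le⟩)
          · exact fun h1 => hqp (Z.eq_of_snd_eq hq hp h1)
      · rintro (rfl | ⟨h1, h2, h3⟩)
        · exact hp
        · rcases hsub h2 with h4 | h4 | h4
          · exact h4.1
          · exact absurd h4 h1
          · exact absurd h4.1 h3
    · rcases hsub h1 with ⟨h4, h5⟩ | h4 | h4
      · exact absurd (Z.eq_of_snd_eq h4 hp rfl) h5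
      · exact absurd (congrArg Prod.snd h4) hlt.ne'
      · exact h4.2.2
    · exact h1 (hsup _ (.inr (.inr ⟨rfl, hi, h2⟩)))
  · rintro ⟨⟨h1, h2, h3⟩, h4⟩
    have h3' : ∀ q, q ∈ Z.dec ↔ q = (p, h') ∨ q ≠ (p, h) ∧ q ∈ X.dec ∧ q.2 ≠ h' := fun q => by
      rw [h3]
      simp only [Finset.mem_insert, Finset.mem_erase, Finset.mem_filter]
    apply le_antisymm <;> rw [lowerClosure_le]
    · rintro ⟨i, j⟩ hq
      apply subset_lowerClosure
      by_cases hj : j = h'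
      · subst hj
        have hip : i < p := by
          by_contra h0
          exact h2 (mem_lowerClosure.mpr ⟨_, hq, ⟨not_lt.mp h0, le_rfl⟩⟩)
        exact .inr (.inr ⟨rfl, hip, (h4 i hip).1 hq⟩)
      · by_cases hqp : (i, j) = (p, h)
        · exact .inr (.inl hqp)
        · exact .inl ⟨(h3' _).mpr (.inr ⟨hqp, hq, hj⟩), fun h0 => hj (congrArg Prod.snd h0)⟩
    · rintro ⟨i, j⟩ (⟨hq, hne⟩ | hq | ⟨hj, hip, hP⟩)
      · exact subset_lowerClosure (((h3' _).mp hq).resolve_left hne).2.1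
      · rw [hq]
        exact h1
      · simp only at hj hip hP
        subst hj
        by_contra h5
        exact (h4 i hip).2 h5 hP

/-! ### Counting coordinate vectors -/

section Counting

theorem ncard_setOf_eq_card_filter {α : Type*} [Fintype α] (P : α → Prop) [DecidablePred P] :
    {x | P x}.ncard = (Finset.univ.filter P).card := by
  rw [← Set.ncard_coe_finset]
  congr 1
  ext
  simp

theorem ncard_setOf_forall {n : ℕ} {α : Fin n → Type*} [∀ i, Fintype (α i)]
    (P : ∀ i, α i → Prop) :
    {x : ∀ i, α i | ∀ i, P i (x i)}.ncard = ∏ i, {v | P i v}.ncard := by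
  classical
  simp only [ncard_setOf_eq_card_filter]
  rw [← Fintype.card_piFinset]
  congr 1
  ext x
  simp

open scoped Classical in
/-- A nonempty subset of a finite linear order has exactly one last element. -/
theorem sum_last_eq {ι : Type*} [LinearOrder ι] [Fintype ι] (P : ι → Prop) :
    (∑ p, if P p ∧ ∀ i, p < i → ¬ P i then 1 else 0) = if ∃ i, P i then 1 else 0 := by
  split_ifs with h
  · obtain ⟨i, hi⟩ := h
    have hne : (Finset.univ.filter P).Nonempty := ⟨i, by simpa using hi⟩
    have h1 : P ((Finset.univ.filter P).max' hne) := by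
      simpa using Finset.max'_mem _ hne
    rw [Finset.sum_eq_single ((Finset.univ.filter P).max' hne)]
    · rw [if_pos]
      refine ⟨h1, fun j hj hPj => ?_⟩
      exact absurd hj (not_lt.mpr (Finset.le_max' _ _ (by simpa using hPj)))
    · intro j _ hj
      rw [if_neg]
      rintro ⟨h2, h3⟩
      have : j < (Finset.univ.filter P).max' hne :=
        lt_of_le_of_ne (Finset.le_max' _ _ (by simpa using h2)) hj
      exact h3 _ this h1
    · simp
  · refine Finset.sum_eq_zero fun p _ => if_neg fun h1 => h ⟨p, h1.1⟩

theorem ncard_exists_and {ι α : Type*} [LinearOrder ι] [Fintype ι] [Fintype α]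
    (P : α → ι → Prop) (C : α → Prop) :
    {x | (∃ i, P x i) ∧ C x}.ncard
      = ∑ p, {x | (P x p ∧ ∀ i, p < i → ¬ P x i) ∧ C x}.ncard := by
  classical
  simp only [ncard_setOf_eq_card_filter, Finset.card_filter]
  rw [Finset.sum_comm]
  refine Finset.sum_congr rfl fun x _ => ?_
  by_cases hC : C x
  · simp only [hC, and_true]
    convert (sum_last_eq (P x)).symm
  · simp [hC]

theorem ncard_eq_mul_of_fibers {α β : Type*} [Finite α] [Finite β] {φ : α → β} {A : Set α}
    {S : Set β} {k : ℕ} (h1 : ∀ x ∈ A, φ x ∈ S) (h2 : ∀ s ∈ S, {x | x ∈ A ∧ φ x = s}.ncard = k) :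
    A.ncard = S.ncard * k := by
  classical
  have := Fintype.ofFinite α
  have := Fintype.ofFinite β
  have hA : A.ncard = (Finset.univ.filter (· ∈ A)).card := ncard_setOf_eq_card_filter (· ∈ A)
  have hS : S.ncard = (Finset.univ.filter (· ∈ S)).card := ncard_setOf_eq_card_filter (· ∈ S)
  rw [hA, hS, ← smul_eq_mul, ← Finset.sum_const, Finset.card_eq_sum_card_fiberwise (f := φ)
    (t := Finset.univ.filter (· ∈ S)) (fun x hx => by simpa using h1 x (by simpa using hx))]
  refine Finset.sum_congr rfl fun s hs => ?_
  rw [← h2 s (by simpa using hs), ncard_setOf_eq_card_filter, Finset.filter_filter]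

/-- Vectors with prescribed entries: `R` in the row `p`, `Q` in the rows `T`, zero elsewhere. -/
theorem ncard_box {n : ℕ} {α : Fin n → Type*} [∀ i, Fintype (α i)] [∀ i, Zero (α i)]
    (p : Fin n) (T : Finset (Fin n)) (hpT : p ∉ T) (R Q : ∀ i, α i → Prop) :
    {x : ∀ i, α i | R p (x p) ∧ (∀ i ∈ T, Q i (x i)) ∧ ∀ i, i ≠ p → i ∉ T → x i = 0}.ncard
      = (∏ i ∈ T, {v | Q i v}.ncard) * {v | R p v}.ncard := by
  classical
  have h := ncard_setOf_forall (α := α) fun i v =>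
    if i = p then R i v else if i ∈ T then Q i v else v = 0
  have h1 : {x : ∀ i, α i | R p (x p) ∧ (∀ i ∈ T, Q i (x i)) ∧ ∀ i, i ≠ p → i ∉ T → x i = 0}
      = {x : ∀ i, α i | ∀ i, if i = p then R i (x i) else if i ∈ T then Q i (x i) else x i = 0} := by
    ext x
    simp only [Set.mem_ofPred_eq]
    constructor
    · rintro ⟨h1, h2, h3⟩ i
      split_ifs with h4 h5
      · exact h4 ▸ h1
      · exact h2 i h5
      · exact h3 i h4 h5
    · intro h1
      refine ⟨by simpa using h1 p, fun i hi => ?_, fun i h2 h3 => ?_⟩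
      · have := h1 i
        have hip : i ≠ p := fun h0 => hpT (h0 ▸ hi)
        rwa [if_neg hip, if_pos hi] at this
      · have := h1 i
        rwa [if_neg h2, if_neg h3] at this
  rw [h1, h, ← Finset.prod_subset (Finset.subset_univ (insert p T)), Finset.prod_insert hpT,
    mul_comm]
  · congr 1
    · refine Finset.prod_congr rfl fun i hi => ?_
      have hip : i ≠ p := fun h0 => hpT (h0 ▸ hi)
      simp only [if_neg hip, if_pos hi]
    · simp only [if_true]
  · intro i _ hi
    rw [Finset.mem_insert, not_or] at hi
    simp [hi.1, hi.2]

variable (F : Type*) [Field F] [Fintype F]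

theorem ncard_ne_zero_fun (z : ℕ) :
    ({v : Fin z → F | v ≠ 0}.ncard : ℤ) = (Fintype.card F : ℤ) ^ z - 1 := by
  classical
  rw [ncard_setOf_eq_card_filter, Finset.filter_ne', Finset.card_erase_of_mem (Finset.mem_univ _),
    Nat.cast_sub (Finset.card_pos.mpr ⟨0, Finset.mem_univ _⟩), Finset.card_univ, Fintype.card_fun,
    Fintype.card_fin]
  simp

theorem ncard_ne_zero_field :
    ({a : F | a ≠ 0}.ncard : ℤ) = (Fintype.card F : ℤ) - 1 := by
  classical
  rw [ncard_setOf_eq_card_filter, Finset.filter_ne', Finset.card_erase_of_mem (Finset.mem_univ _),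
    Nat.cast_sub (Finset.card_pos.mpr ⟨0, Finset.mem_univ _⟩), Finset.card_univ]
  simp

theorem ncard_first_line {z : ℕ} (hz : 0 < z) :
    ({v : Fin z → F | v ≠ 0 ∧ ∀ k : Fin z, (k : ℕ) ≠ 0 → v k = 0}.ncard : ℤ)
      = (Fintype.card F : ℤ) - 1 := by
  classical
  rw [← ncard_ne_zero_field, ncard_setOf_eq_card_filter, ncard_setOf_eq_card_filter]
  congr 1
  refine Finset.card_bij (fun v _ => v ⟨0, hz⟩) ?_ ?_ ?_
  · intro v hv
    simp only [Finset.mem_filter, Finset.mem_univ, true_and] at hv ⊢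
    intro h0
    refine hv.1 (funext fun k => ?_)
    by_cases hk : (k : ℕ) = 0
    · rw [show k = ⟨0, hz⟩ from Fin.ext hk, h0]
      rfl
    · exact hv.2 k hk
  · intro v hv v' hv' h0
    simp only [Finset.mem_filter, Finset.mem_univ, true_and] at hv hv'
    funext k
    by_cases hk : (k : ℕ) = 0
    · rw [show k = ⟨0, hz⟩ from Fin.ext hk, h0]
    · rw [hv.2 k hk, hv'.2 k hk]
  · intro a ha
    simp only [Finset.mem_filter, Finset.mem_univ, true_and] at ha
    refine ⟨Pi.single ⟨0, hz⟩ a, ?_, by simp⟩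
    simp only [Finset.mem_filter, Finset.mem_univ, true_and]
    refine ⟨by simpa using ha, fun k hk => ?_⟩
    rw [Pi.single_eq_of_ne]
    rintro rfl
    exact hk rfl

theorem ncard_first_ne_zero {z : ℕ} (hz : 0 < z) :
    ({v : Fin z → F | v ⟨0, hz⟩ ≠ 0}.ncard : ℤ)
      = ((Fintype.card F : ℤ) - 1) * (Fintype.card F : ℤ) ^ (z - 1) := by
  obtain ⟨z, rfl⟩ : ∃ k, z = k + 1 := ⟨z - 1, by omega⟩
  have h := ncard_setOf_forall (n := z + 1) (α := fun _ => F) fun i a => i = 0 → a ≠ 0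
  have h1 : {v : Fin (z + 1) → F | v ⟨0, hz⟩ ≠ 0} = {v | ∀ i, i = 0 → v i ≠ 0} := by
    ext v
    simp only [Set.mem_ofPred_eq, forall_eq]
    rfl
  rw [h1, h, Fin.prod_univ_succ, Nat.cast_mul]
  congr 1
  · simp only [forall_true_left]
    exact ncard_ne_zero_field F
  · simp [Fin.succ_ne_zero, Set.ncard_univ]

end Counting

/-! ### Lines and hyperplanes between two steps of a flag -/

/-- A step of a flag may be replaced by any subspace between its two neighbours. -/
theorem exists_flag_update {F : Type*} [Field F] {m d : ℕ} (g : PFlag F d m) {h h' : Fin m}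
    (hh : (h' : ℕ) = h + 1) {W : Submodule F (Fin d → F)} (h1 : g.1 h.castSucc ≤ W)
    (h2 : W ≤ g.1 h'.succ) :
    ∃ g' : PFlag F d m, (∀ t, t ≠ h.succ → g'.1 t = g.1 t) ∧ g'.1 h.succ = W := by
  classical
  have hs : ∀ t, t < h.succ → g.1 t ≤ W := fun t ht => (g.2.1 (Fin.le_def.mpr (by
    have := Fin.lt_def.mp ht
    simp only [Fin.val_succ, Fin.val_castSucc] at this ⊢
    omega))).trans h1
  have hl : ∀ t, h.succ < t → W ≤ g.1 t := fun t ht => h2.trans (g.2.1 (Fin.le_def.mpr (by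
    have := Fin.lt_def.mp ht
    simp only [Fin.val_succ] at this ⊢
    omega)))
  have hlast : Fin.last m ≠ h.succ := fun h0 => by
    have := congrArg Fin.val h0
    have := h'.2
    simp at *
    omega
  refine ⟨⟨Function.update g.1 h.succ W, ?_, ?_, ?_⟩, fun t ht => Function.update_of_ne ht _ _,
    Function.update_self _ _ _⟩
  · intro s t hst
    by_cases hs' : s = h.succ <;> by_cases ht' : t = h.succ
    · rw [hs', ht']
    · subst hs'
      rw [Function.update_self, Function.update_of_ne ht']
      exact hl t (lt_of_le_of_ne hst (Ne.symm ht'))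
    · subst ht'
      rw [Function.update_self, Function.update_of_ne hs']
      exact hs s (lt_of_le_of_ne hst hs')
    · rw [Function.update_of_ne hs', Function.update_of_ne ht']
      exact g.2.1 hst
  · rw [Function.update_of_ne (Fin.succ_ne_zero h).symm]
    exact g.2.2.1
  · rw [Function.update_of_ne hlast]
    exact g.2.2.2

section

variable {F : Type*} [Field F] {n m d : ℕ} {X Z : DecMat n m d}
  {f : PFlag F d n} {g : PFlag F d m} {w : Fin d → F}
  {e : Module.Basis (Σ c : Fin n × Fin m, Fin (Z.mat c.1 c.2)) F (Fin d → F)} {h h' : Fin m}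

theorem IsAdapted.colVec_mem_right (H : IsAdapted Z f g w e) (x : ∀ i : Fin n, Fin (Z.mat i h) → F)
    {t : Fin (m + 1)} (ht : (h : ℕ) < t) : colVec e h x ∈ g.1 t := by
  rw [H.mem_right]
  intro k hk
  refine repr_colVec_of_ne _ _ _ _ fun h0 => ?_
  rw [h0] at hk
  omega

/-- The coordinate vectors `x ≠ 0` spanning a given line of `V'_{h'} / V'_h` form a punctured
line. -/
theorem IsAdapted.ncard_raise_fiber [Finite F] (H : IsAdapted Z f g w e) (hh : (h' : ℕ) = h + 1)
    {W : Submodule F (Fin d → F)} (h1 : g.1 h.succ ≤ W) (h2 : W ≤ g.1 h'.succ)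
    (h3 : Module.finrank F W = Module.finrank F ↥(g.1 h.succ) + 1) :
    {x : ∀ i : Fin n, Fin (Z.mat i h') → F | (∃ i, x i ≠ 0) ∧
      g.1 h.succ ⊔ Submodule.span F {colVec e h' x} = W}.ncard = {a : F | a ≠ 0}.ncard := by
  have hlt : (h : ℕ) < h' := by omega
  obtain ⟨y, hyW, hyg⟩ := SetLike.not_le_iff_exists.mp (fun h0 : W ≤ g.1 h.succ => by
    have := Submodule.finrank_mono h0
    omega)
  -- the coordinates of `y` in the column `h'`, which determine it modulo `V'_h`
  let x0 : ∀ i : Fin n, Fin (Z.mat i h') → F := fun i k => e.repr y ⟨(i, h'), k⟩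
  have hy : y - colVec e h' x0 ∈ g.1 h.succ := by
    rw [H.mem_right]
    rintro ⟨⟨i, j⟩, k⟩ hk
    rw [map_sub, Finsupp.sub_apply]
    by_cases hj : j = h'
    · subst hj
      rw [repr_colVec, sub_self]
    · rw [repr_colVec_of_ne _ _ _ _ hj, sub_zero]
      refine (H.mem_right _ _).mp (h2 hyW) _ ?_
      have hj' : (j : ℕ) ≠ h' := fun h0 => hj (Fin.ext h0)
      simp only [Fin.val_succ] at hk ⊢
      omega
  have hxW : colVec e h' x0 ∈ W := by
    have := W.sub_mem hyW (h1 hy)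
    simpa using this
  have hxg : colVec e h' x0 ∉ g.1 h.succ := fun h0 => hyg (by
    have := (g.1 h.succ).add_mem hy h0
    simpa using this)
  have hW : g.1 h.succ ⊔ Submodule.span F {colVec e h' x0} = W := by
    refine Submodule.eq_of_le_of_finrank_eq (sup_le h1 (by simpa using hxW)) ?_
    rw [Submodule.finrank_sup_span_singleton hxg, h3]
  have hx0 : x0 ≠ 0 := by
    intro h0
    apply hxg
    rw [h0, show (0 : ∀ i : Fin n, Fin (Z.mat i h') → F) = (0 : F) • x0 by simp, colVec_smul]
    simp
  symm
  refine Set.ncard_congr (fun a _ => a • x0) ?_ ?_ ?_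
  · intro a ha
    refine ⟨Function.ne_iff.mp (smul_ne_zero ha hx0), ?_⟩
    rw [colVec_smul, Submodule.span_singleton_smul_eq (IsUnit.mk0 a ha), hW]
  · intro a b _ _ hab
    exact smul_left_injective F hx0 hab
  · rintro x ⟨⟨i, hi⟩, hx⟩
    have h4 : colVec e h' x ∈ g.1 h.succ ⊔ Submodule.span F {colVec e h' x0} := by
      rw [hW, ← hx]
      exact Submodule.mem_sup_right (Submodule.mem_span_singleton_self _)
    obtain ⟨z, hz, z', hz', h5⟩ := Submodule.mem_sup.mp h4
    obtain ⟨a, rfl⟩ := Submodule.mem_span_singleton.mp hz'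
    have h6 : x = a • x0 := by
      funext i k
      rw [← repr_colVec e h' x i k, ← h5, map_add, Finsupp.add_apply,
        (H.mem_right _ _).mp hz _ (by simpa using hlt), zero_add, map_smul, Finsupp.smul_apply,
        repr_colVec]
      rfl
    refine ⟨a, ?_, h6.symm⟩
    rintro rfl
    exact hi (by rw [h6]; simp)

theorem finrank_right_of_inOrbit (H : InOrbit Z f g w) (t : Fin (m + 1)) :
    Module.finrank F ↥(g.1 t) = rectSum Z.mat n t := by
  obtain ⟨e, H⟩ := inOrbit_iff_exists_isAdapted.mp H
  have := H.finrank_inf (Fin.last n) t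
  rwa [f.2.2.2, top_inf_eq] at this

/-- The matrices `B` and `A` have the same column sums, expressed by the partial sums over the first
`t` columns. -/
def SameCols {k l n m : ℕ} (B : Matrix (Fin k) (Fin m) ℕ) (A : Matrix (Fin n) (Fin l) ℕ) : Prop :=
  ∀ t ≤ m, rectSum B k t = rectSum A n t

theorem finrank_right_eq_iff (H : InOrbit Z f g w) (Y : DecMat m m d) :
    (∀ t : Fin (m + 1), Module.finrank F ↥(g.1 t) = rectSum Y.mat m t) ↔
      SameCols Y.mat Z.mat := by
  simp only [finrank_right_of_inOrbit H]
  exact ⟨fun h0 t ht => (h0 ⟨t, Nat.lt_succ_of_le ht⟩).symm,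
    fun h0 t => (h0 t (Nat.lt_succ_iff.mp t.2)).symm⟩

theorem convCount_eq_zero {Y : DecMat m m d} (h0 : ∀ g' u, ¬ InOrbit Y g' g u) :
    convCount X Y f g w = 0 := by
  unfold convCount
  simp [h0]

theorem convCount_eq_ncard {Y : DecMat m m d} {P : PFlag F d m → Prop}
    (h0 : ∀ g' u, InOrbit Y g' g u ↔ u = 0 ∧ P g') :
    convCount X Y f g w = {g' | InOrbit X f g' w ∧ P g'}.ncard := by
  unfold convCount
  rw [← Set.ncard_image_of_injective {g' | InOrbit X f g' w ∧ P g'} (Prod.mk_left_injective w)]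
  refine congrArg Set.ncard (Set.ext ?_)
  rintro ⟨g', u⟩
  simp only [Set.mem_ofPred_eq, h0, Set.mem_image, Prod.mk.injEq]
  constructor
  · rintro ⟨h1, h2, h3⟩
    rw [sub_eq_zero] at h2
    subst h2
    exact ⟨g', ⟨h1, h3⟩, rfl, rfl⟩
  · rintro ⟨g'', ⟨h1, h3⟩, rfl, rfl⟩
    exact ⟨h1, sub_self _, h3⟩

/-- Counting the subspaces `W` with `V'_h ⊂ W ⊆ V'_{h'}`, `dim W = dim V'_h + 1`, by their spanning
vectors. -/
theorem IsAdapted.convCount_raise [Fintype F] (H : IsAdapted Z f g w e) (hh : (h' : ℕ) = h + 1)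
    {Y : DecMat m m d} (hY : Y.dec = ∅) {a : Fin m → ℕ}
    (ha : Y.mat = Matrix.diagonal a + Matrix.single h h' 1) (hYZ : SameCols Y.mat Z.mat) :
    ∑ p, {x : ∀ i : Fin n, Fin (Z.mat i h') → F | (x p ≠ 0 ∧ ∀ i, p < i → x i = 0) ∧
        X.mat + Matrix.single p h' 1 = Z.mat + Matrix.single p h 1 ∧
        lowerClosure (X.dec : Set (Fin n × Fin m)) = lowerClosure (raiseDec Z h h' p x)}.ncard
      = convCount X Y f g w * {a : F | a ≠ 0}.ncard := by
  have hO : InOrbit Z f g w := inOrbit_iff_exists_isAdapted.mpr ⟨e, H⟩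
  have hcs : g.1 h.castSucc ≤ g.1 h.succ := g.2.1 Fin.castSucc_lt_succ.le
  have hss : g.1 h.succ ≤ g.1 h'.succ := g.2.1 (Fin.le_def.mpr (by simp [hh]))
  have hex : ∀ x : ∀ i : Fin n, Fin (Z.mat i h') → F, ∃ g' : PFlag F d m,
      (∀ t, t ≠ h.succ → g'.1 t = g.1 t) ∧
        g'.1 h.succ = g.1 h.succ ⊔ Submodule.span F {colVec e h' x} := fun x =>
    exists_flag_update g hh (hcs.trans le_sup_left) (sup_le hss (by
      rw [Submodule.span_singleton_le_iff_mem]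
      exact H.colVec_mem_right x (by simp)))
  choose Φ hΦ hΦ' using hex
  -- each nonzero vector is counted at its last nonzero row
  have hcount := ncard_exists_and
    (fun (x : ∀ i : Fin n, Fin (Z.mat i h') → F) i => x i ≠ 0) fun x => InOrbit X f (Φ x) w
  refine Eq.trans (Eq.trans (Finset.sum_congr rfl fun p _ =>
    congrArg Set.ncard (Set.ext fun x => ?_)) hcount.symm) ?_
  · simp only [not_not, Set.mem_ofPred_eq]
    exact and_congr_right fun h1 => (H.inOrbit_raise hh h1.1 h1.2 (hΦ x) (hΦ' x)).symm
  rw [convCount_eq_ncard (P := fun g' => (∀ s, s ≠ h.succ → g'.1 s = g.1 s) ∧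
      g.1 h.succ ≤ g'.1 h.succ ∧
      Module.finrank F ↥(g'.1 h.succ) = Module.finrank F ↥(g.1 h.succ) + 1) (fun g' u => by
    rw [inOrbit_raise_iff hY hh ha, finrank_right_eq_iff hO]
    simp only [hYZ, and_true])]
  refine ncard_eq_mul_of_fibers (φ := Φ) ?_ ?_
  · rintro x ⟨⟨i, hi⟩, hx⟩
    refine ⟨hx, hΦ x, by rw [hΦ']; exact le_sup_left, ?_⟩
    rw [hΦ' x]
    exact Submodule.finrank_sup_span_singleton (H.colVec_notMem_right (by omega) hi)
  · rintro g' ⟨h1, h2, h3, h4⟩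
    have hup : g'.1 h.succ ≤ g.1 h'.succ := by
      rw [← h2 h'.succ]
      · exact g'.2.1 (Fin.le_def.mpr (by simp [hh]))
      · intro h0
        have := congrArg Fin.val h0
        simp only [Fin.val_succ] at this
        omega
    rw [← H.ncard_raise_fiber hh h3 hup h4]
    congr 1
    ext x
    constructor
    · rintro ⟨⟨h5, -⟩, rfl⟩
      exact ⟨h5, (hΦ' x).symm⟩
    · rintro ⟨h5, h6⟩
      have : Φ x = g' := by
        refine Subtype.ext (funext fun t => ?_)
        by_cases ht : t = h.succ
        · rw [ht, hΦ', h6]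
        · rw [hΦ x t ht, h2 t ht]
      exact ⟨⟨h5, this ▸ h1⟩, this⟩

theorem colForm_smul (a : F) (x : ∀ i : Fin n, Fin (Z.mat i h) → F) :
    colForm e h (a • x) = a • colForm e h x := by
  ext y
  simp [colForm_apply, Finset.mul_sum, mul_assoc]

/-- The coefficient vectors `x ≠ 0` of the linear forms cutting out a given hyperplane of
`V'_h / V'_{h-1}` form a punctured line. -/
theorem IsAdapted.ncard_lower_fiber [Finite F] (H : IsAdapted Z f g w e)
    {W : Submodule F (Fin d → F)} (h1 : g.1 h.castSucc ≤ W) (h2 : W ≤ g.1 h.succ)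
    (h3 : Module.finrank F ↥(g.1 h.succ) = Module.finrank F W + 1) :
    {x : ∀ i : Fin n, Fin (Z.mat i h) → F | (∃ i, x i ≠ 0) ∧
      g.1 h.succ ⊓ LinearMap.ker (colForm e h x) = W}.ncard = {a : F | a ≠ 0}.ncard := by
  obtain ⟨y, hyg, hyW⟩ := SetLike.not_le_iff_exists.mp (fun h0 : g.1 h.succ ≤ W => by
    have := Submodule.finrank_mono h0
    omega)
  obtain ⟨φ, hφy, hφW⟩ := Submodule.exists_le_ker_of_notMem hyW
  let x0 : ∀ i : Fin n, Fin (Z.mat i h) → F := fun i k => φ (e ⟨(i, h), k⟩)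
  -- the form with coefficients `x0` agrees with `φ` on `V'_h`
  have hform : ∀ z ∈ g.1 h.succ, colForm e h x0 z = φ z := by
    have hs : g.1 h.succ ≤ LinearMap.eqLocus (colForm e h x0) φ := by
      rw [H.right, Submodule.span_le]
      rintro _ ⟨⟨⟨i, j⟩, k⟩, hk, rfl⟩
      rw [SetLike.mem_coe, LinearMap.mem_eqLocus]
      by_cases hj : j = h
      · subst hj
        rw [colForm_basis]
      · have hjs : (j : ℕ) < h := by
          have h4 : (j : ℕ) ≠ h := fun h0 => hj (Fin.ext h0)
          have h5 : (j : ℕ) < (h.succ : Fin (m + 1)) := hk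
          rw [Fin.val_succ] at h5
          omega
        have h6 : e ⟨(i, j), k⟩ ∈ g.1 h.castSucc := by
          rw [H.right]
          exact Submodule.subset_span ⟨_, hjs, rfl⟩
        rw [hφW (h1 h6), H.colForm_eq_zero_of_mem_right (t := h.castSucc) (by simp) h6]
    exact fun z hz => hs hz
  have hne : ∀ x : ∀ i : Fin n, Fin (Z.mat i h) → F,
      g.1 h.succ ⊓ LinearMap.ker (colForm e h x) = W → colForm e h x y ≠ 0 := fun x hx h0 =>
    hyW (hx ▸ ⟨hyg, h0⟩)
  have hW : g.1 h.succ ⊓ LinearMap.ker (colForm e h x0) = W := by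
    symm
    refine Submodule.eq_of_le_of_finrank_eq (le_inf h2 fun z hz => ?_) ?_
    · rw [LinearMap.mem_ker, hform z (h2 hz)]
      exact hφW hz
    · have := finrank_inf_ker_add_one (l := colForm e h x0) hyg (by rwa [hform y hyg])
      omega
  have hx0 : x0 ≠ 0 := by
    intro h0
    apply hφy
    rw [← hform y hyg, h0]
    simp [colForm_apply]
  symm
  refine Set.ncard_congr (fun a _ => a • x0) ?_ ?_ ?_
  · intro a ha
    refine ⟨Function.ne_iff.mp (smul_ne_zero ha hx0), ?_⟩
    rw [colForm_smul, LinearMap.ker_smul _ _ ha, hW]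
  · intro a b _ _ hab
    exact smul_left_injective F hx0 hab
  · rintro x ⟨⟨i, hi⟩, hx⟩
    have hx0y := hne x0 hW
    refine ⟨colForm e h x y / colForm e h x0 y, div_ne_zero (hne x hx) hx0y, ?_⟩
    funext i k
    have hmem : e ⟨(i, h), k⟩ ∈ g.1 h.succ := by
      rw [H.right]
      exact Submodule.subset_span ⟨_, by simp, rfl⟩
    -- subtracting a multiple of `y` moves a basis vector into the hyperplane
    have h4 : e ⟨(i, h), k⟩ - (colForm e h x0 (e ⟨(i, h), k⟩) / colForm e h x0 y) • y
        ∈ g.1 h.succ ⊓ LinearMap.ker (colForm e h x0) := by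
      refine ⟨Submodule.sub_mem _ hmem (Submodule.smul_mem _ _ hyg), ?_⟩
      simp [hx0y]
    rw [hW, ← hx] at h4
    have h5 := h4.2
    rw [SetLike.mem_coe, LinearMap.mem_ker, map_sub, map_smul, colForm_basis, colForm_basis,
      sub_eq_zero] at h5
    rw [h5]
    simp only [Pi.smul_apply, smul_eq_mul]
    ring

/-- Counting the hyperplanes `W` of `V'_h` containing `V'_{h-1}` by the linear forms cutting them
out. -/
theorem IsAdapted.convCount_lower [Fintype F] (H : IsAdapted Z f g w e) (hh : (h' : ℕ) = h + 1)
    {Y : DecMat m m d} (hY : Y.dec = ∅) {a : Fin m → ℕ}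
    (ha : Y.mat = Matrix.diagonal a + Matrix.single h' h 1) (hYZ : SameCols Y.mat Z.mat) :
    ∑ p, {x : ∀ i : Fin n, Fin (Z.mat i h) → F | (x p ≠ 0 ∧ ∀ i, i < p → x i = 0) ∧
        X.mat + Matrix.single p h 1 = Z.mat + Matrix.single p h' 1 ∧
        lowerClosure (X.dec : Set (Fin n × Fin m)) = lowerClosure (lowerDec Z h h' p x)}.ncard
      = convCount X Y f g w * {a : F | a ≠ 0}.ncard := by
  have hO : InOrbit Z f g w := inOrbit_iff_exists_isAdapted.mpr ⟨e, H⟩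
  have hcs : ∀ x : ∀ i : Fin n, Fin (Z.mat i h) → F,
      g.1 h.castSucc ≤ g.1 h.succ ⊓ LinearMap.ker (colForm e h x) := fun x =>
    le_inf (g.2.1 Fin.castSucc_lt_succ.le) fun z hz =>
      H.colForm_eq_zero_of_mem_right (t := h.castSucc) (by simp) hz
  have hss : g.1 h.succ ≤ g.1 h'.succ := g.2.1 (Fin.le_def.mpr (by simp [hh]))
  have hex : ∀ x : ∀ i : Fin n, Fin (Z.mat i h) → F, ∃ g' : PFlag F d m,
      (∀ t, t ≠ h.succ → g'.1 t = g.1 t) ∧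
        g'.1 h.succ = g.1 h.succ ⊓ LinearMap.ker (colForm e h x) := fun x =>
    exists_flag_update g hh (hcs x) (inf_le_left.trans hss)
  choose Φ hΦ hΦ' using hex
  -- each nonzero form is counted at its first nonzero row
  have hcount : {x : ∀ i : Fin n, Fin (Z.mat i h) → F |
        (∃ i, x i ≠ 0) ∧ InOrbit X f (Φ x) w}.ncard
      = ∑ p : Fin n, {x : ∀ i : Fin n, Fin (Z.mat i h) → F |
        (x p ≠ 0 ∧ ∀ i, i < p → ¬ x i ≠ 0) ∧ InOrbit X f (Φ x) w}.ncard :=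
    ncard_exists_and (ι := (Fin n)ᵒᵈ)
      (fun (x : ∀ i : Fin n, Fin (Z.mat i h) → F) i => x i ≠ 0) fun x => InOrbit X f (Φ x) w
  refine Eq.trans (Eq.trans (Finset.sum_congr rfl fun p _ =>
    congrArg Set.ncard (Set.ext fun x => ?_)) hcount.symm) ?_
  · simp only [not_not, Set.mem_ofPred_eq]
    exact and_congr_right fun h1 => (H.inOrbit_lower hh h1.1 h1.2 (hΦ x) (hΦ' x)).symm
  rw [convCount_eq_ncard (P := fun g' => (∀ s, s ≠ h.succ → g'.1 s = g.1 s) ∧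
      g'.1 h.succ ≤ g.1 h.succ ∧
      Module.finrank F ↥(g.1 h.succ) = Module.finrank F ↥(g'.1 h.succ) + 1) (fun g' u => by
    rw [inOrbit_lower_iff hY hh ha, finrank_right_eq_iff hO]
    simp only [hYZ, and_true])]
  refine ncard_eq_mul_of_fibers (φ := Φ) ?_ ?_
  · rintro x ⟨⟨i, hi⟩, hx⟩
    refine ⟨hx, hΦ x, by rw [hΦ']; exact inf_le_left, ?_⟩
    rw [hΦ' x]
    obtain ⟨u, h4, -, h5⟩ := H.exists_mem_colForm_ne_zero (x := x) (p := i) hi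
    exact (finrank_inf_ker_add_one (h5 h.succ (by simp)) h4).symm
  · rintro g' ⟨h1, h2, h3, h4⟩
    have hlow : g.1 h.castSucc ≤ g'.1 h.succ := by
      rw [← h2 h.castSucc]
      · exact g'.2.1 Fin.castSucc_lt_succ.le
      · intro h0
        have := congrArg Fin.val h0
        simp at this
    rw [← H.ncard_lower_fiber hlow h3 h4]
    congr 1
    ext x
    constructor
    · rintro ⟨⟨h5, -⟩, rfl⟩
      exact ⟨h5, (hΦ' x).symm⟩
    · rintro ⟨h5, h6⟩
      have : Φ x = g' := by
        refine Subtype.ext (funext fun t => ?_)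
        by_cases ht : t = h.succ
        · rw [ht, hΦ', h6]
        · rw [hΦ x t ht, h2 t ht]
      exact ⟨⟨h5, this ▸ h1⟩, this⟩

end

/-! ### The structure polynomials -/

section Polynomials

open Polynomial

variable {n m : ℕ}

open scoped Classical in
/-- The polynomial counting the vectors in `F ^ a_{i,c}` that are nonzero if `(i,c) ∈ Δ`, arbitrary
if `(i,c)` is below another cell of `Δ`, and zero otherwise. -/
noncomputable def rowPoly (A : Matrix (Fin n) (Fin m) ℕ) (Δ : Finset (Fin n × Fin m)) (c : Fin m)
    (i : Fin n) : ℤ[X] :=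
  if (i, c) ∈ Δ then X ^ A i c - 1
  else if (i, c) ∈ lowerClosure (Δ : Set (Fin n × Fin m)) then X ^ A i c else 1

open scoped Classical in
/-- The number of lines leading from the decorated matrix `(A, Δ')` to one with decoration `Δ`, the
last nonzero coordinate being in the row `p`, as a polynomial in the number of elements of the
field. The first term counts the lines that leave the decoration unchanged. -/
noncomputable def raisePoly (A : Matrix (Fin n) (Fin m) ℕ) (Δ Δ' : Finset (Fin n × Fin m))
    (h h' : Fin m) (p : Fin n) : ℤ[X] :=
  (if Δ = Δ' then ((∑ i ∈ Finset.range (A p h'), X ^ i) - if (p, h') ∈ Δ' then 1 else 0)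
      * X ^ (∑ i ∈ Finset.Iio p, A i h') else 0)
    + if RaiseRel h h' p Δ Δ' then ∏ i ∈ Finset.Iio p, rowPoly A Δ h' i else 0

open scoped Classical in
/-- The number of hyperplanes, given by linear forms with first nonzero coefficient in the row `p`,
that do not contain the vector of the triple. The vector has at most one nonzero coordinate in the
column `h`, and the form must not vanish there. -/
noncomputable def lowerSpecialPoly (A : Matrix (Fin n) (Fin m) ℕ) (Δ' : Finset (Fin n × Fin m))
    (h : Fin m) (p : Fin n) : ℤ[X] :=
  if (p, h) ∈ Δ' then X ^ (A p h - 1) * X ^ (∑ i ∈ Finset.Ioi p, A i h)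
  else if ∃ t, p < t ∧ (t, h) ∈ Δ' then
    (X ^ A p h - 1) * X ^ (∑ i ∈ Finset.Ioi p, A i h - 1)
  else 0

open scoped Classical in
/-- The number of hyperplanes leading from the decorated matrix `(A, Δ')` to one with decoration
`Δ`, the first nonzero coefficient of the linear form being in the row `p`. -/
noncomputable def lowerPoly (A : Matrix (Fin n) (Fin m) ℕ) (Δ Δ' : Finset (Fin n × Fin m))
    (h h' : Fin m) (p : Fin n) : ℤ[X] :=
  (if Δ = Δ' then (∑ i ∈ Finset.range (A p h), X ^ i) * X ^ (∑ i ∈ Finset.Ioi p, A i h)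
      - lowerSpecialPoly A Δ' h p else 0)
    + if lowerClosure (Δ : Set (Fin n × Fin m))
          = lowerClosure (insert (p, h') (Δ' : Set (Fin n × Fin m))) then
        lowerSpecialPoly A Δ' h p else 0

open scoped Classical in
/-- The structure polynomial for a matrix `diag + E_{h,h'}`. -/
noncomputable def raiseStruct {d : ℕ} (X Z : DecMat n m d) (h h' : Fin m) : ℤ[X] :=
  ∑ p, if X.mat + Matrix.single p h' 1 = Z.mat + Matrix.single p h 1 then
    raisePoly Z.mat X.dec Z.dec h h' p else 0

open scoped Classical in
/-- The structure polynomial for a matrix `diag + E_{h',h}`. -/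
noncomputable def lowerStruct {d : ℕ} (X Z : DecMat n m d) (h h' : Fin m) : ℤ[X] :=
  ∑ p, if X.mat + Matrix.single p h 1 = Z.mat + Matrix.single p h' 1 then
    lowerPoly Z.mat X.dec Z.dec h h' p else 0

open scoped Classical in
/-- The number of vectors of the first step, zero included, that move the vector of a triple in the
orbit of `Z` into the orbit of `X`. -/
noncomputable def cornerStruct {d : ℕ} (X Z : DecMat n m d) (c : Fin m) : ℤ[X] :=
  if X.mat = Z.mat ∧ X.dec.filter (·.2 ≠ c) = Z.dec.filter (·.2 ≠ c) then
    ∏ i, rowPoly Z.mat X.dec c i else 0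

theorem ncard_setOf_and_add {α : Type*} [Finite α] (P S : α → Prop) :
    {x | P x}.ncard = {x | P x ∧ S x}.ncard + {x | P x ∧ ¬ S x}.ncard := by
  rw [← Set.ncard_union_eq]
  · congr 1
    ext x
    simp only [Set.mem_ofPred_eq, Set.mem_union]
    tauto
  · rw [Set.disjoint_left]
    rintro x ⟨-, h1⟩ ⟨-, h2⟩
    exact h2 h1

theorem ncard_setOf_true (F : Type*) [Fintype F] (z : ℕ) :
    ({_v | True} : Set (Fin z → F)).ncard = Fintype.card F ^ z := by
  simp [Set.ncard_univ]

variable (F : Type*) [Field F] [Fintype F]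

/-- The number of blocks of coordinates allowed in one row. -/
theorem ncard_row (A : Matrix (Fin n) (Fin m) ℕ) (Δ : Finset (Fin n × Fin m)) (c : Fin m)
    (i : Fin n) :
    ({v : Fin (A i c) → F | ((i, c) ∈ Δ → v ≠ 0) ∧
      ((i, c) ∉ lowerClosure (Δ : Set (Fin n × Fin m)) → ¬ v ≠ 0)}.ncard : ℤ)
      = (rowPoly A Δ c i).eval (Fintype.card F : ℤ) := by
  classical
  unfold rowPoly
  split_ifs with h1 h2
  · have h2 : (i, c) ∈ lowerClosure (Δ : Set (Fin n × Fin m)) := subset_lowerClosure h1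
    simp only [h1, h2, not_true_eq_false, IsEmpty.forall_iff, and_true, forall_true_left]
    rw [ncard_ne_zero_fun]
    simp
  · simp [h1, h2, Set.ncard_univ]
  · simp [h1, h2]

/-- Vectors whose last nonzero row is `p`, with conditions on the single rows. -/
theorem ncard_last_box (z : Fin n → ℕ) (p : Fin n) (R Q : ∀ i, (Fin (z i) → F) → Prop)
    (hR : ∀ v, R p v → v ≠ 0) :
    {x : ∀ i : Fin n, Fin (z i) → F | (x p ≠ 0 ∧ ∀ i, p < i → x i = 0) ∧ R p (x p) ∧
        ∀ i < p, Q i (x i)}.ncard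
      = (∏ i ∈ Finset.Iio p, {v | Q i v}.ncard) * {v | R p v}.ncard := by
  rw [← ncard_box p (Finset.Iio p) (by simp)]
  congr 1
  ext x
  simp only [Set.mem_ofPred_eq, Finset.mem_Iio]
  constructor
  · rintro ⟨⟨h1, h2⟩, h3, h4⟩
    exact ⟨h3, h4, fun i h5 h6 => h2 i (lt_of_le_of_ne (not_lt.mp h6) h5.symm)⟩
  · rintro ⟨h3, h4, h5⟩
    exact ⟨⟨hR _ h3, fun i hi => h5 i hi.ne' (not_lt.mpr hi.le)⟩, h3, h4⟩

/-- Vectors whose first nonzero row is `p`, with conditions on the single rows. -/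
theorem ncard_first_box (z : Fin n → ℕ) (p : Fin n) (R Q : ∀ i, (Fin (z i) → F) → Prop)
    (hR : ∀ v, R p v → v ≠ 0) :
    {x : ∀ i : Fin n, Fin (z i) → F | (x p ≠ 0 ∧ ∀ i, i < p → x i = 0) ∧ R p (x p) ∧
        ∀ i, p < i → Q i (x i)}.ncard
      = (∏ i ∈ Finset.Ioi p, {v | Q i v}.ncard) * {v | R p v}.ncard := by
  rw [← ncard_box p (Finset.Ioi p) (by simp)]
  congr 1
  ext x
  simp only [Set.mem_ofPred_eq, Finset.mem_Ioi]
  constructor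
  · rintro ⟨⟨h1, h2⟩, h3, h4⟩
    exact ⟨h3, h4, fun i h5 h6 => h2 i (lt_of_le_of_ne (not_lt.mp h6) h5)⟩
  · rintro ⟨h3, h4, h5⟩
    exact ⟨⟨hR _ h3, fun i hi => h5 i hi.ne (not_lt.mpr hi.le)⟩, h3, h4⟩

/-- The spanning vectors with last nonzero row `p` of the lines that lead from `Z` to the decoration
of `X`; each line has `q - 1` of them. -/
theorem ncard_raise {d : ℕ} (X Z : DecMat n m d) {h h' : Fin m} (hh : (h' : ℕ) = h + 1)
    (p : Fin n) :
    ({x : ∀ i : Fin n, Fin (Z.mat i h') → F | (x p ≠ 0 ∧ ∀ i, p < i → x i = 0) ∧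
        lowerClosure (X.dec : Set (Fin n × Fin m)) = lowerClosure (raiseDec Z h h' p x)}.ncard : ℤ)
      = ((Fintype.card F : ℤ) - 1)
        * (raisePoly Z.mat X.dec Z.dec h h' p).eval (Fintype.card F : ℤ) := by
  classical
  set q : ℤ := (Fintype.card F : ℤ) with hq
  -- all vectors with last nonzero row `p`
  have hall : ({x : ∀ i : Fin n, Fin (Z.mat i h') → F | x p ≠ 0 ∧ ∀ i, p < i → x i = 0}.ncard : ℤ)
      = q ^ (∑ i ∈ Finset.Iio p, Z.mat i h') * (q ^ Z.mat p h' - 1) := by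
    have := ncard_last_box F (fun i => Z.mat i h') p (fun i v => v ≠ 0) (fun _ _ => True)
      (fun _ hv => hv)
    simp only [implies_true, and_true, ncard_setOf_true] at this
    rw [← ncard_ne_zero_fun, ← Finset.prod_pow_eq_pow_sum]
    have h2 : ∀ x : ∀ i : Fin n, Fin (Z.mat i h') → F,
        ((x p ≠ 0 ∧ ∀ i, p < i → x i = 0) ∧ x p ≠ 0) ↔ (x p ≠ 0 ∧ ∀ i, p < i → x i = 0) :=
      fun x => ⟨fun h3 => h3.1, fun h3 => ⟨h3, h3.1⟩⟩
    simp only [h2] at this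
    rw [this]
    push_cast
    rfl
  have hgeom : (q - 1) * ∑ i ∈ Finset.range (Z.mat p h'), q ^ i = q ^ Z.mat p h' - 1 := by
    rw [mul_comm]
    exact geom_sum_mul q _
  unfold raisePoly
  by_cases hp : (p, h') ∈ Z.dec
  · have hz := Z.isDec.pos _ hp
    -- the vectors whose block in the row `p` is a multiple of the first basis vector, the only ones
    -- that can change the decoration
    have hsp : ∀ Q : ∀ i, (Fin (Z.mat i h') → F) → Prop,
        ({x : ∀ i : Fin n, Fin (Z.mat i h') → F | (x p ≠ 0 ∧ ∀ i, p < i → x i = 0) ∧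
          (∀ k : Fin (Z.mat p h'), (k : ℕ) ≠ 0 → x p k = 0) ∧ ∀ i < p, Q i (x i)}.ncard : ℤ)
        = (∏ i ∈ Finset.Iio p, ({v | Q i v}.ncard : ℤ)) * (q - 1) := by
      intro Q
      have := ncard_last_box F (fun i => Z.mat i h') p
        (fun i v => v ≠ 0 ∧ ∀ k : Fin (Z.mat i h'), (k : ℕ) ≠ 0 → v k = 0) Q (fun _ hv => hv.1)
      rw [hq, ← ncard_first_line F hz, ← Nat.cast_prod, ← Nat.cast_mul, ← this]
      congr 2
      ext x
      simp only [Set.mem_ofPred_eq]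
      tauto
    have h0 : {x : ∀ i : Fin n, Fin (Z.mat i h') → F | (x p ≠ 0 ∧ ∀ i, p < i → x i = 0) ∧
        ∀ k : Fin (Z.mat p h'), (k : ℕ) ≠ 0 → x p k = 0}.ncard
        = q ^ (∑ i ∈ Finset.Iio p, Z.mat i h') * (q - 1) := by
      have := hsp fun _ _ => True
      simp only [implies_true, and_true, ncard_setOf_true] at this
      rw [this, ← Finset.prod_pow_eq_pow_sum]
      push_cast
      rfl
    have h1 : ({x : ∀ i : Fin n, Fin (Z.mat i h') → F | ((x p ≠ 0 ∧ ∀ i, p < i → x i = 0) ∧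
        lowerClosure (X.dec : Set (Fin n × Fin m)) = lowerClosure (raiseDec Z h h' p x)) ∧
        ∀ k : Fin (Z.mat p h'), (k : ℕ) ≠ 0 → x p k = 0}.ncard : ℤ)
        = (q - 1) * ((if RaiseRel h h' p X.dec Z.dec then
          ∏ i ∈ Finset.Iio p, rowPoly Z.mat X.dec h' i else 0 : ℤ[X]).eval q) := by
      have h2 : ∀ x : ∀ i : Fin n, Fin (Z.mat i h') → F,
          (((x p ≠ 0 ∧ ∀ i, p < i → x i = 0) ∧
          lowerClosure (X.dec : Set (Fin n × Fin m)) = lowerClosure (raiseDec Z h h' p x)) ∧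
          ∀ k : Fin (Z.mat p h'), (k : ℕ) ≠ 0 → x p k = 0) ↔
          RaiseRel h h' p X.dec Z.dec ∧ (x p ≠ 0 ∧ ∀ i, p < i → x i = 0) ∧
          (∀ k : Fin (Z.mat p h'), (k : ℕ) ≠ 0 → x p k = 0) ∧ ∀ i < p,
            ((i, h') ∈ X.dec → x i ≠ 0) ∧
              ((i, h') ∉ lowerClosure (X.dec : Set (Fin n × Fin m)) → ¬ x i ≠ 0) := by
        intro x
        by_cases hx : ∀ k : Fin (Z.mat p h'), (k : ℕ) ≠ 0 → x p k = 0
        · have := lowerClosure_raise_iff X Z hh hp fun i => x i ≠ 0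
          rw [raiseDec, if_pos ⟨hp, hx⟩, this]
          tauto
        · tauto
      simp only [h2]
      split_ifs with h3
      · simp only [h3, true_and]
        rw [hsp fun i v => ((i, h') ∈ X.dec → v ≠ 0) ∧
          ((i, h') ∉ lowerClosure (X.dec : Set (Fin n × Fin m)) → ¬ v ≠ 0)]
        simp only [ncard_row F Z.mat X.dec h']
        rw [eval_prod, mul_comm]
      · simp [h3]
    -- the other vectors do not change the decoration
    have h2 : ({x : ∀ i : Fin n, Fin (Z.mat i h') → F | ((x p ≠ 0 ∧ ∀ i, p < i → x i = 0) ∧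
        lowerClosure (X.dec : Set (Fin n × Fin m)) = lowerClosure (raiseDec Z h h' p x)) ∧
        ¬ ∀ k : Fin (Z.mat p h'), (k : ℕ) ≠ 0 → x p k = 0}.ncard : ℤ)
        = if X.dec = Z.dec then q ^ (∑ i ∈ Finset.Iio p, Z.mat i h') * (q ^ Z.mat p h' - 1)
          - q ^ (∑ i ∈ Finset.Iio p, Z.mat i h') * (q - 1) else 0 := by
      have h3 : ∀ x : ∀ i : Fin n, Fin (Z.mat i h') → F,
          (((x p ≠ 0 ∧ ∀ i, p < i → x i = 0) ∧
          lowerClosure (X.dec : Set (Fin n × Fin m)) = lowerClosure (raiseDec Z h h' p x)) ∧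
          ¬ ∀ k : Fin (Z.mat p h'), (k : ℕ) ≠ 0 → x p k = 0) ↔
          X.dec = Z.dec ∧ (x p ≠ 0 ∧ ∀ i, p < i → x i = 0) ∧
          ¬ ∀ k : Fin (Z.mat p h'), (k : ℕ) ≠ 0 → x p k = 0 := by
        intro x
        by_cases hx : ∀ k : Fin (Z.mat p h'), (k : ℕ) ≠ 0 → x p k = 0
        · tauto
        · rw [raiseDec, if_neg (fun h4 => hx h4.2), DecMat.lowerClosure_dec_eq_iff]
          tauto
      simp only [h3]
      split_ifs with h4
      · simp only [h4, true_and]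
        rw [← hall, ← h0, ncard_setOf_and_add
          (fun x : ∀ i : Fin n, Fin (Z.mat i h') → F => x p ≠ 0 ∧ ∀ i, p < i → x i = 0)
          fun x => ∀ k : Fin (Z.mat p h'), (k : ℕ) ≠ 0 → x p k = 0]
        push_cast
        ring
      · simp [h4]
    rw [ncard_setOf_and_add _ fun x => ∀ k : Fin (Z.mat p h'), (k : ℕ) ≠ 0 → x p k = 0,
      Nat.cast_add, h1, h2, eval_add, mul_add, add_comm]
    congr 1
    split_ifs with h3
    · simp only [eval_mul, eval_sub, eval_finsetSum, eval_pow, eval_X, eval_one]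
      rw [← hgeom]
      ring
    · simp
  · have hnr : ¬ RaiseRel h h' p X.dec Z.dec := fun h0 => hp (by rw [h0.2.2]; simp)
    have h1 : ∀ x : ∀ i : Fin n, Fin (Z.mat i h') → F, raiseDec Z h h' p x = Z.dec := fun x => by
      rw [raiseDec, if_neg fun h0 => hp h0.1]
    simp only [h1, DecMat.lowerClosure_dec_eq_iff, hp, hnr, if_false, add_zero, sub_zero]
    split_ifs with h2
    · simp only [h2, and_true]
      rw [hall, ← hgeom]
      simp only [eval_mul, eval_finsetSum, eval_pow, eval_X]
      ring
    · simp [h2]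

/-- The linear forms with first nonzero row `p` that do not vanish on the vector of the triple; each
hyperplane is cut out by `q - 1` of them. -/
theorem ncard_lower_special {d : ℕ} (Z : DecMat n m d) {h : Fin m} (p : Fin n) :
    ({x : ∀ i : Fin n, Fin (Z.mat i h) → F | (x p ≠ 0 ∧ ∀ i, i < p → x i = 0) ∧
        ∃ t, ∃ ht : (t, h) ∈ Z.dec, x t ⟨0, Z.isDec.pos _ ht⟩ ≠ 0}.ncard : ℤ)
      = ((Fintype.card F : ℤ) - 1)
        * (lowerSpecialPoly Z.mat Z.dec h p).eval (Fintype.card F : ℤ) := by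
  classical
  set q : ℤ := (Fintype.card F : ℤ) with hq
  -- there is at most one coordinate of the vector to be considered
  have huniq : ∀ s t, (s, h) ∈ Z.dec → (t, h) ∈ Z.dec → s = t := fun s t hs ht =>
    congrArg Prod.fst (Z.eq_of_snd_eq hs ht rfl)
  have hex : ∀ {t} (ht : (t, h) ∈ Z.dec) (x : ∀ i : Fin n, Fin (Z.mat i h) → F),
      (∃ t, ∃ ht : (t, h) ∈ Z.dec, x t ⟨0, Z.isDec.pos _ ht⟩ ≠ 0) ↔
        x t ⟨0, Z.isDec.pos _ ht⟩ ≠ 0 := by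
    intro t ht x
    constructor
    · rintro ⟨s, hs, h1⟩
      obtain rfl := huniq s t hs ht
      exact h1
    · exact fun h1 => ⟨t, ht, h1⟩
  unfold lowerSpecialPoly
  split_ifs with hp hp'
  · have hz := Z.isDec.pos _ hp
    have := ncard_first_box F (fun i => Z.mat i h) p
      (fun i v => ∃ hz : 0 < Z.mat i h, v ⟨0, hz⟩ ≠ 0) (fun _ _ => True)
      (fun v hv => by
        rintro rfl
        exact hv.2 rfl)
    simp only [implies_true, and_true, ncard_setOf_true, hz, exists_true_left] at this
    simp only [hex hp]
    rw [this]
    push_cast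
    rw [ncard_first_ne_zero F hz, ← hq]
    simp only [eval_mul, eval_pow, eval_X, Finset.prod_pow_eq_pow_sum]
    ring
  · obtain ⟨t, hpt, ht⟩ := hp'
    have hz : 0 < Z.mat t h := Z.isDec.pos _ ht
    have := ncard_first_box F (fun i => Z.mat i h) p (fun i v => v ≠ 0)
      (fun i v => i = t → ∃ hz : 0 < Z.mat i h, v ⟨0, hz⟩ ≠ 0) (fun v hv => hv)
    have h2 : ∀ x : ∀ i : Fin n, Fin (Z.mat i h) → F,
        ((x p ≠ 0 ∧ ∀ i, i < p → x i = 0) ∧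
          ∃ t, ∃ ht : (t, h) ∈ Z.dec, x t ⟨0, Z.isDec.pos _ ht⟩ ≠ 0) ↔
        ((x p ≠ 0 ∧ ∀ i, i < p → x i = 0) ∧ x p ≠ 0 ∧
          ∀ i, p < i → i = t → ∃ hz : 0 < Z.mat i h, x i ⟨0, hz⟩ ≠ 0) := by
      intro x
      rw [hex ht]
      constructor
      · rintro ⟨h3, h4⟩
        refine ⟨h3, h3.1, ?_⟩
        rintro i - rfl
        exact ⟨hz, h4⟩
      · rintro ⟨h3, -, h4⟩
        obtain ⟨_, h5⟩ := h4 t hpt rfl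
        exact ⟨h3, h5⟩
    simp only [h2]
    rw [this, ← Finset.mul_prod_erase _ _ (Finset.mem_Ioi.mpr hpt)]
    have h3 : ∏ i ∈ (Finset.Ioi p).erase t,
        {v : Fin (Z.mat i h) → F | i = t → ∃ hz : 0 < Z.mat i h, v ⟨0, hz⟩ ≠ 0}.ncard
        = ∏ i ∈ (Finset.Ioi p).erase t, Fintype.card F ^ Z.mat i h := by
      refine Finset.prod_congr rfl fun i hi => ?_
      have := (Finset.mem_erase.mp hi).1
      simp [this, Set.ncard_univ]
    rw [h3]
    simp only [forall_true_left, hz, exists_true_left]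
    push_cast
    rw [ncard_first_ne_zero F hz, ncard_ne_zero_fun, ← hq, Finset.prod_pow_eq_pow_sum]
    have h4 : ∑ i ∈ Finset.Ioi p, Z.mat i h - 1
        = (Z.mat t h - 1) + ∑ i ∈ (Finset.Ioi p).erase t, Z.mat i h := by
      rw [← Finset.add_sum_erase _ _ (Finset.mem_Ioi.mpr hpt)]
      omega
    simp only [eval_mul, eval_pow, eval_X, eval_sub, eval_one]
    rw [h4, pow_add]
    ring
  · rw [eval_zero, mul_zero, Nat.cast_eq_zero, Set.ncard_eq_zero (Set.toFinite _)]
    ext x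
    simp only [Set.mem_ofPred_eq, Set.mem_empty_iff_false, iff_false]
    rintro ⟨⟨h1, h2⟩, t, ht, h3⟩
    rcases lt_trichotomy t p with h4 | rfl | h4
    · exact h3 (by rw [h2 t h4]; rfl)
    · exact hp ht
    · exact hp' ⟨t, h4, ht⟩

/-- The linear forms with first nonzero row `p` of the hyperplanes that lead from `Z` to the
decoration of `X`. -/
theorem ncard_lower {d : ℕ} (X Z : DecMat n m d) {h h' : Fin m} (p : Fin n) :
    ({x : ∀ i : Fin n, Fin (Z.mat i h) → F | (x p ≠ 0 ∧ ∀ i, i < p → x i = 0) ∧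
        lowerClosure (X.dec : Set (Fin n × Fin m)) = lowerClosure (lowerDec Z h h' p x)}.ncard : ℤ)
      = ((Fintype.card F : ℤ) - 1)
        * (lowerPoly Z.mat X.dec Z.dec h h' p).eval (Fintype.card F : ℤ) := by
  classical
  have hspec := ncard_lower_special F Z (h := h) p
  set q : ℤ := (Fintype.card F : ℤ) with hq
  -- all forms with first nonzero row `p`
  have hall : ({x : ∀ i : Fin n, Fin (Z.mat i h) → F | x p ≠ 0 ∧ ∀ i, i < p → x i = 0}.ncard : ℤ)
      = q ^ (∑ i ∈ Finset.Ioi p, Z.mat i h) * (q ^ Z.mat p h - 1) := by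
    have := ncard_first_box F (fun i => Z.mat i h) p (fun i v => v ≠ 0) (fun _ _ => True)
      (fun _ hv => hv)
    simp only [implies_true, and_true, ncard_setOf_true] at this
    rw [← ncard_ne_zero_fun, ← Finset.prod_pow_eq_pow_sum]
    have h2 : ∀ x : ∀ i : Fin n, Fin (Z.mat i h) → F,
        ((x p ≠ 0 ∧ ∀ i, i < p → x i = 0) ∧ x p ≠ 0) ↔ (x p ≠ 0 ∧ ∀ i, i < p → x i = 0) :=
      fun x => ⟨fun h3 => h3.1, fun h3 => ⟨h3, h3.1⟩⟩
    simp only [h2] at this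
    rw [this]
    push_cast
    rfl
  have hgeom : (q - 1) * ∑ i ∈ Finset.range (Z.mat p h), q ^ i = q ^ Z.mat p h - 1 := by
    rw [mul_comm]
    exact geom_sum_mul q _
  -- the decoration depends on whether the form vanishes on the vector
  rw [ncard_setOf_and_add _ fun x => ∃ t, ∃ ht : (t, h) ∈ Z.dec, x t ⟨0, Z.isDec.pos _ ht⟩ ≠ 0]
  have h1 : ∀ x : ∀ i : Fin n, Fin (Z.mat i h) → F,
      (((x p ≠ 0 ∧ ∀ i, i < p → x i = 0) ∧
        lowerClosure (X.dec : Set (Fin n × Fin m)) = lowerClosure (lowerDec Z h h' p x)) ∧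
        ∃ t, ∃ ht : (t, h) ∈ Z.dec, x t ⟨0, Z.isDec.pos _ ht⟩ ≠ 0) ↔
      lowerClosure (X.dec : Set (Fin n × Fin m))
          = lowerClosure (insert (p, h') (Z.dec : Set (Fin n × Fin m))) ∧
        (x p ≠ 0 ∧ ∀ i, i < p → x i = 0) ∧
        ∃ t, ∃ ht : (t, h) ∈ Z.dec, x t ⟨0, Z.isDec.pos _ ht⟩ ≠ 0 := by
    intro x
    by_cases hx : ∃ t, ∃ ht : (t, h) ∈ Z.dec, x t ⟨0, Z.isDec.pos _ ht⟩ ≠ 0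
    · rw [lowerDec, if_pos hx]
      tauto
    · exact ⟨fun h0 => absurd h0.2 hx, fun h0 => absurd h0.2.2 hx⟩
  have h2 : ∀ x : ∀ i : Fin n, Fin (Z.mat i h) → F,
      (((x p ≠ 0 ∧ ∀ i, i < p → x i = 0) ∧
        lowerClosure (X.dec : Set (Fin n × Fin m)) = lowerClosure (lowerDec Z h h' p x)) ∧
        ¬ ∃ t, ∃ ht : (t, h) ∈ Z.dec, x t ⟨0, Z.isDec.pos _ ht⟩ ≠ 0) ↔
      X.dec = Z.dec ∧ (x p ≠ 0 ∧ ∀ i, i < p → x i = 0) ∧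
        ¬ ∃ t, ∃ ht : (t, h) ∈ Z.dec, x t ⟨0, Z.isDec.pos _ ht⟩ ≠ 0 := by
    intro x
    by_cases hx : ∃ t, ∃ ht : (t, h) ∈ Z.dec, x t ⟨0, Z.isDec.pos _ ht⟩ ≠ 0
    · exact ⟨fun h0 => absurd hx h0.2, fun h0 => absurd hx h0.2.2⟩
    · rw [lowerDec, if_neg hx, DecMat.lowerClosure_dec_eq_iff]
      tauto
  have h3 : ({x : ∀ i : Fin n, Fin (Z.mat i h) → F | (x p ≠ 0 ∧ ∀ i, i < p → x i = 0) ∧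
        ¬ ∃ t, ∃ ht : (t, h) ∈ Z.dec, x t ⟨0, Z.isDec.pos _ ht⟩ ≠ 0}.ncard : ℤ)
      = q ^ (∑ i ∈ Finset.Ioi p, Z.mat i h) * (q ^ Z.mat p h - 1)
        - (q - 1) * (lowerSpecialPoly Z.mat Z.dec h p).eval q := by
    rw [← hall, ← hspec, ncard_setOf_and_add
      (fun x : ∀ i : Fin n, Fin (Z.mat i h) → F => x p ≠ 0 ∧ ∀ i, i < p → x i = 0)
      fun x => ∃ t, ∃ ht : (t, h) ∈ Z.dec, x t ⟨0, Z.isDec.pos _ ht⟩ ≠ 0]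
    push_cast
    ring
  simp only [h1, h2]
  unfold lowerPoly
  rw [add_comm, Nat.cast_add, eval_add, mul_add]
  congr 1
  · split_ifs with h4
    · simp only [h4, true_and]
      rw [h3, ← hgeom]
      simp only [eval_mul, eval_sub, eval_finsetSum, eval_pow, eval_X]
      ring
    · simp [h4]
  · split_ifs with h4
    · simp only [h4, true_and]
      exact hspec
    · simp [h4]

end Polynomials

/-! ### The structure constants for the generators -/

section StructureConstants

open Polynomial

variable {F : Type*} [Field F] [Fintype F] {n m d : ℕ} {X Z : DecMat n m d} {Y : DecMat m m d}
  {f : PFlag F d n} {g : PFlag F d m} {w : Fin d → F} {a : Fin m → ℕ} {h h' c : Fin m}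

theorem convCount_eq_zero_of_not_sameCols (H : InOrbit Z f g w)
    (hYZ : ¬ SameCols Y.mat Z.mat) : convCount X Y f g w = 0 :=
  convCount_eq_zero fun _ _ H' => hYZ ((finrank_right_eq_iff H Y).mp (finrank_right_of_inOrbit H'))

open scoped Classical in
theorem convCount_raise_eq_eval (H : InOrbit Z f g w) (hh : (h' : ℕ) = h + 1) (hY : Y.dec = ∅)
    (ha : Y.mat = Matrix.diagonal a + Matrix.single h h' 1) :
    (convCount X Y f g w : ℤ)
      = (if SameCols Y.mat Z.mat then raiseStruct X Z h h' else 0).eval (Fintype.card F : ℤ) := by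
  split_ifs with hYZ
  · obtain ⟨e, He⟩ := inOrbit_iff_exists_isAdapted.mp H
    have h1 : ((Fintype.card F : ℤ) - 1) ≠ 0 := by
      have := Fintype.one_lt_card (α := F)
      omega
    refine mul_right_cancel₀ h1 ?_
    rw [← ncard_ne_zero_field, ← Nat.cast_mul, ← He.convCount_raise hh hY ha hYZ,
      ncard_ne_zero_field, raiseStruct, eval_finsetSum, Finset.sum_mul, Nat.cast_sum]
    refine Finset.sum_congr rfl fun p _ => ?_
    split_ifs with h2
    · simp only [h2, true_and]
      rw [ncard_raise F X Z hh p, mul_comm]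
    · simp [h2]
  · rw [convCount_eq_zero_of_not_sameCols H hYZ]
    simp

open scoped Classical in
theorem convCount_lower_eq_eval (H : InOrbit Z f g w) (hh : (h' : ℕ) = h + 1) (hY : Y.dec = ∅)
    (ha : Y.mat = Matrix.diagonal a + Matrix.single h' h 1) :
    (convCount X Y f g w : ℤ)
      = (if SameCols Y.mat Z.mat then lowerStruct X Z h h' else 0).eval (Fintype.card F : ℤ) := by
  split_ifs with hYZ
  · obtain ⟨e, He⟩ := inOrbit_iff_exists_isAdapted.mp H
    have h1 : ((Fintype.card F : ℤ) - 1) ≠ 0 := by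
      have := Fintype.one_lt_card (α := F)
      omega
    refine mul_right_cancel₀ h1 ?_
    rw [← ncard_ne_zero_field, ← Nat.cast_mul, ← He.convCount_lower hh hY ha hYZ,
      ncard_ne_zero_field, lowerStruct, eval_finsetSum, Finset.sum_mul, Nat.cast_sum]
    refine Finset.sum_congr rfl fun p _ => ?_
    split_ifs with h2
    · simp only [h2, true_and]
      rw [ncard_lower F X Z p, mul_comm]
    · simp [h2]
  · rw [convCount_eq_zero_of_not_sameCols H hYZ]
    simp

open scoped Classical in
theorem convCount_diagonal_eq_eval (H : InOrbit Z f g w) (hY : Y.dec = ∅)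
    (ha : Y.mat = Matrix.diagonal a) :
    (convCount X Y f g w : ℤ)
      = (if SameCols Y.mat Z.mat then (if X = Z then 1 else 0) else 0 : ℤ[X]).eval
        (Fintype.card F : ℤ) := by
  split_ifs with hYZ hXZ
  · subst hXZ
    rw [convCount_eq_ncard (P := fun g' => g' = g) fun g' u => ?_]
    · have : {g' | InOrbit X f g' w ∧ g' = g} = {g} := by
        ext g'
        simp only [Set.mem_ofPred_eq, Set.mem_singleton_iff, and_iff_right_iff_imp]
        rintro rfl
        exact H
      simp [this]
    · rw [inOrbit_diagonal_iff hY ha, finrank_right_eq_iff H, and_iff_left hYZ]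
  · rw [convCount_eq_ncard (P := fun g' => g' = g) fun g' u => ?_]
    · have : {g' | InOrbit X f g' w ∧ g' = g} = ∅ := by
        ext g'
        simp only [Set.mem_ofPred_eq, Set.mem_empty_iff_false, iff_false]
        rintro ⟨H', rfl⟩
        exact hXZ (H'.unique H)
      simp [this]
    · rw [inOrbit_diagonal_iff hY ha, finrank_right_eq_iff H, and_iff_left hYZ]
  · rw [convCount_eq_zero_of_not_sameCols H hYZ]
    simp

/-- The vectors `u` in the orbit of `X` congruent to `w` modulo the first step: they are determined
by their coordinates in the first column, on which the orbit imposes one condition for each row. -/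
theorem IsAdapted.ncard_shift
    {e : Module.Basis (Σ c : Fin n × Fin m, Fin (Z.mat c.1 c.2)) F (Fin d → F)}
    (H : IsAdapted Z f g w e) (hc : (c : ℕ) = 0) :
    ({u | InOrbit X f g u ∧ w - u ∈ g.1 c.succ}.ncard : ℤ)
      = (cornerStruct X Z c).eval (Fintype.card F : ℤ) := by
  let x0 : ∀ i : Fin n, Fin (Z.mat i c) → F := fun i k => e.repr w ⟨(i, c), k⟩
  -- the vector with coordinates `x` in the column `c` that agrees with `w` elsewhere
  let φ : (∀ i : Fin n, Fin (Z.mat i c) → F) → Fin d → F :=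
    fun x => w - colVec e c x0 + colVec e c x
  have hφ : ∀ x i, (fun k => e.repr (φ x) ⟨(i, c), k⟩) = x i := fun x i => by
    funext k
    simp only [φ, map_add, map_sub, Finsupp.add_apply, Finsupp.sub_apply, repr_colVec, x0]
    ring
  have hφ' : ∀ x k, k.1.2 ≠ c → e.repr (φ x) k = e.repr w k := fun x k hk => by
    simp only [φ, map_add, map_sub, Finsupp.add_apply, Finsupp.sub_apply,
      repr_colVec_of_ne e _ _ _ hk]
    ring
  have hinj : Function.Injective φ := fun x y hxy => by
    funext i
    rw [← hφ x i, hxy, hφ y i]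
  have himg : {u | InOrbit X f g u ∧ w - u ∈ g.1 c.succ} = φ '' {x | X.mat = Z.mat ∧
      X.dec.filter (·.2 ≠ c) = Z.dec.filter (·.2 ≠ c) ∧ ∀ i, ((i, c) ∈ X.dec → x i ≠ 0) ∧
        ((i, c) ∉ lowerClosure (X.dec : Set (Fin n × Fin m)) → ¬ x i ≠ 0)} := by
    have key : ∀ x, InOrbit X f g (φ x) ↔ X.mat = Z.mat ∧
      X.dec.filter (·.2 ≠ c) = Z.dec.filter (·.2 ≠ c) ∧ ∀ i, ((i, c) ∈ X.dec → x i ≠ 0) ∧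
        ((i, c) ∉ lowerClosure (X.dec : Set (Fin n × Fin m)) → ¬ x i ≠ 0) := fun x => by
      rw [H.inOrbit_shift (hφ' x)]
      simp only [hφ]
      rw [lowerClosure_corner_iff X Z hc fun i => x i ≠ 0]
    ext u
    constructor
    · rintro ⟨h1, h2⟩
      have hu : φ (fun i k => e.repr u ⟨(i, c), k⟩) = u := by
        apply e.repr.injective
        ext k
        by_cases hk : k.1.2 = c
        · obtain ⟨⟨i, j⟩, k⟩ := k
          obtain rfl : j = c := hk
          exact congrFun (hφ (fun i k => e.repr u ⟨(i, j), k⟩) i) k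
        · rw [hφ' _ _ hk]
          have h3 := (H.mem_right _ _).mp h2 k (by
            have h4 : (k.1.2 : ℕ) ≠ c := fun h5 => hk (Fin.ext h5)
            rw [Fin.val_succ]
            omega)
          rwa [map_sub, Finsupp.sub_apply, sub_eq_zero] at h3
      exact ⟨_, (key _).mp (hu.symm ▸ h1), hu⟩
    · rintro ⟨x, hx, rfl⟩
      refine ⟨(key x).mpr hx, ?_⟩
      have h3 : w - φ x = colVec e c x0 - colVec e c x := by
        simp only [φ]
        abel
      rw [h3]
      exact sub_mem (H.colVec_mem_right _ (by simp)) (H.colVec_mem_right _ (by simp))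
  rw [himg, Set.ncard_image_of_injective _ hinj, cornerStruct]
  split_ifs with h1
  · simp only [h1.1, true_and]
    have h2 : (X.dec.filter (·.2 ≠ c) = Z.dec.filter (·.2 ≠ c)) = True := eq_true h1.2
    simp only [h2, true_and]
    rw [ncard_setOf_forall (fun i (v : Fin (Z.mat i c) → F) => ((i, c) ∈ X.dec → v ≠ 0) ∧
        ((i, c) ∉ lowerClosure (X.dec : Set (Fin n × Fin m)) → ¬ v ≠ 0)), eval_prod,
      Nat.cast_prod]
    exact Finset.prod_congr rfl fun i _ => ncard_row F Z.mat X.dec c i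
  · have : ∀ x : ∀ i : Fin n, Fin (Z.mat i c) → F, ¬ (X.mat = Z.mat ∧
      X.dec.filter (·.2 ≠ c) = Z.dec.filter (·.2 ≠ c) ∧ ∀ i, ((i, c) ∈ X.dec → x i ≠ 0) ∧
        ((i, c) ∉ lowerClosure (X.dec : Set (Fin n × Fin m)) → ¬ x i ≠ 0)) :=
      fun x hx => h1 ⟨hx.1, hx.2.1⟩
    simp only [this]
    simp

open scoped Classical in
/-- The orbit of `(diag(a), {(1,1)})` consists of the nonzero vectors of the first step, so the zero
vector, which fixes the triple, is subtracted. -/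
theorem convCount_corner_eq_eval (H : InOrbit Z f g w) (hc : (c : ℕ) = 0)
    (hY : Y.dec = {(c, c)}) (ha : Y.mat = Matrix.diagonal a) :
    (convCount X Y f g w : ℤ)
      = (if SameCols Y.mat Z.mat then cornerStruct X Z c - (if X = Z then 1 else 0) else 0 :
        ℤ[X]).eval (Fintype.card F : ℤ) := by
  by_cases hYZ : SameCols Y.mat Z.mat
  · have h1 : convCount X Y f g w
        = {u | (InOrbit X f g u ∧ w - u ∈ g.1 c.succ) ∧ ¬ w = u}.ncard := by
      unfold convCount
      rw [← Set.ncard_image_of_injective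
        {u | (InOrbit X f g u ∧ w - u ∈ g.1 c.succ) ∧ ¬ w = u} (Prod.mk_right_injective g)]
      refine congrArg Set.ncard (Set.ext ?_)
      rintro ⟨g', u⟩
      simp only [Set.mem_ofPred_eq, inOrbit_diagonal_corner_iff hc hY ha, finrank_right_eq_iff H,
        hYZ, and_true, Set.mem_image, Prod.mk.injEq, sub_ne_zero]
      constructor
      · rintro ⟨h1, h2, h3, rfl⟩
        exact ⟨u, ⟨⟨h1, h3⟩, h2⟩, rfl, rfl⟩
      · rintro ⟨u, ⟨⟨h1, h3⟩, h2⟩, rfl, rfl⟩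
        exact ⟨h1, h2, h3, rfl⟩
    have h2 := ncard_setOf_and_add (fun u => InOrbit X f g u ∧ w - u ∈ g.1 c.succ) fun u => w = u
    obtain ⟨e, He⟩ := inOrbit_iff_exists_isAdapted.mp H
    rw [if_pos hYZ, eval_sub, ← He.ncard_shift hc, h1, h2]
    split_ifs with hXZ
    · subst hXZ
      have h3 : {u | (InOrbit X f g u ∧ w - u ∈ g.1 c.succ) ∧ w = u} = {w} := by
        ext u
        simp only [Set.mem_ofPred_eq, Set.mem_singleton_iff]
        constructor
        · exact fun h4 => h4.2.symm
        · rintro rfl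
          exact ⟨⟨H, by simp⟩, rfl⟩
      rw [h3]
      simp
    · have h3 : {u | (InOrbit X f g u ∧ w - u ∈ g.1 c.succ) ∧ w = u} = ∅ := by
        ext u
        simp only [Set.mem_ofPred_eq, Set.mem_empty_iff_false, iff_false]
        rintro ⟨⟨H', -⟩, rfl⟩
        exact hXZ (H'.unique H)
      rw [h3]
      simp
  · rw [if_neg hYZ, convCount_eq_zero_of_not_sameCols H hYZ]
    simp

end StructureConstants

/-! ### From counting to the two convolution products -/

open Polynomial in
/-- The structure constant may be computed from any polynomial counting over all finite fields: two
such polynomials agree at all primes, since every orbit has a point over every prime field. -/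
theorem structConst_eq {R : Type*} [Field R] (v : R) {n m l d : ℕ} {X : DecMat n m d}
    {Y : DecMat m l d} {Z : DecMat n l d} {P : ℤ[X]} (hP : IsStructPoly X Y Z P) :
    structConst v X Y Z = aeval (v ^ 2) P := by
  have hex : ∃ P : ℤ[X], IsStructPoly X Y Z P := ⟨P, hP⟩
  rw [structConst, dif_pos hex]
  congr 1
  refine Polynomial.eq_of_infinite_eval_eq _ _ (Set.Infinite.mono
    (s := (fun p : ℕ => (p : ℤ)) '' {p | p.Prime}) ?_
    (Nat.infinite_setOfPred_prime.image Nat.cast_injective.injOn))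
  rintro _ ⟨p, hp, rfl⟩
  have : Fact p.Prime := ⟨hp⟩
  obtain ⟨f, g, w, H⟩ := exists_inOrbit_of_decMat (ZMod p) Z
  have h1 := hP (ZMod p) f g w H
  have h2 := hex.choose_spec (ZMod p) f g w H
  rw [ZMod.card] at h1 h2
  exact h2.symm.trans h1

section Transfer

open Polynomial

variable {n m l d : ℕ} {X : DecMat n m d} {Y : DecMat m l d} {T : DecMat n l d → ℤ[X]}

theorem genConv_genChar {R : Type*} [Field R] (v : R) (hT : ∀ Z, IsStructPoly X Y Z (T Z)) :
    genConv v (genChar R X) (genChar R Y) = ∑ Z, aeval (v ^ 2) (T Z) • genChar R Z := by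
  classical
  funext Z
  have h1 : ∀ Z', genChar R Z' Z = if Z' = Z then 1 else 0 := fun Z' => by
    simp only [genChar, Pi.single_apply, eq_comm]
  simp only [genConv, Finset.sum_apply, Pi.smul_apply, h1, smul_eq_mul, mul_ite, mul_one, mul_zero,
    Finset.sum_ite_eq', Finset.mem_univ, if_true]
  rw [Finset.sum_eq_single X, Finset.sum_eq_single Y]
  · simp [genChar, structConst_eq v (hT Z)]
  · intro Y' _ hY'
    simp [genChar, hY']
  · simp
  · intro X' _ hX'
    simp [genChar, hX']
  · simp

/-- Over one finite field it suffices to have the counts as values of polynomials. The two sides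
agree at every triple because every triple lies in exactly one orbit. -/
theorem conv_orbitChar {K : Type*} [Field K] {F : Type*} [Field F] [Fintype F] (v : K)
    (hv : v ^ 2 = (Fintype.card F : K))
    (hT : ∀ Z (f : PFlag F d n) (g : PFlag F d l) (w : Fin d → F), InOrbit Z f g w →
      (convCount X Y f g w : ℤ) = (T Z).eval (Fintype.card F : ℤ)) :
    conv (orbitChar K F X) (orbitChar K F Y) = ∑ Z, aeval (v ^ 2) (T Z) • orbitChar K F Z := by
  classical
  refine Subtype.ext ?_
  funext f g w
  obtain ⟨Z, hZ⟩ := exists_inOrbit f g w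
  have h1 : (∑ Z, aeval (v ^ 2) (T Z) • orbitChar K F Z : InvFun K F n l d).1 f g w
      = aeval (v ^ 2) (T Z) := by
    rw [AddSubmonoidClass.coe_finsetSum]
    simp only [Finset.sum_apply]
    rw [Finset.sum_eq_single Z]
    · simp [orbitChar, hZ]
    · intro Z' _ hZ'
      have : ¬ InOrbit Z' f g w := fun h => hZ' (h.unique hZ)
      simp [orbitChar, this]
    · simp
  have h2 : (conv (orbitChar K F X) (orbitChar K F Y)).1 f g w = (convCount X Y f g w : K) := by
    simp only [conv, orbitChar, convCount]
    rw [← Fintype.sum_prod_type' (f := fun (f'' : PFlag F d m) (u : Fin d → F) =>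
      (if InOrbit X f f'' u then (1 : K) else 0) * if InOrbit Y f'' g (w - u) then 1 else 0)]
    simp only [← ite_and, mul_ite, mul_one, mul_zero]
    rw [Finset.sum_ite, Finset.sum_const_zero, add_zero, Finset.sum_const, nsmul_one,
      ncard_setOf_eq_card_filter]
    congr 3
    ext x
    exact and_comm
  rw [h1, h2]
  have h3 := hT Z f g w hZ
  have h4 : v ^ 2 = algebraMap ℤ K (Fintype.card F : ℤ) := by simp [hv]
  rw [h4, Polynomial.aeval_algebraMap_apply, Polynomial.coe_aeval_eq_eval, ← h3]
  simp

end Transfer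

/-- The properties of the right multiplication `mul` on a space with basis `e` that determine the
action of the generators: the linearity needed to expand products, and the products of two
basis vectors whose second factor occurs in a generator: its matrix is diagonal up to at most one
unit next to the diagonal, and its decoration is empty or, for a diagonal matrix, the corner. -/
structure IsRightMul {R M M' : Type*} [Field R] [AddCommGroup M] [Module R M] [AddCommGroup M']
    [Module R M'] {n m d : ℕ} (v : R) (mul : M → M' → M) (e : DecMat n m d → M)
    (e' : DecMat m m d → M') : Prop where
  smul_left : ∀ (c : R) x y, mul (c • x) y = c • mul x y
  smul_right : ∀ (c : R) x y, mul x (c • y) = c • mul x y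
  add_right : ∀ x y y', mul x (y + y') = mul x y + mul x y'
  raise : ∀ X (Y : DecMat m m d) (h h' : Fin m) a, (h' : ℕ) = h + 1 → Y.dec = ∅ →
    Y.mat = Matrix.diagonal a + Matrix.single h h' 1 → mul (e X) (e' Y)
      = ∑ Z, Polynomial.aeval (v ^ 2)
        (open Classical in if SameCols Y.mat Z.mat then raiseStruct X Z h h' else 0) • e Z
  lower : ∀ X (Y : DecMat m m d) (h h' : Fin m) a, (h' : ℕ) = h + 1 → Y.dec = ∅ →
    Y.mat = Matrix.diagonal a + Matrix.single h' h 1 → mul (e X) (e' Y)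
      = ∑ Z, Polynomial.aeval (v ^ 2)
        (open Classical in if SameCols Y.mat Z.mat then lowerStruct X Z h h' else 0) • e Z
  diagonal : ∀ X (Y : DecMat m m d) a, Y.dec = ∅ →
    Y.mat = Matrix.diagonal a → mul (e X) (e' Y)
      = ∑ Z, Polynomial.aeval (v ^ 2)
        (open Classical in if SameCols Y.mat Z.mat then if X = Z then 1 else 0 else 0 :
          Polynomial ℤ) • e Z
  corner : ∀ X (Y : DecMat m m d) (c : Fin m) a, (c : ℕ) = 0 → Y.dec = {(c, c)} →
    Y.mat = Matrix.diagonal a → mul (e X) (e' Y)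
      = ∑ Z, Polynomial.aeval (v ^ 2)
        (open Classical in if SameCols Y.mat Z.mat then cornerStruct X Z c - if X = Z then 1 else 0
          else 0) • e Z

theorem isRightMul_genConv {R : Type*} [Field R] (v : R) (n m d : ℕ) :
    IsRightMul v (genConv v) (genChar R (n := n) (m := m) (d := d))
      (genChar R (n := m) (m := m) (d := d)) where
  smul_left c x y := by
    funext Z
    simp [genConv, Finset.mul_sum, mul_assoc]
  smul_right c x y := by
    funext Z
    simp [genConv, Finset.mul_sum, mul_assoc, mul_left_comm]
  add_right x y y' := by
    funext Z
    simp [genConv, mul_add, add_mul, Finset.sum_add_distrib]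
  raise X Y h h' a hh hY ha := genConv_genChar v fun Z _ _ _ _ _ _ H =>
    convCount_raise_eq_eval H hh hY ha
  lower X Y h h' a hh hY ha := genConv_genChar v fun Z _ _ _ _ _ _ H =>
    convCount_lower_eq_eval H hh hY ha
  diagonal X Y a hY ha := genConv_genChar v fun Z _ _ _ _ _ _ H =>
    convCount_diagonal_eq_eval H hY ha
  corner X Y c a hc hY ha := genConv_genChar v fun Z _ _ _ _ _ _ H =>
    convCount_corner_eq_eval H hc hY ha

theorem isRightMul_conv {K : Type*} [Field K] (F : Type*) [Field F] [Fintype F] (v : K)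
    (hv : v ^ 2 = (Fintype.card F : K)) (n m d : ℕ) :
    IsRightMul v conv (orbitChar K F (n := n) (m := m) (d := d))
      (orbitChar K F (n := m) (m := m) (d := d)) where
  smul_left c x y := by
    refine Subtype.ext ?_
    funext f g w
    simp [conv, Finset.mul_sum, mul_assoc]
  smul_right c x y := by
    refine Subtype.ext ?_
    funext f g w
    simp [conv, Finset.mul_sum, mul_left_comm]
  add_right x y y' := by
    refine Subtype.ext ?_
    funext f g w
    simp [conv, mul_add, Finset.sum_add_distrib]
  raise X Y h h' a hh hY ha := conv_orbitChar v hv fun Z _ _ _ H =>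
    convCount_raise_eq_eval H hh hY ha
  lower X Y h h' a hh hY ha := conv_orbitChar v hv fun Z _ _ _ H =>
    convCount_lower_eq_eval H hh hY ha
  diagonal X Y a hY ha := conv_orbitChar v hv fun Z _ _ _ H =>
    convCount_diagonal_eq_eval H hY ha
  corner X Y c a hc hY ha := conv_orbitChar v hv fun Z _ _ _ H =>
    convCount_corner_eq_eval H hc hY ha

/-! ### The action of the generators on basis vectors -/

theorem sameCols_iff {k n m : ℕ} {B : Matrix (Fin k) (Fin m) ℕ} {A : Matrix (Fin n) (Fin m) ℕ} :
    SameCols B A ↔ ∀ j, ∑ i, B i j = ∑ i, A i j := by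
  have hstep : ∀ {r : ℕ} (C : Matrix (Fin r) (Fin m) ℕ) (j : Fin m),
      rectSum C r (j + 1) = rectSum C r j + ∑ i, C i j := by
    classical
    intro r C j
    unfold rectSum
    simp only [Finset.sum_filter, Fin.is_lt, true_and, Fintype.sum_prod_type,
      ← Finset.sum_add_distrib]
    refine Finset.sum_congr rfl fun i _ => ?_
    have : C i j = ∑ j', if j' = j then C i j' else 0 := by simp
    rw [this, ← Finset.sum_add_distrib]
    refine Finset.sum_congr rfl fun j' _ => ?_
    simp only [Fin.ext_iff]
    split_ifs <;> omega
  constructor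
  · intro h j
    have h1 := h (j + 1) j.2
    have h2 := h j j.2.le
    rw [hstep, hstep] at h1
    omega
  · intro h t
    induction t with
    | zero => intro _; simp [rectSum]
    | succ t ih =>
      intro ht
      have := h ⟨t, ht⟩
      have h1 := hstep B ⟨t, ht⟩
      have h2 := hstep A ⟨t, ht⟩
      simp only at h1 h2
      rw [h1, h2, ih (by omega), this]

section Families

variable {n m d : ℕ}

theorem sum_diagonal_add (a : Fin m → ℕ) (B : Matrix (Fin m) (Fin m) ℕ) (j : Fin m) :
    ∑ i, (Matrix.diagonal a + B) i j = a j + ∑ i, B i j := by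
  simp [Matrix.add_apply, Finset.sum_add_distrib, Matrix.diagonal_apply]

/-- There is a matrix with the column sums of `Z` that differs from `B` by a diagonal matrix,
provided the column sums of `B` are not larger. -/
theorem exists_decMat_sameCols (Z : DecMat n m d) (B : Matrix (Fin m) (Fin m) ℕ)
    (D : Finset (Fin m × Fin m)) (hB : ∀ j, ∑ i, B i j ≤ ∑ i, Z.mat i j)
    (hD : D = ∅ ∨ ∃ c, D = {(c, c)} ∧ ∑ i, B i c < ∑ i, Z.mat i c) :
    ∃ Y : DecMat m m d, Y.dec = D ∧
      Y.mat = Matrix.diagonal (fun j => ∑ i, Z.mat i j - ∑ i, B i j) + B ∧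
      SameCols Y.mat Z.mat := by
  have hcol : ∀ j, ∑ i, (Matrix.diagonal (fun j => ∑ i, Z.mat i j - ∑ i, B i j) + B) i j
      = ∑ i, Z.mat i j := fun j => by
    rw [sum_diagonal_add]
    have := hB j
    omega
  refine ⟨⟨Matrix.diagonal (fun j => ∑ i, Z.mat i j - ∑ i, B i j) + B, D, ?_, ?_, ?_⟩, rfl, rfl,
    sameCols_iff.mpr hcol⟩
  · intro x hx
    rcases hD with rfl | ⟨c, rfl, hc⟩
    · simp at hx
    · rw [Finset.mem_singleton] at hx
      subst hx
      simp only [Matrix.add_apply, Matrix.diagonal_apply_eq]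
      omega
  · intro x hx y hy hxy
    rcases hD with rfl | ⟨c, rfl, hc⟩
    · simp at hx
    · rw [Finset.mem_singleton] at hx hy
      exact absurd (hx.trans hy.symm) hxy
  · refine Finset.sum_comm.trans ((Finset.sum_congr rfl fun j _ => hcol j).trans ?_)
    exact Finset.sum_comm.trans Z.isDec.total

open scoped Classical in
/-- A sum over the decorated matrices with decoration `D` that differ from `B` by a diagonal matrix
reduces to a single term, since the column sums determine the diagonal. -/
theorem sum_ite_sameCols {R : Type*} [Field R] (Z : DecMat n m d) (B : Matrix (Fin m) (Fin m) ℕ)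
    (D : Finset (Fin m × Fin m)) (wt : DecMat m m d → R) (k P : R)
    (hP : P = 0 ∨ ∃ Y : DecMat m m d, Y.dec = D ∧ (∃ a, Y.mat = Matrix.diagonal a + B) ∧
      SameCols Y.mat Z.mat ∧ wt Y = k) :
    ∑ Y : DecMat m m d with Y.dec = D ∧ ∃ a : Fin m → ℕ, Y.mat = Matrix.diagonal a + B,
      wt Y * (if SameCols Y.mat Z.mat then P else 0) = k * P := by
  rcases hP with rfl | ⟨Y, hY, ⟨a, ha⟩, hYZ, rfl⟩
  · simp
  · rw [Finset.sum_eq_single Y]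
    · rw [if_pos hYZ]
    · intro Y' hY' hne
      rw [if_neg, mul_zero]
      intro h1
      obtain ⟨h2, a', ha'⟩ := (Finset.mem_filter.mp hY').2
      refine hne (DecMat.ext ?_ (h2.trans hY.symm))
      have : a' = a := by
        funext j
        have h3 := (sameCols_iff.mp h1 j).trans (sameCols_iff.mp hYZ j).symm
        rw [ha, ha', sum_diagonal_add, sum_diagonal_add] at h3
        omega
      rw [ha, ha', this]
    · intro h1
      exact absurd (Finset.mem_filter.mpr ⟨Finset.mem_univ _, hY, a, ha⟩) h1

/-- The normalizing exponent of the summands of `E_h` and `F_h`. -/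
theorem normExp_diagonal_add_single (a : Fin m → ℕ) {p r : Fin m}
    (hpr : (r : ℕ) = p + 1 ∨ (p : ℕ) = r + 1) :
    normExp (Matrix.diagonal a + Matrix.single p r 1) ∅ = -(a p : ℤ) := by
  classical
  set B := Matrix.diagonal a + Matrix.single p r 1 with hB
  have hne : p ≠ r := by
    rintro rfl
    omega
  have hzero : ∀ i j, i ≠ j → ¬ (i = p ∧ j = r) → B i j = 0 := fun i j h1 h2 => by
    rw [hB, Matrix.add_apply, Matrix.diagonal_apply_ne _ h1,
      Matrix.single_apply_of_ne _ _ _ _ _ fun h3 => h2 ⟨h3.1.symm, h3.2.symm⟩, add_zero]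
  have hpp : B p p = a p := by
    rw [hB, Matrix.add_apply, Matrix.diagonal_apply_eq,
      Matrix.single_apply_of_ne _ _ _ _ _ fun h3 => hne h3.2.symm, add_zero]
  have hpr1 : B p r = 1 := by
    rw [hB, Matrix.add_apply, Matrix.diagonal_apply_ne _ hne, Matrix.single_apply_same]
  -- the only nonzero product pairs the extra unit with the diagonal entry in its row
  have key : ∀ i j k l : Fin m, k ≤ i → j < l →
      ¬ ((i = p ∧ j = min p r) ∧ k = p ∧ l = max p r) → (B i j : ℤ) * (B k l : ℤ) = 0 := by
    intro i j k l h1 h2 h3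
    by_cases h4 : i = j
    · by_cases h5 : k = p ∧ l = r
      · obtain ⟨rfl, rfl⟩ := h5
        subst h4
        refine absurd ⟨⟨?_, ?_⟩, rfl, ?_⟩ h3 <;>
        · simp only [Fin.ext_iff, Fin.coe_min, Fin.coe_max, Fin.le_def, Fin.lt_def] at *
          omega
      · rw [hzero k l (by rintro rfl; subst h4; exact absurd (h2.trans_le h1) (lt_irrefl _)) h5]
        simp
    · by_cases h5 : i = p ∧ j = r
      · obtain ⟨rfl, rfl⟩ := h5
        by_cases h6 : k = l
        · subst h6
          refine absurd ⟨⟨rfl, ?_⟩, ?_, ?_⟩ h3 <;>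
          · simp only [Fin.ext_iff, Fin.coe_min, Fin.coe_max, Fin.le_def, Fin.lt_def] at *
            omega
        · rw [hzero k l h6 (by rintro ⟨rfl, rfl⟩; exact absurd h2 (lt_irrefl _))]
          simp
      · rw [hzero i j h4 h5]
        simp
  have hval : (B p (min p r) : ℤ) * (B p (max p r) : ℤ) = a p := by
    rcases hpr with h | h
    · have h1 : p ≤ r := Fin.le_def.mpr (by omega)
      rw [min_eq_left h1, max_eq_right h1, hpp, hpr1]
      simp
    · have h1 : r ≤ p := Fin.le_def.mpr (by omega)
      rw [min_eq_right h1, max_eq_left h1, hpp, hpr1]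
      simp
  have hlt : min p r < max p r := min_lt_max.mpr hne
  unfold normExp
  rw [Finset.sum_eq_single (p, min p r), Finset.sum_eq_single (p, max p r), hval]
  · simp
  · rintro ⟨k, l⟩ hx hkl
    obtain ⟨-, h1, h2⟩ := Finset.mem_filter.mp hx
    exact key _ _ _ _ h1 h2 fun h3 => hkl (Prod.ext h3.2.1 h3.2.2)
  · intro h1
    exact absurd (Finset.mem_filter.mpr ⟨Finset.mem_univ _, le_rfl, hlt⟩) h1
  · rintro ⟨i, j⟩ - hij
    refine Finset.sum_eq_zero ?_
    rintro ⟨k, l⟩ hx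
    obtain ⟨-, h1, h2⟩ := Finset.mem_filter.mp hx
    exact key _ _ _ _ h1 h2 fun h3 => hij (Prod.ext h3.1.1 h3.1.2)
  · exact fun h1 => absurd (Finset.mem_univ _) h1

open scoped Classical in
theorem sum_cross_diagonal (a : Fin m → ℕ) :
    ∑ x : Fin m × Fin m, ∑ y : Fin m × Fin m with y.1 ≤ x.1 ∧ x.2 < y.2,
      ((Matrix.diagonal a x.1 x.2 : ℕ) : ℤ) * ((Matrix.diagonal a y.1 y.2 : ℕ) : ℤ) = 0 := by
  refine Finset.sum_eq_zero ?_
  rintro ⟨i, j⟩ -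
  refine Finset.sum_eq_zero ?_
  rintro ⟨k, l⟩ hx
  obtain ⟨-, h1, h2⟩ := Finset.mem_filter.mp hx
  by_cases hij : i = j
  · have : k ≠ l := by
      rintro rfl
      subst hij
      exact absurd (lt_of_lt_of_le h2 h1) (lt_irrefl _)
    simp [Matrix.diagonal_apply_ne _ this]
  · simp [Matrix.diagonal_apply_ne _ hij]

theorem normExp_diagonal (a : Fin m → ℕ) : normExp (Matrix.diagonal a) ∅ = 0 := by
  classical
  unfold normExp
  rw [sum_cross_diagonal]
  simp

theorem normExp_diagonal_corner (a : Fin m → ℕ) {c : Fin m} (hc : (c : ℕ) = 0) :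
    normExp (Matrix.diagonal a) {(c, c)} = -(a c : ℤ) := by
  classical
  unfold normExp
  rw [sum_cross_diagonal, Finset.sum_eq_single (c, c)]
  · simp
  · rintro ⟨i, j⟩ hx hij
    obtain ⟨-, y, hy, h1, h2⟩ := Finset.mem_filter.mp hx
    rw [Finset.mem_singleton] at hy
    subst hy
    refine absurd (Prod.ext (Fin.ext ?_) (Fin.ext ?_)) hij <;>
    · simp only [Fin.le_def] at *
      omega
  · intro h1
    exact absurd (Finset.mem_filter.mpr
      ⟨Finset.mem_univ _, (c, c), Finset.mem_singleton_self _, le_rfl, le_rfl⟩) h1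

theorem sum_col_single (p r j : Fin m) :
    ∑ i, Matrix.single p r (1 : ℕ) i j = if j = r then 1 else 0 := by
  classical
  rw [Finset.sum_eq_single p]
  · simp [Matrix.single_apply, eq_comm]
  · intro i _ hi
    exact Matrix.single_apply_of_ne _ _ _ _ _ fun h => hi h.1.symm
  · simp

theorem exists_decMat_diagonal_add_single (Z : DecMat n m d) {p r : Fin m}
    (hpr : (r : ℕ) = p + 1 ∨ (p : ℕ) = r + 1) {i : Fin n} (hi : 0 < Z.mat i r) :
    ∃ Y : DecMat m m d, Y.dec = ∅ ∧ (∃ a, Y.mat = Matrix.diagonal a + Matrix.single p r 1) ∧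
      SameCols Y.mat Z.mat ∧ normExp Y.mat Y.dec = -∑ i, (Z.mat i p : ℤ) := by
  classical
  have hne : p ≠ r := by
    rintro rfl
    omega
  obtain ⟨Y, h1, h2, h3⟩ := exists_decMat_sameCols Z (Matrix.single p r 1) ∅ (fun j => by
    rw [sum_col_single]
    split_ifs with hj
    · subst hj
      exact hi.trans_le (Finset.single_le_sum (f := fun i => Z.mat i j) (fun _ _ => Nat.zero_le _)
        (Finset.mem_univ i))
    · exact Nat.zero_le _) (.inl rfl)
  refine ⟨Y, h1, ⟨_, h2⟩, h3, ?_⟩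
  rw [h1, h2, normExp_diagonal_add_single _ hpr, sum_col_single, if_neg hne]
  simp

theorem exists_decMat_diagonal (Z : DecMat n m d) :
    ∃ Y : DecMat m m d, Y.dec = ∅ ∧ (∃ a, Y.mat = Matrix.diagonal a) ∧
      SameCols Y.mat Z.mat ∧ normExp Y.mat Y.dec = 0 ∧ ∀ j, Y.mat j j = ∑ i, Z.mat i j := by
  obtain ⟨Y, h1, h2, h3⟩ := exists_decMat_sameCols Z 0 ∅ (fun j => by simp) (.inl rfl)
  simp only [Matrix.zero_apply, Finset.sum_const_zero, Nat.sub_zero, add_zero] at h2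
  refine ⟨Y, h1, ⟨_, h2⟩, h3, ?_, fun j => ?_⟩
  · rw [h1, h2, normExp_diagonal]
  · rw [h2, Matrix.diagonal_apply_eq]

theorem exists_decMat_diagonal_corner (Z : DecMat n m d) {c : Fin m} (hc : (c : ℕ) = 0)
    (hZ : 0 < ∑ i, Z.mat i c) :
    ∃ Y : DecMat m m d, Y.dec = {(c, c)} ∧ (∃ a, Y.mat = Matrix.diagonal a) ∧
      SameCols Y.mat Z.mat ∧ normExp Y.mat Y.dec = -(∑ i, Z.mat i c : ℕ) ∧
      Y.mat c c = ∑ i, Z.mat i c := by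
  obtain ⟨Y, h1, h2, h3⟩ := exists_decMat_sameCols Z 0 {(c, c)} (fun j => by simp)
    (.inr ⟨c, rfl, by simpa using hZ⟩)
  simp only [Matrix.zero_apply, Finset.sum_const_zero, Nat.sub_zero, add_zero] at h2
  refine ⟨Y, h1, ⟨_, h2⟩, h3, ?_, ?_⟩
  · rw [h1, h2, normExp_diagonal_corner _ hc]
  · rw [h2, Matrix.diagonal_apply_eq]

/-- If the first step vanishes, only the zero vector is counted. There is then no summand of `L`
with decoration `{(1,1)}`. -/
theorem cornerStruct_of_sum_eq_zero (X Z : DecMat n m d) {c : Fin m} (hZ : ∑ i, Z.mat i c = 0) :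
    cornerStruct X Z c = open Classical in if X = Z then 1 else 0 := by
  classical
  have hz : ∀ i, Z.mat i c = 0 := fun i => Finset.sum_eq_zero_iff.mp hZ i (Finset.mem_univ i)
  have hfil : ∀ Y : DecMat n m d, Y.mat = Z.mat → Y.dec.filter (·.2 ≠ c) = Y.dec := by
    intro Y hY
    refine Finset.filter_true_of_mem fun x hx h1 => ?_
    have := Y.isDec.pos x hx
    rw [hY, h1, hz] at this
    exact lt_irrefl _ this
  unfold cornerStruct
  by_cases h1 : X.mat = Z.mat
  · by_cases h2 : X.dec = Z.dec
    · rw [if_pos ⟨h1, by rw [h2]⟩, if_pos (DecMat.ext h1 h2)]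
      refine Finset.prod_eq_one fun i _ => ?_
      have h3 : (i, c) ∉ X.dec := fun h3 => by
        have := X.isDec.pos _ h3
        rw [h1, hz] at this
        exact lt_irrefl _ this
      rw [rowPoly, if_neg h3, hz]
      simp
    · rw [if_neg, if_neg fun h3 => h2 (by rw [h3])]
      rintro ⟨-, h3⟩
      rw [hfil X h1, hfil Z rfl] at h3
      exact h2 h3
  · rw [if_neg fun h2 => h1 h2.1, if_neg fun h3 => h1 (by rw [h3])]

end Families

namespace IsRightMul

open Polynomial

variable {R M M' : Type*} [Field R] [AddCommGroup M] [Module R M] [AddCommGroup M']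
  [Module R M'] {n m d : ℕ} {v : R} {mul : M → M' → M} {e : DecMat n m d → M}
  {e' : DecMat m m d → M'}

theorem sum_right (H : IsRightMul v mul e e') {ι : Type*} (s : Finset ι) (x : M) (y : ι → M') :
    mul x (∑ i ∈ s, y i) = ∑ i ∈ s, mul x (y i) := by
  classical
  induction s using Finset.induction_on with
  | empty =>
    have := H.smul_right 0 x 0
    simpa using this
  | insert i s hi ih => rw [Finset.sum_insert hi, Finset.sum_insert hi, H.add_right, ih]

theorem stdVec_eq (e : DecMat n m d → M) (v : R) (X : DecMat n m d) :
    stdVec v e X.mat X.dec = v ^ normExp X.mat X.dec • e X := by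
  rw [stdVec, dif_pos X.isDec]

open scoped Classical in
/-- The product of a basis vector with a sum of basis vectors over all matrices that differ from `B`
by a diagonal matrix: each basis vector of the result receives a contribution from only one summand.
-/
theorem mul_family (H : IsRightMul v mul e e') (X : DecMat n m d) (B : Matrix (Fin m) (Fin m) ℕ)
    (D : Finset (Fin m × Fin m)) (wt : DecMat m m d → R) (T : DecMat n m d → ℤ[X])
    (hT : ∀ Y : DecMat m m d, Y.dec = D → (∃ a, Y.mat = Matrix.diagonal a + B) →
      mul (e X) (e' Y) = ∑ Z, aeval (v ^ 2) (if SameCols Y.mat Z.mat then T Z else 0) • e Z)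
    (k : DecMat n m d → R)
    (hP : ∀ Z, T Z = 0 ∨ ∃ Y : DecMat m m d, Y.dec = D ∧ (∃ a, Y.mat = Matrix.diagonal a + B) ∧
      SameCols Y.mat Z.mat ∧ wt Y * v ^ normExp Y.mat Y.dec = k Z) :
    mul (e X) (∑ Y : DecMat m m d with Y.dec = D ∧ ∃ a : Fin m → ℕ, Y.mat = Matrix.diagonal a + B,
      wt Y • stdVec v e' Y.mat Y.dec) = ∑ Z, (k Z * aeval (v ^ 2) (T Z)) • e Z := by
  rw [H.sum_right]
  have h1 : ∀ Y ∈ Finset.univ.filter fun Y : DecMat m m d => Y.dec = D ∧ ∃ a : Fin m → ℕ,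
      Y.mat = Matrix.diagonal a + B, mul (e X) (wt Y • stdVec v e' Y.mat Y.dec)
      = ∑ Z, ((wt Y * v ^ normExp Y.mat Y.dec)
        * if SameCols Y.mat Z.mat then aeval (v ^ 2) (T Z) else 0) • e Z := by
    intro Y hY
    obtain ⟨-, h1, h2⟩ := Finset.mem_filter.mp hY
    rw [stdVec_eq, smul_smul, H.smul_right, hT Y h1 h2, Finset.smul_sum]
    refine Finset.sum_congr rfl fun Z _ => ?_
    rw [smul_smul]
    congr 2
    split_ifs <;> simp
  rw [Finset.sum_congr rfl h1, Finset.sum_comm]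
  refine Finset.sum_congr rfl fun Z _ => ?_
  rw [← Finset.sum_smul, sum_ite_sameCols Z B D]
  refine (hP Z).imp (fun h2 => by rw [h2, map_zero]) id

theorem mul_genOff_raise (H : IsRightMul v mul e e') (X : DecMat n m d) {h h' : Fin m}
    (hh : (h' : ℕ) = h + 1) :
    mul (e X) (genOff v e' h h')
      = ∑ Z, (v ^ (-(∑ i, (Z.mat i h : ℤ))) * aeval (v ^ 2) (raiseStruct X Z h h')) • e Z := by
  classical
  have := H.mul_family X (Matrix.single h h' 1) ∅ (fun _ => 1) (fun Z => raiseStruct X Z h h')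
    (fun Y hY ⟨a, ha⟩ => H.raise X Y h h' a hh hY ha)
    (fun Z => v ^ (-(∑ i, (Z.mat i h : ℤ)))) fun Z => ?_
  · simpa [genOff] using this
  · by_cases h0 : ∃ p, X.mat + Matrix.single p h' 1 = Z.mat + Matrix.single p h 1
    · obtain ⟨p, hp⟩ := h0
      have h1 := congrFun (congrFun hp p) h'
      have hne : h ≠ h' := by
        rintro rfl
        omega
      simp only [Matrix.add_apply, Matrix.single_apply_same] at h1
      rw [Matrix.single_apply_of_ne _ _ _ _ _ fun h3 => hne h3.2] at h1
      obtain ⟨Y, h2, h3, h4, h5⟩ :=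
        exists_decMat_diagonal_add_single Z (p := h) (r := h') (.inl hh) (i := p) (by omega)
      exact .inr ⟨Y, h2, h3, h4, by rw [h5, one_mul]⟩
    · exact .inl (Finset.sum_eq_zero fun p _ => if_neg fun h1 => h0 ⟨p, h1⟩)

theorem mul_genOff_lower (H : IsRightMul v mul e e') (X : DecMat n m d) {h h' : Fin m}
    (hh : (h' : ℕ) = h + 1) :
    mul (e X) (genOff v e' h' h)
      = ∑ Z, (v ^ (-(∑ i, (Z.mat i h' : ℤ))) * aeval (v ^ 2) (lowerStruct X Z h h')) • e Z := by
  classical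
  have := H.mul_family X (Matrix.single h' h 1) ∅ (fun _ => 1) (fun Z => lowerStruct X Z h h')
    (fun Y hY ⟨a, ha⟩ => H.lower X Y h h' a hh hY ha)
    (fun Z => v ^ (-(∑ i, (Z.mat i h' : ℤ)))) fun Z => ?_
  · simpa [genOff] using this
  · by_cases h0 : ∃ p, X.mat + Matrix.single p h 1 = Z.mat + Matrix.single p h' 1
    · obtain ⟨p, hp⟩ := h0
      have h1 := congrFun (congrFun hp p) h
      have hne : h' ≠ h := by
        rintro rfl
        omega
      simp only [Matrix.add_apply, Matrix.single_apply_same] at h1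
      rw [Matrix.single_apply_of_ne _ _ _ _ _ fun h3 => hne h3.2] at h1
      obtain ⟨Y, h2, h3, h4, h5⟩ :=
        exists_decMat_diagonal_add_single Z (p := h') (r := h) (.inr hh) (i := p) (by omega)
      exact .inr ⟨Y, h2, h3, h4, by rw [h5, one_mul]⟩
    · exact .inl (Finset.sum_eq_zero fun p _ => if_neg fun h1 => h0 ⟨p, h1⟩)

theorem mul_diagonal (H : IsRightMul v mul e e') (X : DecMat n m d) (r : Fin m) (s : ℤ) :
    open Classical in
    mul (e X) (∑ Y : DecMat m m d with Y.dec = ∅ ∧ ∃ a : Fin m → ℕ, Y.mat = Matrix.diagonal a,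
      v ^ (s * (Y.mat r r : ℤ)) • stdVec v e' Y.mat Y.dec)
      = v ^ (s * ∑ i, (X.mat i r : ℤ)) • e X := by
  classical
  have := H.mul_family X 0 ∅ (fun Y => v ^ (s * (Y.mat r r : ℤ))) (fun Z => if X = Z then 1 else 0)
    (fun Y hY ⟨a, ha⟩ => by
      rw [H.diagonal X Y a hY (by rw [ha, add_zero])])
    (fun Z => v ^ (s * ∑ i, (Z.mat i r : ℤ))) fun Z => ?_
  · simp only [add_zero] at this
    rw [this, Finset.sum_eq_single X]
    · simp
    · intro Z _ hZ
      simp [hZ.symm]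
    · simp
  · obtain ⟨Y, h1, ⟨a, h2⟩, h3, h4, h5⟩ := exists_decMat_diagonal Z
    refine .inr ⟨Y, h1, ⟨a, by rw [h2, add_zero]⟩, h3, ?_⟩
    rw [h4, h5]
    simp

theorem mul_genH (H : IsRightMul v mul e e') (X : DecMat n m d) (r : Fin m) (s : ℤ) :
    mul (e X) (genH v e' r s) = v ^ (-s * ∑ i, (X.mat i r : ℤ)) • e X := by
  rw [genH, H.mul_diagonal]

theorem mul_genL (H : IsRightMul v mul e e') (hv : v ≠ 0) (X : DecMat n m d) {c : Fin m}
    (hc : (c : ℕ) = 0) :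
    mul (e X) (genL v e' c)
      = ∑ Z, (v ^ (-2 * ∑ i, (Z.mat i c : ℤ)) * aeval (v ^ 2) (cornerStruct X Z c)) • e Z := by
  classical
  have := H.mul_family X 0 {(c, c)} (fun Y => v ^ (-(Y.mat c c : ℤ)))
    (fun Z => cornerStruct X Z c - if X = Z then 1 else 0)
    (fun Y hY ⟨a, ha⟩ => H.corner X Y c a hc hY (by rw [ha, add_zero]))
    (fun Z => v ^ (-2 * ∑ i, (Z.mat i c : ℤ))) fun Z => ?_
  · simp only [add_zero] at this
    rw [genL, H.add_right, H.mul_diagonal, this]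
    have h1 : v ^ (-2 * ∑ i, (X.mat i c : ℤ)) • e X
        = ∑ Z, (v ^ (-2 * ∑ i, (Z.mat i c : ℤ)) * if X = Z then 1 else 0) • e Z := by
      rw [Finset.sum_eq_single X]
      · simp
      · intro Z _ hZ
        simp [hZ.symm]
      · simp
    rw [h1, ← Finset.sum_add_distrib]
    refine Finset.sum_congr rfl fun Z _ => ?_
    rw [← add_smul, ← mul_add]
    congr 2
    split_ifs <;> simp
  · rcases Nat.eq_zero_or_pos (∑ i, Z.mat i c) with h0 | h0
    · left
      rw [cornerStruct_of_sum_eq_zero X Z h0, sub_self]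
    · obtain ⟨Y, h1, ⟨a, h2⟩, h3, h4, h5⟩ := exists_decMat_diagonal_corner Z hc h0
      refine .inr ⟨Y, h1, ⟨a, by rw [h2, add_zero]⟩, h3, ?_⟩
      rw [h4, h5, ← zpow_add₀ hv]
      congr 1
      push_cast
      ring

end IsRightMul

/-! ### Exponents -/

section Exponents

variable {n m : ℕ}

theorem mem_lowerClosure_finset {Δ : Finset (Fin n × Fin m)} {x : Fin n × Fin m} :
    x ∈ lowerClosure (Δ : Set (Fin n × Fin m)) ↔ ∃ y ∈ Δ, x.1 ≤ y.1 ∧ x.2 ≤ y.2 := by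
  simp only [mem_lowerClosure, Finset.mem_coe, Prod.le_def]

open scoped Classical in
/-- The quadratic part of `normExp`. -/
noncomputable def crossSum (A : Matrix (Fin n) (Fin m) ℕ) : ℤ :=
  ∑ x : Fin n × Fin m, ∑ y : Fin n × Fin m with y.1 ≤ x.1 ∧ x.2 < y.2,
    (A x.1 x.2 : ℤ) * (A y.1 y.2 : ℤ)

/-- The normalizing exponent is a quadratic form in `A`, and a sum over the columns of the cells
below `Δ`. -/
theorem normExp_eq (A : Matrix (Fin n) (Fin m) ℕ) (Δ : Finset (Fin n × Fin m)) :
    normExp A Δ = -crossSum A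
      - ∑ j, colSum A j fun i => (i, j) ∈ lowerClosure (Δ : Set (Fin n × Fin m)) := by
  classical
  unfold normExp crossSum colSum
  congr 1
  simp only [Finset.sum_filter, mem_lowerClosure_finset]
  rw [Fintype.sum_prod_type_right]

theorem colSum_congr (A : Matrix (Fin n) (Fin m) ℕ) (c : Fin m) {P Q : Fin n → Prop}
    (h : ∀ i, P i ↔ Q i) : colSum A c P = colSum A c Q := by
  rw [funext fun i => propext (h i)]

theorem colSum_eq_add (A : Matrix (Fin n) (Fin m) ℕ) (c : Fin m) (P Q : Fin n → Prop) :
    colSum A c P = colSum A c (fun i => P i ∧ Q i) + colSum A c (fun i => P i ∧ ¬ Q i) := by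
  classical
  simp only [colSum, Finset.sum_filter, ← Finset.sum_add_distrib]
  refine Finset.sum_congr rfl fun i _ => ?_
  by_cases h1 : P i <;> by_cases h2 : Q i <;> simp [h1, h2]

theorem colSum_true (A : Matrix (Fin n) (Fin m) ℕ) (c : Fin m) (P : Fin n → Prop)
    (h : ∀ i, P i) : colSum A c P = ∑ i, (A i c : ℤ) := by
  simp [colSum, h]

theorem colSum_false (A : Matrix (Fin n) (Fin m) ℕ) (c : Fin m) (P : Fin n → Prop)
    (h : ∀ i, ¬ P i) : colSum A c P = 0 := by
  simp [colSum, h]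

/-- If two decorations generate lower sets that differ only in the column `c`, the exponents differ
by sums over this column. -/
theorem normExp_sub_of_column (A : Matrix (Fin n) (Fin m) ℕ) (Δ Δ' : Finset (Fin n × Fin m))
    (c : Fin m) (h : ∀ i j, j ≠ c → ((i, j) ∈ lowerClosure (Δ : Set (Fin n × Fin m)) ↔
      (i, j) ∈ lowerClosure (Δ' : Set (Fin n × Fin m)))) :
    normExp A Δ - normExp A Δ'
      = colSum A c (fun i => (i, c) ∈ lowerClosure (Δ' : Set (Fin n × Fin m)))
        - colSum A c (fun i => (i, c) ∈ lowerClosure (Δ : Set (Fin n × Fin m))) := by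
  classical
  rw [normExp_eq, normExp_eq, ← Finset.add_sum_erase _ _ (Finset.mem_univ c),
    ← Finset.add_sum_erase (a := c) _ (fun j => colSum A j fun i =>
      (i, j) ∈ lowerClosure (Δ' : Set (Fin n × Fin m))) (Finset.mem_univ c)]
  have : ∀ j ∈ Finset.univ.erase c,
      colSum A j (fun i => (i, j) ∈ lowerClosure (Δ : Set (Fin n × Fin m)))
        = colSum A j (fun i => (i, j) ∈ lowerClosure (Δ' : Set (Fin n × Fin m))) :=
    fun j hj => colSum_congr A j fun i => h i j (Finset.mem_erase.mp hj).1
  rw [Finset.sum_congr rfl this]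
  ring

theorem moveCell_apply (A : Matrix (Fin n) (Fin m) ℕ) {p : Fin n} {c c' : Fin m} (hc : c ≠ c')
    (hp : 1 ≤ A p c) (i : Fin n) (j : Fin m) :
    (moveCell A p c c' i j : ℤ) = A i j + ((if i = p ∧ j = c' then 1 else 0)
      - if i = p ∧ j = c then 1 else 0) := by
  classical
  unfold moveCell
  rw [Matrix.sub_apply, Matrix.add_apply, Matrix.single_apply, Matrix.single_apply]
  by_cases hi : i = p
  · subst hi
    by_cases h1 : j = c'
    · subst h1
      simp [hc.symm, hc]
    · by_cases h2 : j = c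
      · subst h2
        simp only [hc.symm, and_false, if_false, add_zero, and_self, if_true]
        omega
      · simp [h1, h2, Ne.symm h1, Ne.symm h2]
  · simp [hi, Ne.symm hi]

theorem eq_moveCell_iff (A B : Matrix (Fin n) (Fin m) ℕ) {p : Fin n} {c c' : Fin m}
    (hc : c ≠ c') : A + Matrix.single p c' 1 = B + Matrix.single p c 1 ↔
      1 ≤ A p c ∧ B = moveCell A p c c' := by
  constructor
  · intro h
    refine ⟨?_, ?_⟩
    · have := congrFun (congrFun h p) c
      simp only [Matrix.add_apply, Matrix.single_apply_same] at this
      rw [Matrix.single_apply_of_ne _ _ _ _ _ fun h3 => hc h3.2.symm] at this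
      omega
    · rw [moveCell, h]
      ext i j
      simp
  · rintro ⟨h, rfl⟩
    unfold moveCell
    ext i j
    simp only [Matrix.add_apply, Matrix.sub_apply, Matrix.single_apply]
    split_ifs with h1 h2 h2
    · omega
    · omega
    · obtain ⟨rfl, rfl⟩ := h2
      omega
    · omega

theorem colSum_moveCell (A : Matrix (Fin n) (Fin m) ℕ) {p : Fin n} {c c' : Fin m} (hc : c ≠ c')
    (hp : 1 ≤ A p c) (j : Fin m) (P : Fin n → Prop) :
    open Classical in
    colSum (moveCell A p c c') j P = colSum A j P + ((if j = c' ∧ P p then 1 else 0)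
      - if j = c ∧ P p then 1 else 0) := by
  classical
  simp only [colSum, moveCell_apply A hc hp, Finset.sum_add_distrib, Finset.sum_sub_distrib]
  congr 2 <;>
  · simp only [Finset.sum_filter]
    rw [Finset.sum_eq_single p]
    · split_ifs <;> simp_all
    · intro i _ hi
      simp [hi]
    · simp

/-- Expand the quadratic form at `A + s`, where `s` is the difference of the two matrix units: the
terms of first order are sums over the two columns concerned. -/
theorem crossSum_moveCell (A : Matrix (Fin n) (Fin m) ℕ) {p : Fin n} {h h' : Fin m}
    (hh : (h' : ℕ) = h + 1) (hp : 1 ≤ A p h) :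
    crossSum (moveCell A p h h')
      = crossSum A + colSum A h (fun i => p ≤ i) - colSum A h' (fun i => i ≤ p) - 1 := by
  classical
  have hne : h ≠ h' := by
    rintro rfl
    omega
  let C : Fin n × Fin m → Fin n × Fin m → Prop := fun x y => y.1 ≤ x.1 ∧ x.2 < y.2
  let s : Fin n × Fin m → ℤ := fun x => (if x.1 = p ∧ x.2 = h' then 1 else 0)
      - if x.1 = p ∧ x.2 = h then 1 else 0
  -- a sum against `s` is the difference of two values
  have hs : ∀ g : Fin n × Fin m → ℤ, ∑ x, s x * g x = g (p, h') - g (p, h) := by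
    intro g
    have : ∀ x : Fin n × Fin m, s x = (if x = (p, h') then 1 else 0) - if x = (p, h) then 1 else 0 :=
      fun x => by simp only [s, Prod.ext_iff]
    simp [this, sub_mul, Finset.sum_sub_distrib]
  have h1 : ∀ x : Fin n × Fin m, (if C x (p, h') then (1 : ℤ) else 0) - (if C x (p, h) then 1 else 0)
      = if p ≤ x.1 ∧ x.2 = h then 1 else 0 := by
    intro x
    simp only [C, Fin.lt_def, Fin.ext_iff, Fin.le_def]
    split_ifs <;> omega
  have h2 : ∀ y : Fin n × Fin m, (if C (p, h') y then (1 : ℤ) else 0) - (if C (p, h) y then 1 else 0)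
      = -if y.1 ≤ p ∧ y.2 = h' then 1 else 0 := by
    intro x
    simp only [C, Fin.lt_def, Fin.ext_iff, Fin.le_def]
    split_ifs <;> omega
  have hcol : ∀ (j : Fin m) (P : Fin n → Prop) [DecidablePred P],
      ∑ x : Fin n × Fin m, (A x.1 x.2 : ℤ) * (if P x.1 ∧ x.2 = j then 1 else 0) = colSum A j P := by
    intro j P _
    rw [Fintype.sum_prod_type, colSum, Finset.sum_filter]
    refine Finset.sum_congr rfl fun i _ => ?_
    rw [Finset.sum_eq_single j]
    · by_cases hi : P i <;> simp [hi]
    · intro j' _ hj'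
      simp [hj']
    · simp
  have hexp : crossSum (moveCell A p h h') = crossSum A
      + ∑ x : Fin n × Fin m, (A x.1 x.2 : ℤ) * ∑ y, s y * (if C x y then 1 else 0)
      + ∑ y : Fin n × Fin m, (A y.1 y.2 : ℤ) * ∑ x, s x * (if C x y then 1 else 0)
      + ∑ x, s x * ∑ y, s y * (if C x y then 1 else 0) := by
    simp only [crossSum, moveCell_apply A hne hp, Finset.sum_filter, Finset.mul_sum]
    rw [Finset.sum_comm (f := fun (y x : Fin n × Fin m) =>
      (A y.1 y.2 : ℤ) * (s x * if C x y then 1 else 0))]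
    simp only [← Finset.sum_add_distrib]
    refine Finset.sum_congr rfl fun x _ => Finset.sum_congr rfl fun y _ => ?_
    by_cases hxy : C x y
    · rw [if_pos hxy, if_pos hxy, if_pos hxy]
      simp only [s]
      ring
    · rw [if_neg hxy, if_neg hxy, if_neg hxy]
      ring
  rw [hexp]
  simp only [hs, h1, h2, mul_neg, Finset.sum_neg_distrib]
  rw [hcol h fun i => p ≤ i, hcol h' fun i => i ≤ p]
  simp [hne.symm]
  ring

end Exponents

section QBar

variable {R : Type*} [Field R] {v : R}

theorem qbar_one (v : R) (N : ℕ) :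
    qbar v N 1 = (v ^ (-2 * (N : ℤ)) - 1) / (v ^ (-2 : ℤ) - 1) := by
  simp [qbar]

/-- The defining relation of the `q`-integers, free of denominators. -/
theorem one_sub_mul_qbar (hv1 : v ^ 2 ≠ 1) (N : ℕ) :
    (1 - v ^ (-2 : ℤ)) * qbar v N 1 = 1 - v ^ (-2 * (N : ℤ)) := by
  have h : v ^ (-2 : ℤ) - 1 ≠ 0 := by
    rw [sub_ne_zero, zpow_neg]
    intro h
    exact hv1 (by rw [inv_eq_one] at h; exact_mod_cast h)
  rw [qbar_one, mul_div_assoc', div_eq_iff h]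
  generalize v ^ (-2 : ℤ) = a
  ring

theorem zpow_two_mul_natCast (v : R) (N : ℕ) : (v ^ 2) ^ N = v ^ (2 * (N : ℤ)) := by
  rw [← pow_mul, ← zpow_natCast]
  push_cast
  rfl

/-- The `q`-integer `1 + q + ⋯ + q^{N-1}` at `q = v ^ 2` in terms of the one at `q = v ^ (-2)`. -/
theorem sum_pow_eq_qbar (hv : v ≠ 0) (hv1 : v ^ 2 ≠ 1) (N : ℕ) :
    ∑ i ∈ Finset.range N, (v ^ 2) ^ i = v ^ (2 * (N : ℤ) - 2) * qbar v N 1 := by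
  have h1 : v ^ 2 - 1 ≠ 0 := sub_ne_zero.mpr hv1
  refine mul_right_cancel₀ h1 ?_
  rw [geom_sum_mul, zpow_two_mul_natCast]
  have h2 : v ^ 2 - 1 = v ^ (2 : ℤ) * (1 - v ^ (-2 : ℤ)) := by
    rw [mul_sub, ← zpow_add₀ hv]
    norm_cast
    simp
  have h3 : v ^ (2 * (N : ℤ) - 2) * qbar v N 1 * (v ^ 2 - 1)
      = (v ^ (2 * (N : ℤ) - 2) * v ^ (2 : ℤ)) * ((1 - v ^ (-2 : ℤ)) * qbar v N 1) := by
    rw [h2]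
    ring
  rw [h3, one_sub_mul_qbar hv1, ← zpow_add₀ hv, mul_sub, ← zpow_add₀ hv]
  simp

end QBar

/-! ### The action on normalized basis vectors -/

section Exponents

variable {n m : ℕ}

theorem colSum_add_not (A : Matrix (Fin n) (Fin m) ℕ) (c : Fin m) (P : Fin n → Prop) :
    colSum A c P + colSum A c (fun i => ¬ P i) = ∑ i, (A i c : ℤ) := by
  rw [← colSum_true A c (fun _ => True) fun _ => trivial, colSum_eq_add A c (fun _ => True) P]
  simp

theorem cast_sum_Iio (A : Matrix (Fin n) (Fin m) ℕ) (c : Fin m) (p : Fin n) :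
    ((∑ i ∈ Finset.Iio p, A i c : ℕ) : ℤ) = colSum A c fun i => i < p := by
  classical
  rw [Nat.cast_sum, colSum]
  refine Finset.sum_congr ?_ fun _ _ => rfl
  ext i
  simp

theorem cast_sum_Ioi (A : Matrix (Fin n) (Fin m) ℕ) (c : Fin m) (p : Fin n) :
    ((∑ i ∈ Finset.Ioi p, A i c : ℕ) : ℤ) = colSum A c fun i => p < i := by
  classical
  rw [Nat.cast_sum, colSum]
  refine Finset.sum_congr ?_ fun _ _ => rfl
  ext i
  simp

theorem colSum_le_eq (A : Matrix (Fin n) (Fin m) ℕ) (c : Fin m) (p : Fin n) :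
    colSum A c (fun i => i ≤ p) = colSum A c (fun i => i < p) + A p c := by
  classical
  simp only [colSum, Finset.sum_filter]
  have : (A p c : ℤ) = ∑ i, if i = p then (A i c : ℤ) else 0 := by simp
  rw [this, ← Finset.sum_add_distrib]
  refine Finset.sum_congr rfl fun i _ => ?_
  rcases lt_trichotomy i p with h | h | h
  · simp [h, h.le, h.ne]
  · simp [h]
  · simp [h.not_ge, h.not_gt, h.ne']

theorem colSum_ge_eq (A : Matrix (Fin n) (Fin m) ℕ) (c : Fin m) (p : Fin n) :
    colSum A c (fun i => p ≤ i) = colSum A c (fun i => p < i) + A p c := by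
  classical
  simp only [colSum, Finset.sum_filter]
  have : (A p c : ℤ) = ∑ i, if i = p then (A i c : ℤ) else 0 := by simp
  rw [this, ← Finset.sum_add_distrib]
  refine Finset.sum_congr rfl fun i _ => ?_
  rcases lt_trichotomy i p with h | h | h
  · simp [h.not_ge, h.not_gt, h.ne]
  · simp [h]
  · simp [h, h.le, h.ne']

open scoped Classical in
theorem normExp_moveCell (A : Matrix (Fin n) (Fin m) ℕ) (Δ : Finset (Fin n × Fin m)) {p : Fin n}
    {c c' : Fin m} (hc : c ≠ c') (hp : 1 ≤ A p c) :
    normExp (moveCell A p c c') Δ = normExp A Δ - (crossSum (moveCell A p c c') - crossSum A)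
      - ((if (p, c') ∈ lowerClosure (Δ : Set (Fin n × Fin m)) then 1 else 0)
        - if (p, c) ∈ lowerClosure (Δ : Set (Fin n × Fin m)) then 1 else 0) := by
  rw [normExp_eq, normExp_eq]
  simp only [colSum_moveCell A hc hp, Finset.sum_add_distrib, Finset.sum_sub_distrib, ite_and,
    Finset.sum_ite_eq', Finset.mem_univ, if_true]
  ring_nf

theorem moveCell_symm (A : Matrix (Fin n) (Fin m) ℕ) {p : Fin n} {c c' : Fin m} (hc : c ≠ c')
    (hp : 1 ≤ A p c) : 1 ≤ moveCell A p c c' p c' ∧ moveCell (moveCell A p c c') p c' c = A := by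
  have h := ((eq_moveCell_iff _ _ hc.symm).mp ((eq_moveCell_iff A _ hc).mpr ⟨hp, rfl⟩).symm)
  exact ⟨h.1, h.2.symm⟩

theorem crossSum_moveCell_lower (A : Matrix (Fin n) (Fin m) ℕ) {p : Fin n} {h h' : Fin m}
    (hh : (h' : ℕ) = h + 1) (hp : 1 ≤ A p h') :
    crossSum (moveCell A p h' h)
      = crossSum A - colSum A h (fun i => p ≤ i) + colSum A h' (fun i => i ≤ p) - 1 := by
  classical
  have hne : h' ≠ h := by
    rintro rfl
    omega
  obtain ⟨h1, h2⟩ := moveCell_symm A hne hp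
  have := crossSum_moveCell (moveCell A p h' h) hh h1
  rw [h2, colSum_moveCell A hne hp, colSum_moveCell A hne hp] at this
  simp [hne, hne.symm] at this
  linarith

theorem sum_moveCell (A : Matrix (Fin n) (Fin m) ℕ) {p : Fin n} {c c' : Fin m} (hc : c ≠ c')
    (hp : 1 ≤ A p c) : ∑ i, (moveCell A p c c' i c : ℤ) = ∑ i, (A i c : ℤ) - 1 := by
  rw [← colSum_true _ _ (fun _ => True) fun _ => trivial, colSum_moveCell A hc hp,
    ← colSum_true A _ (fun _ => True) fun _ => trivial]
  simp [hc]
  ring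

open scoped Classical in
theorem normExp_sub_raise (A : Matrix (Fin n) (Fin m) ℕ) (Δ Δ' : Finset (Fin n × Fin m))
    {p : Fin n} {h h' : Fin m} (hh : (h' : ℕ) = h + 1) (hp : 1 ≤ A p h) :
    normExp A Δ - normExp (moveCell A p h h') Δ' - ∑ i, (moveCell A p h h' i h : ℤ)
      = (normExp A Δ - normExp A Δ') - colSum A h (fun i => i < p) - colSum A h' (fun i => i ≤ p)
        + ((if (p, h') ∈ lowerClosure (Δ' : Set (Fin n × Fin m)) then 1 else 0)
          - if (p, h) ∈ lowerClosure (Δ' : Set (Fin n × Fin m)) then 1 else 0) := by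
  have hne : h ≠ h' := by
    rintro rfl
    omega
  rw [normExp_moveCell A Δ' hne hp, crossSum_moveCell A hh hp, sum_moveCell A hne hp]
  have h1 := colSum_add_not A h fun i => i < p
  simp only [not_lt] at h1
  linarith

open scoped Classical in
theorem normExp_sub_lower (A : Matrix (Fin n) (Fin m) ℕ) (Δ Δ' : Finset (Fin n × Fin m))
    {p : Fin n} {h h' : Fin m} (hh : (h' : ℕ) = h + 1) (hp : 1 ≤ A p h') :
    normExp A Δ - normExp (moveCell A p h' h) Δ' - ∑ i, (moveCell A p h' h i h' : ℤ)
      = (normExp A Δ - normExp A Δ') - colSum A h (fun i => p ≤ i) - colSum A h' (fun i => p < i)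
        + ((if (p, h) ∈ lowerClosure (Δ' : Set (Fin n × Fin m)) then 1 else 0)
          - if (p, h') ∈ lowerClosure (Δ' : Set (Fin n × Fin m)) then 1 else 0) := by
  have hne : h' ≠ h := by
    rintro rfl
    omega
  rw [normExp_moveCell A Δ' hne hp, crossSum_moveCell_lower A hh hp, sum_moveCell A hne hp]
  have h1 := colSum_add_not A h' fun i => p < i
  simp only [not_lt] at h1
  linarith

end Exponents

section Normalized

open Polynomial

variable {R M M' : Type*} [Field R] [AddCommGroup M] [Module R M] [AddCommGroup M']
  [Module R M'] {n m d : ℕ} {v : R} {mul : M → M' → M} {e : DecMat n m d → M}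
  {e' : DecMat m m d → M'}

theorem stdVec_of_not_isDecorated (v : R) (e : DecMat n m d → M) {A : Matrix (Fin n) (Fin m) ℕ}
    {Δ : Finset (Fin n × Fin m)} (h : ¬ IsDecorated d A Δ) : stdVec v e A Δ = 0 := by
  rw [stdVec, dif_neg h]

open scoped Classical in
/-- Sums over the decorated matrices with a given matrix are written as sums over all finite sets
`Δ` of cells, the terms with `Δ` not a decoration being zero. -/
theorem sum_smul_of_mat_eq (hv : v ≠ 0) (e : DecMat n m d → M) (A : Matrix (Fin n) (Fin m) ℕ)
    (c : Finset (Fin n × Fin m) → R) :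
    ∑ Z : DecMat n m d, (if Z.mat = A then c Z.dec else 0) • e Z
      = ∑ Δ, (v ^ (-normExp A Δ) * c Δ) • stdVec v e A Δ := by
  simp only [ite_smul, zero_smul]
  rw [← Finset.sum_filter, ← Finset.sum_filter_add_sum_filter_not _ (fun Δ => IsDecorated d A Δ),
    Finset.sum_eq_zero (s := Finset.univ.filter fun Δ => ¬ IsDecorated d A Δ) fun Δ hΔ => by
      rw [stdVec_of_not_isDecorated v e (Finset.mem_filter.mp hΔ).2, smul_zero], add_zero]
  refine Finset.sum_bij (fun Z _ => Z.dec) ?_ ?_ ?_ ?_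
  · intro Z hZ
    obtain rfl := (Finset.mem_filter.mp hZ).2
    exact Finset.mem_filter.mpr ⟨Finset.mem_univ _, Z.isDec⟩
  · intro Z hZ Z' hZ' h
    exact DecMat.ext ((Finset.mem_filter.mp hZ).2.trans (Finset.mem_filter.mp hZ').2.symm) h
  · intro Δ hΔ
    exact ⟨⟨A, Δ, (Finset.mem_filter.mp hΔ).2⟩, Finset.mem_filter.mpr ⟨Finset.mem_univ _, rfl⟩, rfl⟩
  · intro Z hZ
    obtain rfl := (Finset.mem_filter.mp hZ).2
    rw [IsRightMul.stdVec_eq, smul_smul, mul_right_comm, ← zpow_add₀ hv, neg_add_cancel, zpow_zero,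
      one_mul]

open scoped Classical in
theorem smul_sum_moveCell (hv : v ≠ 0) (e : DecMat n m d → M) (A : Matrix (Fin n) (Fin m) ℕ)
    (N : ℤ) {a b : Fin m} (hab : a ≠ b)
    (Q : Fin n → Matrix (Fin n) (Fin m) ℕ → Finset (Fin n × Fin m) → R) :
    v ^ N • ∑ Z : DecMat n m d, (v ^ (-∑ i, (Z.mat i a : ℤ)) *
        ∑ p, if A + Matrix.single p b 1 = Z.mat + Matrix.single p a 1 then Q p Z.mat Z.dec else 0)
          • e Z
      = ∑ p with 1 ≤ A p a, ∑ Δ,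
        (v ^ (N - normExp (moveCell A p a b) Δ - ∑ i, (moveCell A p a b i a : ℤ))
          * Q p (moveCell A p a b) Δ) • stdVec v e (moveCell A p a b) Δ := by
  have h1 : ∀ p, ∑ Z : DecMat n m d, (if Z.mat = moveCell A p a b then
        (v ^ (N - ∑ i, (moveCell A p a b i a : ℤ)) * Q p (moveCell A p a b) Z.dec) else 0) • e Z
      = ∑ Δ, (v ^ (N - normExp (moveCell A p a b) Δ - ∑ i, (moveCell A p a b i a : ℤ))
          * Q p (moveCell A p a b) Δ) • stdVec v e (moveCell A p a b) Δ := fun p => by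
    rw [sum_smul_of_mat_eq hv e _ fun Δ => v ^ (N - ∑ i, (moveCell A p a b i a : ℤ)) *
      Q p (moveCell A p a b) Δ]
    refine Finset.sum_congr rfl fun Δ _ => ?_
    rw [← mul_assoc, ← zpow_add₀ hv]
    congr 3
    ring
  simp only [← h1]
  rw [Finset.sum_comm, Finset.smul_sum]
  refine Finset.sum_congr rfl fun Z _ => ?_
  rw [smul_smul, ← mul_assoc, ← zpow_add₀ hv, Finset.mul_sum, Finset.sum_smul, Finset.sum_filter]
  refine Finset.sum_congr rfl fun p _ => ?_
  have h2 := eq_moveCell_iff A Z.mat (p := p) hab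
  by_cases h3 : 1 ≤ A p a
  · by_cases h4 : Z.mat = moveCell A p a b
    · rw [if_pos (h2.mpr ⟨h3, h4⟩), if_pos h3, if_pos h4, h4]
      rfl
    · rw [if_neg fun h5 => h4 (h2.mp h5).2, if_pos h3, if_neg h4, mul_zero]
  · rw [if_neg fun h5 => h3 (h2.mp h5).1, if_neg h3, mul_zero, zero_smul]

variable {A : Matrix (Fin n) (Fin m) ℕ} {Δ : Finset (Fin n × Fin m)} {h h' c : Fin m}

open scoped Classical in
/-- The product with `E_h` in terms of normalized basis vectors, before the sum over the decorations
is evaluated. -/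
theorem IsRightMul.mul_stdVec_raise (H : IsRightMul v mul e e') (hv : v ≠ 0)
    (hd : IsDecorated d A Δ) (hh : (h' : ℕ) = h + 1) :
    mul (stdVec v e A Δ) (genOff v e' h h') = ∑ p with 1 ≤ A p h, ∑ Δ',
        (v ^ (normExp A Δ - normExp (moveCell A p h h') Δ' - ∑ i, (moveCell A p h h' i h : ℤ))
          * aeval (v ^ 2) (raisePoly (moveCell A p h h') Δ Δ' h h' p))
            • stdVec v e (moveCell A p h h') Δ' := by
  have hne : h ≠ h' := by
    rintro rfl
    omega
  have h1 := stdVec_eq e v (⟨A, Δ, hd⟩ : DecMat n m d)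
  simp only at h1
  rw [h1, H.smul_left, H.mul_genOff_raise _ hh,
    ← smul_sum_moveCell hv e A (normExp A Δ) hne
      fun p B Δ' => aeval (v ^ 2) (raisePoly B Δ Δ' h h' p)]
  simp only [raiseStruct, map_sum, apply_ite (aeval (v ^ 2)), map_zero]

open scoped Classical in
/-- The product with `F_h` in terms of normalized basis vectors, before the sum over the decorations
is evaluated. -/
theorem IsRightMul.mul_stdVec_lower (H : IsRightMul v mul e e') (hv : v ≠ 0)
    (hd : IsDecorated d A Δ) (hh : (h' : ℕ) = h + 1) :
    mul (stdVec v e A Δ) (genOff v e' h' h) = ∑ p with 1 ≤ A p h', ∑ Δ',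
        (v ^ (normExp A Δ - normExp (moveCell A p h' h) Δ' - ∑ i, (moveCell A p h' h i h' : ℤ))
          * aeval (v ^ 2) (lowerPoly (moveCell A p h' h) Δ Δ' h h' p))
            • stdVec v e (moveCell A p h' h) Δ' := by
  have hne : h' ≠ h := by
    rintro rfl
    omega
  have h1 := stdVec_eq e v (⟨A, Δ, hd⟩ : DecMat n m d)
  simp only at h1
  rw [h1, H.smul_left, H.mul_genOff_lower _ hh,
    ← smul_sum_moveCell hv e A (normExp A Δ) hne
      fun p B Δ' => aeval (v ^ 2) (lowerPoly B Δ Δ' h h' p)]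
  simp only [lowerStruct, map_sum, apply_ite (aeval (v ^ 2)), map_zero]

open scoped Classical in
/-- The product with `L` in terms of normalized basis vectors: it changes the decoration only in the
first column. -/
theorem IsRightMul.mul_stdVec_genL (H : IsRightMul v mul e e') (hv : v ≠ 0)
    (hd : IsDecorated d A Δ) (hc : (c : ℕ) = 0) :
    mul (stdVec v e A Δ) (genL v e' c) = ∑ Δ' with Δ.filter (·.2 ≠ c) = Δ'.filter (·.2 ≠ c),
        (v ^ (normExp A Δ - normExp A Δ' - 2 * ∑ i, (A i c : ℤ))
          * ∏ i, aeval (v ^ 2) (rowPoly A Δ c i)) • stdVec v e A Δ' := by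
  have h1 := stdVec_eq e v (⟨A, Δ, hd⟩ : DecMat n m d)
  simp only at h1
  have h2 := sum_smul_of_mat_eq hv e A fun Δ' => (v ^ (normExp A Δ - 2 * ∑ i, (A i c : ℤ))
    * if Δ.filter (·.2 ≠ c) = Δ'.filter (·.2 ≠ c) then
      ∏ i, aeval (v ^ 2) (rowPoly A Δ c i) else 0)
  rw [h1, H.smul_left, H.mul_genL hv _ hc, Finset.sum_filter]
  have h3 : ∀ Δ', (if Δ.filter (·.2 ≠ c) = Δ'.filter (·.2 ≠ c) then
        (v ^ (normExp A Δ - normExp A Δ' - 2 * ∑ i, (A i c : ℤ))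
          * ∏ i, aeval (v ^ 2) (rowPoly A Δ c i)) • stdVec v e A Δ' else 0)
      = (v ^ (-normExp A Δ') * (v ^ (normExp A Δ - 2 * ∑ i, (A i c : ℤ))
    * if Δ.filter (·.2 ≠ c) = Δ'.filter (·.2 ≠ c) then
      ∏ i, aeval (v ^ 2) (rowPoly A Δ c i) else 0)) • stdVec v e A Δ' := fun Δ' => by
    split_ifs
    · rw [← mul_assoc, ← zpow_add₀ hv]
      congr 3
      ring
    · simp
  rw [Finset.sum_congr rfl fun Δ' _ => h3 Δ', ← h2, Finset.smul_sum]
  refine Finset.sum_congr rfl fun Z _ => ?_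
  rw [smul_smul]
  congr 1
  unfold cornerStruct
  by_cases h4 : Z.mat = A
  · simp only [h4, true_and, if_true]
    rw [← mul_assoc, ← zpow_add₀ hv, apply_ite (aeval (v ^ 2)), map_zero, map_prod]
    congr 2
    ring
  · rw [if_neg h4, if_neg fun h5 => h4 h5.1.symm]
    simp

end Normalized

/-! ### The product with `E_h` -/

section Corner

variable {n m : ℕ} {Δ : Finset (Fin n × Fin m)} {h h' : Fin m} {p : Fin n}

/-- The lower set generated by `Δ` reaches the column `h`, but not the column `h'`, in the row
`p`. This is the case in which moving an entry of the row `p` between the two columns changes the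
part of the normalizing exponent that depends on `Δ`. -/
def Corner (Δ : Finset (Fin n × Fin m)) (h h' : Fin m) (p : Fin n) : Prop :=
  (p, h) ∈ lowerClosure (Δ : Set (Fin n × Fin m)) ∧
    (p, h') ∉ lowerClosure (Δ : Set (Fin n × Fin m))

theorem mem_lowerClosure_of_le (hh : (h' : ℕ) = h + 1)
    (hp : (p, h') ∈ lowerClosure (Δ : Set (Fin n × Fin m))) :
    (p, h) ∈ lowerClosure (Δ : Set (Fin n × Fin m)) := by
  have h1 : (p, h) ≤ (p, h') := Prod.mk_le_mk.mpr ⟨le_rfl, Fin.le_def.mpr (by omega)⟩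
  exact (lowerClosure (Δ : Set (Fin n × Fin m))).lower h1 hp

open scoped Classical in
theorem ite_sub_ite_eq_corner (hh : (h' : ℕ) = h + 1) :
    ((if (p, h') ∈ lowerClosure (Δ : Set (Fin n × Fin m)) then 1 else 0)
      - if (p, h) ∈ lowerClosure (Δ : Set (Fin n × Fin m)) then 1 else 0 : ℤ)
      = -if Corner Δ h h' p then 1 else 0 := by
  unfold Corner
  by_cases h1 : (p, h') ∈ lowerClosure (Δ : Set (Fin n × Fin m))
  · have h2 := mem_lowerClosure_of_le hh h1
    simp [h1, h2]
  · simp [h1]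

/-- The decoration that arises in the product with `E_h` generates the same lower set as `Δ`, except
that it reaches the row `p` in the column `h'`. -/
theorem mem_lowerClosure_raised (hh : (h' : ℕ) = h + 1) (hp : Corner Δ h h' p) (i : Fin n)
    (j : Fin m) :
    (i, j) ∈ lowerClosure
        ((insert (p, h') ((Δ.filter (·.2 ≠ h')).erase (p, h)) : Finset (Fin n × Fin m)) :
          Set (Fin n × Fin m)) ↔
      if j = h' then i ≤ p else (i, j) ∈ lowerClosure (Δ : Set (Fin n × Fin m)) := by
  obtain ⟨hp1, hp2⟩ := hp
  rw [mem_lowerClosure_finset] at hp1 hp2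
  simp only [mem_lowerClosure_finset, Finset.mem_insert, Finset.mem_erase, Finset.mem_filter]
  obtain ⟨z, hz, hpz, hhz⟩ := hp1
  have hlt : ∀ y ∈ Δ, h' ≤ y.2 → y.1 < p := fun y hy h1 => by
    by_contra h2
    exact hp2 ⟨y, hy, not_lt.mp h2, h1⟩
  split_ifs with hj
  · subst hj
    constructor
    · rintro ⟨y, rfl | ⟨-, hy, -⟩, h1, h2⟩
      · exact h1
      · exact h1.trans (hlt y hy h2).le
    · exact fun h1 => ⟨(p, j), .inl rfl, h1, le_rfl⟩
  · constructor
    · rintro ⟨y, rfl | ⟨-, hy, -⟩, h1, h2⟩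
      · refine ⟨z, hz, h1.trans hpz, le_trans (Fin.le_def.mpr ?_) hhz⟩
        have h3 : (j : ℕ) ≠ h' := fun h4 => hj (Fin.ext h4)
        have h4 := Fin.le_def.mp h2
        simp only at h4 ⊢
        omega
      · exact ⟨y, hy, h1, h2⟩
    · rintro ⟨y, hy, h1, h2⟩
      by_cases h3 : y.2 = h'
      · exact ⟨(p, h'), .inl rfl, h1.trans (hlt y hy h3.ge).le, h2.trans h3.le⟩
      · by_cases h4 : y = (p, h)
        · subst h4
          exact ⟨(p, h'), .inl rfl, h1, h2.trans (Fin.le_def.mpr (by simp only; omega))⟩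
        · exact ⟨y, .inr ⟨h4, hy, h3⟩, h1, h2⟩

end Corner

section RaiseFormula

open Polynomial

variable {R : Type*} [Field R] {n m : ℕ} {v : R}

open scoped Classical in
theorem aeval_rowPoly (hv : v ≠ 0) (A : Matrix (Fin n) (Fin m) ℕ) (Δ : Finset (Fin n × Fin m))
    (c : Fin m) (i : Fin n) : aeval (v ^ 2) (rowPoly A Δ c i)
      = (if (i, c) ∈ lowerClosure (Δ : Set (Fin n × Fin m)) then v ^ (2 * (A i c : ℤ)) else 1)
        * if (i, c) ∈ Δ then 1 - v ^ (-2 * (A i c : ℤ)) else 1 := by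
  unfold rowPoly
  by_cases h1 : (i, c) ∈ Δ
  · have h2 : (i, c) ∈ lowerClosure (Δ : Set (Fin n × Fin m)) := subset_lowerClosure h1
    simp only [h1, h2, if_true, map_sub, map_pow, aeval_X, map_one, zpow_two_mul_natCast, mul_sub,
      mul_one]
    rw [← zpow_add₀ hv]
    simp
  · by_cases h2 : (i, c) ∈ lowerClosure (Δ : Set (Fin n × Fin m))
    · simp [h1, h2, zpow_two_mul_natCast]
    · simp [h1, h2]

theorem prod_zpow_eq_colSum (hv : v ≠ 0) (A : Matrix (Fin n) (Fin m) ℕ) (c : Fin m) (k : ℤ)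
    (P : Fin n → Prop) [DecidablePred P] :
    ∏ i, (if P i then v ^ (k * (A i c : ℤ)) else 1) = v ^ (k * colSum A c P) := by
  classical
  simp only [colSum, Finset.sum_filter, Finset.mul_sum]
  generalize (Finset.univ : Finset (Fin n)) = s
  induction s using Finset.induction_on with
  | empty => simp
  | insert i s hi ih =>
    rw [Finset.prod_insert hi, Finset.sum_insert hi, zpow_add₀ hv, ih]
    by_cases h : P i <;> simp [h]

open scoped Classical in
theorem prod_aeval_rowPoly (hv : v ≠ 0) (A : Matrix (Fin n) (Fin m) ℕ)
    (Δ : Finset (Fin n × Fin m)) (c : Fin m) : ∏ i, aeval (v ^ 2) (rowPoly A Δ c i)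
      = v ^ (2 * colSum A c fun i => (i, c) ∈ lowerClosure (Δ : Set (Fin n × Fin m)))
        * ∏ i with (i, c) ∈ Δ, (1 - v ^ (-2 * (A i c : ℤ))) := by
  simp only [aeval_rowPoly hv, Finset.prod_mul_distrib]
  rw [prod_zpow_eq_colSum hv,
    Finset.prod_filter]

variable {A : Matrix (Fin n) (Fin m) ℕ} {Δ : Finset (Fin n × Fin m)} {h h' : Fin m} {p : Fin n}

open scoped Classical in
/-- The coefficient of the term of the product with `E_h` that keeps the decoration. -/
theorem raise_coeff_self (hv : v ≠ 0) (hv1 : v ^ 2 ≠ 1) (hh : (h' : ℕ) = h + 1)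
    (hp : 1 ≤ A p h) :
    v ^ (normExp A Δ - normExp (moveCell A p h h') Δ - ∑ i, (moveCell A p h h' i h : ℤ))
      * aeval (v ^ 2) (((∑ i ∈ Finset.range (moveCell A p h h' p h'), X ^ i)
          - if (p, h') ∈ Δ then 1 else 0)
        * X ^ (∑ i ∈ Finset.Iio p, moveCell A p h h' i h') : ℤ[X])
      = v ^ (xi A h h' p - if Corner Δ h h' p then 1 else 0)
        * qbar v (A p h' + 1 - if (p, h') ∈ Δ then 1 else 0) 1 := by
  have hne : h ≠ h' := by
    rintro rfl
    omega
  have h1 : moveCell A p h h' p h' = A p h' + 1 := by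
    have := moveCell_apply A hne hp p h'
    simp [hne.symm] at this
    exact_mod_cast this
  have h2 : colSum (moveCell A p h h') h' (fun i => i < p) = colSum A h' fun i => i < p := by
    rw [colSum_moveCell A hne hp]
    simp
  have h3 : ∑ i ∈ Finset.range (A p h' + 1), (v ^ 2) ^ i - (if (p, h') ∈ Δ then 1 else 0)
      = v ^ (2 * (A p h' : ℤ)) * qbar v (A p h' + 1 - if (p, h') ∈ Δ then 1 else 0) 1 := by
    split_ifs
    · rw [Finset.sum_range_succ', pow_zero, add_sub_cancel_right, Nat.add_sub_cancel]
      simp only [pow_succ (v ^ 2)]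
      rw [← Finset.sum_mul, sum_pow_eq_qbar hv hv1, mul_right_comm]
      congr 1
      rw [← zpow_natCast v 2, ← zpow_add₀ hv]
      simp
    · rw [sum_pow_eq_qbar hv hv1, sub_zero, Nat.sub_zero]
      congr 2
      push_cast
      ring
  rw [normExp_sub_raise A Δ Δ hh hp, ite_sub_ite_eq_corner hh, h1]
  simp only [map_mul, map_sub, map_sum, map_pow, aeval_X, apply_ite (aeval (v ^ 2)), map_one,
    map_zero]
  rw [h3, zpow_two_mul_natCast, cast_sum_Iio, h2, ← mul_assoc, mul_right_comm, ← mul_assoc,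
    ← zpow_add₀ hv, ← zpow_add₀ hv]
  congr 2
  rw [xi, colSum_le_eq]
  ring

open scoped Classical in
/-- The coefficient of the term of the product with `E_h` that changes the decoration. -/
theorem raise_coeff_raised (hv : v ≠ 0) (hh : (h' : ℕ) = h + 1) (hp : 1 ≤ A p h)
    (hc : Corner Δ h h' p) :
    v ^ (normExp A Δ - normExp (moveCell A p h h')
          (insert (p, h') ((Δ.filter (·.2 ≠ h')).erase (p, h)))
        - ∑ i, (moveCell A p h h' i h : ℤ))
      * aeval (v ^ 2) (∏ i ∈ Finset.Iio p, rowPoly (moveCell A p h h') Δ h' i)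
      = v ^ (colSum A h' (fun i => (i, h') ∈ lowerClosure (Δ : Set (Fin n × Fin m)))
          - colSum A h (fun i => i < p))
        * ∏ i with (i, h') ∈ Δ, (1 - v ^ (-2 * (A i h' : ℤ))) := by
  have hne : h ≠ h' := by
    rintro rfl
    omega
  -- the lower set does not reach the row `p` in the column `h'`, so the product may be extended to
  -- all rows
  have hlt : ∀ i, (i, h') ∈ lowerClosure (Δ : Set (Fin n × Fin m)) → i < p := fun i hi => by
    by_contra h2
    have h3 : (p, h') ≤ (i, h') := Prod.mk_le_mk.mpr ⟨not_lt.mp h2, le_rfl⟩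
    exact hc.2 ((lowerClosure (Δ : Set (Fin n × Fin m))).lower h3 hi)
  have h1 : ∏ i ∈ Finset.Iio p, rowPoly (moveCell A p h h') Δ h' i = ∏ i, rowPoly A Δ h' i := by
    rw [← Finset.prod_subset (Finset.subset_univ (Finset.Iio p))]
    · refine Finset.prod_congr rfl fun i hi => ?_
      have h2 : moveCell A p h h' i h' = A i h' := by
        have := moveCell_apply A hne hp i h'
        simp [(Finset.mem_Iio.mp hi).ne] at this
        exact this
      rw [rowPoly, rowPoly, h2]
    · intro i _ hi
      have h2 : (i, h') ∉ lowerClosure (Δ : Set (Fin n × Fin m)) := fun h3 =>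
        hi (Finset.mem_Iio.mpr (hlt i h3))
      have h3 : (i, h') ∉ Δ := fun h3 => h2 (subset_lowerClosure h3)
      rw [rowPoly, if_neg h3, if_neg h2]
  rw [h1, map_prod, prod_aeval_rowPoly hv, ← mul_assoc, ← zpow_add₀ hv,
    normExp_sub_raise A _ _ hh hp, normExp_sub_of_column A Δ _ h' fun i j hj => by
      rw [mem_lowerClosure_raised hh hc, if_neg hj]]
  congr 2
  simp only [mem_lowerClosure_raised hh hc, if_true, if_neg hne, le_refl, hc.1]
  ring

variable {M M' : Type*} [AddCommGroup M] [Module R M] [AddCommGroup M'] [Module R M'] {d : ℕ}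
  {mul : M → M' → M} {e : DecMat n m d → M} {e' : DecMat m m d → M'}

open scoped Classical in
/-- The product with `E_h` for an arbitrary decoration. The several formulas result from it by
evaluating `Corner` and the membership of the cells of the columns `h` and `h'`. -/
theorem IsRightMul.mul_stdVec_raise_eq (H : IsRightMul v mul e e') (hv : v ≠ 0) (hv1 : v ^ 2 ≠ 1)
    (hd : IsDecorated d A Δ) (hh : (h' : ℕ) = h + 1) :
    mul (stdVec v e A Δ) (genOff v e' h h')
      = (∑ p with 1 ≤ A p h, (v ^ (xi A h h' p - if Corner Δ h h' p then 1 else 0)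
          * qbar v (A p h' + 1 - if (p, h') ∈ Δ then 1 else 0) 1) •
            stdVec v e (moveCell A p h h') Δ)
        + ∑ p with Corner Δ h h' p ∧ 1 ≤ A p h,
          (v ^ (colSum A h' (fun i => (i, h') ∈ lowerClosure (Δ : Set (Fin n × Fin m)))
              - colSum A h (fun i => i < p))
            * ∏ i with (i, h') ∈ Δ, (1 - v ^ (-2 * (A i h' : ℤ)))) •
          stdVec v e (moveCell A p h h') (insert (p, h') ((Δ.filter (·.2 ≠ h')).erase (p, h))) := by
  rw [H.mul_stdVec_raise hv hd hh]
  have h1 : ∀ s : Finset (Fin n), ∑ p ∈ s with Corner Δ h h' p ∧ 1 ≤ A p h,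
          (v ^ (colSum A h' (fun i => (i, h') ∈ lowerClosure (Δ : Set (Fin n × Fin m)))
              - colSum A h (fun i => i < p))
            * ∏ i with (i, h') ∈ Δ, (1 - v ^ (-2 * (A i h' : ℤ)))) •
          stdVec v e (moveCell A p h h') (insert (p, h') ((Δ.filter (·.2 ≠ h')).erase (p, h)))
      = ∑ p ∈ s with 1 ≤ A p h, if Corner Δ h h' p then
          (v ^ (colSum A h' (fun i => (i, h') ∈ lowerClosure (Δ : Set (Fin n × Fin m)))
              - colSum A h (fun i => i < p))
            * ∏ i with (i, h') ∈ Δ, (1 - v ^ (-2 * (A i h' : ℤ)))) •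
          stdVec v e (moveCell A p h h') (insert (p, h') ((Δ.filter (·.2 ≠ h')).erase (p, h)))
        else 0 := fun s => by
    rw [← Finset.sum_filter, Finset.filter_filter]
    simp only [and_comm]
  rw [h1, ← Finset.sum_add_distrib]
  refine Finset.sum_congr rfl fun p hp => ?_
  have hp := (Finset.mem_filter.mp hp).2
  simp only [raisePoly, map_add, mul_add, add_smul, Finset.sum_add_distrib]
  congr 1
  · rw [Finset.sum_eq_single Δ]
    · rw [if_pos rfl, raise_coeff_self hv hv1 hh hp]
    · intro Δ' _ hne
      rw [if_neg hne.symm, map_zero, mul_zero, zero_smul]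
    · simp
  · split_ifs with hc
    · rw [Finset.sum_eq_single (insert (p, h') ((Δ.filter (·.2 ≠ h')).erase (p, h)))]
      · rw [if_pos ⟨hc.1, hc.2, rfl⟩, raise_coeff_raised hv hh hp hc]
      · intro Δ' _ hne
        rw [if_neg fun h2 => hne h2.2.2, map_zero, mul_zero, zero_smul]
      · simp
    · refine Finset.sum_eq_zero fun Δ' _ => ?_
      rw [if_neg fun h2 => hc ⟨h2.1, h2.2.1⟩, map_zero, mul_zero, zero_smul]

end RaiseFormula

/-! ### Evaluation of the product with `E_h` -/

section Decorations

variable {n m d : ℕ} {A : Matrix (Fin n) (Fin m) ℕ} {Δ : Finset (Fin n × Fin m)} {h h' : Fin m}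
  {p i il iu : Fin n}

theorem IsDecorated.row_lt_iff (hd : IsDecorated d A Δ) {x y : Fin n × Fin m} (hx : x ∈ Δ)
    (hy : y ∈ Δ) : x.1 < y.1 ↔ y.2 < x.2 := by
  by_cases hxy : x = y
  · subst hxy
    simp
  · rcases hd.anti x hx y hy hxy with h | h
    · exact ⟨fun _ => h.2, fun _ => h.1⟩
    · exact ⟨fun h1 => absurd h1 h.1.not_gt, fun h1 => absurd h1 h.2.not_gt⟩

theorem IsDecorated.row_eq (hd : IsDecorated d A Δ) {c : Fin m} {i j : Fin n} (hi : (i, c) ∈ Δ)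
    (hj : (j, c) ∈ Δ) : i = j := by
  rcases lt_trichotomy i j with h | h | h
  · exact absurd ((hd.row_lt_iff hi hj).mp h) (lt_irrefl _)
  · exact h
  · exact absurd ((hd.row_lt_iff hj hi).mp h) (lt_irrefl _)

/-- The cell of `Δ` preceding the one in the column `h` is the lowest one reaching the next column.
-/
theorem IsDecorated.mem_lowerClosure_iff_not_afterPrev (hd : IsDecorated d A Δ)
    (hh : (h' : ℕ) = h + 1) (hl : (il, h) ∈ Δ) :
    (i, h') ∈ lowerClosure (Δ : Set (Fin n × Fin m)) ↔ ¬ AfterPrev Δ il i := by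
  rw [mem_lowerClosure_finset, AfterPrev]
  push Not
  refine exists_congr fun x => and_congr_right fun hx => ?_
  rw [hd.row_lt_iff hx hl]
  simp only [Fin.le_def, Fin.lt_def]
  omega

theorem IsDecorated.corner_iff (hd : IsDecorated d A Δ) (hh : (h' : ℕ) = h + 1)
    (hl : (il, h) ∈ Δ) : Corner Δ h h' p ↔ AfterPrev Δ il p ∧ p ≤ il := by
  rw [Corner, hd.mem_lowerClosure_iff_not_afterPrev hh hl, not_not, and_comm]
  refine and_congr_right fun h1 => ?_
  rw [mem_lowerClosure_finset]
  constructor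
  · rintro ⟨x, hx, h2, h3⟩
    by_cases h4 : x.1 < il
    · exact absurd (h1 x hx h4) h2.not_gt
    · have h5 : ¬ h < x.2 := fun h6 => h4 ((hd.row_lt_iff hx hl).mpr h6)
      obtain rfl : x = (il, h) := by
        have h6 : x.2 = h := le_antisymm (not_lt.mp h5) h3
        obtain ⟨x1, x2⟩ := x
        simp only at h6
        subst h6
        rw [hd.row_eq hx hl]
      exact h2
  · exact fun h2 => ⟨(il, h), hl, h2, le_rfl⟩

theorem not_corner_of_forall_ne (hh : (h' : ℕ) = h + 1) (hl : ∀ x ∈ Δ, x.2 ≠ h) :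
    ¬ Corner Δ h h' p := by
  rintro ⟨h1, h2⟩
  rw [mem_lowerClosure_finset] at h1 h2
  obtain ⟨x, hx, h3, h4⟩ := h1
  refine h2 ⟨x, hx, h3, Fin.le_def.mpr ?_⟩
  have h5 : (x.2 : ℕ) ≠ h := fun h6 => hl x hx (Fin.ext h6)
  have h6 := Fin.le_def.mp h4
  simp only at h6 ⊢
  omega

theorem IsDecorated.afterPrev_iff (hd : IsDecorated d A Δ) (hh : (h' : ℕ) = h + 1)
    (hl : (il, h) ∈ Δ) (hu : (iu, h') ∈ Δ) : AfterPrev Δ il p ↔ iu < p := by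
  constructor
  · intro h1
    refine h1 _ hu ((hd.row_lt_iff hu hl).mpr (Fin.lt_def.mpr ?_))
    simp only
    omega
  · intro h1 x hx h2
    refine lt_of_le_of_lt ?_ h1
    by_contra h3
    have h4 := (hd.row_lt_iff hu hx).mp (not_le.mp h3)
    have h5 := (hd.row_lt_iff hx hl).mp h2
    simp only [Fin.lt_def] at h4 h5
    omega

theorem afterPrev_self : AfterPrev Δ il il := fun _ _ h => h

end Decorations

theorem sum_filter_eq_add {α M : Type*} [Fintype α] [AddCommGroup M] {f g k : α → M}
    {P Q R : α → Prop} [DecidablePred P] [DecidablePred Q] [DecidablePred R]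
    (hP : ∀ x, P x ↔ Q x ∨ R x) (hQR : ∀ x, Q x → ¬ R x) (hQ : ∀ x, Q x → f x = g x)
    (hR : ∀ x, R x → f x = k x) :
    ∑ x with P x, f x = ∑ x with Q x, g x + ∑ x with R x, k x := by
  simp only [Finset.sum_filter, ← Finset.sum_add_distrib]
  refine Finset.sum_congr rfl fun x _ => ?_
  by_cases h1 : Q x
  · rw [if_pos ((hP x).mpr (.inl h1)), if_pos h1, if_neg (hQR x h1), add_zero, hQ x h1]
  · by_cases h2 : R x
    · rw [if_pos ((hP x).mpr (.inr h2)), if_neg h1, if_pos h2, zero_add, hR x h2]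
    · rw [if_neg fun h3 => ((hP x).mp h3).elim h1 h2, if_neg h1, if_neg h2, add_zero]

theorem sum_filter_eq_zero {α M : Type*} [Fintype α] [AddCommGroup M] (f : α → M)
    {P : α → Prop} [DecidablePred P] (hP : ∀ x, ¬ P x) : ∑ x with P x, f x = 0 := by
  simp [hP]

section RaiseCases

variable {R M M' : Type*} [Field R] [AddCommGroup M] [Module R M] [AddCommGroup M']
  [Module R M'] {n m d : ℕ} {v : R} {mul : M → M' → M} {e : DecMat n m d → M}
  {e' : DecMat m m d → M'} {A : Matrix (Fin n) (Fin m) ℕ} {Δ : Finset (Fin n × Fin m)}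
  {h h' : Fin m} {il iu : Fin n}

/-- Neither the column `h` nor the column `h'` is decorated: the decoration does not change. -/
theorem IsRightMul.raise_of_forall_ne (H : IsRightMul v mul e e') (hv : v ≠ 0) (hv1 : v ^ 2 ≠ 1)
    (hd : IsDecorated d A Δ) (hh : (h' : ℕ) = h + 1) (hΔ : ∀ x ∈ Δ, x.2 ≠ h ∧ x.2 ≠ h') :
    mul (stdVec v e A Δ) (genOff v e' h h') = ∑ p : Fin n with 1 ≤ A p h,
        (v ^ xi A h h' p * qbar v (A p h' + 1) 1) • stdVec v e (moveCell A p h h') Δ := by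
  classical
  have hc : ∀ p, ¬ Corner Δ h h' p := fun p => not_corner_of_forall_ne hh fun x hx => (hΔ x hx).1
  rw [H.mul_stdVec_raise_eq hv hv1 hd hh, sum_filter_eq_zero
    (P := fun p => Corner Δ h h' p ∧ 1 ≤ A p h) _ fun p h1 => hc p h1.1, add_zero]
  refine Finset.sum_congr rfl fun p _ => ?_
  have h1 : (p, h') ∉ Δ := fun h1 => (hΔ _ h1).2 rfl
  simp [hc, h1]

open scoped Classical in
/-- The column `h` is decorated, the column `h'` is not. -/
theorem IsRightMul.raise_of_mem (H : IsRightMul v mul e e') (hv : v ≠ 0) (hv1 : v ^ 2 ≠ 1)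
    (hd : IsDecorated d A Δ) (hh : (h' : ℕ) = h + 1) (hl : (il, h) ∈ Δ)
    (hΔ : ∀ x ∈ Δ, x.2 ≠ h') :
    mul (stdVec v e A Δ) (genOff v e' h h') =
      (∑ p : Fin n with (AfterPrev Δ il p ∧ p ≤ il) ∧ 1 ≤ A p h,
        (v ^ (xi A h h' p - 1) * qbar v (A p h' + 1) 1) • stdVec v e (moveCell A p h h') Δ)
      + (∑ p : Fin n with ¬ (AfterPrev Δ il p ∧ p ≤ il) ∧ 1 ≤ A p h,
        (v ^ xi A h h' p * qbar v (A p h' + 1) 1) • stdVec v e (moveCell A p h h') Δ)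
      + (∑ p : Fin n with p = il ∧ 1 ≤ A p h,
        v ^ (colSum A h' (fun i => ¬ AfterPrev Δ il i) - colSum A h (fun i => i < il)) •
          stdVec v e (moveCell A p h h') (insert (il, h') (Δ.erase (il, h))))
      + (∑ s : Fin n with (AfterPrev Δ il s ∧ s < il) ∧ 1 ≤ A s h,
        v ^ (colSum A h' (fun i => ¬ AfterPrev Δ il i) - colSum A h (fun i => i < s)) •
          stdVec v e (moveCell A s h h') (insert (s, h') Δ)) := by
  have hmem : ∀ p, (p, h') ∉ Δ := fun p h1 => hΔ _ h1 rfl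
  have hfil : Δ.filter (·.2 ≠ h') = Δ := Finset.filter_true_of_mem hΔ
  rw [H.mul_stdVec_raise_eq hv hv1 hd hh, add_assoc (_ + _)]
  congr 1
  · refine sum_filter_eq_add (fun p => by tauto) (fun p => by tauto) (fun p hp => ?_) fun p hp => ?_
    · rw [if_pos ((hd.corner_iff hh hl).mpr hp.1), if_neg (hmem p), Nat.sub_zero]
    · rw [if_neg fun h1 => hp.1 ((hd.corner_iff hh hl).mp h1), if_neg (hmem p), Nat.sub_zero,
        sub_zero]
  · have hprod : ∏ i with (i, h') ∈ Δ, (1 - v ^ (-2 * (A i h' : ℤ))) = 1 := by simp [hmem]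
    refine sum_filter_eq_add (fun p => ?_) (fun p => ?_) (fun p hp => ?_) fun p hp => ?_
    · rw [hd.corner_iff hh hl, le_iff_eq_or_lt]
      constructor
      · tauto
      · rintro (⟨rfl, h1⟩ | ⟨h1, h2⟩)
        · exact ⟨⟨afterPrev_self, .inl rfl⟩, h1⟩
        · exact ⟨⟨h1.1, .inr h1.2⟩, h2⟩
    · rintro ⟨rfl, -⟩ ⟨⟨-, h1⟩, -⟩
      exact lt_irrefl _ h1
    · obtain ⟨rfl, -⟩ := hp
      simp only [hprod, mul_one, hfil, hd.mem_lowerClosure_iff_not_afterPrev hh hl]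
    · have h1 : (p, h) ∉ Δ := fun h1 => hp.1.2.ne (hd.row_eq h1 hl)
      simp only [hprod, mul_one, hfil, hd.mem_lowerClosure_iff_not_afterPrev hh hl,
        Finset.erase_eq_of_notMem h1]

open scoped Classical in
/-- The column `h'` is decorated, the column `h` is not. -/
theorem IsRightMul.raise_of_mem_next (H : IsRightMul v mul e e') (hv : v ≠ 0) (hv1 : v ^ 2 ≠ 1)
    (hd : IsDecorated d A Δ) (hh : (h' : ℕ) = h + 1) (hl : (il, h') ∈ Δ)
    (hΔ : ∀ x ∈ Δ, x.2 ≠ h) :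
    mul (stdVec v e A Δ) (genOff v e' h h') =
      (∑ p : Fin n with p ≠ il ∧ 1 ≤ A p h,
        (v ^ xi A h h' p * qbar v (A p h' + 1) 1) • stdVec v e (moveCell A p h h') Δ)
      + (∑ p : Fin n with p = il ∧ 1 ≤ A p h,
        (v ^ xi A h h' p * qbar v (A p h') 1) • stdVec v e (moveCell A p h h') Δ) := by
  have hc : ∀ p, ¬ Corner Δ h h' p := fun p => not_corner_of_forall_ne hh hΔ
  rw [H.mul_stdVec_raise_eq hv hv1 hd hh, sum_filter_eq_zero
    (P := fun p => Corner Δ h h' p ∧ 1 ≤ A p h) _ fun p h1 => hc p h1.1, add_zero]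
  refine sum_filter_eq_add (fun p => by tauto) (fun p => by tauto) (fun p hp => ?_) fun p hp => ?_
  · have h1 : (p, h') ∉ Δ := fun h1 => hp.1 (hd.row_eq h1 hl)
    rw [if_neg (hc p), if_neg h1, sub_zero, Nat.sub_zero]
  · obtain ⟨rfl, -⟩ := hp
    rw [if_neg (hc p), if_pos hl, sub_zero, Nat.add_sub_cancel]

open scoped Classical in
/-- Both columns are decorated. -/
theorem IsRightMul.raise_of_mem_mem (H : IsRightMul v mul e e') (hv : v ≠ 0) (hv1 : v ^ 2 ≠ 1)
    (hd : IsDecorated d A Δ) (hh : (h' : ℕ) = h + 1) (hl : (il, h) ∈ Δ) (hu : (iu, h') ∈ Δ) :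
    mul (stdVec v e A Δ) (genOff v e' h h') =
      (∑ p : Fin n with ¬ (iu ≤ p ∧ p ≤ il) ∧ 1 ≤ A p h,
        (v ^ xi A h h' p * qbar v (A p h' + 1) 1) • stdVec v e (moveCell A p h h') Δ)
      + (∑ p : Fin n with (iu < p ∧ p ≤ il) ∧ 1 ≤ A p h,
        (v ^ (xi A h h' p - 1) * qbar v (A p h' + 1) 1) • stdVec v e (moveCell A p h h') Δ)
      + (∑ p : Fin n with p = iu ∧ 1 ≤ A p h,
        (v ^ xi A h h' p * qbar v (A p h') 1) • stdVec v e (moveCell A p h h') Δ)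
      + (∑ p : Fin n with p = il ∧ 1 ≤ A p h,
        (v ^ (xi A h h' iu - colSum A h (fun j => iu ≤ j ∧ j < p))
            * (1 - v ^ (-2 : ℤ)) * qbar v (A iu h') 1) •
          stdVec v e (moveCell A p h h') (insert (il, h') ((Δ.erase (iu, h')).erase (il, h))))
      + (∑ s : Fin n with (iu < s ∧ s < il) ∧ 1 ≤ A s h,
        (v ^ (xi A h h' iu - colSum A h (fun j => iu ≤ j ∧ j < s))
            * (1 - v ^ (-2 : ℤ)) * qbar v (A iu h') 1) •
          stdVec v e (moveCell A s h h') (insert (s, h') (Δ.erase (iu, h')))) := by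
  have hcorner : ∀ p, Corner Δ h h' p ↔ iu < p ∧ p ≤ il := fun p => by
    rw [hd.corner_iff hh hl, hd.afterPrev_iff hh hl hu]
  have hul : iu < il := (hd.row_lt_iff hu hl).mpr (Fin.lt_def.mpr (by simp only; omega))
  have hmem : ∀ p, (p, h') ∈ Δ ↔ p = iu := fun p =>
    ⟨fun h1 => hd.row_eq h1 hu, fun h1 => h1 ▸ hu⟩
  have hfil : Δ.filter (·.2 ≠ h') = Δ.erase (iu, h') := by
    ext ⟨i, j⟩
    rw [Finset.mem_filter, Finset.mem_erase]
    constructor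
    · rintro ⟨h1, h2⟩
      exact ⟨fun h3 => h2 (congrArg Prod.snd h3), h1⟩
    · rintro ⟨h1, h2⟩
      refine ⟨h2, ?_⟩
      rintro rfl
      exact h1 (by rw [hd.row_eq h2 hu])
  rw [H.mul_stdVec_raise_eq hv hv1 hd hh, add_assoc (_ + _ + _)]
  congr 1
  · rw [add_assoc]
    refine (sum_filter_eq_add (Q := fun p => ¬ (iu ≤ p ∧ p ≤ il) ∧ 1 ≤ A p h)
      (R := fun p => (iu ≤ p ∧ p ≤ il) ∧ 1 ≤ A p h)
      (g := fun p => (v ^ xi A h h' p * qbar v (A p h' + 1) 1) • stdVec v e (moveCell A p h h') Δ)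
      (fun p => by tauto) (fun p => by tauto)
      (fun p hp => ?_) fun p _ => rfl).trans ?_
    · have h1 : ¬ Corner Δ h h' p := fun h1 =>
        hp.1 ⟨((hcorner p).mp h1).1.le, ((hcorner p).mp h1).2⟩
      have h2 : (p, h') ∉ Δ := fun h2 => hp.1 (by
        rw [hmem] at h2
        subst h2
        exact ⟨le_rfl, hul.le⟩)
      rw [if_neg h1, if_neg h2, sub_zero, Nat.sub_zero]
    · congr 1
      refine sum_filter_eq_add (fun p => ?_) (fun p => ?_) (fun p hp => ?_) fun p hp => ?_
      · rw [le_iff_eq_or_lt (a := iu)]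
        constructor
        · rintro ⟨⟨h1 | h1, h2⟩, h3⟩
          · exact .inr ⟨h1.symm, h3⟩
          · exact .inl ⟨⟨h1, h2⟩, h3⟩
        · rintro (⟨⟨h1, h2⟩, h3⟩ | ⟨rfl, h3⟩)
          · exact ⟨⟨.inr h1, h2⟩, h3⟩
          · exact ⟨⟨.inl rfl, hul.le⟩, h3⟩
      · rintro ⟨⟨h1, -⟩, -⟩ ⟨rfl, -⟩
        exact lt_irrefl _ h1
      · have h2 : (p, h') ∉ Δ := fun h2 => hp.1.1.ne' ((hmem p).mp h2)
        rw [if_pos ((hcorner p).mpr hp.1), if_neg h2, Nat.sub_zero]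
      · obtain ⟨rfl, -⟩ := hp
        rw [if_neg fun h1 => absurd ((hcorner p).mp h1).1 (lt_irrefl _), if_pos hu, sub_zero,
          Nat.add_sub_cancel]
  · have hprod : ∏ i with (i, h') ∈ Δ, (1 - v ^ (-2 * (A i h' : ℤ)))
        = (1 - v ^ (-2 : ℤ)) * qbar v (A iu h') 1 := by
      rw [one_sub_mul_qbar hv1]
      simp only [hmem, Finset.filter_eq', Finset.mem_univ, if_true, Finset.prod_singleton]
    -- the exponent of the changed terms, rewritten by splitting off the rows from `iu` on in the
    -- column `h`
    have hcoef : ∀ p, iu < p →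
        colSum A h' (fun i => (i, h') ∈ lowerClosure (Δ : Set (Fin n × Fin m)))
          - colSum A h (fun i => i < p)
        = xi A h h' iu - colSum A h (fun j => iu ≤ j ∧ j < p) := by
      intro p hp
      have h1 := colSum_eq_add A h (fun i => i < p) fun i => iu ≤ i
      rw [colSum_congr A h' fun i => (hd.mem_lowerClosure_iff_not_afterPrev hh hl).trans
          ((hd.afterPrev_iff hh hl hu).not.trans not_lt), xi, h1,
        colSum_congr A h (P := fun i => i < p ∧ iu ≤ i) fun i => and_comm,
        colSum_congr A h (P := fun i => i < p ∧ ¬ iu ≤ i) (Q := fun i => i < iu) fun i =>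
          ⟨fun h2 => not_le.mp h2.2, fun h2 => ⟨h2.trans hp, not_le.mpr h2⟩⟩]
      ring
    refine sum_filter_eq_add (fun p => ?_) (fun p => ?_) (fun p hp => ?_) fun p hp => ?_
    · rw [hcorner, le_iff_eq_or_lt]
      constructor
      · tauto
      · rintro (⟨rfl, h1⟩ | ⟨h1, h2⟩)
        · exact ⟨⟨hul, .inl rfl⟩, h1⟩
        · exact ⟨⟨h1.1, .inr h1.2⟩, h2⟩
    · rintro ⟨rfl, -⟩ ⟨⟨-, h1⟩, -⟩
      exact lt_irrefl _ h1
    · obtain ⟨rfl, -⟩ := hp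
      rw [hprod, hfil, hcoef p hul, mul_assoc]
    · have h1 : (p, h) ∉ Δ.erase (iu, h') := fun h1 =>
        hp.1.2.ne (hd.row_eq (Finset.mem_of_mem_erase h1) hl)
      rw [hprod, hfil, hcoef p hp.1.1, mul_assoc, Finset.erase_eq_of_notMem h1]

end RaiseCases

/-! ### The product with `L` -/

section CornerFormula

variable {R M M' : Type*} [Field R] [AddCommGroup M] [Module R M] [AddCommGroup M']
  [Module R M'] {n m d : ℕ} {v : R} {mul : M → M' → M} {e : DecMat n m d → M}
  {e' : DecMat m m d → M'} {A : Matrix (Fin n) (Fin m) ℕ} {Δ : Finset (Fin n × Fin m)}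
  {c : Fin m}

/-- The cells of the first column do not contribute to the lower set in the other columns. -/
theorem mem_lowerClosure_filter_of_ne (hc : (c : ℕ) = 0) {i : Fin n} {j : Fin m} (hj : j ≠ c) :
    (i, j) ∈ lowerClosure (Δ : Set (Fin n × Fin m)) ↔
      (i, j) ∈ lowerClosure ((Δ.filter (·.2 ≠ c) : Finset _) : Set (Fin n × Fin m)) := by
  simp only [mem_lowerClosure_finset, Finset.mem_filter]
  constructor
  · rintro ⟨y, hy, h1, h2⟩
    refine ⟨y, ⟨hy, ?_⟩, h1, h2⟩
    rintro rfl
    refine hj (Fin.ext ?_)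
    have := Fin.le_def.mp h2
    omega
  · rintro ⟨y, ⟨hy, -⟩, h1, h2⟩
    exact ⟨y, hy, h1, h2⟩

theorem mem_lowerClosure_insert {x y : Fin n × Fin m} :
    x ∈ lowerClosure ((insert y Δ : Finset _) : Set (Fin n × Fin m)) ↔
      x ≤ y ∨ x ∈ lowerClosure (Δ : Set (Fin n × Fin m)) := by
  simp [mem_lowerClosure]

/-- A decoration agreeing with `Δ` outside the first column has at most one cell in that column,
below all the rows of the others. -/
theorem IsDecorated.eq_filter_or_insert {Δ' : Finset (Fin n × Fin m)} (hd : IsDecorated d A Δ')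
    (hc : (c : ℕ) = 0) (hΔ : Δ.filter (·.2 ≠ c) = Δ'.filter (·.2 ≠ c)) :
    Δ' = Δ.filter (·.2 ≠ c) ∨ ∃ t, ((t, c) ∉ lowerClosure
        ((Δ.filter (·.2 ≠ c) : Finset _) : Set (Fin n × Fin m)) ∧ 0 < A t c) ∧
      Δ' = insert (t, c) (Δ.filter (·.2 ≠ c)) := by
  rw [hΔ]
  by_cases h : ∃ t, (t, c) ∈ Δ'
  · obtain ⟨t, ht⟩ := h
    refine .inr ⟨t, ⟨fun h1 => ?_, hd.pos _ ht⟩, ?_⟩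
    · obtain ⟨y, hy, h1, h2⟩ := mem_lowerClosure_finset.mp h1
      obtain ⟨hy, h3⟩ := Finset.mem_filter.mp hy
      refine absurd ((hd.row_lt_iff hy ht).mpr (lt_of_le_of_ne h2 fun h4 => h3 h4.symm)) h1.not_gt
    · ext ⟨i, j⟩
      rw [Finset.mem_insert, Finset.mem_filter]
      constructor
      · intro h1
        by_cases h2 : j = c
        · subst h2
          exact .inl (by rw [hd.row_eq h1 ht])
        · exact .inr ⟨h1, h2⟩
      · rintro (h1 | h1)
        · rw [h1]
          exact ht
        · exact h1.1
  · have h1 : ∀ x ∈ Δ', x.2 ≠ c := by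
      rintro ⟨i, j⟩ hx rfl
      exact h ⟨i, hx⟩
    exact .inl (Finset.filter_true_of_mem h1).symm

open scoped Classical in
/-- The product with `L` for an arbitrary decoration; `Δ₀` is the decoration without its cell in the
first column. -/
theorem IsRightMul.mul_stdVec_genL_eq (H : IsRightMul v mul e e') (hv : v ≠ 0)
    (hd : IsDecorated d A Δ) (hc : (c : ℕ) = 0) (Δ₀ : Finset (Fin n × Fin m))
    (hΔ₀ : Δ₀ = Δ.filter (·.2 ≠ c)) :
    mul (stdVec v e A Δ) (genL v e' c) =
      (v ^ (-2 * (∑ i, (A i c : ℤ))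
          + colSum A c (fun i => (i, c) ∈ lowerClosure (Δ : Set (Fin n × Fin m)))
          + colSum A c (fun i => (i, c) ∈ lowerClosure (Δ₀ : Set (Fin n × Fin m))))
        * ∏ i with (i, c) ∈ Δ, (1 - v ^ (-2 * (A i c : ℤ)))) •
      (stdVec v e A Δ₀
        + ∑ t with (t, c) ∉ lowerClosure (Δ₀ : Set (Fin n × Fin m)) ∧ 0 < A t c,
          v ^ colSum A c (fun i => (i, c) ∉ lowerClosure (Δ₀ : Set (Fin n × Fin m)) ∧ i ≤ t) •
            stdVec v e A (insert (t, c) Δ₀)) := by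
  have hnot : ∀ t, (t, c) ∉ Δ₀ := fun t h1 => by
    rw [hΔ₀] at h1
    exact (Finset.mem_filter.mp h1).2 rfl
  have hfil : Δ₀.filter (·.2 ≠ c) = Δ₀ := by
    rw [hΔ₀, Finset.filter_filter]
    simp
  -- only `Δ₀` and its extensions by one cell in the first column contribute
  have hsub : ∀ f : Finset (Fin n × Fin m) → R,
      ∑ Δ' with Δ.filter (·.2 ≠ c) = Δ'.filter (·.2 ≠ c), f Δ' • stdVec v e A Δ'
      = f Δ₀ • stdVec v e A Δ₀
        + ∑ t with (t, c) ∉ lowerClosure (Δ₀ : Set (Fin n × Fin m)) ∧ 0 < A t c,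
          f (insert (t, c) Δ₀) • stdVec v e A (insert (t, c) Δ₀) := by
    intro f
    rw [← Finset.sum_image (s := Finset.univ.filter fun t =>
        (t, c) ∉ lowerClosure (Δ₀ : Set (Fin n × Fin m)) ∧ 0 < A t c)
      (g := fun t => insert (t, c) Δ₀) (f := fun Δ' => f Δ' • stdVec v e A Δ'),
      ← Finset.sum_insert (f := fun Δ' => f Δ' • stdVec v e A Δ')]
    · symm
      refine Finset.sum_subset ?_ ?_
      · intro Δ' hΔ'
        rw [Finset.mem_filter, ← hΔ₀]
        refine ⟨Finset.mem_univ _, ?_⟩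
        rcases Finset.mem_insert.mp hΔ' with rfl | h1
        · exact hfil.symm
        · obtain ⟨t, -, rfl⟩ := Finset.mem_image.mp h1
          rw [Finset.filter_insert, if_neg (by simp), hfil]
      · intro Δ' h1 h2
        rw [stdVec_of_not_isDecorated, smul_zero]
        intro hd'
        rcases hd'.eq_filter_or_insert hc (Finset.mem_filter.mp h1).2 with h3 | ⟨t, ht, h3⟩
        · rw [← hΔ₀] at h3
          exact h2 (Finset.mem_insert.mpr (.inl h3))
        · rw [← hΔ₀] at h3 ht
          exact h2 (Finset.mem_insert_of_mem (Finset.mem_image.mpr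
            ⟨t, Finset.mem_filter.mpr ⟨Finset.mem_univ _, ht⟩, h3.symm⟩))
    · intro h1
      obtain ⟨t, -, h2⟩ := Finset.mem_image.mp h1
      exact hnot t (h2 ▸ Finset.mem_insert_self _ _)
    · intro s _ t _ hst
      have h1 : (s, c) ∈ insert (t, c) Δ₀ := by
        simp only at hst
        rw [← hst]
        exact Finset.mem_insert_self _ _
      rcases Finset.mem_insert.mp h1 with h2 | h2
      · exact congrArg Prod.fst h2
      · exact absurd h2 (hnot s)
  have hexp : ∀ Δ' : Finset (Fin n × Fin m), Δ.filter (·.2 ≠ c) = Δ'.filter (·.2 ≠ c) →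
      normExp A Δ - normExp A Δ'
        = colSum A c (fun i => (i, c) ∈ lowerClosure (Δ' : Set (Fin n × Fin m)))
          - colSum A c (fun i => (i, c) ∈ lowerClosure (Δ : Set (Fin n × Fin m))) :=
    fun Δ' h1 => normExp_sub_of_column A Δ Δ' c fun i j hj => by
      rw [mem_lowerClosure_filter_of_ne hc hj, h1, ← mem_lowerClosure_filter_of_ne hc hj]
  rw [H.mul_stdVec_genL hv hd hc, hsub, prod_aeval_rowPoly hv, smul_add, Finset.smul_sum,
    hexp Δ₀ (by rw [hfil, hΔ₀])]
  congr 1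
  · rw [← mul_assoc, ← zpow_add₀ hv]
    congr 3
    ring
  · refine Finset.sum_congr rfl fun t ht => ?_
    have h1 : colSum A c (fun i => i ≤ t ∨ (i, c) ∈ lowerClosure (Δ₀ : Set (Fin n × Fin m)))
        = colSum A c (fun i => (i, c) ∈ lowerClosure (Δ₀ : Set (Fin n × Fin m)))
        + colSum A c (fun i => (i, c) ∉ lowerClosure (Δ₀ : Set (Fin n × Fin m)) ∧ i ≤ t) := by
      rw [colSum_eq_add A c _ fun i => (i, c) ∈ lowerClosure (Δ₀ : Set (Fin n × Fin m))]
      exact congrArg₂ (· + ·) (colSum_congr A c fun i => by tauto)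
        (colSum_congr A c fun i => by tauto)
    rw [hexp _ (by rw [Finset.filter_insert, if_neg (by simp), hfil, hΔ₀])]
    simp only [mem_lowerClosure_insert, Prod.mk_le_mk, le_refl, and_true]
    rw [h1, smul_smul, ← mul_assoc, ← zpow_add₀ hv, mul_right_comm, ← zpow_add₀ hv]
    congr 3
    ring

open scoped Classical in
/-- The decoration is not empty and does not meet the first column. -/
theorem IsRightMul.genL_of_lt (H : IsRightMul v mul e e') (hv : v ≠ 0)
    (hd : IsDecorated d A Δ) (hc : (c : ℕ) = 0) {ik : Fin n} {jk : Fin m} (hk : (ik, jk) ∈ Δ)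
    (hmax : ∀ x ∈ Δ, x.1 ≤ ik) (hjk : c < jk) :
    mul (stdVec v e A Δ) (genL v e' c) = v ^ (-2 * colSum A c (fun i => ik < i)) •
      (stdVec v e A Δ + ∑ t : Fin n with ik < t ∧ 0 < A t c,
        v ^ colSum A c (fun i => ik < i ∧ i ≤ t) • stdVec v e A (insert (t, c) Δ)) := by
  have hne : ∀ x ∈ Δ, x.2 ≠ c := by
    rintro ⟨i, j⟩ hx rfl
    refine absurd (hmax _ hx) (not_le.mpr ((hd.row_lt_iff hk hx).mpr hjk))
  have hmem : ∀ i, (i, c) ∉ Δ := fun i h1 => hne _ h1 rfl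
  have hlc : ∀ i, (i, c) ∈ lowerClosure (Δ : Set (Fin n × Fin m)) ↔ i ≤ ik := fun i => by
    rw [mem_lowerClosure_finset]
    exact ⟨fun ⟨y, hy, h1, _⟩ => h1.trans (hmax y hy), fun h1 => ⟨_, hk, h1, hjk.le⟩⟩
  rw [H.mul_stdVec_genL_eq hv hd hc Δ (Finset.filter_true_of_mem hne).symm]
  simp only [hlc, not_le]
  have h1 := colSum_add_not A c fun i => i ≤ ik
  simp only [not_le] at h1
  congr 1
  rw [← h1]
  simp only [hmem, Finset.filter_false, Finset.prod_empty, mul_one]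
  congr 1
  ring

open scoped Classical in
/-- The decoration meets the first column in the row `ik`. -/
theorem IsRightMul.genL_of_mem (H : IsRightMul v mul e e') (hv : v ≠ 0)
    (hd : IsDecorated d A Δ) (hc : (c : ℕ) = 0) {ik : Fin n} (hk : (ik, c) ∈ Δ) :
    mul (stdVec v e A Δ) (genL v e' c) =
      v ^ (-2 * colSum A c (fun i => ik < i)) •
        (∑ t : Fin n with AfterPrev Δ ik t ∧ 0 < A t c,
          (v ^ (-colSum A c (fun i => i ≤ ik) + colSum A c (fun i => i ≤ t))
            * (1 - v ^ (-2 * (A ik c : ℤ)))) • stdVec v e A (insert (t, c) (Δ.erase (ik, c))))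
      + v ^ (-2 * colSum A c (fun i => ik < i)) •
        ((v ^ (-colSum A c (fun i => AfterPrev Δ ik i ∧ i ≤ ik))
            * (1 - v ^ (-2 * (A ik c : ℤ)))) • stdVec v e A (Δ.erase (ik, c))) := by
  have hmem : ∀ i, (i, c) ∈ Δ ↔ i = ik := fun i =>
    ⟨fun h1 => hd.row_eq h1 hk, fun h1 => h1 ▸ hk⟩
  have hfil : Δ.erase (ik, c) = Δ.filter (·.2 ≠ c) := by
    ext ⟨i, j⟩
    rw [Finset.mem_filter, Finset.mem_erase]
    constructor
    · rintro ⟨h1, h2⟩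
      refine ⟨h2, ?_⟩
      rintro rfl
      exact h1 (by rw [hd.row_eq h2 hk])
    · rintro ⟨h1, h2⟩
      exact ⟨fun h3 => h2 (congrArg Prod.snd h3), h1⟩
  have hcle : ∀ j : Fin m, c ≤ j := fun j => Fin.le_def.mpr (by omega)
  have hlt : ∀ x ∈ Δ, x.2 ≠ c → x.1 < ik := fun x hx h1 =>
    (hd.row_lt_iff hx hk).mpr (lt_of_le_of_ne (hcle _) h1.symm)
  have hlc : ∀ i, (i, c) ∈ lowerClosure (Δ : Set (Fin n × Fin m)) ↔ i ≤ ik := fun i => by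
    rw [mem_lowerClosure_finset]
    constructor
    · rintro ⟨y, hy, h1, -⟩
      refine h1.trans ?_
      by_cases h2 : y.2 = c
      · obtain ⟨i', j'⟩ := y
        simp only at h2
        subst h2
        exact (hd.row_eq hy hk).le
      · exact (hlt y hy h2).le
    · exact fun h1 => ⟨_, hk, h1, le_rfl⟩
  have hlc' : ∀ i, (i, c) ∈ lowerClosure ((Δ.erase (ik, c) : Finset _) : Set (Fin n × Fin m)) ↔
      ¬ AfterPrev Δ ik i := fun i => by
    rw [mem_lowerClosure_finset, AfterPrev, hfil]
    push Not
    constructor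
    · rintro ⟨y, hy, h1, -⟩
      obtain ⟨hy, h2⟩ := Finset.mem_filter.mp hy
      exact ⟨y, hy, hlt y hy h2, h1⟩
    · rintro ⟨y, hy, h1, h2⟩
      refine ⟨y, Finset.mem_filter.mpr ⟨hy, fun h3 => ?_⟩, h2, hcle _⟩
      obtain ⟨i', j'⟩ := y
      simp only at h3
      subst h3
      exact h1.ne (hd.row_eq hy hk)
  have hprod : ∏ i with (i, c) ∈ Δ, (1 - v ^ (-2 * (A i c : ℤ))) = 1 - v ^ (-2 * (A ik c : ℤ)) := by
    simp only [hmem, Finset.filter_eq', Finset.mem_univ, if_true, Finset.prod_singleton]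
  have hprev : ∀ i, ¬ AfterPrev Δ ik i → i ≤ ik := fun i h1 => by
    unfold AfterPrev at h1
    push Not at h1
    obtain ⟨x, -, h2, h3⟩ := h1
    exact h3.trans h2.le
  rw [H.mul_stdVec_genL_eq hv hd hc _ hfil, hprod]
  simp only [hlc, hlc', not_not]
  have h1 := colSum_add_not A c fun i => i ≤ ik
  simp only [not_le] at h1
  have h2 : ∀ t, AfterPrev Δ ik t → colSum A c (fun i => i ≤ t)
      = colSum A c (fun i => AfterPrev Δ ik i ∧ i ≤ t)
        + colSum A c (fun i => ¬ AfterPrev Δ ik i) := fun t ht => by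
    rw [colSum_eq_add A c (fun i => i ≤ t) (AfterPrev Δ ik)]
    congr 1
    · exact colSum_congr A c fun i => and_comm
    · refine colSum_congr A c fun i => ⟨fun h3 => h3.2, fun h3 => ⟨?_, h3⟩⟩
      unfold AfterPrev at h3
      push Not at h3
      obtain ⟨x, hx, h4, h5⟩ := h3
      exact h5.trans (ht x hx h4).le
  rw [smul_add, add_comm]
  congr 1
  · rw [Finset.smul_sum, Finset.smul_sum]
    refine Finset.sum_congr rfl fun t ht => ?_
    rw [smul_smul, smul_smul, mul_right_comm, ← mul_assoc, ← zpow_add₀ hv, ← zpow_add₀ hv,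
      h2 t (Finset.mem_filter.mp ht).2.1, ← h1]
    congr 3
    ring
  · rw [smul_smul, ← mul_assoc, ← zpow_add₀ hv, ← h1]
    have h3 := h2 ik afterPrev_self
    congr 3
    linarith

open scoped Classical in
/-- The decoration is empty: a vector of the first step is added to zero. -/
theorem IsRightMul.genL_of_empty (H : IsRightMul v mul e e') (hv : v ≠ 0)
    (hd : IsDecorated d A ∅) (hc : (c : ℕ) = 0) :
    mul (stdVec v e A ∅) (genL v e' c) =
      (∑ t : Fin n with 0 < A t c,
        v ^ (-(∑ i, (A i c : ℤ)) - colSum A c (fun i => t < i)) • stdVec v e A {(t, c)})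
      + v ^ (-2 * ∑ i, (A i c : ℤ)) • stdVec v e A ∅ := by
  rw [H.mul_stdVec_genL_eq hv hd hc ∅ rfl]
  have hlc : ∀ i, (i, c) ∉ lowerClosure ((∅ : Finset (Fin n × Fin m)) : Set (Fin n × Fin m)) :=
    fun i => by simp
  simp only [hlc, not_false_eq_true, true_and, Finset.notMem_empty, Finset.filter_false,
    Finset.prod_empty, mul_one, colSum_false A c (fun _ => False) (fun _ => id), add_zero,
    insert_empty_eq]
  rw [smul_add, add_comm, Finset.smul_sum]
  congr 1
  refine Finset.sum_congr rfl fun t _ => ?_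
  have h1 := colSum_add_not A c fun i => i ≤ t
  simp only [not_le] at h1
  rw [smul_smul, ← zpow_add₀ hv]
  congr 2
  linarith

end CornerFormula

/-! ### Decorations occurring in the product with `F_h` -/

section LowerFormula

open Polynomial

variable {R : Type*} [Field R] {n m d : ℕ} {v : R} {A B : Matrix (Fin n) (Fin m) ℕ}
  {Δ Δ' : Finset (Fin n × Fin m)} {h h' : Fin m} {p s T : Fin n}

theorem IsDecorated.eq_of_le (hd : IsDecorated d A Δ) {x y : Fin n × Fin m} (hx : x ∈ Δ)
    (hy : y ∈ Δ) (h1 : x.1 ≤ y.1) (h2 : x.2 ≤ y.2) : x = y := by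
  by_contra hxy
  rcases hd.anti x hx y hy hxy with h3 | h3
  · exact absurd h2 h3.2.not_ge
  · exact absurd h1 h3.1.not_ge

theorem IsDecorated.eq_of_lowerClosure_eq (hd : IsDecorated d A Δ) (hd' : IsDecorated d B Δ')
    (hlc : lowerClosure (Δ : Set (Fin n × Fin m)) = lowerClosure (Δ' : Set (Fin n × Fin m))) :
    Δ = Δ' :=
  DecMat.dec_eq_of_lowerClosure_eq (X := ⟨A, Δ, hd⟩) (Y := ⟨B, Δ', hd'⟩) hlc

theorem IsDecorated.mem_of_lowerClosure_insert (hd : IsDecorated d A Δ)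
    (hlc : lowerClosure (Δ : Set (Fin n × Fin m))
      = lowerClosure (insert (p, h') (Δ' : Set (Fin n × Fin m)))) {x : Fin n × Fin m} (hx : x ∈ Δ)
    (hne : x ≠ (p, h')) : x ∈ Δ' :=
  (DecMat.dec_subset_of_lowerClosure_eq ⟨A, Δ, hd⟩ hlc hx).resolve_left hne

/-- If the decoration changes, the cell `(p, h')` belongs to the new lower set as a maximal element.
-/
theorem IsDecorated.mem_of_lowerClosure_insert_of_ne (hd : IsDecorated d A Δ)
    (hd' : IsDecorated d B Δ') (hlc : lowerClosure (Δ : Set (Fin n × Fin m))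
      = lowerClosure (insert (p, h') (Δ' : Set (Fin n × Fin m)))) (hne : Δ' ≠ Δ) :
    (p, h') ∈ Δ := by
  by_contra h1
  have h2 : Δ ⊆ Δ' := fun x hx =>
    hd.mem_of_lowerClosure_insert hlc hx (by rintro rfl; exact h1 hx)
  refine hne (hd.eq_of_lowerClosure_eq hd' (le_antisymm (lowerClosure_mono (by exact_mod_cast h2))
    ?_)).symm
  rw [hlc]
  exact lowerClosure_mono (Set.subset_insert _ _)

theorem IsDecorated.notMem_of_lowerClosure_insert (hd : IsDecorated d A Δ)
    (hd' : IsDecorated d B Δ') (hlc : lowerClosure (Δ : Set (Fin n × Fin m))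
      = lowerClosure (insert (p, h') (Δ' : Set (Fin n × Fin m)))) (hne : Δ' ≠ Δ) :
    (p, h') ∉ Δ' := fun h1 => hne (hd.eq_of_lowerClosure_eq hd' (by
      rw [hlc, Set.insert_eq_of_mem (by exact_mod_cast h1)])).symm

theorem IsDecorated.le_of_lowerClosure_insert (hd : IsDecorated d A Δ) (hd' : IsDecorated d B Δ')
    (hlc : lowerClosure (Δ : Set (Fin n × Fin m))
      = lowerClosure (insert (p, h') (Δ' : Set (Fin n × Fin m)))) {y : Fin n × Fin m} (hy : y ∈ Δ')
    (hyΔ : y ∉ Δ) : y.1 ≤ p ∧ y.2 ≤ h' := by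
  have h1 : y ∈ lowerClosure (Δ : Set (Fin n × Fin m)) := by
    rw [hlc]
    exact subset_lowerClosure (Set.mem_insert_of_mem _ hy)
  obtain ⟨x, hx, h2, h3⟩ := mem_lowerClosure_finset.mp h1
  by_cases h4 : x = (p, h')
  · subst h4
    exact ⟨h2, h3⟩
  · exact absurd (hd'.eq_of_le hy (hd.mem_of_lowerClosure_insert hlc hx h4) h2 h3 ▸ hx) hyΔ

/-- The decorations that generate the same lower set as `Δ` once the cell `(p, h')` is added, and
reach the row `p` in the column `h`: the cell `(p, h')` is replaced by a cell of the column `h` and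
possibly a cell above it. -/
theorem IsDecorated.eq_of_lowerClosure_insert (hd : IsDecorated d A Δ) (hd' : IsDecorated d B Δ')
    (hh : (h' : ℕ) = h + 1) (hlc : lowerClosure (Δ : Set (Fin n × Fin m))
      = lowerClosure (insert (p, h') (Δ' : Set (Fin n × Fin m)))) (hne : Δ' ≠ Δ)
    (hpT : p ≤ T) (hT : (T, h) ∈ Δ') :
    Δ' = insert (T, h) (Δ.erase (p, h')) ∨ ∃ s, (AfterPrev Δ p s ∧ s < p) ∧
      Δ' = insert (s, h') (insert (T, h) (Δ.erase (p, h'))) := by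
  have hp := hd.mem_of_lowerClosure_insert_of_ne hd' hlc hne
  have hp' := hd.notMem_of_lowerClosure_insert hd' hlc hne
  have hsub : insert (T, h) (Δ.erase (p, h')) ⊆ Δ' := by
    intro x hx
    rcases Finset.mem_insert.mp hx with rfl | hx
    · exact hT
    · obtain ⟨h1, h2⟩ := Finset.mem_erase.mp hx
      exact hd.mem_of_lowerClosure_insert hlc h2 h1
  have hnew : ∀ y ∈ Δ', y ∉ insert (T, h) (Δ.erase (p, h')) → y.2 = h' ∧ y.1 < p := by
    intro y hy h1
    rw [Finset.mem_insert, Finset.mem_erase] at h1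
    push Not at h1
    have h2 : y ≠ (p, h') := by
      rintro rfl
      exact hp' hy
    obtain ⟨h3, h4⟩ := hd.le_of_lowerClosure_insert hd' hlc hy (h1.2 h2)
    have h5 : y.2 = h' := by
      by_contra h5
      refine h1.1 (hd'.eq_of_le hy hT (h3.trans hpT) (Fin.le_def.mpr ?_))
      have h6 : (y.2 : ℕ) ≠ h' := fun h6 => h5 (Fin.ext h6)
      have h7 := Fin.le_def.mp h4
      simp only
      omega
    exact ⟨h5, lt_of_le_of_ne h3 fun h6 => h2 (Prod.ext h6 h5)⟩
  by_cases hex : ∃ y ∈ Δ', y ∉ insert (T, h) (Δ.erase (p, h'))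
  · obtain ⟨⟨s, j⟩, hy, h1⟩ := hex
    obtain ⟨h2, h3⟩ := hnew _ hy h1
    simp only at h2 h3
    subst h2
    refine .inr ⟨s, ⟨fun x hx h4 => ?_, h3⟩, ?_⟩
    · have h5 : x ∈ Δ' := hd.mem_of_lowerClosure_insert hlc hx (by
        rintro rfl
        exact lt_irrefl _ h4)
      exact (hd'.row_lt_iff h5 hy).mpr ((hd.row_lt_iff hx hp).mp h4)
    · refine Finset.Subset.antisymm (fun z hz => ?_) (Finset.insert_subset hy hsub)
      by_cases h4 : z ∈ insert (T, h) (Δ.erase (p, j))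
      · exact Finset.mem_insert_of_mem h4
      · obtain ⟨i', j'⟩ := z
        obtain ⟨h5, -⟩ := hnew _ hz h4
        simp only at h5
        subst h5
        rw [hd'.row_eq hz hy]
        exact Finset.mem_insert_self _ _
  · push Not at hex
    exact .inl (Finset.Subset.antisymm hex hsub)

/-- Conversely, these sets generate the same lower set as `Δ` once the cell `(p, h')` is added, and
differ from `Δ`. -/
theorem IsDecorated.lowerClosure_insert_insert (hd : IsDecorated d A Δ)
    (hh : (h' : ℕ) = h + 1) (hp : (p, h') ∈ Δ) (hT : T = p ∨ (T, h) ∈ Δ)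
    (hΔ' : Δ' = insert (T, h) (Δ.erase (p, h')) ∨ ∃ s, s < p ∧
      Δ' = insert (s, h') (insert (T, h) (Δ.erase (p, h')))) :
    lowerClosure (Δ : Set (Fin n × Fin m))
      = lowerClosure (insert (p, h') (Δ' : Set (Fin n × Fin m))) ∧ Δ' ≠ Δ := by
  have hle : (p, h) ≤ (p, h') := Prod.mk_le_mk.mpr ⟨le_rfl, Fin.le_def.mpr (by omega)⟩
  have hne : (p, h') ≠ (T, h) := fun h1 => by
    have := congrArg (fun x => (x.2 : ℕ)) h1
    simp only at this
    omega
  have hTlc : (T, h) ∈ lowerClosure (Δ : Set (Fin n × Fin m)) := by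
    rcases hT with rfl | hT
    · exact (lowerClosure (Δ : Set (Fin n × Fin m))).lower hle (subset_lowerClosure hp)
    · exact subset_lowerClosure hT
  have hsup : Δ.erase (p, h') ⊆ Δ' := by
    rcases hΔ' with rfl | ⟨s, -, rfl⟩
    · exact Finset.subset_insert _ _
    · exact (Finset.subset_insert _ _).trans (Finset.subset_insert _ _)
  have hlow : ∀ x ∈ Δ', x ∈ lowerClosure (Δ : Set (Fin n × Fin m)) := by
    have h1 : ∀ x ∈ insert (T, h) (Δ.erase (p, h')),
        x ∈ lowerClosure (Δ : Set (Fin n × Fin m)) := by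
      intro x hx
      rcases Finset.mem_insert.mp hx with rfl | hx
      · exact hTlc
      · exact subset_lowerClosure (Finset.mem_of_mem_erase hx)
    rcases hΔ' with rfl | ⟨s, hs, rfl⟩
    · exact h1
    · intro x hx
      rcases Finset.mem_insert.mp hx with rfl | hx
      · have h2 : (s, h') ≤ (p, h') := Prod.mk_le_mk.mpr ⟨hs.le, le_rfl⟩
        exact (lowerClosure (Δ : Set (Fin n × Fin m))).lower h2 (subset_lowerClosure hp)
      · exact h1 x hx
  have hnot : (p, h') ∉ Δ' := by
    have h1 : (p, h') ∉ insert (T, h) (Δ.erase (p, h')) := by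
      simp [hne]
    rcases hΔ' with rfl | ⟨s, hs, rfl⟩
    · exact h1
    · intro h2
      rcases Finset.mem_insert.mp h2 with h3 | h3
      · exact hs.ne' (congrArg Prod.fst h3)
      · exact h1 h3
  refine ⟨le_antisymm (lowerClosure_mono fun x hx => ?_) (lowerClosure_le.mpr ?_), ?_⟩
  · by_cases h1 : x = (p, h')
    · exact .inl h1
    · exact .inr (hsup (Finset.mem_erase.mpr ⟨h1, hx⟩))
  · rintro x (rfl | hx)
    · exact subset_lowerClosure hp
    · exact hlow x hx
  · rintro rfl
    exact hnot hp

/-- Without the cell `(p, h')`, the column `h'` is reached up to the row of the preceding cell of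
`Δ`. -/
theorem IsDecorated.mem_lowerClosure_base (hd : IsDecorated d A Δ) (hh : (h' : ℕ) = h + 1)
    (hp : (p, h') ∈ Δ) (i : Fin n) :
    (i, h') ∈ lowerClosure
      ((insert (T, h) (Δ.erase (p, h')) : Finset (Fin n × Fin m)) : Set (Fin n × Fin m)) ↔
      ¬ AfterPrev Δ p i := by
  rw [mem_lowerClosure_insert, mem_lowerClosure_finset, AfterPrev]
  push Not
  constructor
  · rintro (h1 | ⟨y, hy, h1, h2⟩)
    · have := Fin.le_def.mp (Prod.mk_le_mk.mp h1).2
      omega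
    · obtain ⟨h3, hy⟩ := Finset.mem_erase.mp hy
      refine ⟨y, hy, (hd.row_lt_iff hy hp).mpr (lt_of_le_of_ne h2 fun h4 => h3 ?_), h1⟩
      obtain ⟨i', j'⟩ := y
      simp only at h4
      subst h4
      rw [hd.row_eq hy hp]
  · rintro ⟨x, hx, h1, h2⟩
    refine .inr ⟨x, Finset.mem_erase.mpr ⟨?_, hx⟩, h2, ((hd.row_lt_iff hx hp).mp h1).le⟩
    rintro rfl
    exact lt_irrefl _ h1

end LowerFormula

/-! ### The product with `F_h` -/

section LowerFormula

open Polynomial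

variable {R : Type*} [Field R] {n m d : ℕ} {v : R} {A : Matrix (Fin n) (Fin m) ℕ}
  {Δ Δ' : Finset (Fin n × Fin m)} {h h' : Fin m} {p T : Fin n}

theorem moveCell_lower_self (hh : (h' : ℕ) = h + 1) (hp : 1 ≤ A p h') :
    moveCell A p h' h p h = A p h + 1 := by
  have hne : h' ≠ h := by
    rintro rfl
    omega
  have := moveCell_apply A hne hp p h
  simp [hne.symm] at this
  exact_mod_cast this

theorem sum_Ioi_moveCell_lower (hh : (h' : ℕ) = h + 1) (hp : 1 ≤ A p h') :
    ((∑ i ∈ Finset.Ioi p, moveCell A p h' h i h : ℕ) : ℤ) = colSum A h fun i => p < i := by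
  have hne : h' ≠ h := by
    rintro rfl
    omega
  rw [cast_sum_Ioi, colSum_moveCell A hne hp]
  simp

/-- The value of `lowerSpecialPoly` for a decoration with the cell `(p, h)`. -/
theorem aeval_lowerSpecialPoly_self (hv : v ≠ 0) (hh : (h' : ℕ) = h + 1) (hp : 1 ≤ A p h')
    (hΔ : (p, h) ∈ Δ) : aeval (v ^ 2) (lowerSpecialPoly (moveCell A p h' h) Δ h p)
      = v ^ (2 * colSum A h fun i => p ≤ i) := by
  rw [lowerSpecialPoly, if_pos hΔ, moveCell_lower_self hh hp]
  simp only [map_mul, map_pow, aeval_X, Nat.add_sub_cancel]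
  rw [zpow_two_mul_natCast, zpow_two_mul_natCast, sum_Ioi_moveCell_lower hh hp, ← zpow_add₀ hv,
    colSum_ge_eq]
  congr 1
  ring

/-- The value of `lowerSpecialPoly` for a decoration with a cell in the column `h` below the row
`p`. -/
theorem aeval_lowerSpecialPoly_of_lt (hv : v ≠ 0) (hv1 : v ^ 2 ≠ 1) (hh : (h' : ℕ) = h + 1)
    (hp : 1 ≤ A p h') (hd : IsDecorated d (moveCell A p h' h) Δ) (hpT : p < T) (hT : (T, h) ∈ Δ) :
    aeval (v ^ 2) (lowerSpecialPoly (moveCell A p h' h) Δ h p)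
      = v ^ (2 * colSum A h fun i => p ≤ i) * ((1 - v ^ (-2 : ℤ)) * qbar v (A p h + 1) 1) := by
  have h1 : (p, h) ∉ Δ := fun h1 => hpT.ne (hd.row_eq h1 hT)
  have h2 : 1 ≤ ∑ i ∈ Finset.Ioi p, moveCell A p h' h i h :=
    (hd.pos _ hT).trans_le (Finset.single_le_sum (f := fun i => moveCell A p h' h i h)
      (fun _ _ => Nat.zero_le _) (Finset.mem_Ioi.mpr hpT))
  rw [lowerSpecialPoly, if_neg h1, if_pos ⟨T, hpT, hT⟩, moveCell_lower_self hh hp,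
    one_sub_mul_qbar hv1]
  simp only [map_mul, map_sub, map_one, map_pow, aeval_X]
  rw [zpow_two_mul_natCast, zpow_two_mul_natCast, Nat.cast_sub h2, sum_Ioi_moveCell_lower hh hp,
    sub_mul, mul_sub (v ^ (2 * colSum A h fun i => p ≤ i)), ← zpow_add₀ hv, ← zpow_add₀ hv,
    colSum_ge_eq, one_mul, mul_one]
  push_cast
  have h3 : ∀ a b c d : ℤ, a = c → b = d → v ^ a - v ^ b = v ^ c - v ^ d := by
    rintro a b _ _ rfl rfl
    rfl
  refine h3 _ _ _ _ ?_ ?_ <;> ring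

open scoped Classical in
/-- The number of hyperplanes that keep the decoration. Those not containing the vector are excluded
if they would add the cell `(p, h')`. -/
theorem aeval_lowerPoly_self (hv : v ≠ 0) (hv1 : v ^ 2 ≠ 1) (hh : (h' : ℕ) = h + 1)
    (hp : 1 ≤ A p h') (hd : IsDecorated d (moveCell A p h' h) Δ) :
    aeval (v ^ 2) (lowerPoly (moveCell A p h' h) Δ Δ h h' p)
      = v ^ (2 * (colSum A h fun i => p ≤ i) - if Corner Δ h h' p then 2 else 0)
        * qbar v (A p h + 1 - if (p, h) ∈ Δ then 1 else 0) 1 := by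
  have hfull : aeval (v ^ 2) ((∑ i ∈ Finset.range (moveCell A p h' h p h), X ^ i)
      * X ^ (∑ i ∈ Finset.Ioi p, moveCell A p h' h i h) : ℤ[X])
      = v ^ (2 * colSum A h fun i => p ≤ i) * qbar v (A p h + 1) 1 := by
    simp only [map_mul, map_sum, map_pow, aeval_X]
    rw [sum_pow_eq_qbar hv hv1, zpow_two_mul_natCast, sum_Ioi_moveCell_lower hh hp,
      moveCell_lower_self hh hp, mul_right_comm, ← zpow_add₀ hv, colSum_ge_eq]
    congr 2
    push_cast
    ring
  have hins : lowerClosure (Δ : Set (Fin n × Fin m))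
      = lowerClosure (insert (p, h') (Δ : Set (Fin n × Fin m))) ↔
      (p, h') ∈ lowerClosure (Δ : Set (Fin n × Fin m)) := by
    constructor
    · intro h1
      rw [h1]
      exact subset_lowerClosure (Set.mem_insert _ _)
    · intro h1
      refine le_antisymm (lowerClosure_mono (Set.subset_insert _ _)) (lowerClosure_le.mpr ?_)
      exact Set.insert_subset h1 subset_lowerClosure
  have hzero : (p, h) ∉ lowerClosure (Δ : Set (Fin n × Fin m)) →
      lowerSpecialPoly (moveCell A p h' h) Δ h p = 0 := by
    intro h1
    rw [mem_lowerClosure_finset] at h1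
    rw [lowerSpecialPoly, if_neg fun h2 => h1 ⟨_, h2, le_rfl, le_rfl⟩, if_neg]
    rintro ⟨t, h2, h3⟩
    exact h1 ⟨_, h3, h2.le, le_rfl⟩
  by_cases hc : Corner Δ h h' p
  · rw [lowerPoly, if_pos rfl, if_neg fun h1 => hc.2 (hins.mp h1), add_zero, map_sub, hfull,
      if_pos hc]
    obtain ⟨y, hy, h1, h2⟩ := mem_lowerClosure_finset.mp hc.1
    -- the cell of `Δ` reaching the row `p` lies in the column `h`
    have h3 : y.2 = h := by
      by_contra h3
      refine hc.2 (mem_lowerClosure_finset.mpr ⟨y, hy, h1, Fin.le_def.mpr ?_⟩)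
      have h4 : (y.2 : ℕ) ≠ h := fun h4 => h3 (Fin.ext h4)
      have h5 := Fin.le_def.mp h2
      simp only at h5 ⊢
      omega
    obtain ⟨T, j⟩ := y
    simp only at h1 h3
    subst h3
    rcases eq_or_lt_of_le h1 with rfl | h1
    · rw [if_pos hy, aeval_lowerSpecialPoly_self hv hh hp hy, Nat.add_sub_cancel]
      have h4 : v ^ (-2 : ℤ) ≠ 1 := fun h4 => hv1 (by
        rw [zpow_neg, inv_eq_one] at h4
        exact_mod_cast h4)
      rw [zpow_sub₀ hv, div_eq_mul_inv, ← zpow_neg]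
      have h5 : (1 - v ^ (-2 : ℤ)) ≠ 0 := sub_ne_zero.mpr h4.symm
      refine mul_right_cancel₀ h5 ?_
      have h6 := one_sub_mul_qbar hv1 (A p j)
      have h7 := one_sub_mul_qbar hv1 (A p j + 1)
      have h8 : v ^ (-2 * ((A p j + 1 : ℕ) : ℤ)) = v ^ (-2 : ℤ) * v ^ (-2 * (A p j : ℤ)) := by
        rw [← zpow_add₀ hv]
        congr 1
        push_cast
        ring
      rw [h8] at h7
      generalize v ^ (-2 : ℤ) = a at *
      generalize v ^ (-2 * (A p j : ℤ)) = b at *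
      linear_combination (v ^ (2 * colSum A j fun i => p ≤ i)) * h7
        - (v ^ (2 * colSum A j fun i => p ≤ i)) * a * h6
    · have h4 : (p, j) ∉ Δ := fun h4 => h1.ne (hd.row_eq h4 hy)
      rw [if_neg h4, aeval_lowerSpecialPoly_of_lt hv hv1 hh hp hd h1 hy, zpow_sub₀ hv,
        div_eq_mul_inv, ← zpow_neg, Nat.sub_zero]
      ring
  · have h1 : (p, h) ∉ Δ := fun h1 => hc ⟨subset_lowerClosure h1, fun h2 => by
      obtain ⟨y, hy, h3, h4⟩ := mem_lowerClosure_finset.mp h2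
      have h5 := hd.eq_of_le h1 hy h3 (le_trans (Fin.le_def.mpr (by simp only; omega)) h4)
      subst h5
      have := Fin.le_def.mp h4
      simp only at this
      omega⟩
    rw [if_neg hc, sub_zero, if_neg h1, Nat.sub_zero, ← hfull]
    congr 1
    rw [lowerPoly, if_pos rfl]
    by_cases h2 : (p, h') ∈ lowerClosure (Δ : Set (Fin n × Fin m))
    · rw [if_pos (hins.mpr h2), sub_add_cancel]
    · rw [if_neg fun h3 => h2 (hins.mp h3), hzero fun h3 => hc ⟨h3, h2⟩, sub_zero, add_zero]

variable {M M' : Type*} [AddCommGroup M] [Module R M] [AddCommGroup M'] [Module R M']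
  {mul : M → M' → M} {e : DecMat n m d → M} {e' : DecMat m m d → M'}

open scoped Classical in
/-- The terms of the product with `F_h` in which the decoration changes and an entry of the row `p`
is moved. -/
noncomputable def lowerSpecialSum (v : R) (e : DecMat n m d → M) (A : Matrix (Fin n) (Fin m) ℕ)
    (Δ : Finset (Fin n × Fin m)) (h h' : Fin m) (p : Fin n) : M :=
  ∑ Δ' with Δ' ≠ Δ ∧ lowerClosure (Δ : Set (Fin n × Fin m))
      = lowerClosure (insert (p, h') (Δ' : Set (Fin n × Fin m))),
    (v ^ (normExp A Δ - normExp (moveCell A p h' h) Δ' - ∑ i, (moveCell A p h' h i h' : ℤ))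
      * aeval (v ^ 2) (lowerSpecialPoly (moveCell A p h' h) Δ' h p)) •
        stdVec v e (moveCell A p h' h) Δ'

open scoped Classical in
/-- The product with `F_h` for an arbitrary decoration, the terms in which the decoration changes
being collected in `lowerSpecialSum`. -/
theorem IsRightMul.mul_stdVec_lower_eq (H : IsRightMul v mul e e') (hv : v ≠ 0) (hv1 : v ^ 2 ≠ 1)
    (hd : IsDecorated d A Δ) (hh : (h' : ℕ) = h + 1) :
    mul (stdVec v e A Δ) (genOff v e' h' h)
      = (∑ p with 1 ≤ A p h', (v ^ (xi' A h h' p - if Corner Δ h h' p then 1 else 0)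
          * qbar v (A p h + 1 - if (p, h) ∈ Δ then 1 else 0) 1) •
            stdVec v e (moveCell A p h' h) Δ)
        + ∑ p with 1 ≤ A p h', lowerSpecialSum v e A Δ h h' p := by
  rw [H.mul_stdVec_lower hv hd hh, ← Finset.sum_add_distrib]
  refine Finset.sum_congr rfl fun p hp => ?_
  have hp := (Finset.mem_filter.mp hp).2
  rw [← Finset.add_sum_erase _ _ (Finset.mem_univ Δ), lowerSpecialSum]
  congr 1
  · by_cases hd' : IsDecorated d (moveCell A p h' h) Δ
    · rw [aeval_lowerPoly_self hv hv1 hh hp hd', normExp_sub_lower A Δ Δ hh hp, ← mul_assoc,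
        ← zpow_add₀ hv]
      have h1 := ite_sub_ite_eq_corner (Δ := Δ) (p := p) hh
      have h2 := colSum_add_not A h fun i => p ≤ i
      congr 3
      rw [xi']
      have h3 : (if Corner Δ h h' p then (2 : ℤ) else 0)
          = (if Corner Δ h h' p then 1 else 0) + if Corner Δ h h' p then 1 else 0 := by
        split_ifs <;> norm_num
      rw [h3]
      linarith
    · rw [stdVec_of_not_isDecorated v e hd', smul_zero, smul_zero]
  · rw [Finset.sum_filter, ← Finset.add_sum_erase (a := Δ) Finset.univ _ (Finset.mem_univ Δ),
      if_neg (by simp), zero_add]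
    refine Finset.sum_congr rfl fun Δ' hΔ' => ?_
    have hne := (Finset.mem_erase.mp hΔ').1
    rw [lowerPoly, if_neg hne.symm, zero_add]
    split_ifs with h1 h2 h2
    · rfl
    · exact absurd ⟨hne, h1⟩ h2
    · exact absurd h2.2 h1
    · simp

/-- The decoration can change only in the row of its cell in the column `h'`. -/
theorem lowerSpecialSum_eq_zero (hd : IsDecorated d A Δ) (hp : (p, h') ∉ Δ)
    (e : DecMat n m d → M) : lowerSpecialSum v e A Δ h h' p = 0 := by
  classical
  refine Finset.sum_eq_zero fun Δ' hΔ' => ?_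
  obtain ⟨-, h1, h2⟩ := Finset.mem_filter.mp hΔ'
  rw [stdVec_of_not_isDecorated, smul_zero]
  exact fun hd' => hp (hd.mem_of_lowerClosure_insert_of_ne hd' h2 h1)

open scoped Classical in
/-- The terms in which the decoration changes, if all the decorations involved have their cell of
the column `h` in the row `T`: either `T = p` is new, or `(T, h)` is a cell of `Δ`. The number `κ`
is the factor by which the two situations differ. -/
theorem lowerSpecialSum_eq (hv : v ≠ 0) (hd : IsDecorated d A Δ) (hh : (h' : ℕ) = h + 1)
    (hpA : 1 ≤ A p h') (hp : (p, h') ∈ Δ) (hpT : p ≤ T) (hT : T = p ∨ (T, h) ∈ Δ)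
    (huniq : ∀ Δ', IsDecorated d (moveCell A p h' h) Δ' → Δ' ≠ Δ →
      lowerClosure (Δ : Set (Fin n × Fin m))
        = lowerClosure (insert (p, h') (Δ' : Set (Fin n × Fin m))) →
      ∀ t, p ≤ t → (t, h) ∈ Δ' → t = T) (κ : R)
    (hκ : ∀ Δ', IsDecorated d (moveCell A p h' h) Δ' → (T, h) ∈ Δ' →
      aeval (v ^ 2) (lowerSpecialPoly (moveCell A p h' h) Δ' h p)
        = v ^ (2 * colSum A h fun i => p ≤ i) * κ) (e : DecMat n m d → M) :
    lowerSpecialSum v e A Δ h h' p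
      = (v ^ (xi' A h h' p - colSum A h' (fun i => AfterPrev Δ p i ∧ i ≤ p) + 1) * κ) •
          stdVec v e (moveCell A p h' h) (insert (T, h) (Δ.erase (p, h')))
        + ∑ s with AfterPrev Δ p s ∧ s < p,
          (v ^ (xi' A h h' p - colSum A h' (fun i => s < i ∧ i ≤ p) + 1) * κ) •
            stdVec v e (moveCell A p h' h)
              (insert (s, h') (insert (T, h) (Δ.erase (p, h')))) := by
  set D := insert (T, h) (Δ.erase (p, h')) with hD
  have hbase : ∀ s, s < p → (s, h') ∉ D := by
    intro s hs h1
    rcases Finset.mem_insert.mp h1 with h2 | h2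
    · have := congrArg (fun x => (x.2 : ℕ)) h2
      simp only at this
      omega
    · exact hs.ne (hd.row_eq (Finset.mem_of_mem_erase h2) hp)
  have hlcD : ∀ i, (i, h') ∈ lowerClosure (D : Set (Fin n × Fin m)) ↔ ¬ AfterPrev Δ p i :=
    hd.mem_lowerClosure_base hh hp
  have hTD : (T, h) ∈ D := Finset.mem_insert_self _ _
  -- the coefficient of a decorated matrix in the sum
  have hcoef : ∀ Δ', IsDecorated d (moveCell A p h' h) Δ' → Δ' ≠ Δ →
      lowerClosure (Δ : Set (Fin n × Fin m))
        = lowerClosure (insert (p, h') (Δ' : Set (Fin n × Fin m))) → (T, h) ∈ Δ' →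
      v ^ (normExp A Δ - normExp (moveCell A p h' h) Δ' - ∑ i, (moveCell A p h' h i h' : ℤ))
        * aeval (v ^ 2) (lowerSpecialPoly (moveCell A p h' h) Δ' h p)
      = v ^ (xi' A h h' p - colSum A h' (fun i => i ≤ p ∧
          (i, h') ∉ lowerClosure (Δ' : Set (Fin n × Fin m))) + 1) * κ := by
    intro Δ' hd' hne hlc hT'
    have hlc' : ∀ i j, (i, j) ∈ lowerClosure (Δ : Set (Fin n × Fin m)) ↔
        (i, j) ≤ (p, h') ∨ (i, j) ∈ lowerClosure (Δ' : Set (Fin n × Fin m)) := fun i j => by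
      rw [hlc]
      have := mem_lowerClosure_insert (Δ := Δ') (x := (i, j)) (y := (p, h'))
      rwa [Finset.coe_insert] at this
    have h1 : (p, h) ∈ lowerClosure (Δ' : Set (Fin n × Fin m)) :=
      mem_lowerClosure_finset.mpr ⟨_, hT', hpT, le_rfl⟩
    have h2 : (p, h') ∉ lowerClosure (Δ' : Set (Fin n × Fin m)) := fun h2 =>
      hne (hd.eq_of_lowerClosure_eq hd' (by
        rw [hlc]
        exact le_antisymm (lowerClosure_le.mpr (Set.insert_subset h2 subset_lowerClosure))
          (lowerClosure_mono (Set.subset_insert _ _)))).symm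
    have h3 : normExp A Δ - normExp A Δ'
        = -colSum A h' (fun i => i ≤ p ∧
          (i, h') ∉ lowerClosure (Δ' : Set (Fin n × Fin m))) := by
      rw [normExp_sub_of_column A Δ Δ' h' fun i j hj => ?_,
        colSum_eq_add A h' (fun i => (i, h') ∈ lowerClosure (Δ : Set (Fin n × Fin m)))
          fun i => (i, h') ∈ lowerClosure (Δ' : Set (Fin n × Fin m)),
        colSum_congr A h' (Q := fun i => (i, h') ∈ lowerClosure (Δ' : Set (Fin n × Fin m)))
          (P := fun i => (i, h') ∈ lowerClosure (Δ : Set (Fin n × Fin m)) ∧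
            (i, h') ∈ lowerClosure (Δ' : Set (Fin n × Fin m))) fun i =>
            ⟨fun h4 => h4.2, fun h4 => ⟨(hlc' i h').mpr (.inr h4), h4⟩⟩,
        colSum_congr A h' (Q := fun i => i ≤ p ∧
            (i, h') ∉ lowerClosure (Δ' : Set (Fin n × Fin m)))
          (P := fun i => (i, h') ∈ lowerClosure (Δ : Set (Fin n × Fin m)) ∧
            (i, h') ∉ lowerClosure (Δ' : Set (Fin n × Fin m))) fun i => by
            rw [hlc', Prod.mk_le_mk]
            simp only [le_refl, and_true]
            tauto]
      · ring
      · rw [hlc', or_iff_right_iff_imp]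
        intro h4
        obtain ⟨h5, h6⟩ := Prod.mk_le_mk.mp h4
        refine mem_lowerClosure_finset.mpr ⟨_, hT', h5.trans hpT, Fin.le_def.mpr ?_⟩
        have h7 : (j : ℕ) ≠ h' := fun h7 => hj (Fin.ext h7)
        have h8 := Fin.le_def.mp h6
        simp only
        omega
    rw [hκ Δ' hd' hT', normExp_sub_lower A Δ Δ' hh hpA, h3, if_pos h1, if_neg h2, ← mul_assoc,
      ← zpow_add₀ hv]
    congr 2
    rw [xi']
    ring
  -- the decorations that contribute
  have hsum : lowerSpecialSum v e A Δ h h' p = ∑ Δ' ∈ insert D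
      ((Finset.univ.filter fun s => AfterPrev Δ p s ∧ s < p).image fun s => insert (s, h') D),
      (v ^ (normExp A Δ - normExp (moveCell A p h' h) Δ' - ∑ i, (moveCell A p h' h i h' : ℤ))
        * aeval (v ^ 2) (lowerSpecialPoly (moveCell A p h' h) Δ' h p)) •
          stdVec v e (moveCell A p h' h) Δ' := by
    symm
    refine Finset.sum_subset ?_ ?_
    · intro Δ' hΔ'
      have := hd.lowerClosure_insert_insert hh hp hT (Δ' := Δ') (by
        rcases Finset.mem_insert.mp hΔ' with h1 | h1
        · exact .inl h1
        · obtain ⟨s, hs, h2⟩ := Finset.mem_image.mp h1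
          exact .inr ⟨s, (Finset.mem_filter.mp hs).2.2, h2.symm⟩)
      exact Finset.mem_filter.mpr ⟨Finset.mem_univ _, this.2, this.1⟩
    · intro Δ' h1 h2
      obtain ⟨-, hne, hlc⟩ := Finset.mem_filter.mp h1
      by_cases hd' : IsDecorated d (moveCell A p h' h) Δ'
      · have h3 : ∀ t, p ≤ t → (t, h) ∉ Δ' := by
          intro t hpt ht
          obtain rfl := huniq Δ' hd' hne hlc t hpt ht
          rcases hd.eq_of_lowerClosure_insert hd' hh hlc hne hpt ht with h4 | ⟨s, hs, h4⟩
          · exact h2 (Finset.mem_insert.mpr (.inl h4))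
          · exact h2 (Finset.mem_insert_of_mem (Finset.mem_image.mpr
              ⟨s, Finset.mem_filter.mpr ⟨Finset.mem_univ _, hs⟩, h4.symm⟩))
        rw [lowerSpecialPoly, if_neg (h3 p le_rfl), if_neg fun ⟨t, h4, h5⟩ => h3 t h4.le h5,
          map_zero, mul_zero, zero_smul]
      · rw [stdVec_of_not_isDecorated v e hd', smul_zero]
  have hlc : ∀ Δ', (Δ' = D ∨ ∃ s, s < p ∧ Δ' = insert (s, h') D) → _ := fun Δ' =>
    hd.lowerClosure_insert_insert hh hp hT (Δ' := Δ')
  rw [hsum, Finset.sum_insert, Finset.sum_image]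
  · congr 1
    · by_cases hd' : IsDecorated d (moveCell A p h' h) D
      · obtain ⟨h1, h2⟩ := hlc D (.inl rfl)
        rw [hcoef D hd' h2 h1 hTD, colSum_congr A h' fun i => ?_]
        rw [hlcD, not_not, and_comm]
      · rw [stdVec_of_not_isDecorated v e hd', smul_zero, smul_zero]
    · refine Finset.sum_congr rfl fun s hs => ?_
      have hs := (Finset.mem_filter.mp hs).2
      by_cases hd' : IsDecorated d (moveCell A p h' h) (insert (s, h') D)
      · obtain ⟨h1, h2⟩ := hlc _ (.inr ⟨s, hs.2, rfl⟩)
        rw [hcoef _ hd' h2 h1 (Finset.mem_insert_of_mem hTD), colSum_congr A h' fun i => ?_]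
        rw [mem_lowerClosure_insert, hlcD, Prod.mk_le_mk, and_comm]
        refine and_congr_left fun h3 => ?_
        simp only [le_refl, and_true, not_or, not_not, not_le]
        refine ⟨fun h4 => h4.1, fun h4 => ⟨h4, fun x hx h5 => (hs.1 x hx h5).trans h4⟩⟩
      · rw [stdVec_of_not_isDecorated v e hd', smul_zero, smul_zero]
  · intro s hs t ht hst
    have h1 : (s, h') ∈ insert (t, h') D := by
      simp only at hst
      rw [← hst]
      exact Finset.mem_insert_self _ _
    rcases Finset.mem_insert.mp h1 with h2 | h2
    · exact congrArg Prod.fst h2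
    · exact absurd h2 (hbase s (Finset.mem_filter.mp hs).2.2)
  · intro h1
    obtain ⟨s, hs, h2⟩ := Finset.mem_image.mp h1
    exact hbase s (Finset.mem_filter.mp hs).2.2 (h2 ▸ Finset.mem_insert_self _ _)

end LowerFormula

/-! ### Evaluation of the product with `F_h` -/

section LowerCases

variable {R M M' : Type*} [Field R] [AddCommGroup M] [Module R M] [AddCommGroup M']
  [Module R M'] {n m d : ℕ} {v : R} {mul : M → M' → M} {e : DecMat n m d → M}
  {e' : DecMat m m d → M'} {A : Matrix (Fin n) (Fin m) ℕ} {Δ : Finset (Fin n × Fin m)}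
  {h h' : Fin m} {il iu : Fin n}

/-- Neither the column `h` nor the column `h'` is decorated: the decoration does not change. -/
theorem IsRightMul.lower_of_forall_ne (H : IsRightMul v mul e e') (hv : v ≠ 0) (hv1 : v ^ 2 ≠ 1)
    (hd : IsDecorated d A Δ) (hh : (h' : ℕ) = h + 1) (hΔ : ∀ x ∈ Δ, x.2 ≠ h ∧ x.2 ≠ h') :
    mul (stdVec v e A Δ) (genOff v e' h' h) = ∑ p : Fin n with 1 ≤ A p h',
        (v ^ xi' A h h' p * qbar v (A p h + 1) 1) • stdVec v e (moveCell A p h' h) Δ := by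
  classical
  have hc : ∀ p, ¬ Corner Δ h h' p := fun p => not_corner_of_forall_ne hh fun x hx => (hΔ x hx).1
  rw [H.mul_stdVec_lower_eq hv hv1 hd hh, add_eq_left.mpr (Finset.sum_eq_zero fun p _ =>
    lowerSpecialSum_eq_zero hd (fun h1 => (hΔ _ h1).2 rfl) e)]
  refine Finset.sum_congr rfl fun p _ => ?_
  rw [if_neg (hc p), if_neg fun h1 => (hΔ _ h1).1 rfl, sub_zero, Nat.sub_zero]

open scoped Classical in
/-- The column `h` is decorated, the column `h'` is not: the decoration does not change. -/
theorem IsRightMul.lower_of_mem (H : IsRightMul v mul e e') (hv : v ≠ 0) (hv1 : v ^ 2 ≠ 1)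
    (hd : IsDecorated d A Δ) (hh : (h' : ℕ) = h + 1) (hl : (il, h) ∈ Δ)
    (hΔ : ∀ x ∈ Δ, x.2 ≠ h') :
    mul (stdVec v e A Δ) (genOff v e' h' h) =
      (∑ p : Fin n with (AfterPrev Δ il p ∧ p < il) ∧ 1 ≤ A p h',
        (v ^ (xi' A h h' p - 1) * qbar v (A p h + 1) 1) • stdVec v e (moveCell A p h' h) Δ)
      + (∑ p : Fin n with p = il ∧ 1 ≤ A p h',
        (v ^ (xi' A h h' p - 1) * qbar v (A p h) 1) • stdVec v e (moveCell A p h' h) Δ)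
      + (∑ p : Fin n with ¬ (AfterPrev Δ il p ∧ p ≤ il) ∧ 1 ≤ A p h',
        (v ^ xi' A h h' p * qbar v (A p h + 1) 1) • stdVec v e (moveCell A p h' h) Δ) := by
  rw [H.mul_stdVec_lower_eq hv hv1 hd hh, add_eq_left.mpr (Finset.sum_eq_zero fun p _ =>
    lowerSpecialSum_eq_zero hd (fun h1 => hΔ _ h1 rfl) e)]
  refine (sum_filter_eq_add (Q := fun p => (AfterPrev Δ il p ∧ p ≤ il) ∧ 1 ≤ A p h')
    (R := fun p => ¬ (AfterPrev Δ il p ∧ p ≤ il) ∧ 1 ≤ A p h')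
    (k := fun p => (v ^ xi' A h h' p * qbar v (A p h + 1) 1) •
      stdVec v e (moveCell A p h' h) Δ)
    (fun p => by tauto) (fun p => by tauto) (fun p _ => rfl) fun p hp => ?_).trans ?_
  · have h1 : (p, h) ∉ Δ := fun h1 => hp.1 (by
      obtain rfl := hd.row_eq h1 hl
      exact ⟨afterPrev_self, le_rfl⟩)
    rw [if_neg fun h2 => hp.1 ((hd.corner_iff hh hl).mp h2), if_neg h1, sub_zero, Nat.sub_zero]
  · congr 1
    refine sum_filter_eq_add (fun p => ?_) (fun p => ?_) (fun p hp => ?_) fun p hp => ?_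
    · rw [le_iff_eq_or_lt]
      constructor
      · tauto
      · rintro (⟨h1, h2⟩ | ⟨rfl, h1⟩)
        · exact ⟨⟨h1.1, .inr h1.2⟩, h2⟩
        · exact ⟨⟨afterPrev_self, .inl rfl⟩, h1⟩
    · rintro ⟨⟨-, h1⟩, -⟩ ⟨rfl, -⟩
      exact lt_irrefl _ h1
    · have h1 : (p, h) ∉ Δ := fun h1 => hp.1.2.ne (hd.row_eq h1 hl)
      rw [if_pos ((hd.corner_iff hh hl).mpr ⟨hp.1.1, hp.1.2.le⟩), if_neg h1, Nat.sub_zero]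
    · obtain ⟨rfl, -⟩ := hp
      rw [if_pos ((hd.corner_iff hh hl).mpr ⟨afterPrev_self, le_rfl⟩), if_pos hl,
        Nat.add_sub_cancel]

open scoped Classical in
/-- Only the row of the decorated cell in the column `h'` contributes. -/
theorem sum_lowerSpecialSum (hd : IsDecorated d A Δ) (hu : (iu, h') ∈ Δ) {f g : Fin n → M}
    (hf : 1 ≤ A iu h' → lowerSpecialSum v e A Δ h h' iu = f iu + g iu) :
    ∑ p with 1 ≤ A p h', lowerSpecialSum v e A Δ h h' p
      = ∑ p with p = iu ∧ 1 ≤ A p h', f p + ∑ p with p = iu ∧ 1 ≤ A p h', g p := by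
  rw [← Finset.sum_add_distrib, Finset.sum_filter, Finset.sum_filter]
  refine Finset.sum_congr rfl fun p _ => ?_
  by_cases h1 : p = iu
  · subst h1
    by_cases h2 : 1 ≤ A p h'
    · rw [if_pos h2, if_pos ⟨rfl, h2⟩, hf h2]
    · rw [if_neg h2, if_neg fun h3 => h2 h3.2]
  · rw [if_neg (c := p = iu ∧ _) fun h2 => h1 h2.1,
      lowerSpecialSum_eq_zero hd (fun h2 => h1 (hd.row_eq h2 hu)) e, ite_self]

open scoped Classical in
/-- The column `h'` is decorated, the column `h` is not: the new cell of the column `h` is in the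
same row. -/
theorem IsRightMul.lower_of_mem_next (H : IsRightMul v mul e e') (hv : v ≠ 0) (hv1 : v ^ 2 ≠ 1)
    (hd : IsDecorated d A Δ) (hh : (h' : ℕ) = h + 1) (hl : (il, h') ∈ Δ)
    (hΔ : ∀ x ∈ Δ, x.2 ≠ h) :
    mul (stdVec v e A Δ) (genOff v e' h' h) =
      (∑ p : Fin n with 1 ≤ A p h',
        (v ^ xi' A h h' p * qbar v (A p h + 1) 1) • stdVec v e (moveCell A p h' h) Δ)
      + (∑ p : Fin n with p = il ∧ 1 ≤ A p h',
        v ^ (xi' A h h' p - colSum A h' (fun i => AfterPrev Δ il i ∧ i ≤ p) + 1) •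
          stdVec v e (moveCell A p h' h) (insert (il, h) (Δ.erase (il, h'))))
      + (∑ p : Fin n with p = il ∧ 1 ≤ A p h', ∑ s : Fin n with AfterPrev Δ il s ∧ s < il,
        v ^ (xi' A h h' p - colSum A h' (fun i => s < i ∧ i ≤ p) + 1) •
          stdVec v e (moveCell A p h' h)
            (insert (s, h') (insert (il, h) (Δ.erase (il, h'))))) := by
  have hc : ∀ p, ¬ Corner Δ h h' p := fun p => not_corner_of_forall_ne hh hΔ
  rw [H.mul_stdVec_lower_eq hv hv1 hd hh, add_assoc]
  congr 1
  · refine Finset.sum_congr rfl fun p _ => ?_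
    rw [if_neg (hc p), if_neg fun h1 => hΔ _ h1 rfl, sub_zero, Nat.sub_zero]
  · refine sum_lowerSpecialSum hd hl fun hA => ?_
    rw [lowerSpecialSum_eq hv hd hh hA hl le_rfl (.inl rfl) ?_ 1 ?_]
    · simp only [mul_one]
    · intro Δ' hd' _ hlc t ht htΔ
      exact le_antisymm (hd.le_of_lowerClosure_insert hd' hlc htΔ fun h1 => hΔ _ h1 rfl).1 ht
    · intro Δ' _ hT
      rw [aeval_lowerSpecialPoly_self hv hh hA hT, mul_one]

open scoped Classical in
/-- Both columns are decorated: the cell of the column `h` is kept. -/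
theorem IsRightMul.lower_of_mem_mem (H : IsRightMul v mul e e') (hv : v ≠ 0) (hv1 : v ^ 2 ≠ 1)
    (hd : IsDecorated d A Δ) (hh : (h' : ℕ) = h + 1) (hl : (il, h) ∈ Δ) (hu : (iu, h') ∈ Δ) :
    mul (stdVec v e A Δ) (genOff v e' h' h) =
      (∑ p : Fin n with ¬ (iu < p ∧ p ≤ il) ∧ 1 ≤ A p h',
        (v ^ xi' A h h' p * qbar v (A p h + 1) 1) • stdVec v e (moveCell A p h' h) Δ)
      + (∑ p : Fin n with (iu < p ∧ p < il) ∧ 1 ≤ A p h',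
        (v ^ (xi' A h h' p - 1) * qbar v (A p h + 1) 1) • stdVec v e (moveCell A p h' h) Δ)
      + (∑ p : Fin n with p = il ∧ 1 ≤ A p h',
        (v ^ (xi' A h h' p - 1) * qbar v (A p h) 1) • stdVec v e (moveCell A p h' h) Δ)
      + (∑ p : Fin n with p = iu ∧ 1 ≤ A p h',
        (v ^ (xi' A h h' p - colSum A h' (fun i => AfterPrev Δ iu i ∧ i ≤ p) + 1)
            * (1 - v ^ (-2 : ℤ)) * qbar v (A p h + 1) 1) •
          stdVec v e (moveCell A p h' h) (Δ.erase (iu, h')))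
      + (∑ p : Fin n with p = iu ∧ 1 ≤ A p h', ∑ s : Fin n with AfterPrev Δ iu s ∧ s < iu,
        (v ^ (xi' A h h' p - colSum A h' (fun i => s < i ∧ i ≤ p) + 1)
            * (1 - v ^ (-2 : ℤ)) * qbar v (A p h + 1) 1) •
          stdVec v e (moveCell A p h' h) (insert (s, h') (Δ.erase (iu, h')))) := by
  have hcorner : ∀ p, Corner Δ h h' p ↔ iu < p ∧ p ≤ il := fun p => by
    rw [hd.corner_iff hh hl, hd.afterPrev_iff hh hl hu]
  have hul : iu < il := (hd.row_lt_iff hu hl).mpr (Fin.lt_def.mpr (by simp only; omega))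
  have hne : (il, h) ≠ (iu, h') := fun h1 => hul.ne' (congrArg Prod.fst h1)
  rw [H.mul_stdVec_lower_eq hv hv1 hd hh, add_assoc (_ + _ + _)]
  congr 1
  · rw [add_assoc]
    refine (sum_filter_eq_add (Q := fun p => ¬ (iu < p ∧ p ≤ il) ∧ 1 ≤ A p h')
      (R := fun p => (iu < p ∧ p ≤ il) ∧ 1 ≤ A p h')
      (g := fun p => (v ^ xi' A h h' p * qbar v (A p h + 1) 1) •
        stdVec v e (moveCell A p h' h) Δ)
      (fun p => by tauto) (fun p => by tauto) (fun p hp => ?_) fun p _ => rfl).trans ?_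
    · have h1 : (p, h) ∉ Δ := fun h1 => hp.1 (by
        obtain rfl := hd.row_eq h1 hl
        exact ⟨hul, le_rfl⟩)
      rw [if_neg fun h2 => hp.1 ((hcorner p).mp h2), if_neg h1, sub_zero, Nat.sub_zero]
    · congr 1
      refine sum_filter_eq_add (fun p => ?_) (fun p => ?_) (fun p hp => ?_) fun p hp => ?_
      · rw [le_iff_eq_or_lt]
        constructor
        · tauto
        · rintro (⟨h1, h2⟩ | ⟨rfl, h1⟩)
          · exact ⟨⟨h1.1, .inr h1.2⟩, h2⟩
          · exact ⟨⟨hul, .inl rfl⟩, h1⟩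
      · rintro ⟨⟨-, h1⟩, -⟩ ⟨rfl, -⟩
        exact lt_irrefl _ h1
      · have h1 : (p, h) ∉ Δ := fun h1 => hp.1.2.ne (hd.row_eq h1 hl)
        rw [if_pos ((hcorner p).mpr ⟨hp.1.1, hp.1.2.le⟩), if_neg h1, Nat.sub_zero]
      · obtain ⟨rfl, -⟩ := hp
        rw [if_pos ((hcorner p).mpr ⟨hul, le_rfl⟩), if_pos hl, Nat.add_sub_cancel]
  · have hbase : insert (il, h) (Δ.erase (iu, h')) = Δ.erase (iu, h') :=
      Finset.insert_eq_of_mem (Finset.mem_erase.mpr ⟨hne, hl⟩)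
    refine sum_lowerSpecialSum hd hu fun hA => ?_
    rw [lowerSpecialSum_eq hv hd hh hA hu hul.le (.inr hl) ?_
      ((1 - v ^ (-2 : ℤ)) * qbar v (A iu h + 1) 1) ?_, hbase]
    · simp only [mul_assoc]
    · intro Δ' hd' _ hlc t _ htΔ
      exact hd'.row_eq htΔ (hd.mem_of_lowerClosure_insert hlc hl hne)
    · intro Δ' hd' hT
      exact aeval_lowerSpecialPoly_of_lt hv hv1 hh hA hd' hul hT

end LowerCases

/-! ### The explicit formulas -/

/-- The multiplication rules of `IsRightMul` imply the explicit formulas, as soon as `v` and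
`v ^ 2 - 1` are invertible. -/
theorem IsRightMul.explicitRightFormulas {R M M' : Type*} [Field R] [AddCommGroup M] [Module R M]
    [AddCommGroup M'] [Module R M'] {n m d : ℕ} {v : R} {mul : M → M' → M} {e : DecMat n m d → M}
    {e' : DecMat m m d → M'} (H : IsRightMul v mul e e') (hv : v ≠ 0) (hv1 : v ^ 2 ≠ 1)
    (hm : 0 < m) :
    ExplicitRightFormulas d v ⟨0, hm⟩ (stdVec v e) (fun r s x => mul x (genH v e' r s))
      (fun x => mul x (genL v e' ⟨0, hm⟩)) (fun h h' x => mul x (genOff v e' h h'))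
      (fun h h' x => mul x (genOff v e' h' h)) where
  caseA A Δ hd r s _ := by
    rw [stdVec_eq e v ⟨A, Δ, hd⟩, H.smul_left, H.mul_genH, smul_comm]
  caseB A Δ hd _ _ hk hmax hjk := H.genL_of_lt hv hd rfl hk hmax hjk
  caseC A Δ hd _ hk := H.genL_of_mem hv hd rfl hk
  caseD A hd := H.genL_of_empty hv hd rfl
  caseE A Δ hd h h' hh hΔ :=
    ⟨H.raise_of_forall_ne hv hv1 hd hh hΔ, H.lower_of_forall_ne hv hv1 hd hh hΔ⟩
  caseF A Δ hd h h' hh _ hl hΔ :=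
    ⟨H.raise_of_mem hv hv1 hd hh hl hΔ, H.lower_of_mem hv hv1 hd hh hl hΔ⟩
  caseG A Δ hd h h' hh _ hl hΔ :=
    ⟨H.raise_of_mem_next hv hv1 hd hh hl hΔ, H.lower_of_mem_next hv hv1 hd hh hl hΔ⟩
  caseH A Δ hd h h' hh _ _ hl hu :=
    ⟨H.raise_of_mem_mem hv hv1 hd hh hl hu, H.lower_of_mem_mem hv hv1 hd hh hl hu⟩

theorem RatFunc.X_sq_ne_one (K : Type*) [Field K] : (RatFunc.X : RatFunc K) ^ 2 ≠ 1 := by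
  intro h
  rw [← RatFunc.algebraMap_X, ← map_pow, ← map_one (algebraMap (Polynomial K) (RatFunc K))] at h
  have h1 := congrArg Polynomial.natDegree (RatFunc.algebraMap_injective K h)
  simp at h1

theorem mainTheorem3 (K : Type*) [Field K] [CharZero K] [IsAlgClosed K]
    (n m d : ℕ) (hm : 0 < m) (hmn : m ≤ n) :
    -- the generic action on the space over `K(v)`, `v` an indeterminate
    ExplicitRightFormulas (n := n) (m := m) d (RatFunc.X : RatFunc K) ⟨0, hm⟩
      (stdVec (RatFunc.X : RatFunc K) (genChar (RatFunc K) (n := n) (m := m) (d := d)))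
      (fun r s x => genConv (RatFunc.X : RatFunc K) x (genH (RatFunc.X : RatFunc K) (genChar (RatFunc K) (n := m) (m := m) (d := d)) r s))
      (fun x => genConv (RatFunc.X : RatFunc K) x (genL (RatFunc.X : RatFunc K) (genChar (RatFunc K) (n := m) (m := m) (d := d)) ⟨0, hm⟩))
      (fun h h' x => genConv (RatFunc.X : RatFunc K) x (genOff (RatFunc.X : RatFunc K) (genChar (RatFunc K) (n := m) (m := m) (d := d)) h h'))
      (fun h h' x => genConv (RatFunc.X : RatFunc K) x (genOff (RatFunc.X : RatFunc K) (genChar (RatFunc K) (n := m) (m := m) (d := d)) h' h)) ∧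
    -- the specialization at `v = √q`: convolution of invariant functions over `F = 𝔽_q`
    (∀ (F : Type*) [Field F] [Fintype F] (v : K), v ^ 2 = (Fintype.card F : K) →
      ExplicitRightFormulas (n := n) (m := m) d v ⟨0, hm⟩
        (stdVec v (orbitChar K F (n := n) (m := m) (d := d)))
        (fun r s x => conv x (genH v (orbitChar K F (n := m) (m := m) (d := d)) r s))
        (fun x => conv x (genL v (orbitChar K F (n := m) (m := m) (d := d)) ⟨0, hm⟩))
        (fun h h' x => conv x (genOff v (orbitChar K F (n := m) (m := m) (d := d)) h h'))
        (fun h h' x => conv x (genOff v (orbitChar K F (n := m) (m := m) (d := d)) h' h))) := by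
  refine ⟨(isRightMul_genConv _ n m d).explicitRightFormulas RatFunc.X_ne_zero
    (RatFunc.X_sq_ne_one K) hm, fun F _ _ v hv => ?_⟩
  refine (isRightMul_conv F v hv n m d).explicitRightFormulas ?_ ?_ hm
  · rintro rfl
    have h0 : (Fintype.card F : K) = 0 := by rw [← hv, zero_pow two_ne_zero]
    exact Fintype.card_ne_zero (Nat.cast_eq_zero.mp h0)
  · intro h1
    rw [hv, Nat.cast_eq_one] at h1
    exact (Fintype.one_lt_card (α := F)).ne' h1
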